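/- \textbf{Setting.} Let $F_0$ be a non-archimedean local field of characteristic $0$ with integers $\mathcal O_0$, uniformizer $\varpi$ and $q_0=|\mathcal O_0/\varpi\mathcal O_0|$, let $F=F_0\times F_0$ (a split place), and let $n\ge 1$. Put $\tilde G_0=\mathrm{GL}_n(F_0)\times \mathrm{GL}_{n+1}(F_0)$, $G'=(\tilde G_0\times\tilde G_0)/(F_0^\times)^2$ with $(F_0^\times)^2$ the diagonally embedded pairs of scalar matrices, $H_1'=\mathrm{GL}_n(F_0)^2$ and $H_2'=\tilde G_0/(F_0^\times)^2$. Write $j(h)=(h,\mathrm{diag}(h,1))\in\tilde G_0$; then $H'_1$ maps to $G'$ by $(h,h')\mapsto[j(h);j(h')]$ and $H'_2$ by $h\mapsto[h;h]$. All Haar measures give volume $1$ to the integral points. For $\nu\in\{n,n+1\}$ let $t_\nu=\mathrm{diag}(\varpi^{\nu-1},\dots,\varpi,1)$, let $w_\nu$ be the antidiagonal permutation matrix, $w_{\nu,c}=w_\nu t_\nu^c$, and put $t_0=(t_n,t_{n+1})$, $w_0=(w_n,w_{n+1})$, $w_{0,c}=(w_{n,c},w_{n+1,c})$, $m_0=\bigl(1_n,\begin{pmatrix}w_n&u\\0&1\end{pmatrix}\bigr)$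 with $u=(1,\dots,1)^{\mathrm t}$, $m_{0,s}=m_0t_0^s$, $m_s=[m_{0,s};m_{0,s}]\in G'$. For $r\in\mathbf Z$ let $K_\nu^{(r)}=\mathrm{GL}_\nu(\mathcal O_0)\cap t_\nu^{-r}\mathrm{GL}_\nu(\mathcal O_0)t_\nu^{r}$, and for $r\ge1$ let $K_\nu^{\langle r\rangle}$ be the group of $g\in K^{(r)}_\nu$ with $g_{ii}\in 1+\varpi^{r-1}\mathcal O_0$ for all $i$ (for $r=1$, $1+\varpi^0\mathcal O_0$ means $\mathcal O_0$). For a diagonal $a=(a_1,\dots,a_\nu)$, say that $a$ is dominant (strictly dominant) if $v(a_i/a_j)\ge0$ ($>0$) for $i<j$; this is applied componentwise to the diagonal torus $T_0$ of $\tilde G_0$ and to $T_0\times T_0$. Put $a^\iota=w_0^{-1}a^{-1}w_0$ and $K^g=g^{-1}Kg$. \textbf{The group.} Let $c\ge1$, and for $\nu=n,n+1$ let $K_{\nu,0}\supseteq K_\nu^{\langle c\rangle}$ be an open subgroup of the standard (upper triangular) Iwahori subgroup of $\mathrm{GL}_\nu(\mathcal O_0)$, containing all integral upper-triangular unipotent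 matrices, with an Iwahori decomposition $K_{\nu,0}=(K_{\nu,0}\cap N)(K_{\nu,0}\cap T)(K_{\nu,0}\cap N^-)$ whose torus part is stable under $w_\nu$. Let $K_0=K_{n,0}\times K_{n+1,0}$, and let $K\subset G'$ be the image of $K_0\times K_0^{w_{0,c}}$. \textbf{The test measure.} Hecke measures are identified with their densities, $e_K=\mathrm{vol}(K)^{-1}\mathbf 1_K$ and $[KxK]=\mathrm{vol}(K)^{-1}\mathbf 1_{KxK}$. Let $t'=(t_1',t_2')\in T_0\times T_0$ be strictly dominant, $f^\dagger=U_{t'}$, and let $K''$ be the image of $(K^{\langle c\rangle}_n\times K_{n+1}^{\langle c\rangle})^2$ in $G'$. With $d(n)=\sum_{k=1}^nk^2$ put $$f'_{K,s}(x)=q_0^{d(n)(2s-c)}\,\bigl([K''\,t'(t_0,t_0)^{-s}K'']\star e_K\star[K[t_0^c;1]K]\bigr)\bigl(m_s^{-1}\,x\,[w_{0,c};1]\bigr).$$ Call $s\in\mathbf N$ admissible if (i) there is $c'\ge1$ with $2c'\le s$ such that, for $\nu=n,n+1$, $K_\nu^{\langle c'\rangle}$ is contained in $K_{\nu,0}$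 and in $K_{\nu,0}^{w_{\nu,c}}$, and (ii) $t'(t_0,t_0)^{-(s+c)}$ is dominant. Call $s$ admissible for a character $\chi:F_0^\times\to\mathbf C^\times$ if it is admissible and $\chi$ is trivial on $1+\varpi^s\mathcal O_0$. \textbf{Orbits and integrals.} For $g\in\tilde G_0$ put $g_\star=\mathrm{diag}(g_n,1)^{-1}g_{n+1}$; for $g=(g_1,g_2)\in\tilde G_0^2$ put $s_1(g)=g_{1,\star}g_{2,\star}^{-1}$, $s_2(g)=s_1(g)^{-1}$. With $e=(0,\dots,0,1)^{\mathrm t}$ let $D^+(s)$ be the determinant of the matrix with rows $e^{\mathrm t}s^i$ and $D^-(s)$ that of the matrix with columns $s^ie$ ($0\le i\le n$). Then $[g]$ is plus-regular if $D^+(s_1)D^+(s_2)\ne0$, and regular semisimple if also $D^-(s_1)D^-(s_2)\neq0$. Let $\mathrm{inv}(g)\in (F_0^{2n+1})^2$ be given by the invariants $\mathrm{tr}\wedge^iA$ $(1\le i\le n)$, $CA^{j-1}b$ $(1\le j\le n)$, $d$ of the two block matrices $s_1,s_2=\begin{pmatrix}A&b\\C&d\end{pmatrix}$, and let $B'$ be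 the image of $\mathrm{inv}$. Fix a character $\theta$ of $F_0^\times$, let $\epsilon\in\{0,1\}$ be the parity of $n$, $\kappa_i(g)=\det(g_{i,\star})^{\epsilon}\det(s_i)^{-(n+\epsilon)/2}D^+(s_i)$ and $\kappa(g)=\theta(\kappa_1(g))\theta(\kappa_2(g))^{-1}$. For $g$ plus-regular put $$I_g(f',\chi)=\kappa(g)\int_{H_1'}\int_{H_2'}f'(h_1^{-1}[g]h_2)\,\chi(\det h_1)\,dh_1\,dh_2,\qquad \det(h,h')=\det h\det h'.$$ A function $f$ on $\tilde G_0$ \emph{matches} $f'$ if for all regular semisimple $g$ and all $\delta\in\tilde G_0$ with $\delta_\star$ conjugate to $s_1(g)$ under $\mathrm{GL}_n(F_0)$, one has $I_g(f',1)=\int_{\mathrm{GL}_n(F_0)^2}f(j(x)^{-1}\delta j(y))\,dx\,dy$, both integrals being absolutely convergent. An element $\delta\in\tilde G_0$ is regular if its stabilizer in $\mathrm{GL}_n(F_0)^2$ (acting by $(x,y)\cdot\delta=j(x)^{-1}\delta j(y)$) is trivial. \textbf{The constant.} Let $K_{H,0}^{(r)}=\mathrm{GL}_n(\mathcal O_0)\cap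 j^{-1}\bigl(m_0(K_n^{(-r)}\times K_{n+1}^{(-r)})m_0^{-1}\bigr)$, $\mathrm{vol}^\circ(K_H)=q_0^{2d(n)r}\,\mathrm{vol}(K_{H,0}^{(r)})^2$ for $r=1$, $q_0^{\ell(w_0)}=|K_0/(K_0\cap w_0K_0w_0^{-1})|$, and $$k'=k\,q_0^{-\ell(w_0)},\qquad k=\mathrm{vol}^\circ(K_H)/\mathrm{vol}(K_0).$$ \textbf{Statement.} (1) For every admissible $s$, the support of $f'_{K,s}$ consists of plus-regular elements, and $f'_{K,s}$ matches some locally constant compactly supported $f:\tilde G_0\to\mathbf Q$ that is non-zero only at regular elements and is bi-invariant under a conjugate of $K_0$ in $\tilde G_0$. (2) There is a compact subset $B=B_K^\dagger(f^\dagger)\subset B'$ which, for every admissible $s$, equals $$\bigl\{\mathrm{inv}(x,1): x\in m_{0,s}K_0X^\circ K_0m_{0,s}^{-1}\bigr\},\qquad X^\circ=(t_1't_0^{-s})(t_2't_0^{-s})^\iota w_0,$$ and such that, all integrals being absolutely convergent: if $g$ is plus-regular with $\mathrm{inv}(g)\notin B$, then $I_g(f'_{K,s},\chi)=0$ for every $\chi$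 and every $s$ admissible for $\chi$; and every $\gamma\in B$ has a plus-regular representative $g$, $\mathrm{inv}(g)=\gamma$, such that for every $\chi$ and every $s$ admissible for $\chi$ $$I_g(f'_{K,s},\chi)=\theta(-1)^{n(n+1)/2}\,k'.$$ -/

import Mathlib

open MeasureTheory

noncomputable section

namespace SplitOrb

/-! ### The local field, its integers, and matrix groups over it -/

section Field

variable {F : Type*} [NontriviallyNormedField F]

/-- `ϖ` is a uniformizer: a generator of the maximal ideal `{‖x‖ < 1}` of the ring of integers. -/
def IsUniformizer (ϖ : Fˣ) : Prop :=
  ‖(ϖ : F)‖ < 1 ∧ ∀ x : F, ‖x‖ < 1 → ‖x‖ ≤ ‖(ϖ : F)‖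

/-- The additive group `{‖x‖ ≤ r}`; for `r = 1` these are the integers `𝒪₀`. -/
def ballAdd [IsUltrametricDist F] (r : ℝ) (hr : 0 ≤ r) : AddSubgroup F where
  carrier := {x | ‖x‖ ≤ r}
  zero_mem' := by simpa using hr
  add_mem' := fun {a b} ha hb => (IsUltrametricDist.norm_add_le_max a b).trans (max_le ha hb)
  neg_mem' := fun {a} ha => by simpa using ha

/-- `q₀ = |𝒪₀ / ϖ 𝒪₀|`. -/
def q0 [IsUltrametricDist F] (ϖ : Fˣ) : ℕ :=
  (ballAdd ‖(ϖ : F)‖ (norm_nonneg _)).relIndex (ballAdd (F := F) 1 zero_le_one)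

instance instMeasurableGL (ν : ℕ) : MeasurableSpace (GL (Fin ν) F) := borel _
instance instBorelGL (ν : ℕ) : BorelSpace (GL (Fin ν) F) := ⟨rfl⟩

/-- The set `GL_ν(𝒪₀)`. -/
def GLO (F : Type*) [NontriviallyNormedField F] (ν : ℕ) : Set (GL (Fin ν) F) :=
  {g | (∀ i j, ‖g.1 i j‖ ≤ 1) ∧ ∀ i j, ‖(g⁻¹).1 i j‖ ≤ 1}

/-- The diagonal matrix with diagonal `a`. -/
def diagGL {ν : ℕ} (a : Fin ν → Fˣ) : GL (Fin ν) F where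
  val := Matrix.diagonal fun i => (a i : F)
  inv := Matrix.diagonal fun i => ((a i)⁻¹ : F)
  val_inv := by simp [Matrix.diagonal_mul_diagonal]
  inv_val := by simp [Matrix.diagonal_mul_diagonal]

/-- The antidiagonal permutation matrix `w_ν`. -/
def wGL (F : Type*) [NontriviallyNormedField F] (ν : ℕ) : GL (Fin ν) F where
  val := Matrix.of fun i j => if i = Fin.rev j then 1 else 0
  inv := Matrix.of fun i j => if i = Fin.rev j then 1 else 0
  val_inv := by ext i j; simp [Matrix.mul_apply, Matrix.one_apply]
  inv_val := by ext i j; simp [Matrix.mul_apply, Matrix.one_apply]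

/-- The diagonal `(ϖ^{ν-1}, …, ϖ, 1)`. -/
def tVec (ϖ : Fˣ) (ν : ℕ) : Fin ν → Fˣ := fun i => ϖ ^ (ν - 1 - (i : ℕ))

/-- The torus element `t_ν = diag(ϖ^{ν-1}, …, ϖ, 1)`. -/
def tGL (ϖ : Fˣ) (ν : ℕ) : GL (Fin ν) F := diagGL (tVec ϖ ν)

/-- `w_{ν,c} = w_ν t_ν^c`. -/
def wcGL (ϖ : Fˣ) (ν c : ℕ) : GL (Fin ν) F := wGL F ν * tGL ϖ ν ^ c

/-- The block matrix `(A u; 0 1)` of size `n + 1`. -/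
def blockGL {n : ℕ} (A : GL (Fin n) F) (u : Matrix (Fin n) (Fin 1) F) :
    GL (Fin (n + 1)) F where
  val := (Matrix.fromBlocks A.1 u 0 1).submatrix finSumFinEquiv.symm finSumFinEquiv.symm
  inv := (Matrix.fromBlocks (A⁻¹).1 (-((A⁻¹).1 * u)) 0 1).submatrix
    finSumFinEquiv.symm finSumFinEquiv.symm
  val_inv := by
    simp [Matrix.submatrix_mul_equiv, Matrix.fromBlocks_multiply, ← Matrix.mul_assoc]
  inv_val := by
    simp [Matrix.submatrix_mul_equiv, Matrix.fromBlocks_multiply]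

/-- The embedding `h ↦ diag(h, 1)` of `GL_n` in `GL_{n+1}`. -/
def embGL {n : ℕ} (h : GL (Fin n) F) : GL (Fin (n + 1)) F := blockGL h 0

/-! ### Subgroups of `GL_ν(F₀)` -/

/-- Upper-triangular unipotent matrices. -/
def UpperUnip {ν : ℕ} (g : GL (Fin ν) F) : Prop :=
  (∀ i, g.1 i i = 1) ∧ ∀ i j, j < i → g.1 i j = 0

/-- Lower-triangular unipotent matrices. -/
def LowerUnip {ν : ℕ} (g : GL (Fin ν) F) : Prop :=
  (∀ i, g.1 i i = 1) ∧ ∀ i j, i < j → g.1 i j = 0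

/-- The standard Iwahori subgroup: integral matrices, upper triangular modulo `ϖ`. -/
def Iw (F : Type*) [NontriviallyNormedField F] (ν : ℕ) : Set (GL (Fin ν) F) :=
  {g | g ∈ GLO F ν ∧ ∀ i j, j < i → ‖g.1 i j‖ < 1}

/-- `K^{(r)} = GL_ν(𝒪₀) ∩ t^{-r} GL_ν(𝒪₀) t^r`, for an integer `r`. -/
def Kround (ϖ : Fˣ) (ν : ℕ) (r : ℤ) : Set (GL (Fin ν) F) :=
  {g | g ∈ GLO F ν ∧ tGL ϖ ν ^ r * g * tGL ϖ ν ^ (-r) ∈ GLO F ν}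

/-- `K^{⟨r⟩} = {g ∈ K^{(r)} : g_{ii} ∈ 1 + ϖ^{r-1} 𝒪₀}`, for `r ≥ 1`. -/
def Kangle (ϖ : Fˣ) (ν r : ℕ) : Set (GL (Fin ν) F) :=
  {g | g ∈ Kround ϖ ν r ∧ ∀ i, ‖g.1 i i - 1‖ ≤ ‖(ϖ : F)‖ ^ (r - 1)}

/-- A standard deeper Iwahori subgroup: an open subgroup of the standard Iwahori subgroup whose
upper-triangular unipotent elements are exactly the integral ones. -/
def IsStandardDeeperIwahori {ν : ℕ} (K : Subgroup (GL (Fin ν) F)) : Prop :=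
  IsOpen (K : Set (GL (Fin ν) F)) ∧ (K : Set (GL (Fin ν) F)) ⊆ Iw F ν ∧
    ∀ g, UpperUnip g → (g ∈ K ↔ g ∈ GLO F ν)

/-- `K` has an Iwahori decomposition `K = (K ∩ N)(K ∩ T)(K ∩ N⁻)`, and its torus part is
stable under the longest Weyl element. -/
def HasIwahoriDecomposition {ν : ℕ} (K : Subgroup (GL (Fin ν) F)) : Prop :=
  (∀ g ∈ K, ∃ x ∈ K, ∃ a : Fin ν → Fˣ, ∃ y ∈ K,
    UpperUnip x ∧ diagGL a ∈ K ∧ LowerUnip y ∧ g = x * diagGL a * y) ∧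
  ∀ a : Fin ν → Fˣ, diagGL a ∈ K → wGL F ν * diagGL a * (wGL F ν)⁻¹ ∈ K

/-- `K^g = g⁻¹ K g`. -/
def conjSub {G : Type*} [Group G] (K : Subgroup G) (g : G) : Subgroup G :=
  K.map (MulAut.conj g⁻¹).toMonoidHom

/-- `q₀^{ℓ_K(w)} = |K / K ∩ w K w⁻¹|`. -/
def qEllW {ν : ℕ} (K : Subgroup (GL (Fin ν) F)) : ℕ :=
  (conjSub K (wGL F ν)⁻¹).relIndex K

/-- `T^+`: diagonals `a` with `v(a_i / a_j) ≥ 0` for `i < j`. -/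
def IsDom {ν : ℕ} (a : Fin ν → Fˣ) : Prop := ∀ i j, i < j → ‖(a i : F)‖ ≤ ‖(a j : F)‖

/-- `T^{++}`: diagonals `a` with `v(a_i / a_j) > 0` for `i < j`. -/
def IsStrictDom {ν : ℕ} (a : Fin ν → Fˣ) : Prop := ∀ i j, i < j → ‖(a i : F)‖ < ‖(a j : F)‖

/-- The involution `t ↦ w⁻¹ t⁻¹ w` of the diagonal torus. -/
def iotaT {ν : ℕ} (a : Fin ν → Fˣ) : Fin ν → Fˣ := fun i => (a (Fin.rev i))⁻¹

/-! ### The groups `G̃₀`, `G'`, `H₁'`, `H₂'` at a split place -/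

/-- `G̃₀ = GL_n(F₀) × GL_{n+1}(F₀)`. As `F = F₀ × F₀`, the group `GL_n(F) × GL_{n+1}(F)` is
`G̃₀ × G̃₀`, an element being a pair `(g₁, g₂)` of elements of `G̃₀`. -/
abbrev G0 (n : ℕ) (F : Type*) [NontriviallyNormedField F] : Type _ :=
  GL (Fin n) F × GL (Fin (n + 1)) F

/-- The diagonal torus of `G̃₀`. -/
abbrev T0 (n : ℕ) (F : Type*) [NontriviallyNormedField F] : Type _ :=
  (Fin n → Fˣ) × (Fin (n + 1) → Fˣ)

def scalarGL (ν : ℕ) : Fˣ →* GL (Fin ν) F where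
  toFun z := diagGL fun _ => z
  map_one' := by ext i j; simp [diagGL]
  map_mul' a b := by
    ext i j
    by_cases h : i = j <;> simp [diagGL, h]

theorem scalarGL_comm {ν : ℕ} (z : Fˣ) (g : GL (Fin ν) F) :
    g * scalarGL ν z = scalarGL ν z * g := by
  ext i j; simp [scalarGL, diagGL, mul_comm]

/-- Pairs of scalar matrices in `G̃₀`. -/
def zHom (n : ℕ) (F : Type*) [NontriviallyNormedField F] : Fˣ × Fˣ →* G0 n F :=
  (scalarGL n).prodMap (scalarGL (n + 1))

def Z0 (n : ℕ) (F : Type*) [NontriviallyNormedField F] : Subgroup (G0 n F) := (zHom n F).range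

/-- `(F₀^×)²`, embedded in `G̃₀ × G̃₀` diagonally. -/
def ZZ (n : ℕ) (F : Type*) [NontriviallyNormedField F] : Subgroup (G0 n F × G0 n F) :=
  ((zHom n F).prod (zHom n F)).range

instance Z0_normal (n : ℕ) : (Z0 n F).Normal where
  conj_mem := by
    rintro _ ⟨z, rfl⟩ g
    refine ⟨z, ?_⟩
    ext1 <;> simp [zHom, scalarGL_comm]

instance ZZ_normal (n : ℕ) : (ZZ n F).Normal where
  conj_mem := by
    rintro _ ⟨z, rfl⟩ g
    refine ⟨z, ?_⟩
    ext1 <;> ext1 <;> simp [zHom, scalarGL_comm]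

/-- `G' = GL_n(F)/F₀^× × GL_{n+1}(F)/F₀^×`. -/
def Gp (n : ℕ) (F : Type*) [NontriviallyNormedField F] : Type _ := (G0 n F × G0 n F) ⧸ ZZ n F

/-- `H₂' = PGL_n(F₀) × PGL_{n+1}(F₀)`. -/
def H2 (n : ℕ) (F : Type*) [NontriviallyNormedField F] : Type _ := G0 n F ⧸ Z0 n F

instance (n : ℕ) : Group (Gp n F) := inferInstanceAs (Group ((G0 n F × G0 n F) ⧸ ZZ n F))
instance (n : ℕ) : TopologicalSpace (Gp n F) :=
  inferInstanceAs (TopologicalSpace ((G0 n F × G0 n F) ⧸ ZZ n F))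
instance (n : ℕ) : MeasurableSpace (Gp n F) := borel _
instance (n : ℕ) : BorelSpace (Gp n F) := ⟨rfl⟩
instance (n : ℕ) : Group (H2 n F) := inferInstanceAs (Group (G0 n F ⧸ Z0 n F))
instance (n : ℕ) : TopologicalSpace (H2 n F) :=
  inferInstanceAs (TopologicalSpace (G0 n F ⧸ Z0 n F))
instance (n : ℕ) : MeasurableSpace (H2 n F) := borel _
instance (n : ℕ) : BorelSpace (H2 n F) := ⟨rfl⟩

/-- The class `[g₁; g₂]` in `G'`. -/
def mkGp {n : ℕ} : G0 n F × G0 n F →* Gp n F := QuotientGroup.mk' (ZZ n F)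

def mkH2 {n : ℕ} : G0 n F →* H2 n F := QuotientGroup.mk' (Z0 n F)

/-- The embedding `h ↦ (h, diag(h, 1))` of `GL_n(F₀)` in `G̃₀`. -/
def j0 {n : ℕ} (h : GL (Fin n) F) : G0 n F := (h, embGL h)

/-- The embedding of `H₁' = GL_n(F) = GL_n(F₀) × GL_n(F₀)` in `G'`. -/
def j1 {n : ℕ} (h : GL (Fin n) F × GL (Fin n) F) : Gp n F := mkGp (j0 h.1, j0 h.2)

/-- The diagonal embedding `[h] ↦ [h; h]` of `H₂'` in `G'`. -/
def j2 {n : ℕ} : H2 n F →* Gp n F :=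
  QuotientGroup.map (Z0 n F) (ZZ n F) ((MonoidHom.id _).prod (MonoidHom.id _)) (by
    rintro _ ⟨z, rfl⟩
    exact ⟨z, rfl⟩)

/-- `GL_n(𝒪₀) × GL_{n+1}(𝒪₀)`. -/
def G0O (n : ℕ) (F : Type*) [NontriviallyNormedField F] : Set (G0 n F) := GLO F n ×ˢ GLO F (n + 1)

/-! ### Invariants, orbits, regularity -/

/-- `g_⋆ = g_n⁻¹ g_{n+1}`, with `GL_n` embedded in `GL_{n+1}`. -/
def gstar {n : ℕ} (g : G0 n F) : GL (Fin (n + 1)) F := (embGL g.1)⁻¹ * g.2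

/-- The image `s = (s₁, s₂)` of `(g₁, g₂)` in the symmetric space `S ⊆ GL_{n+1}(F₀ × F₀)`:
`s = g_⋆ (g_⋆^c)⁻¹`, where the conjugation `c` exchanges the two factors. -/
def sMat {n : ℕ} (g : G0 n F × G0 n F) : GL (Fin (n + 1)) F × GL (Fin (n + 1)) F :=
  (gstar g.1 * (gstar g.2)⁻¹, gstar g.2 * (gstar g.1)⁻¹)

/-- `D⁺(s) = det (e^t, e^t s, …, e^t s^n)`, with `e` the last basis vector. -/
def Dplus {n : ℕ} (s : GL (Fin (n + 1)) F) : F :=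
  (Matrix.of fun i j : Fin (n + 1) => (s.1 ^ (i : ℕ)) (Fin.last n) j).det

/-- `D⁻(s) = det (e, s e, …, s^n e)`. -/
def Dminus {n : ℕ} (s : GL (Fin (n + 1)) F) : F :=
  (Matrix.of fun i j : Fin (n + 1) => (s.1 ^ (j : ℕ)) i (Fin.last n)).det

/-- The plus-regular locus of `GL_n(F) × GL_{n+1}(F)` (where `D⁺` is invertible in `F₀ × F₀`). -/
def RegPlus (n : ℕ) (F : Type*) [NontriviallyNormedField F] : Set (G0 n F × G0 n F) :=
  {g | Dplus (sMat g).1 ≠ 0 ∧ Dplus (sMat g).2 ≠ 0}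

/-- The regular semisimple locus (where `D⁺ D⁻` is invertible in `F₀ × F₀`). -/
def RegSS (n : ℕ) (F : Type*) [NontriviallyNormedField F] : Set (G0 n F × G0 n F) :=
  {g | g ∈ RegPlus n F ∧ Dminus (sMat g).1 ≠ 0 ∧ Dminus (sMat g).2 ≠ 0}

/-- The affine space `F₀^{2n+1}`. -/
abbrev Aff (n : ℕ) (F : Type*) : Type _ := (Fin n → F) × (Fin n → F) × F

/-- The invariants `(tr ⋀^i A)_{1 ≤ i ≤ n}, (c A^{j-1} b)_{1 ≤ j ≤ n}, d` of the block matrix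
`(A b; c d)`; here `tr ⋀^i A` is `(-1)^i` times the coefficient of `X^{n-i}` in the
characteristic polynomial of `A`. -/
def invMat {n : ℕ} (s : GL (Fin (n + 1)) F) : Aff n F :=
  let A : Matrix (Fin n) (Fin n) F := s.1.submatrix Fin.castSucc Fin.castSucc
  (fun i => (-1) ^ ((i : ℕ) + 1) * A.charpoly.coeff (n - ((i : ℕ) + 1)),
   fun j => (fun k => s.1 (Fin.last n) (Fin.castSucc k)) ⬝ᵥ
      ((A ^ (j : ℕ)).mulVec fun k => s.1 (Fin.castSucc k) (Fin.last n)),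
   s.1 (Fin.last n) (Fin.last n))

/-- The invariant map, with values in `(F₀ × F₀)^{2n+1}`. -/
def invB {n : ℕ} (g : G0 n F × G0 n F) : Aff n F × Aff n F :=
  (invMat (sMat g).1, invMat (sMat g).2)

/-- The `F₀`-points of the orbit variety `B' = H₁'\G'/H₂'`, embedded in affine space by the
invariant map. -/
def Bp (n : ℕ) (F : Type*) [NontriviallyNormedField F] : Set (Aff n F × Aff n F) :=
  Set.range (invB (n := n) (F := F))

/-! ### Hecke measures

A Hecke measure `f dg` is represented by the function `f`. -/

section Hecke

variable {G : Type*} [Group G] [MeasurableSpace G]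

/-- Convolution, `(f₁ ⋆ f₂)(x) = ∫ f₁(x y) f₂(y⁻¹) dy`. -/
def conv (μ : Measure G) (f₁ f₂ : G → ℂ) : G → ℂ := fun x => ∫ y, f₁ (x * y) * f₂ y⁻¹ ∂μ

/-- `e_K = vol(K)⁻¹ 1_K`. -/
def eK (μ : Measure G) (K : Set G) : G → ℂ := K.indicator fun _ => ((μ.real K)⁻¹ : ℂ)

/-- `[K x K] = vol(K)⁻¹ 1_{K x K}`. -/
def heckeOp (μ : Measure G) (K : Set G) (x : G) : G → ℂ :=
  {y | ∃ a ∈ K, ∃ b ∈ K, y = a * x * b}.indicator fun _ => ((μ.real K)⁻¹ : ℂ)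

end Hecke

/-! ### Elements and subgroups attached to the situation -/

variable {n : ℕ}

def diag0 (a : T0 n F) : G0 n F := (diagGL a.1, diagGL a.2)

def tVec0 (ϖ : Fˣ) (n : ℕ) : T0 n F := (tVec ϖ n, tVec ϖ (n + 1))

def iota0 (a : T0 n F) : T0 n F := (iotaT a.1, iotaT a.2)

/-- `t₀ = (t_n, t_{n+1})`. -/
def t0 (ϖ : Fˣ) (n : ℕ) : G0 n F := diag0 (tVec0 ϖ n)

def w0 (n : ℕ) (F : Type*) [NontriviallyNormedField F] : G0 n F := (wGL F n, wGL F (n + 1))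

/-- `w_{0,c} = (w_{n,c}, w_{n+1,c})`. -/
def wc0 (ϖ : Fˣ) (n c : ℕ) : G0 n F := (wcGL ϖ n c, wcGL ϖ (n + 1) c)

/-- The twisting matrices `m₀ = (1_n, (w_n u; 0 1))`, with `u = (1, …, 1)^t`. -/
def m0 (n : ℕ) (F : Type*) [NontriviallyNormedField F] : G0 n F :=
  (1, blockGL (wGL F n) (Matrix.of fun _ _ => 1))

/-- `m_{0,s} = m₀ t₀^s`. -/
def m0s (ϖ : Fˣ) (n s : ℕ) : G0 n F := m0 n F * t0 ϖ n ^ s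

/-- `K_{H,0}^{(r)} = m₀ K₀^{(-r)} m₀⁻¹ ∩ GL_n(𝒪₀)`. -/
def KH (ϖ : Fˣ) (n : ℕ) (r : ℕ) : Set (GL (Fin n) F) :=
  {h | h ∈ GLO F n ∧
    (m0 n F)⁻¹ * j0 h * m0 n F ∈ Kround ϖ n (-(r : ℤ)) ×ˢ Kround ϖ (n + 1) (-(r : ℤ))}

/-- `d(n) = ∑_{k=1}^n k²`. -/
def dn (n : ℕ) : ℕ := ∑ k ∈ Finset.range (n + 1), k ^ 2

/-- The hypotheses on each component `K_{ν,0}` of the group `K₀`: a standard deeper Iwahori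
subgroup containing `K^{⟨c⟩}`, with an Iwahori decomposition. -/
def IsCSDIComponent (ϖ : Fˣ) (c : ℕ) {ν : ℕ} (K : Subgroup (GL (Fin ν) F)) : Prop :=
  IsStandardDeeperIwahori K ∧ Kangle ϖ ν c ⊆ K ∧ HasIwahoriDecomposition K

/-- `K₀ = K_{n,0} × K_{n+1,0}`. -/
def K0 (Kn : Subgroup (GL (Fin n) F)) (Kn1 : Subgroup (GL (Fin (n + 1)) F)) : Subgroup (G0 n F) :=
  Kn.prod Kn1

/-- The conjugate-symmetric deeper Iwahori `K = K₀ × K₀^{w_{0,c}}` in `G'`. -/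
def KCS (ϖ : Fˣ) (c : ℕ) (Kn : Subgroup (GL (Fin n) F)) (Kn1 : Subgroup (GL (Fin (n + 1)) F)) :
    Subgroup (Gp n F) :=
  ((K0 Kn Kn1).prod (conjSub (K0 Kn Kn1) (wc0 ϖ n c))).map mkGp

/-- The image in `G'` of `K₀^{⟨c⟩} × K₀^{⟨c⟩}`, a standard deeper Iwahori contained in `K`. -/
def KangleGp (ϖ : Fˣ) (n c : ℕ) : Set (Gp n F) :=
  mkGp '' ((Kangle ϖ n c ×ˢ Kangle ϖ (n + 1) c) ×ˢ (Kangle ϖ n c ×ˢ Kangle ϖ (n + 1) c))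

/-- The conditions on an integer `s`: `s` is sufficiently positive for `K` (the group `K` contains
a deeper Iwahori of level `c'` with `s ≥ 2c'`), and `U_t^{-(s+c)} U_{t'}` is in the positive part
of the Hecke algebra. -/
def SuffPos (ϖ : Fˣ) (c : ℕ) (Kn : Subgroup (GL (Fin n) F)) (Kn1 : Subgroup (GL (Fin (n + 1)) F))
    (t' : T0 n F × T0 n F) (s : ℕ) : Prop :=
  (∃ c' : ℕ, 1 ≤ c' ∧ 2 * c' ≤ s ∧
    Kangle ϖ n c' ⊆ Kn ∧ Kangle ϖ n c' ⊆ conjSub Kn (wcGL ϖ n c) ∧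
    Kangle ϖ (n + 1) c' ⊆ Kn1 ∧ Kangle ϖ (n + 1) c' ⊆ conjSub Kn1 (wcGL ϖ (n + 1) c)) ∧
  (IsDom (t'.1 / tVec0 ϖ n ^ (s + c)).1 ∧ IsDom (t'.1 / tVec0 ϖ n ^ (s + c)).2) ∧
  (IsDom (t'.2 / tVec0 ϖ n ^ (s + c)).1 ∧ IsDom (t'.2 / tVec0 ϖ n ^ (s + c)).2)

/-- The test measure
`f'_{K,s} = q₀^{d(n)(2s-c)} m_s (U_t^{-s} f^†) e_K U_{[t₀;1]}^c [w_{0,c}⁻¹; 1]` for `f^† = U_{t'}`.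
Here `U_t^{-s} U_{t'} = U_{t' t^{-s}}` is realized as `[K'' t' t^{-s} K'']` for the standard deeper
Iwahori `K'' = K^{⟨c⟩} × K^{⟨c⟩}` contained in `K`, and `e_K U_{[t₀;1]}^c = [K [t₀^c;1] K]`. -/
def testMeasure [IsUltrametricDist F] (ϖ : Fˣ) (c : ℕ) (Kn : Subgroup (GL (Fin n) F))
    (Kn1 : Subgroup (GL (Fin (n + 1)) F)) (t' : T0 n F × T0 n F) (μ : Measure (Gp n F)) (s : ℕ) :
    Gp n F → ℂ := fun x =>
  (q0 ϖ : ℂ) ^ ((dn n : ℤ) * (2 * s - c)) *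
    conv μ
      (conv μ
        (heckeOp μ (KangleGp ϖ n c)
          (mkGp (diag0 (t'.1 / tVec0 ϖ n ^ s), diag0 (t'.2 / tVec0 ϖ n ^ s))))
        (eK μ (KCS ϖ c Kn Kn1)))
      (heckeOp μ (KCS ϖ c Kn Kn1) (mkGp (t0 ϖ n ^ c, 1)))
      ((mkGp (m0s ϖ n s, m0s ϖ n s))⁻¹ * x * mkGp (wc0 ϖ n c, 1))

/-! ### Orbital integrals and matching -/

/-- The integrand `f'(h₁⁻¹ γ' h₂) χ(N_{F/F₀} det h₁)` (at a split place `η = 1`). -/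
def orbIntegrand (f : Gp n F → ℂ) (χ : Fˣ →* ℂˣ) (γ : Gp n F)
    (p : (GL (Fin n) F × GL (Fin n) F) × H2 n F) : ℂ :=
  f ((j1 p.1)⁻¹ * γ * j2 p.2) *
    (χ (Matrix.GeneralLinearGroup.det p.1.1 * Matrix.GeneralLinearGroup.det p.1.2) : ℂ)

/-- The measure on `H₁' × H₂'`. -/
def orbMeasure (μn : Measure (GL (Fin n) F)) (μH : Measure (H2 n F)) :
    Measure ((GL (Fin n) F × GL (Fin n) F) × H2 n F) := (μn.prod μn).prod μH

/-- A character of `F₀^×`, extended by zero to `F₀`. -/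
def charExt (θ : Fˣ →* ℂˣ) (x : F) : ℂ :=
  open Classical in if h : x = 0 then 0 else (θ (Units.mk0 x h) : ℂ)

/-- The number `det(γ_⋆)^ε det(s)^{-(n+ε)/2} D⁺(s)`, with `ε ∈ {0, 1}` the parity of `n`. -/
def kappaArg (a s : GL (Fin (n + 1)) F) : F :=
  a.1.det ^ (n % 2) * (s.1.det ^ ((n + n % 2) / 2))⁻¹ * Dplus s

/-- The transfer factor `κ(γ')`, for the character `η' = (θ, θ⁻¹)` of `F^× = F₀^× × F₀^×`
(every character of `F^×` trivial on `F₀^×` has this form). -/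
def kappa (θ : Fˣ →* ℂˣ) (g : G0 n F × G0 n F) : ℂ :=
  charExt θ (kappaArg (gstar g.1) (sMat g).1) * (charExt θ (kappaArg (gstar g.2) (sMat g).2))⁻¹

/-- The orbital integral `I^♯_γ(f', χ) = κ(γ') ∫∫ f'(h₁⁻¹ γ' h₂) χ(h₁) dh₁ dh₂`, for the
representative `γ' = [g]`. -/
def orbI (θ : Fˣ →* ℂˣ) (μn : Measure (GL (Fin n) F)) (μH : Measure (H2 n F))
    (f : Gp n F → ℂ) (χ : Fˣ →* ℂˣ) (g : G0 n F × G0 n F) : ℂ :=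
  kappa θ g * ∫ p, orbIntegrand f χ (mkGp g) p ∂(orbMeasure μn μH)

/-- At a split place the unitary group `G` is `G̃₀`, with `H = GL_n(F₀)` embedded by `j0`;
this is the integrand `f(x⁻¹ δ y)` of the orbital integral on `G`. -/
def unitaryIntegrand (f : G0 n F → ℂ) (δ : G0 n F) (p : GL (Fin n) F × GL (Fin n) F) : ℂ :=
  f ((j0 p.1)⁻¹ * δ * j0 p.2)

/-- Regular semisimple orbits of `γ' = [g]` in `G'` and `δ` in `G` match: the associated elements
of `GL_{n+1}(F₀)` are conjugate under `GL_n(F₀)`. -/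
def OrbitsMatch (g : G0 n F × G0 n F) (δ : G0 n F) : Prop :=
  ∃ y : GL (Fin n) F, embGL y * gstar δ * (embGL y)⁻¹ = (sMat g).1

/-- Matching of Hecke measures on `G'` and `G`: equality of the (absolutely convergent) orbital
integrals, with trivial `χ`, at all matching regular semisimple orbits. -/
def Matches (θ : Fˣ →* ℂˣ) (μn : Measure (GL (Fin n) F)) (μH : Measure (H2 n F))
    (f' : Gp n F → ℂ) (f : G0 n F → ℂ) : Prop :=
  ∀ g ∈ RegSS n F, ∀ δ : G0 n F, OrbitsMatch g δ →
    Integrable (orbIntegrand f' 1 (mkGp g)) (orbMeasure μn μH) ∧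
    Integrable (unitaryIntegrand f δ) (μn.prod μn) ∧
    orbI θ μn μH f' 1 g = ∫ p, unitaryIntegrand f δ p ∂(μn.prod μn)

/-- `δ ∈ G` is regular: its stabilizer in `H × H` is trivial. -/
def IsRegularG (δ : G0 n F) : Prop :=
  ∀ x y : GL (Fin n) F, (j0 x)⁻¹ * δ * j0 y = δ → x = 1 ∧ y = 1

/-! ### The explicit orbits and the explicit constant -/

/-- The set `m_{0,s} K₀ X° K₀ m_{0,s}⁻¹` in `G̃₀`, with
`X° = (t'₁ t^{-s}) (t'₂ t^{-s})^ι w₀`. -/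
def orbitSet (ϖ : Fˣ) (Kn : Subgroup (GL (Fin n) F)) (Kn1 : Subgroup (GL (Fin (n + 1)) F))
    (t' : T0 n F × T0 n F) (s : ℕ) : Set (G0 n F) :=
  {x | ∃ a ∈ K0 Kn Kn1, ∃ b ∈ K0 Kn Kn1,
    x = m0s ϖ n s * a *
      (diag0 ((t'.1 / tVec0 ϖ n ^ s) * iota0 (t'.2 / tVec0 ϖ n ^ s)) * w0 n F) * b *
        (m0s ϖ n s)⁻¹}

/-- `vol°(K_H) = q^{d(n) r} vol(K_H^{(r)})`, which does not depend on `r ≥ 1`, evaluated at `r = 1`;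
here `q = |𝒪/ϖ𝒪| = q₀²` and `K_H^{(r)} = K_{H,0}^{(r)} × K_{H,0}^{(r)}`. -/
def volCirc [IsUltrametricDist F] (ϖ : Fˣ) (n : ℕ) (μn : Measure (GL (Fin n) F)) : ℝ :=
  ((q0 ϖ : ℝ) ^ 2) ^ dn n * (μn.prod μn).real (KH ϖ n 1 ×ˢ KH ϖ n 1)

/-- `k' = k q₀^{-ℓ_{K₀}(w₀)}` with `k = vol°(K_H) / vol(K₀)`. -/
def kPrime [IsUltrametricDist F] (ϖ : Fˣ) (Kn : Subgroup (GL (Fin n) F))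
    (Kn1 : Subgroup (GL (Fin (n + 1)) F)) (μn : Measure (GL (Fin n) F))
    (μn1 : Measure (GL (Fin (n + 1)) F)) : ℝ :=
  volCirc ϖ n μn / (μn.prod μn1).real (K0 Kn Kn1) / ((qEllW Kn : ℝ) * qEllW Kn1)

/-- `s` is sufficiently positive for `χ`: `s ≥ 1` and `χ` is trivial on `1 + ϖ^s 𝒪₀`. -/
def SuffPosChar (ϖ : Fˣ) (χ : Fˣ →* ℂˣ) (s : ℕ) : Prop :=
  1 ≤ s ∧ ∀ u : Fˣ, ‖(u : F) - 1‖ ≤ ‖(ϖ : F)‖ ^ s → χ u = 1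

end Field

end SplitOrb

end

open SplitOrb

set_option linter.unusedSectionVars false

/-! Put `y_i = t'_i t₀^{-s}` and `Q = K₀^{w_{0,c}}`, and let `O_s` be `m_{0,s} K₀ X° K₀ m_{0,s}⁻¹`,
called `orbitSet`. Iwahori decompositions show that each convolution in the test measure involves a
single double coset, so the measure is a constant times an indicator function (`conv_hecke`,
`testMeasure_eq`). After the translation by `[w_{0,c}; 1]`, the class `[g₁; g₂]` lies in the support
exactly when, up to a common central factor, `m_{0,s}⁻¹ g₂` lies in `K^{⟨c⟩} y₂ Q` and `m_{0,s}⁻¹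
g₁` lies in `K^{⟨c⟩} y₁ w₀ Q`, where `K^{⟨c⟩}` has both its components. The same group `Q` stands on
the right of both conditions.

The integral over `H₂'` multiplies `g₁` and `g₂` on the right by the same element. By dominance of
`y_i t₀^{-c}`, the elements that bring the pair into the support form one coset of `Q` if `g₁ g₂⁻¹`
lies in `O_s`, and there are none otherwise (`Tri.quot_mem`, `Tri.fibre`). By Fubini the orbital
integral is the transfer factor, times a rational mass, times the volume of the pairs `(h, h')` with
`j(h)⁻¹ g₁ g₂⁻¹ j(h')` in `O_s`, provided that the character is trivial on the support. The transfer
factor is the constant sign `θ(-1)^{n(n+1)/2}` on the plus-regular locus (`kappa_eq`), so a rational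
multiple of the indicator of `O_s` matches.

It remains to study the action of `H × H` on `O_s`. After conjugation by `m₀` one has `O_s = N_s T
X₀ N_s`, with `N_s = t₀^s N(𝒪₀) t₀^{-s}`, `T` the torus part of `K₀`, and `X₀` independent of `s`.
The point is that the strictly upper triangular parts of an `n × n` matrix and of its image under `h
↦ m⁻¹ diag(h,1) m` have `n²` entries in all and determine the matrix (`norm_le_of_upper_parts`);
infinitesimally, `H` has an open orbit on the flag variety. With ultrametric contraction this yields
three facts. An element of `H × H` that carries a point of `O_s` into `O_s` lies in `K_{H,0}^{(s)} ×
K_{H,0}^{(s)}` (`rigidity`). Every point of `O_s` can be moved into `O_{s'}` for `s' ≥ s`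
(`exists_lower`). Every point of `O_s` is plus-regular (`Dplus_ne_zero_of_cell`).

Rigidity computes the volume and puts the determinants in `1 + ϖ^s 𝒪₀`, where the character is
trivial. The second fact makes the invariants of `O_s` independent of `s`. The value `k'` then
follows from three counts: `[N_a : N_{a+m}] = q₀^{m d(n)}`, the same index for the groups
`K_{H,0}^{(r)}`, and `[N ∩ Q : N(𝒪₀)] q₀^{ℓ(w₀)} = q₀^{c d(n)}`. -/

namespace SplitOrb

/-! ### Relative indices of subgroups -/

section Index

variable {G : Type*} [Group G]

theorem card_image_mk (H K : Subgroup G) :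
    Nat.card ((QuotientGroup.mk : G → G ⧸ H) '' (K : Set G)) = H.relIndex K := by
  rw [Subgroup.relIndex, Subgroup.index_eq_card]
  refine (Nat.card_congr (Equiv.ofBijective
    (fun x : K ⧸ H.subgroupOf K => (⟨Quotient.liftOn' x (fun k => ((k : G) : G ⧸ H)) ?_, ?_⟩ :
      ((QuotientGroup.mk : G → G ⧸ H) '' (K : Set G)))) ⟨?_, ?_⟩)).symm
  · intro a b hab
    rw [QuotientGroup.leftRel_apply, Subgroup.mem_subgroupOf] at hab
    exact QuotientGroup.eq.2 (by simpa using hab)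
  · induction x using QuotientGroup.induction_on with
    | H k => exact ⟨k, k.2, rfl⟩
  · intro x y
    induction x using QuotientGroup.induction_on with
    | H a =>
      induction y using QuotientGroup.induction_on with
      | H b =>
        intro h
        have h1 : ((a : G) : G ⧸ H) = ((b : G) : G ⧸ H) := congrArg Subtype.val h
        rw [QuotientGroup.eq] at h1
        exact QuotientGroup.eq.2 (by rw [Subgroup.mem_subgroupOf]; simpa using h1)
  · rintro ⟨_, k, hk, rfl⟩
    exact ⟨((⟨k, hk⟩ : K) : K ⧸ H.subgroupOf K), rfl⟩

/-- Two subgroups meeting the same left cosets of `H` have the same relative index. -/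
theorem relIndex_eq_of_cover {H A B : Subgroup G} (h₁ : ∀ a ∈ A, ∃ b ∈ B, b⁻¹ * a ∈ H)
    (h₂ : ∀ b ∈ B, ∃ a ∈ A, a⁻¹ * b ∈ H) : H.relIndex A = H.relIndex B := by
  rw [← card_image_mk, ← card_image_mk]
  congr 2
  ext x
  constructor
  · rintro ⟨a, ha, rfl⟩
    obtain ⟨b, hb, h⟩ := h₁ a ha
    exact ⟨b, hb, QuotientGroup.eq.2 h⟩
  · rintro ⟨a, ha, rfl⟩
    obtain ⟨b, hb, h⟩ := h₂ a ha
    exact ⟨b, hb, QuotientGroup.eq.2 h⟩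

theorem relIndex_congr_left {H H' K : Subgroup G} (h : ∀ x ∈ K, x ∈ H ↔ x ∈ H') :
    H.relIndex K = H'.relIndex K := by
  rw [← Subgroup.inf_relIndex_right H, ← Subgroup.inf_relIndex_right H']
  congr 1
  ext x
  simp only [Subgroup.mem_inf]
  constructor
  · rintro ⟨a, b⟩; exact ⟨(h x b).1 a, b⟩
  · rintro ⟨a, b⟩; exact ⟨(h x b).2 a, b⟩

theorem mem_conjSub {K : Subgroup G} {g x : G} : x ∈ conjSub K g ↔ g * x * g⁻¹ ∈ K := by
  simp only [conjSub, Subgroup.mem_map, MulEquiv.coe_toMonoidHom, MulAut.conj_apply, inv_inv]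
  constructor
  · rintro ⟨k, hk, rfl⟩
    simpa [mul_assoc] using hk
  · intro h
    exact ⟨_, h, by group⟩

theorem relIndex_conjSub (H K : Subgroup G) (g : G) :
    (conjSub H g).relIndex (conjSub K g) = H.relIndex K :=
  Subgroup.relIndex_map_map_of_injective H K (MulAut.conj g⁻¹).injective

theorem relIndex_prod {G' : Type*} [Group G'] (H K : Subgroup G) (H' K' : Subgroup G') :
    (H.prod H').relIndex (K.prod K') = H.relIndex K * H'.relIndex K' := by
  rw [← card_image_mk, ← card_image_mk, ← card_image_mk, ← Nat.card_prod]
  refine Nat.card_congr (Equiv.ofBijective (fun x => (⟨⟨Quotient.liftOn' x.1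
    (fun p => ((p.1 : G) : G ⧸ H)) ?_, ?_⟩, ⟨Quotient.liftOn' x.1
    (fun p => ((p.2 : G') : G' ⧸ H')) ?_, ?_⟩⟩)) ⟨?_, ?_⟩)
  · intro a b hab
    rw [QuotientGroup.leftRel_apply, Subgroup.mem_prod] at hab
    exact QuotientGroup.eq.2 hab.1
  · obtain ⟨_, p, hp, rfl⟩ := x
    exact ⟨p.1, (Subgroup.mem_prod.1 hp).1, rfl⟩
  · intro a b hab
    rw [QuotientGroup.leftRel_apply, Subgroup.mem_prod] at hab
    exact QuotientGroup.eq.2 hab.2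
  · obtain ⟨_, p, hp, rfl⟩ := x
    exact ⟨p.2, (Subgroup.mem_prod.1 hp).2, rfl⟩
  · rintro ⟨_, p, hp, rfl⟩ ⟨_, p', hp', rfl⟩ h
    have h1 : ((p.1 : G) : G ⧸ H) = p'.1 := congrArg (fun x => x.1.1) h
    have h2 : ((p.2 : G') : G' ⧸ H') = p'.2 := congrArg (fun x => x.2.1) h
    rw [QuotientGroup.eq] at h1 h2
    exact Subtype.ext (QuotientGroup.eq.2 (Subgroup.mem_prod.2 ⟨h1, h2⟩))
  · rintro ⟨⟨_, a, ha, rfl⟩, ⟨_, b, hb, rfl⟩⟩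
    exact ⟨⟨_, (a, b), Subgroup.mem_prod.2 ⟨ha, hb⟩, rfl⟩, rfl⟩

end Index

/-! ### Volumes of cosets and convolution of Hecke operators -/

section Meas

variable {G : Type*} [Group G] [MeasurableSpace G] [MeasurableMul G] {μ : Measure G}
  [μ.IsMulLeftInvariant]

theorem measure_leftCoset (H : Set G) (g : G) : μ {x | g⁻¹ * x ∈ H} = μ H :=
  measure_preimage_mul μ g⁻¹ H

/-- The volume of `M H` is `[M : M ∩ H] vol(H)`. -/
theorem measure_mul_subgroup {H M : Subgroup G} (hH : MeasurableSet (H : Set G))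
    (h0 : H.relIndex M ≠ 0) :
    μ {g | ∃ m ∈ M, m⁻¹ * g ∈ H} = H.relIndex M * μ (H : Set G) := by
  classical
  have hcard := card_image_mk H M
  set S := (QuotientGroup.mk : G → G ⧸ H) '' (M : Set G)
  have hfin : Finite S := Nat.finite_of_card_ne_zero (by rw [hcard]; exact h0)
  have : Fintype S := Fintype.ofFinite S
  have hS : {g | ∃ m ∈ M, m⁻¹ * g ∈ H} = ⋃ s : S, {g | (Quotient.out s.1)⁻¹ * g ∈ H} := by
    ext g
    simp only [Set.mem_ofPred_eq, Set.mem_iUnion]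
    constructor
    · rintro ⟨m, hm, h⟩
      refine ⟨⟨(m : G ⧸ H), m, hm, rfl⟩, ?_⟩
      rw [← QuotientGroup.eq]
      rw [← QuotientGroup.eq] at h
      rw [← h]
      exact Quotient.out_eq _
    · rintro ⟨⟨_, m, hm, rfl⟩, h⟩
      refine ⟨m, hm, ?_⟩
      rw [← QuotientGroup.eq] at h ⊢
      rw [← h]
      exact (Quotient.out_eq _).symm
  rw [hS, measure_iUnion]
  · have : ∀ s : S, μ {g | (Quotient.out s.1)⁻¹ * g ∈ H} = μ (H : Set G) :=
      fun s => measure_leftCoset (H : Set G) _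
    simp only [this]
    rw [tsum_fintype, Finset.sum_const, Finset.card_univ, nsmul_eq_mul, ← hcard,
      Nat.card_eq_fintype_card]
  · intro s s' hss
    refine Set.disjoint_left.2 fun g hg hg' => hss (Subtype.ext ?_)
    simp only [Set.mem_ofPred_eq, ← QuotientGroup.eq] at hg hg'
    rw [← Quotient.out_eq s.1, ← Quotient.out_eq s'.1]
    exact hg.trans hg'.symm
  · exact fun s => (measurable_const_mul _) hH

theorem measure_subgroup_eq {H M : Subgroup G} (hH : MeasurableSet (H : Set G)) (hle : H ≤ M)
    (h0 : H.relIndex M ≠ 0) : μ (M : Set G) = H.relIndex M * μ (H : Set G) := by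
  rw [← measure_mul_subgroup hH h0]
  congr 1
  ext g
  constructor
  · exact fun hg => ⟨g, hg, by simp⟩
  · rintro ⟨m, hm, h⟩
    simpa using M.mul_mem hm (hle h)

/-- Convolution of a double coset with the unit and with a Hecke operator. -/
theorem conv_hecke [MeasurableInv G] {A K : Subgroup G} (hAK : A ≤ K)
    (hK : MeasurableSet (K : Set G)) {y τ : G}
    (hAyA : MeasurableSet {x | ∃ a ∈ A, ∃ b ∈ A, x = a * y * b})
    (hAyK : MeasurableSet {x | ∃ a ∈ A, ∃ b ∈ K, x = a * y * b})
    (hKτK : MeasurableSet {x | ∃ a ∈ K, ∃ b ∈ K, x = a * τ * b})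
    (hK0 : μ (K : Set G) ≠ 0) (hKtop : μ (K : Set G) ≠ ⊤)
    (h₁ : ∀ k ∈ K, ∃ a ∈ A, ∃ b ∈ K, y * k * τ = a * (y * τ) * b)
    (h₂ : ∀ k ∈ K, ∀ k' ∈ K, ∀ a ∈ A, ∀ b ∈ K, y * τ * (k * τ⁻¹ * k') = a * y * b →
      τ * (k * τ⁻¹ * k') ∈ K) :
    conv μ (conv μ (heckeOp μ A y) (eK μ K)) (heckeOp μ K τ) =
      {x | ∃ a ∈ A, ∃ b ∈ K, x = a * (y * τ) * b}.indicator fun _ =>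
        ((μ.real {z | z ∈ K ∧ ∃ a ∈ A, ∃ b ∈ A, y * z = a * y * b} : ℂ) /
          (μ.real (A : Set G) * μ.real (K : Set G))) := by
  set α : ℝ := μ.real {z | z ∈ K ∧ ∃ a ∈ A, ∃ b ∈ A, y * z = a * y * b} with hα
  have hKr : (μ.real (K : Set G) : ℂ) ≠ 0 := by
    rw [Ne, Complex.ofReal_eq_zero, Measure.real, ENNReal.toReal_eq_zero_iff]
    tauto
  have hmul : ∀ (S : Set G) (g : G), MeasurableSet S → MeasurableSet {z | g * z ∈ S} :=
    fun S g hS => (measurable_const_mul g) hS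
  -- At `x` this convolution is, up to normalization, the volume of `{z ∈ K : xz ∈ AyA}`. The set is
  -- empty unless `x ∈ AyK`, and left invariance makes its volume constant on `AyK`.
  have e1 : conv μ (heckeOp μ A y) (eK μ K) =
      {x | ∃ a ∈ A, ∃ b ∈ K, x = a * y * b}.indicator fun _ =>
        ((α : ℂ) / (μ.real (A : Set G) * μ.real (K : Set G))) := by
    funext x
    have hconv : conv μ (heckeOp μ A y) (eK μ K) x =
        (μ.real {z | z ∈ K ∧ ∃ a ∈ A, ∃ b ∈ A, x * z = a * y * b} : ℂ) /
          (μ.real (A : Set G) * μ.real (K : Set G)) := by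
      rw [conv]
      have : (fun z => heckeOp μ A y (x * z) * eK μ K z⁻¹) =
          {z | z ∈ K ∧ ∃ a ∈ A, ∃ b ∈ A, x * z = a * y * b}.indicator fun _ =>
            (((μ.real (A : Set G))⁻¹ : ℂ) * ((μ.real (K : Set G))⁻¹ : ℂ)) := by
        funext z
        by_cases hz : z ∈ K
        · by_cases hz' : ∃ a ∈ A, ∃ b ∈ A, x * z = a * y * b
          · rw [heckeOp, eK, Set.indicator_of_mem, Set.indicator_of_mem, Set.indicator_of_mem]
            · exact ⟨hz, hz'⟩
            · exact K.inv_mem hz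
            · exact hz'
          · rw [heckeOp, Set.indicator_of_notMem, Set.indicator_of_notMem, zero_mul]
            · exact fun h => hz' h.2
            · exact hz'
        · rw [eK, Set.indicator_of_notMem (s := (K : Set G)), Set.indicator_of_notMem, mul_zero]
          · exact fun h => hz h.1
          · exact fun h => hz (by simpa using h)
      rw [this, integral_indicator, setIntegral_const, Complex.real_smul]
      · rw [div_eq_mul_inv, mul_inv]
      · exact hK.inter (hmul _ _ hAyA)
    rw [hconv]
    by_cases hx : ∃ a ∈ A, ∃ b ∈ K, x = a * y * b
    · rw [Set.indicator_of_mem (by exact hx)]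
      obtain ⟨a, ha, b, hb, rfl⟩ := hx
      congr 2
      rw [hα, Measure.real, Measure.real,
        ← measure_leftCoset {z | z ∈ K ∧ ∃ a ∈ A, ∃ b ∈ A, y * z = a * y * b} b⁻¹]
      congr 2
      ext z
      simp only [Set.mem_ofPred_eq, inv_inv]
      constructor
      · rintro ⟨hz, c, hc, d, hd, h⟩
        refine ⟨K.mul_mem hb hz, a⁻¹ * c, A.mul_mem (A.inv_mem ha) hc, d, hd, ?_⟩
        rw [mul_assoc a⁻¹ c y, mul_assoc a⁻¹, ← h]; group
      · rintro ⟨hz, c, hc, d, hd, h⟩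
        refine ⟨by simpa using K.mul_mem (K.inv_mem hb) hz, a * c, A.mul_mem ha hc, d, hd, ?_⟩
        rw [mul_assoc a c y, mul_assoc a (c * y) d, ← h]; group
    · rw [Set.indicator_of_notMem (by exact hx)]
      have : {z | z ∈ K ∧ ∃ a ∈ A, ∃ b ∈ A, x * z = a * y * b} = ∅ := by
        ext z
        simp only [Set.mem_ofPred_eq, Set.mem_empty_iff_false, iff_false]
        rintro ⟨hz, c, hc, d, hd, h⟩
        refine hx ⟨c, hc, d * z⁻¹, K.mul_mem (hAK hd) (K.inv_mem hz), ?_⟩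
        rw [← mul_assoc, ← h]; group
      simp [this]
  rw [e1]
  funext x
  set β : ℂ := (α : ℂ) / (μ.real (A : Set G) * μ.real (K : Set G))
  have hconv : conv μ ({x | ∃ a ∈ A, ∃ b ∈ K, x = a * y * b}.indicator fun _ => β)
      (heckeOp μ K τ) x =
      (μ.real {z | (∃ a ∈ K, ∃ b ∈ K, z⁻¹ = a * τ * b) ∧ ∃ a ∈ A, ∃ b ∈ K, x * z = a * y * b} : ℂ)
        * (β * (μ.real (K : Set G) : ℂ)⁻¹) := by
    rw [conv]
    have : (fun z => ({x | ∃ a ∈ A, ∃ b ∈ K, x = a * y * b}.indicator fun _ => β) (x * z) *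
        heckeOp μ K τ z⁻¹) =
        {z | (∃ a ∈ K, ∃ b ∈ K, z⁻¹ = a * τ * b) ∧ ∃ a ∈ A, ∃ b ∈ K, x * z = a * y * b}.indicator
          fun _ => β * (μ.real (K : Set G) : ℂ)⁻¹ := by
      funext z
      by_cases hz : ∃ a ∈ K, ∃ b ∈ K, z⁻¹ = a * τ * b
      · by_cases hz' : ∃ a ∈ A, ∃ b ∈ K, x * z = a * y * b
        · rw [heckeOp, Set.indicator_of_mem, Set.indicator_of_mem, Set.indicator_of_mem]
          · exact ⟨hz, hz'⟩
          · exact hz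
          · exact hz'
        · rw [Set.indicator_of_notMem, Set.indicator_of_notMem, zero_mul]
          · exact fun h => hz' h.2
          · exact hz'
      · rw [heckeOp, Set.indicator_of_notMem (a := z⁻¹) (by exact hz), mul_zero,
          Set.indicator_of_notMem]
        exact fun h => hz (And.left h)
    rw [this, integral_indicator, setIntegral_const, Complex.real_smul]
    exact (measurable_inv hKτK).inter (hmul _ _ hAyK)
  rw [hconv]
  by_cases hx : ∃ a ∈ A, ∃ b ∈ K, x = a * (y * τ) * b
  · rw [Set.indicator_of_mem (by exact hx)]
    obtain ⟨a, ha, b, hb, rfl⟩ := hx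
    -- By `h₂` the domain of integration is the single coset `b⁻¹ τ⁻¹ K`, whose volume cancels the
    -- normalization of `[KτK]`.
    have : {z | (∃ a ∈ K, ∃ b ∈ K, z⁻¹ = a * τ * b) ∧
        ∃ a' ∈ A, ∃ b' ∈ K, a * (y * τ) * b * z = a' * y * b'} = {z | (b⁻¹ * τ⁻¹)⁻¹ * z ∈ K} := by
      ext z
      simp only [Set.mem_ofPred_eq]
      constructor
      · rintro ⟨⟨k, hk, k', hk', hz⟩, c, hc, d, hd, h⟩
        have hz' : z = k'⁻¹ * τ⁻¹ * k⁻¹ := by rw [← inv_inv z, hz]; group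
        have := h₂ (b * k'⁻¹) (K.mul_mem hb (K.inv_mem hk')) k⁻¹ (K.inv_mem hk) (a⁻¹ * c)
          (A.mul_mem (A.inv_mem ha) hc) d hd (by
            rw [mul_assoc a⁻¹ c y, mul_assoc a⁻¹, ← h, hz']; group)
        rw [hz']
        convert this using 1
        group
      · intro h
        refine ⟨⟨((b⁻¹ * τ⁻¹)⁻¹ * z)⁻¹, K.inv_mem h, b, hb, by group⟩, a, ha,
          (b⁻¹ * τ⁻¹)⁻¹ * z, h, by group⟩
    have hm : μ.real {z | (b⁻¹ * τ⁻¹)⁻¹ * z ∈ K} = μ.real (K : Set G) :=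
      congrArg ENNReal.toReal (measure_leftCoset (K : Set G) (b⁻¹ * τ⁻¹))
    rw [this, hm]
    field_simp
  · rw [Set.indicator_of_notMem (by exact hx)]
    have : {z | (∃ a ∈ K, ∃ b ∈ K, z⁻¹ = a * τ * b) ∧
        ∃ a ∈ A, ∃ b ∈ K, x * z = a * y * b} = ∅ := by
      ext z
      simp only [Set.mem_ofPred_eq, Set.mem_empty_iff_false, iff_false]
      rintro ⟨⟨k, hk, k', hk', hz⟩, c, hc, d, hd, h⟩
      -- Here `x` lies in `A y K τ K`, which `h₁` folds into `A yτ K`.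
      obtain ⟨a, ha, b, hb, h'⟩ := h₁ (d * k) (K.mul_mem hd hk)
      refine hx ⟨c * a, A.mul_mem hc ha, b * k', K.mul_mem hb hk', ?_⟩
      have : x = c * (y * (d * k) * τ) * k' := by
        rw [eq_mul_inv_of_mul_eq h, hz]; group
      rw [this, h']; group
    simp [this]

end Meas

/-! ### Algebra of Iwahori decompositions -/

section Abstract

variable {G : Type*} [Group G]

/-- `y` contracts the integral unipotent group `N₀`, and so does `w y⁻¹ w⁻¹`. -/
def TDom (N0 : Subgroup G) (w y : G) : Prop :=
  ∀ u ∈ N0, y * u * y⁻¹ ∈ N0 ∧ (w * y * w⁻¹)⁻¹ * u * (w * y * w⁻¹) ∈ N0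

theorem TDom.mul {N0 : Subgroup G} {w y z : G} (hy : TDom N0 w y) (hz : TDom N0 w z) :
    TDom N0 w (y * z) := by
  intro u hu
  constructor
  · have := (hy _ (hz u hu).1).1
    convert this using 1
    group
  · have := (hz _ (hy u hu).2).2
    convert this using 1
    group

theorem TDom.one (N0 : Subgroup G) (w : G) : TDom N0 w 1 := by
  intro u hu
  simpa using hu

/-- A group with opposite unipotent subgroups `N`, `L` normalized by a torus `T`, a Weyl element
`w`, a central subgroup `Z ⊆ T`, a dominant `τ ∈ T`, and compact subgroups `Kc ⊆ K` with Iwahori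
decompositions, whose intersection with `N` is `N0`. -/
structure Tri (N T L Z N0 K Kc : Subgroup G) (w τ : G) : Prop where
  conjN : ∀ d ∈ T, ∀ u ∈ N, d * u * d⁻¹ ∈ N
  conjL : ∀ d ∈ T, ∀ l ∈ L, d * l * d⁻¹ ∈ L
  commT : ∀ d ∈ T, ∀ e ∈ T, d * e = e * d
  uniq : ∀ l ∈ L, ∀ d ∈ T, ∀ u ∈ N, l * d * u = 1 → l = 1 ∧ d = 1 ∧ u = 1
  ww : w⁻¹ = w
  wN : ∀ u ∈ N, w * u * w⁻¹ ∈ L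
  wL : ∀ l ∈ L, w * l * w⁻¹ ∈ N
  wT : ∀ d ∈ T, w * d * w⁻¹ ∈ T
  memτ : τ ∈ T
  wτ : (w * τ) * (w * τ) ∈ Z
  ZT : Z ≤ T
  Zc : ∀ z ∈ Z, ∀ g, z * g = g * z
  N0N : N0 ≤ N
  dec : ∀ g ∈ K, ∃ x ∈ N0, ∃ d ∈ T, ∃ l ∈ L, d ∈ K ∧ l ∈ K ∧ g = x * d * l
  KN : ∀ x ∈ N, x ∈ K ↔ x ∈ N0
  wKT : ∀ d ∈ T, d ∈ K → w * d * w⁻¹ ∈ K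
  wKL : ∀ l ∈ L, l ∈ K → w * l * w⁻¹ ∈ N0
  KcK : Kc ≤ K
  N0Kc : N0 ≤ Kc
  KcT : ∀ d ∈ T, ∀ l ∈ L, d * l ∈ Kc → d ∈ Kc
  N0τ : ∀ u ∈ N0, (w * τ) * u * (w * τ)⁻¹ ∈ Kc
  -- In the application `Kc` is `K^{⟨c⟩}`, which lies both in `K` and in `Q = (wτ)⁻¹ K (wτ)`.
  KcQ : ∀ k ∈ Kc, (w * τ) * k * (w * τ)⁻¹ ∈ K
  domτ : TDom N0 w τ

namespace Tri

variable {N T L Z N0 K Kc : Subgroup G} {w τ : G}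

/-- The inverse of `l d u` has a decomposition in `N T L` with all factors in `K`. Multiplying the
two gives a trivial product in `L T N`, and uniqueness identifies the factors one by one. -/
theorem of_ldu (D : Tri N T L Z N0 K Kc w τ) {l d u : G} (hl : l ∈ L) (hd : d ∈ T) (hu : u ∈ N) (h : l * d * u ∈ K) :
    l ∈ K ∧ d ∈ K ∧ u ∈ N0 := by
  obtain ⟨x, hx, d', hd', l', hl', hd'K, hl'K, e⟩ := D.dec _ (K.inv_mem h)
  have h1 : l' * l * (d * d') * (d'⁻¹ * (u * x) * d'⁻¹⁻¹) = 1 := by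
    have : x = u⁻¹ * d⁻¹ * l⁻¹ * l'⁻¹ * d'⁻¹ := by
      have e' : x = (l * d * u)⁻¹ * l'⁻¹ * d'⁻¹ := by rw [e]; group
      rw [e']; group
    rw [this]; group
  obtain ⟨a, b, c⟩ := D.uniq _ (L.mul_mem hl' hl) _ (T.mul_mem hd hd') _
    (D.conjN _ (T.inv_mem hd') _ (N.mul_mem hu (D.N0N hx))) h1
  refine ⟨?_, ?_, ?_⟩
  · rw [eq_inv_of_mul_eq_one_right a]; exact K.inv_mem hl'K
  · rw [eq_inv_of_mul_eq_one_left b]; exact K.inv_mem hd'K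
  · have : u * x = 1 := by
      have := congrArg (fun z => d' * z * d'⁻¹) c
      simpa [mul_assoc] using this
    rw [eq_inv_of_mul_eq_one_left this]; exact N0.inv_mem hx

theorem of_udl (D : Tri N T L Z N0 K Kc w τ) {l d u : G} (hl : l ∈ L) (hd : d ∈ T) (hu : u ∈ N) (h : u * d * l ∈ K) :
    l ∈ K ∧ d ∈ K ∧ u ∈ N0 := by
  have := D.of_ldu (L.inv_mem hl) (T.inv_mem hd) (N.inv_mem hu)
    (by have := K.inv_mem h; simpa [mul_assoc] using this)
  simpa using this

theorem N0K (D : Tri N T L Z N0 K Kc w τ) : N0 ≤ K := D.N0Kc.trans D.KcK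

theorem dec' (D : Tri N T L Z N0 K Kc w τ) {g : G} (hg : g ∈ K) :
    ∃ l ∈ L, ∃ d ∈ T, ∃ x ∈ N0, l ∈ K ∧ d ∈ K ∧ g = l * d * x := by
  obtain ⟨x, hx, d, hd, l, hl, hdK, hlK, e⟩ := D.dec _ (K.inv_mem hg)
  refine ⟨l⁻¹, L.inv_mem hl, d⁻¹, T.inv_mem hd, x⁻¹, N0.inv_mem hx, K.inv_mem hlK, K.inv_mem hdK, ?_⟩
  rw [← inv_inv g, e]; group

/-- Since `(wτ)²` is central, conjugation by `wτ` is an involution. -/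
theorem wc_conj (D : Tri N T L Z N0 K Kc w τ) (g : G) : (w * τ)⁻¹ * g * (w * τ) = (w * τ) * g * (w * τ)⁻¹ := by
  have := D.Zc _ D.wτ ((w * τ)⁻¹ * g)
  have h : (w * τ) * g = ((w * τ)⁻¹ * g) * ((w * τ) * (w * τ)) := by rw [← this]; group
  rw [h]; group

theorem Kc_le_Q (D : Tri N T L Z N0 K Kc w τ) : Kc ≤ conjSub K (w * τ) := fun k hk => mem_conjSub.2 (D.KcQ k hk)

theorem wc_T (D : Tri N T L Z N0 K Kc w τ) {d : G} (hd : d ∈ T) : (w * τ) * d * (w * τ)⁻¹ = w * d * w⁻¹ := by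
  have := D.commT _ D.memτ _ hd
  calc (w * τ) * d * (w * τ)⁻¹ = w * (τ * d) * τ⁻¹ * w⁻¹ := by group
    _ = _ := by rw [this]; group

theorem T_mem_Q (D : Tri N T L Z N0 K Kc w τ) {d : G} (hd : d ∈ T) (hdK : d ∈ K) : d ∈ conjSub K (w * τ) := by
  rw [mem_conjSub, D.wc_T hd]; exact D.wKT d hd hdK

theorem wc_N (D : Tri N T L Z N0 K Kc w τ) {u : G} (hu : u ∈ N) : (w * τ) * u * (w * τ)⁻¹ ∈ L := by
  have := D.wN _ (D.conjN _ D.memτ _ hu)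
  convert this using 1
  group

theorem wc_L (D : Tri N T L Z N0 K Kc w τ) {u : G} (hu : u ∈ L) : (w * τ) * u * (w * τ)⁻¹ ∈ N := by
  have := D.wL _ (D.conjL _ D.memτ _ hu)
  convert this using 1
  group

/-- Conjugation by `wτ` exchanges `N` and `L`, so this is `of_udl` read in `Q = (wτ)⁻¹ K (wτ)`. -/
theorem Q_of_ldu (D : Tri N T L Z N0 K Kc w τ) {l d u : G} (hl : l ∈ L) (hd : d ∈ T) (hu : u ∈ N)
    (h : l * d * u ∈ conjSub K (w * τ)) : u ∈ conjSub K (w * τ) := by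
  rw [mem_conjSub] at h ⊢
  refine (D.of_udl (D.wc_N hu) (d := (w * τ) * d * (w * τ)⁻¹) ?_ (D.wc_L hl) ?_).1
  · rw [D.wc_T hd]; exact D.wT d hd
  · convert h using 1; group

theorem Q_of_udl (D : Tri N T L Z N0 K Kc w τ) {l d u : G} (hl : l ∈ L) (hd : d ∈ T) (hu : u ∈ N)
    (h : u * d * l ∈ conjSub K (w * τ)) : u ∈ conjSub K (w * τ) := by
  have := D.Q_of_ldu (L.inv_mem hl) (T.inv_mem hd) (N.inv_mem hu)
    (by have := Subgroup.inv_mem _ h; simpa [mul_assoc] using this)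
  simpa using this

variable {y y1 y2 : G}

theorem dom_of (D : Tri N T L Z N0 K Kc w τ) (hy : TDom N0 w (y * τ⁻¹)) : TDom N0 w y := by
  simpa using hy.mul D.domτ

/-- Write `y = (yτ⁻¹)τ`. The dominant factor `yτ⁻¹` contracts `L ∩ K`, and the remaining `τ` is
absorbed in the conjugation by `wτ`. This is why dominance is required after division by `τ`. -/
theorem contract_L (D : Tri N T L Z N0 K Kc w τ) (hy : TDom N0 w (y * τ⁻¹)) {l : G} (hl : l ∈ L) (hlK : l ∈ K) :
    ∃ v ∈ N0, y⁻¹ * l * y = (w * τ) * v * (w * τ)⁻¹ := by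
  refine ⟨_, (hy _ (D.wKL l hl hlK)).2, ?_⟩
  rw [← D.wc_conj]
  group

theorem contract_L_mem (D : Tri N T L Z N0 K Kc w τ) (hy : TDom N0 w (y * τ⁻¹)) {l : G} (hl : l ∈ L) (hlK : l ∈ K) :
    y⁻¹ * l * y ∈ Kc := by
  obtain ⟨v, hv, e⟩ := D.contract_L hy hl hlK
  rw [e]; exact D.N0τ v hv

/-- The group `N ∩ Q` lies in `τ⁻¹ N₀ τ`, so that dominance of `yτ⁻¹` is just enough to bring it
into `N₀`. -/
theorem contract_N (D : Tri N T L Z N0 K Kc w τ) (hy : TDom N0 w (y * τ⁻¹)) {u : G} (hu : u ∈ N)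
    (huQ : u ∈ conjSub K (w * τ)) : y * u * y⁻¹ ∈ N0 := by
  rw [mem_conjSub] at huQ
  have h1 := D.wKL _ (D.wc_N hu) huQ
  have h2 : τ * u * τ⁻¹ ∈ N0 := by
    have hw : w * w = 1 := by nth_rewrite 1 [← D.ww]; group
    have hw' : w⁻¹ * w⁻¹ = 1 := by rw [D.ww, hw]
    have : w * (w * τ * u * (w * τ)⁻¹) * w⁻¹ = (w * w) * (τ * u * τ⁻¹) * (w⁻¹ * w⁻¹) := by group
    rw [this, hw, hw'] at h1
    simpa using h1
  have := (hy _ h2).1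
  convert this using 1
  group

/-- One of `y₁`, `y₂` contracts on the `L` side, `w` passes to the `N` side, and the other one
contracts there. The two orders give the two inclusions. -/
theorem X_conj (D : Tri N T L Z N0 K Kc w τ) (h1 : TDom N0 w y1) (h2 : TDom N0 w y2) {l : G} (hl : l ∈ L) (hlK : l ∈ K) :
    (y1 * w * y2⁻¹)⁻¹ * l * (y1 * w * y2⁻¹) ∈ N0 ∧ (y1 * w * y2⁻¹) * l * (y1 * w * y2⁻¹)⁻¹ ∈ N0 := by
  have hu := D.wKL l hl hlK
  constructor
  · have := (h2 _ (h1 _ hu).2).1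
    convert this using 1
    have e : ∀ z : G, w⁻¹ * z * w = w * z * w⁻¹ := fun z => by rw [D.ww]
    calc _ = y2 * (w⁻¹ * (y1⁻¹ * l * y1) * w) * y2⁻¹ := by group
      _ = _ := by rw [e]; group
  · have := (h1 _ (h2 _ hu).2).1
    convert this using 1
    group

theorem X_T (D : Tri N T L Z N0 K Kc w τ) (hy1 : y1 ∈ T) (hy2 : y2 ∈ T) {d : G} (hd : d ∈ T) :
    (y1 * w * y2⁻¹) * d = (w * d * w⁻¹) * (y1 * w * y2⁻¹) := by
  have e1 := D.commT _ (T.inv_mem hy2) _ hd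
  have e2 := D.commT _ hy1 _ (D.wT d hd)
  calc _ = y1 * w * (y2⁻¹ * d) := by group
    _ = (y1 * (w * d * w⁻¹)) * w * y2⁻¹ := by rw [e1]; group
    _ = _ := by rw [e2]; group

/-- `K X K = N₀ (K ∩ T) X N₀`, for `X = y₁ w y₂⁻¹`. -/
theorem KXK (D : Tri N T L Z N0 K Kc w τ) (hy1 : y1 ∈ T) (hy2 : y2 ∈ T) (h1 : TDom N0 w y1) (h2 : TDom N0 w y2) {k k' : G}
    (hk : k ∈ K) (hk' : k' ∈ K) :
    ∃ n ∈ N0, ∃ d ∈ T, d ∈ K ∧ ∃ n' ∈ N0,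
      k * (y1 * w * y2⁻¹) * k' = n * d * (y1 * w * y2⁻¹) * n' := by
  obtain ⟨x, hx, d, hd, l, hl, hdK, hlK, rfl⟩ := D.dec k hk
  set X := y1 * w * y2⁻¹ with hX
  have a1 := (D.X_conj h1 h2 hl hlK).1
  obtain ⟨l', hl', d', hd', x', hx', hlK', hdK', e⟩ := D.dec' (K.mul_mem (D.N0K a1) hk')
  have a2 := (D.X_conj h1 h2 hl' hlK').2
  rw [← hX] at a1 a2 e
  have a3 : d * (X * l' * X⁻¹) * d⁻¹ ∈ N0 :=
    (D.KN _ (D.conjN _ hd _ (D.N0N a2))).1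
      (K.mul_mem (K.mul_mem hdK (D.N0K a2)) (K.inv_mem hdK))
  refine ⟨x * (d * (X * l' * X⁻¹) * d⁻¹), N0.mul_mem hx a3, d * (w * d' * w⁻¹),
    T.mul_mem hd (D.wT _ hd'), K.mul_mem hdK (D.wKT _ hd' hdK'), x', hx', ?_⟩
  have e2 := D.X_T hy1 hy2 hd'
  rw [← hX] at e2
  calc x * d * l * X * k' = x * d * X * (X⁻¹ * l * X * k') := by group
    _ = x * d * X * l' * d' * x' := by rw [e]; group
    _ = x * (d * (X * l' * X⁻¹) * d⁻¹) * d * (X * d') * x' := by group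
    _ = _ := by rw [e2]; group

/-- Only the `N` part of `k` matters: its torus part commutes past `y₁` and `w` into `Q`, and its
`L` part is contracted by `y₁` and lands in `Q`. -/
theorem A0_form (D : Tri N T L Z N0 K Kc w τ) (hy1 : y1 ∈ T) (h1 : TDom N0 w (y1 * τ⁻¹)) {k q : G} (hk : k ∈ Kc)
    (hq : q ∈ conjSub K (w * τ)) :
    ∃ x ∈ N0, ∃ q' ∈ conjSub K (w * τ), k * y1 * w * q = x * y1 * w * q' := by
  obtain ⟨x, hx, d, hd, l, hl, hdK, hlK, rfl⟩ := D.dec k (D.KcK hk)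
  obtain ⟨v, hv, e⟩ := D.contract_L h1 hl hlK
  refine ⟨x, hx, (w * d * w⁻¹) * (τ * v * τ⁻¹) * q, Subgroup.mul_mem _ (Subgroup.mul_mem _
    (D.T_mem_Q (D.wT d hd) (D.wKT d hd hdK)) (D.Kc_le_Q (D.N0Kc (D.domτ v hv).1))) hq, ?_⟩
  have ec := D.commT _ hd _ hy1
  calc x * d * l * y1 * w * q = x * (d * y1) * (y1⁻¹ * l * y1) * w * q := by group
    _ = x * y1 * d * w * (τ * v * τ⁻¹) * q := by rw [e, ec]; group
    _ = x * y1 * w * (w⁻¹ * d * w) * (τ * v * τ⁻¹) * q := by group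
    _ = _ := by
      have : w⁻¹ * d * w = w * d * w⁻¹ := by rw [D.ww]
      rw [this]; group

theorem B0_form (D : Tri N T L Z N0 K Kc w τ) (hy2 : y2 ∈ T) (h2 : TDom N0 w (y2 * τ⁻¹)) {k q : G} (hk : k ∈ Kc)
    (hq : q ∈ conjSub K (w * τ)) :
    ∃ x ∈ N0, ∃ q' ∈ conjSub K (w * τ), k * y2 * q = x * y2 * q' := by
  obtain ⟨x, hx, d, hd, l, hl, hdK, hlK, rfl⟩ := D.dec k (D.KcK hk)
  refine ⟨x, hx, d * (y2⁻¹ * l * y2) * q, Subgroup.mul_mem _ (Subgroup.mul_mem _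
    (D.T_mem_Q hd hdK) (D.Kc_le_Q (D.contract_L_mem h2 hl hlK))) hq, ?_⟩
  have ec := D.commT _ hd _ hy2
  calc x * d * l * y2 * q = x * (d * y2) * (y2⁻¹ * l * y2) * q := by group
    _ = _ := by rw [ec]; group

/-- The element `q q'⁻¹` of `Q` becomes `x d l` in `K` after conjugation by `wτ`. Its three factors
leave the middle: `x` crosses `w` to the left and is contracted by `y₁`, `d` commutes out, and `l`
becomes an element of `N ∩ Q`, contracted by `y₂` on the right. -/
theorem quot_mem (D : Tri N T L Z N0 K Kc w τ) (hy1 : y1 ∈ T) (h1 : TDom N0 w (y1 * τ⁻¹))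
    (h2 : TDom N0 w (y2 * τ⁻¹)) {k q k' q' : G} (hk : k ∈ Kc) (hk' : k' ∈ Kc)
    (hq : q ∈ conjSub K (w * τ)) (hq' : q' ∈ conjSub K (w * τ)) :
    ∃ a ∈ K, ∃ b ∈ K, (k * y1 * w * q) * (k' * y2 * q')⁻¹ = a * (y1 * w * y2⁻¹) * b := by
  have hq3 := Subgroup.mul_mem _ hq (Subgroup.inv_mem _ hq')
  obtain ⟨x, hx, d, hd, l, hl, hdK, hlK, e⟩ := D.dec _ (mem_conjSub.1 hq3)
  have hu : (w * τ)⁻¹ * l * (w * τ) ∈ N := by rw [D.wc_conj]; exact D.wc_L hl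
  have huQ : (w * τ)⁻¹ * l * (w * τ) ∈ conjSub K (w * τ) := by
    rw [mem_conjSub]; convert hlK using 1; group
  have hn := D.contract_N h2 hu huQ
  have hx' := ((D.dom_of h1).mul D.domτ x hx).1
  refine ⟨k * (y1 * τ * x * (y1 * τ)⁻¹) * d, K.mul_mem (K.mul_mem (D.KcK hk) (D.N0K hx')) hdK,
    (y2 * ((w * τ)⁻¹ * l * (w * τ)) * y2⁻¹) * k'⁻¹, K.mul_mem (D.N0K hn)
    (K.inv_mem (D.KcK hk')), ?_⟩
  have e3 : q * q'⁻¹ = (w * τ)⁻¹ * (x * d * l) * (w * τ) := by rw [← e]; group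
  have ed : (w * τ)⁻¹ * d * (w * τ) = w⁻¹ * d * w := by
    rw [D.wc_conj, D.wc_T hd, D.ww]
  have ex : w * ((w * τ)⁻¹ * x * (w * τ)) = (τ * x * τ⁻¹) * w := by
    rw [D.wc_conj]
    have : w * w = 1 := by nth_rewrite 1 [← D.ww]; group
    calc _ = w * w * (τ * x * τ⁻¹) * w⁻¹ := by group
      _ = _ := by rw [this, D.ww]; group
  have ec := D.commT _ hd _ hy1
  calc _ = k * y1 * w * (q * q'⁻¹) * y2⁻¹ * k'⁻¹ := by group
    _ = k * y1 * (w * ((w * τ)⁻¹ * x * (w * τ))) * ((w * τ)⁻¹ * d * (w * τ)) *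
        ((w * τ)⁻¹ * l * (w * τ)) * y2⁻¹ * k'⁻¹ := by rw [e3]; group
    _ = k * (y1 * τ * x * (y1 * τ)⁻¹) * (y1 * d) * w *
        ((w * τ)⁻¹ * l * (w * τ)) * y2⁻¹ * k'⁻¹ := by rw [ex, ed]; group
    _ = _ := by rw [← ec]; group

/-- For `ω ∈ K X K`, the `x ∈ Kc y₂ Q` with `ω x ∈ Kc y₁ w Q` form a left coset of `Q`. -/
theorem fibre (D : Tri N T L Z N0 K Kc w τ) (hy1 : y1 ∈ T) (hy2 : y2 ∈ T) (h1 : TDom N0 w (y1 * τ⁻¹))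
    (h2 : TDom N0 w (y2 * τ⁻¹)) {a b : G} (ha : a ∈ K) (hb : b ∈ K) :
    ∃ x0 : G, ∀ x : G, ((∃ k ∈ Kc, ∃ q ∈ conjSub K (w * τ), x = k * y2 * q) ∧
      ∃ k ∈ Kc, ∃ q ∈ conjSub K (w * τ), a * (y1 * w * y2⁻¹) * b * x = k * y1 * w * q) ↔
      x0⁻¹ * x ∈ conjSub K (w * τ) := by
  obtain ⟨n, hn, d, hd, hdK, n', hn', e⟩ := D.KXK hy1 hy2 (D.dom_of h1) (D.dom_of h2) ha hb
  rw [e]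
  have hdQ := D.T_mem_Q (D.wT d hd) (D.wKT d hd hdK)
  -- With `ω = n d X n'`, the base point cancels `n'` and then `y₂⁻¹`, and `ω` sends it to `n d y₁
  -- w`.
  refine ⟨n'⁻¹ * y2, fun x => ⟨?_, fun hx => ⟨?_, ?_⟩⟩⟩
  · rintro ⟨⟨k1, hk1, q1, hq1, rfl⟩, k2, hk2, q2, hq2, h⟩
    obtain ⟨x1, hx1, q1', hq1', e1⟩ := D.B0_form hy2 h2 hk1 hq1
    obtain ⟨x2, hx2, q2', hq2', e2⟩ := D.A0_form hy1 h1 hk2 hq2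
    rw [e1] at h ⊢
    rw [e2] at h
    have hu : y2⁻¹ * (n' * x1) * y2 ∈ N := by
      simpa using D.conjN _ (T.inv_mem hy2) _ (N.mul_mem (D.N0N hn') (D.N0N hx1))
    have hl : w * (y1⁻¹ * (d⁻¹ * (n⁻¹ * x2) * d) * y1) * w⁻¹ ∈ L := by
      refine D.wN _ ?_
      have := D.conjN _ (T.inv_mem hy1) _ (D.conjN _ (T.inv_mem hd) _
        (N.mul_mem (N.inv_mem (D.N0N hn)) (D.N0N hx2)))
      simpa using this
    -- The two expressions for `ωx` show an element of `N` to be an element of `L` times an element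
    -- of `Q`. Then `Q_of_ldu` puts it in `Q`.
    have key : y2⁻¹ * (n' * x1) * y2 =
        (w * (y1⁻¹ * (d⁻¹ * (n⁻¹ * x2) * d) * y1) * w⁻¹) * ((w * d * w⁻¹)⁻¹ * q2' * q1'⁻¹) := by
      have h3 : y2⁻¹ * (n' * x1) * y2 = w⁻¹ * y1⁻¹ * d⁻¹ * n⁻¹ *
          (n * d * (y1 * w * y2⁻¹) * n' * (x1 * y2 * q1')) * q1'⁻¹ := by group
      rw [h3, h]
      have ec := D.commT _ hd _ hy1
      calc _ = w⁻¹ * (y1⁻¹ * (d⁻¹ * (n⁻¹ * x2) * d) * (d⁻¹ * y1)) * w * q2' * q1'⁻¹ := by group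
        _ = w⁻¹ * (y1⁻¹ * (d⁻¹ * (n⁻¹ * x2) * d) * (y1 * d⁻¹)) * w * q2' * q1'⁻¹ := by
            rw [D.commT _ (T.inv_mem hd) _ hy1]
        _ = w⁻¹ * (y1⁻¹ * (d⁻¹ * (n⁻¹ * x2) * d) * y1) * w * (w⁻¹ * d * w)⁻¹ * q2' * q1'⁻¹ := by
            group
        _ = _ := by
          have e : ∀ z : G, w⁻¹ * z * w = w * z * w⁻¹ := fun z => by rw [D.ww]
          rw [e, e]; group
    have hQ : y2⁻¹ * (n' * x1) * y2 ∈ conjSub K (w * τ) := by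
      refine D.Q_of_ldu (L.inv_mem hl) T.one_mem hu ?_
      rw [mul_one, key, inv_mul_cancel_left]
      exact Subgroup.mul_mem _ (Subgroup.mul_mem _ (Subgroup.inv_mem _ hdQ) hq2')
        (Subgroup.inv_mem _ hq1')
    have := Subgroup.mul_mem _ hQ hq1'
    convert this using 1
    group
  · exact ⟨n'⁻¹, D.N0Kc (N0.inv_mem hn'), _, hx, by group⟩
  · refine ⟨n, D.N0Kc hn, (w * d * w⁻¹) * ((n'⁻¹ * y2)⁻¹ * x), Subgroup.mul_mem _ hdQ hx, ?_⟩
    have ec := D.commT _ hd _ hy1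
    calc _ = n * (d * y1) * w * ((n'⁻¹ * y2)⁻¹ * x) := by group
      _ = n * y1 * w * (w⁻¹ * d * w) * ((n'⁻¹ * y2)⁻¹ * x) := by rw [ec]; group
      _ = _ := by
        have e : ∀ z : G, w⁻¹ * z * w = w * z * w⁻¹ := fun z => by rw [D.ww]
        rw [e]; group

/-- The `N` part of `k` goes left through `y`, its `L` part goes right through `τ`, and both are
contracted. This is hypothesis `h₁` of `conv_hecke`. -/
theorem push_left (D : Tri N T L Z N0 K Kc w τ) (h1 : TDom N0 w (y * τ⁻¹)) {k : G} (hk : k ∈ K) :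
    ∃ a ∈ Kc, ∃ b ∈ K, y * k * τ = a * (y * τ) * b := by
  obtain ⟨x, hx, d, hd, l, hl, hdK, hlK, rfl⟩ := D.dec k hk
  have hl' : τ⁻¹ * l * τ ∈ Kc :=
    D.contract_L_mem (by rw [mul_inv_cancel]; exact TDom.one _ _) hl hlK
  refine ⟨y * x * y⁻¹, D.N0Kc ((D.dom_of h1) x hx).1, d * (τ⁻¹ * l * τ),
    K.mul_mem hdK (D.KcK hl'), ?_⟩
  have ec := D.commT _ hd _ D.memτ
  calc _ = y * x * (d * τ) * (τ⁻¹ * l * τ) := by group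
    _ = _ := by rw [ec]; group

/-- Of the factors of `k = l d x`, only `τ l τ⁻¹` could leave `K`. The equation shows the inverse of
`τ l τ⁻¹` to be the `L` factor of an element of `K`, so `of_ldu` applies. This is hypothesis `h₂` of
`conv_hecke`. -/
theorem single_coset (D : Tri N T L Z N0 K Kc w τ) (hy : y ∈ T) (h1 : TDom N0 w (y * τ⁻¹)) {k k' a b ζ : G} (hk : k ∈ K)
    (hk' : k' ∈ K) (ha : a ∈ Kc) (hb : b ∈ K) (hζ : ζ ∈ Z)
    (h : y * τ * (k * τ⁻¹ * k') = ζ * (a * y * b)) : τ * (k * τ⁻¹ * k') ∈ K := by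
  obtain ⟨l, hl, d, hd, x, hx, hlK, hdK, rfl⟩ := D.dec' hk
  obtain ⟨x2, hx2, d2, hd2, l2, hl2, hdK2, hlK2, rfl⟩ := D.dec a (D.KcK ha)
  have hx' := (D.domτ x hx).1
  have hl2' := D.contract_L_mem h1 hl2 hlK2
  have hm : (τ * l * τ⁻¹)⁻¹ * (ζ * d2) * (d2⁻¹ * (y⁻¹ * x2 * y) * d2) ∈ K := by
    have e1 := D.commT _ hd2 _ hy
    have e2 := D.commT _ hd _ D.memτ
    have : (τ * l * τ⁻¹)⁻¹ * (ζ * d2) * (d2⁻¹ * (y⁻¹ * x2 * y) * d2) =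
        d * (τ * x * τ⁻¹) * k' * b⁻¹ * (y⁻¹ * l2 * y)⁻¹ := by
      have h3 : τ * (l * d * x * τ⁻¹ * k') = y⁻¹ * (ζ * (x2 * d2 * l2 * y * b)) := by
        rw [← h]; group
      have h4 : d * (τ * x * τ⁻¹) * k' = (τ * l * τ⁻¹)⁻¹ * (τ * (l * d * x * τ⁻¹ * k')) := by
        calc _ = (d * τ) * x * τ⁻¹ * k' := by group
          _ = _ := by rw [e2]; group
      rw [h4, h3]
      have h5 := D.Zc ζ hζ y⁻¹
      calc (τ * l * τ⁻¹)⁻¹ * (ζ * d2) * (d2⁻¹ * (y⁻¹ * x2 * y) * d2)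
          = (τ * l * τ⁻¹)⁻¹ * (ζ * y⁻¹) * x2 * (y * d2) := by group
        _ = (τ * l * τ⁻¹)⁻¹ * (y⁻¹ * ζ) * x2 * (d2 * y) := by rw [h5, e1]
        _ = _ := by group
    rw [this]
    exact K.mul_mem (K.mul_mem (K.mul_mem (K.mul_mem hdK (D.N0K hx')) hk') (K.inv_mem hb))
      (K.inv_mem (D.KcK hl2'))
  have hu : y⁻¹ * x2 * y ∈ N := by simpa using D.conjN _ (T.inv_mem hy) _ (D.N0N hx2)
  have := (D.of_ldu (L.inv_mem (D.conjL _ D.memτ _ hl)) (T.mul_mem (D.ZT hζ) hd2)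
    (by simpa using D.conjN _ (T.inv_mem hd2) _ hu) hm).1
  have h6 := D.commT _ hd _ D.memτ
  have : τ * (l * d * x * τ⁻¹ * k') = (τ * l * τ⁻¹) * d * (τ * x * τ⁻¹) * k' := by
    calc _ = τ * l * τ⁻¹ * (τ * d) * x * τ⁻¹ * k' := by group
      _ = _ := by rw [← h6]; group
  rw [this]
  refine K.mul_mem (K.mul_mem (K.mul_mem ?_ hdK) (D.N0K hx')) hk'
  simpa using K.inv_mem ‹(τ * l * τ⁻¹)⁻¹ ∈ K›

/-- The `L` part of `a` is contracted by `y⁻¹` into `Kc`. Only the expanded unipotent part `y⁻¹ x y`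
can leave `Kc`, and it is the `u` of the conclusion. -/
theorem double_coset_form (D : Tri N T L Z N0 K Kc w τ) (hy : y ∈ T) (h1 : TDom N0 w (y * τ⁻¹)) {a b z ζ : G} (ha : a ∈ Kc)
    (hb : b ∈ Kc) (hζ : ζ ∈ Z) (h : y * z = ζ * (a * y * b)) :
    ∃ u ∈ N, ∃ d ∈ T, d ∈ Kc ∧ ∃ κ ∈ Kc, z = u * (ζ * d) * κ := by
  obtain ⟨x, hx, d, hd, l, hl, hdK, hlK, rfl⟩ := D.dec a (D.KcK ha)
  have hd' : d ∈ Kc := by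
    refine D.KcT d hd l hl ?_
    have := Kc.mul_mem (Kc.inv_mem (D.N0Kc hx)) ha
    convert this using 1
    group
  refine ⟨y⁻¹ * x * y, by simpa using D.conjN _ (T.inv_mem hy) _ (D.N0N hx), d, hd, hd',
    (y⁻¹ * l * y) * b, Kc.mul_mem (D.contract_L_mem h1 hl hlK) hb, ?_⟩
  have e1 := D.commT _ hd _ hy
  have e2 := D.Zc ζ hζ (y⁻¹ * x * y)
  calc z = y⁻¹ * (y * z) := by group
    _ = (y⁻¹ * ζ) * x * (d * y) * (y⁻¹ * l * y) * b := by rw [h]; group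
    _ = (ζ * (y⁻¹ * x * y)) * d * (y⁻¹ * l * y) * b := by
      rw [e1, ← D.Zc ζ hζ y⁻¹]; group
    _ = _ := by rw [e2]; group

theorem double_coset_K (D : Tri N T L Z N0 K Kc w τ) (hy : y ∈ T) (h1 : TDom N0 w (y * τ⁻¹)) {a b z ζ : G} (ha : a ∈ Kc)
    (hb : b ∈ Kc) (hζ : ζ ∈ Z) (h : y * z = ζ * (a * y * b)) (hz : z ∈ K) :
    ∃ κ ∈ Kc, z = ζ * κ := by
  obtain ⟨u, hu, d, hd, hd', κ, hκ, rfl⟩ := D.double_coset_form hy h1 ha hb hζ h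
  have hK : u * (ζ * d) * 1 ∈ K := by
    have := K.mul_mem hz (K.inv_mem (D.KcK hκ))
    simpa using this
  have hu0 := (D.of_udl L.one_mem (T.mul_mem (D.ZT hζ) hd) hu hK).2.2
  refine ⟨u * d * κ, Kc.mul_mem (Kc.mul_mem (D.N0Kc hu0) hd') hκ, ?_⟩
  rw [← mul_assoc u ζ d, ← D.Zc ζ hζ u]; group

/-- For `z ∈ K` the expanded unipotent falls back into `N₀`, as in `double_coset_K`. For `z ∈ Q` it
ranges over `N ∩ Q`, and this is where the index `[N ∩ Q : N₀]` enters the value of the test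
measure. -/
theorem double_coset_Q (D : Tri N T L Z N0 K Kc w τ) (hy : y ∈ T) (h1 : TDom N0 w (y * τ⁻¹)) {a b z ζ : G} (ha : a ∈ Kc)
    (hb : b ∈ Kc) (hζ : ζ ∈ Z) (h : y * z = ζ * (a * y * b)) (hz : z ∈ conjSub K (w * τ)) :
    ∃ u ∈ N ⊓ conjSub K (w * τ), ∃ κ ∈ Kc, z = ζ * (u * κ) := by
  obtain ⟨u, hu, d, hd, hd', κ, hκ, rfl⟩ := D.double_coset_form hy h1 ha hb hζ h
  have hK : u * (ζ * d) * 1 ∈ conjSub K (w * τ) := by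
    have := Subgroup.mul_mem _ hz (Subgroup.inv_mem _ (D.Kc_le_Q hκ))
    simpa using this
  have hu0 := D.Q_of_udl L.one_mem (T.mul_mem (D.ZT hζ) hd) hu hK
  refine ⟨u, ⟨hu, hu0⟩, d * κ, Kc.mul_mem hd' hκ, ?_⟩
  rw [← mul_assoc u ζ d, ← D.Zc ζ hζ u]; group

end Tri

end Abstract

theorem Tri.prod {G G' : Type*} [Group G] [Group G'] {N T L Z N0 K Kc : Subgroup G} {w τ : G}
    {N' T' L' Z' N0' K' Kc' : Subgroup G'} {w' τ' : G'} (D : Tri N T L Z N0 K Kc w τ)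
    (D' : Tri N' T' L' Z' N0' K' Kc' w' τ') :
    Tri (N.prod N') (T.prod T') (L.prod L') (Z.prod Z') (N0.prod N0') (K.prod K') (Kc.prod Kc')
      (w, w') (τ, τ') where
  conjN d hd u hu := ⟨D.conjN _ hd.1 _ hu.1, D'.conjN _ hd.2 _ hu.2⟩
  conjL d hd u hu := ⟨D.conjL _ hd.1 _ hu.1, D'.conjL _ hd.2 _ hu.2⟩
  commT d hd u hu := Prod.ext (D.commT _ hd.1 _ hu.1) (D'.commT _ hd.2 _ hu.2)
  uniq l hl d hd u hu h := by
    obtain ⟨a, b, c⟩ := D.uniq _ hl.1 _ hd.1 _ hu.1 (congrArg Prod.fst h)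
    obtain ⟨a', b', c'⟩ := D'.uniq _ hl.2 _ hd.2 _ hu.2 (congrArg Prod.snd h)
    exact ⟨Prod.ext a a', Prod.ext b b', Prod.ext c c'⟩
  ww := Prod.ext D.ww D'.ww
  wN u hu := ⟨D.wN _ hu.1, D'.wN _ hu.2⟩
  wL u hu := ⟨D.wL _ hu.1, D'.wL _ hu.2⟩
  wT u hu := ⟨D.wT _ hu.1, D'.wT _ hu.2⟩
  memτ := ⟨D.memτ, D'.memτ⟩
  wτ := ⟨D.wτ, D'.wτ⟩
  ZT := fun _ h => ⟨D.ZT h.1, D'.ZT h.2⟩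
  Zc z hz g := Prod.ext (D.Zc _ hz.1 _) (D'.Zc _ hz.2 _)
  N0N := fun _ h => ⟨D.N0N h.1, D'.N0N h.2⟩
  dec g hg := by
    obtain ⟨x, hx, d, hd, l, hl, hdK, hlK, e⟩ := D.dec _ hg.1
    obtain ⟨x', hx', d', hd', l', hl', hdK', hlK', e'⟩ := D'.dec _ hg.2
    exact ⟨(x, x'), ⟨hx, hx'⟩, (d, d'), ⟨hd, hd'⟩, (l, l'), ⟨hl, hl'⟩, ⟨hdK, hdK'⟩, ⟨hlK, hlK'⟩,
      Prod.ext e e'⟩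
  KN x hx := by
    simp only [Subgroup.mem_prod]
    rw [D.KN _ hx.1, D'.KN _ hx.2]
  wKT d hd hK := ⟨D.wKT _ hd.1 hK.1, D'.wKT _ hd.2 hK.2⟩
  wKL d hd hK := ⟨D.wKL _ hd.1 hK.1, D'.wKL _ hd.2 hK.2⟩
  KcK := fun _ h => ⟨D.KcK h.1, D'.KcK h.2⟩
  N0Kc := fun _ h => ⟨D.N0Kc h.1, D'.N0Kc h.2⟩
  KcT d hd l hl h := ⟨D.KcT _ hd.1 _ hl.1 h.1, D'.KcT _ hd.2 _ hl.2 h.2⟩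
  N0τ u hu := ⟨D.N0τ _ hu.1, D'.N0τ _ hu.2⟩
  KcQ u hu := ⟨D.KcQ _ hu.1, D'.KcQ _ hu.2⟩
  domτ u hu := ⟨⟨(D.domτ _ hu.1).1, (D'.domτ _ hu.2).1⟩, (D.domτ _ hu.1).2, (D'.domτ _ hu.2).2⟩

theorem TDom.prod {G G' : Type*} [Group G] [Group G'] {N0 : Subgroup G} {N0' : Subgroup G'}
    {w y : G} {w' y' : G'} (h : TDom N0 w y) (h' : TDom N0' w' y') :
    TDom (N0.prod N0') (w, w') (y, y') := fun _ hu =>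
  ⟨⟨(h _ hu.1).1, (h' _ hu.2).1⟩, (h _ hu.1).2, (h' _ hu.2).2⟩

/-! ### Matrix entries, triangular groups and weights -/

section Entries

variable {F : Type*} [NontriviallyNormedField F] {ν : ℕ}

def diagHom (F : Type*) [NontriviallyNormedField F] (ν : ℕ) : (Fin ν → Fˣ) →* GL (Fin ν) F where
  toFun := diagGL
  map_one' := by ext i j; simp [diagGL, Matrix.one_apply]
  map_mul' a b := by
    ext i j
    by_cases h : i = j <;> simp [diagGL, h]

theorem diagGL_mul (a b : Fin ν → Fˣ) : diagGL (a * b) = diagGL a * diagGL b :=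
  (diagHom F ν).map_mul a b

theorem diagGL_inv (a : Fin ν → Fˣ) : diagGL a⁻¹ = (diagGL a)⁻¹ := (diagHom F ν).map_inv a

theorem diagGL_div (a b : Fin ν → Fˣ) : diagGL (a / b) = diagGL a * (diagGL b)⁻¹ := by
  rw [div_eq_mul_inv, diagGL_mul, diagGL_inv]

theorem diagGL_pow (a : Fin ν → Fˣ) (m : ℕ) : diagGL (a ^ m) = diagGL a ^ m :=
  (diagHom F ν).map_pow a m

theorem diagGL_zpow (a : Fin ν → Fˣ) (m : ℤ) : diagGL (a ^ m) = diagGL a ^ m :=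
  (diagHom F ν).map_zpow a m

theorem diag_mul_apply (a : Fin ν → Fˣ) (g : GL (Fin ν) F) (i j : Fin ν) :
    (diagGL a * g).1 i j = a i * g.1 i j := by
  simp [diagGL, Matrix.diagonal_mul]

theorem mul_diag_apply (a : Fin ν → Fˣ) (g : GL (Fin ν) F) (i j : Fin ν) :
    (g * diagGL a).1 i j = g.1 i j * a j := by
  simp [diagGL, Matrix.mul_diagonal]

theorem diagGL_apply_self (a : Fin ν → Fˣ) (i : Fin ν) : (diagGL a).1 i i = a i := by
  simp [diagGL]

theorem diagGL_apply_ne (a : Fin ν → Fˣ) {i j : Fin ν} (h : i ≠ j) : (diagGL a).1 i j = 0 := by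
  simp [diagGL, h]

theorem conj_diag_apply (a : Fin ν → Fˣ) (g : GL (Fin ν) F) (i j : Fin ν) :
    (diagGL a * g * (diagGL a)⁻¹).1 i j = a i * g.1 i j * ((a j : F))⁻¹ := by
  rw [← diagGL_inv, mul_diag_apply, diag_mul_apply]
  simp

theorem w_mul_apply (g : GL (Fin ν) F) (i j : Fin ν) : (wGL F ν * g).1 i j = g.1 i.rev j := by
  have : ∀ k : Fin ν, (i = k.rev) ↔ (k = i.rev) := fun k => by
    constructor <;> (rintro rfl; simp)
  simp [wGL, Matrix.mul_apply, this]

theorem mul_w_apply (g : GL (Fin ν) F) (i j : Fin ν) : (g * wGL F ν).1 i j = g.1 i j.rev := by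
  simp [wGL, Matrix.mul_apply]

theorem wGL_inv : (wGL F ν)⁻¹ = wGL F ν := rfl

theorem conj_w_apply (g : GL (Fin ν) F) (i j : Fin ν) :
    (wGL F ν * g * (wGL F ν)⁻¹).1 i j = g.1 i.rev j.rev := by
  rw [wGL_inv, mul_w_apply, w_mul_apply]

theorem conj_w_diag (a : Fin ν → Fˣ) :
    wGL F ν * diagGL a * (wGL F ν)⁻¹ = diagGL fun i => a i.rev := by
  ext i j
  rw [conj_w_apply]
  by_cases h : i = j
  · subst h; simp [diagGL]
  · simp [diagGL, h]

theorem conj_w_diag_inv (a : Fin ν → Fˣ) :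
    (wGL F ν * diagGL a * (wGL F ν)⁻¹)⁻¹ = diagGL (iotaT a) := by
  rw [conj_w_diag, ← diagGL_inv]; rfl

theorem tGL_pow (ϖ : Fˣ) (m : ℕ) : tGL ϖ ν ^ m = diagGL (tVec ϖ ν ^ m) := (diagGL_pow _ _).symm

theorem tGL_zpow (ϖ : Fˣ) (m : ℤ) : tGL ϖ ν ^ m = diagGL (tVec ϖ ν ^ m) := (diagGL_zpow _ _).symm

theorem norm_conj_t (ϖ : Fˣ) (m : ℤ) (g : GL (Fin ν) F) (i j : Fin ν) :
    ‖(tGL ϖ ν ^ m * g * (tGL ϖ ν ^ m)⁻¹).1 i j‖ =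
      ‖(ϖ : F)‖ ^ (m * ((j : ℤ) - i)) * ‖g.1 i j‖ := by
  have h0 : ‖(ϖ : F)‖ ≠ 0 := by simp
  rw [tGL_zpow, conj_diag_apply]
  simp only [tVec, Pi.pow_apply, norm_mul, norm_inv, Units.val_zpow_eq_zpow_val,
    Units.val_pow_eq_pow_val, norm_zpow, norm_pow]
  rw [mul_right_comm, ← zpow_natCast, ← zpow_natCast, ← zpow_mul, ← zpow_mul, ← zpow_neg,
    ← zpow_add₀ h0]
  congr 2
  have hi := i.2
  have hj := j.2
  have e1 : ((ν - 1 - (i : ℕ) : ℕ) : ℤ) = (ν : ℤ) - 1 - i := by omega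
  have e2 : ((ν - 1 - (j : ℕ) : ℕ) : ℤ) = (ν : ℤ) - 1 - j := by omega
  rw [e1, e2]; ring

end Entries

section Triangular

variable {F : Type*} [NontriviallyNormedField F] {ν : ℕ}

theorem upper_mul {A B : Matrix (Fin ν) (Fin ν) F} (hA : ∀ i j, j < i → A i j = 0)
    (hB : ∀ i j, j < i → B i j = 0) :
    (∀ i j, j < i → (A * B) i j = 0) ∧ ∀ i, (A * B) i i = A i i * B i i := by
  constructor
  · intro i j hij
    rw [Matrix.mul_apply]
    refine Finset.sum_eq_zero fun k _ => ?_
    rcases lt_or_ge k i with h | h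
    · rw [hA i k h, zero_mul]
    · rw [hB k j (lt_of_lt_of_le hij h), mul_zero]
  · intro i
    rw [Matrix.mul_apply, Finset.sum_eq_single i]
    · intro k _ hk
      rcases lt_or_gt_of_ne hk with h | h
      · rw [hA i k h, zero_mul]
      · rw [hB k i h, mul_zero]
    · simp

theorem upper_inv (g : GL (Fin ν) F) (h : ∀ i j, j < i → g.1 i j = 0) :
    (∀ i j, j < i → (g⁻¹).1 i j = 0) ∧ ∀ i, g.1 i i * (g⁻¹).1 i i = 1 := by
  have h1 : ∀ i j, j < i → (g⁻¹).1 i j = 0 := by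
    intro i j hij
    have hb : Matrix.BlockTriangular g.1 id := fun i j hij => h i j hij
    have : Invertible g.1 := g.invertible
    have := Matrix.blockTriangular_inv_of_blockTriangular hb
    rw [Matrix.coe_units_inv]
    exact this hij
  refine ⟨h1, fun i => ?_⟩
  rw [← (upper_mul h h1).2 i]
  have : g.1 * (g⁻¹).1 = 1 := by simp
  rw [this, Matrix.one_apply_eq]

variable (F ν) in
/-- The group of upper-triangular unipotent matrices. -/
def upperN : Subgroup (GL (Fin ν) F) where
  carrier := {g | UpperUnip g}
  one_mem' := ⟨fun i => by simp, fun i j h => by simp [h.ne']⟩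
  mul_mem' := by
    rintro a b ⟨ha, ha'⟩ ⟨hb, hb'⟩
    obtain ⟨h1, h2⟩ := upper_mul ha' hb'
    exact ⟨fun i => (h2 i).trans (by rw [ha, hb, one_mul]), h1⟩
  inv_mem' := by
    rintro a ⟨ha, ha'⟩
    obtain ⟨h1, h2⟩ := upper_inv a ha'
    exact ⟨fun i => by simpa [ha i] using h2 i, h1⟩

variable (F ν) in
/-- The group of lower-triangular unipotent matrices. -/
def lowerN : Subgroup (GL (Fin ν) F) := conjSub (upperN F ν) (wGL F ν)

theorem mem_upperN {g : GL (Fin ν) F} : g ∈ upperN F ν ↔ UpperUnip g := Iff.rfl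

theorem mem_lowerN {g : GL (Fin ν) F} : g ∈ lowerN F ν ↔ LowerUnip g := by
  rw [lowerN, mem_conjSub, mem_upperN]
  simp only [UpperUnip, LowerUnip, conj_w_apply]
  constructor
  · rintro ⟨h1, h2⟩
    refine ⟨fun i => by simpa using h1 i.rev, fun i j h => ?_⟩
    simpa using h2 i.rev j.rev (by simpa using h)
  · rintro ⟨h1, h2⟩
    exact ⟨fun i => h1 i.rev, fun i j h => h2 _ _ (by simpa using h)⟩

theorem w_conj_w (g : GL (Fin ν) F) :
    wGL F ν * (wGL F ν * g * (wGL F ν)⁻¹) * (wGL F ν)⁻¹ = g := by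
  ext i j; rw [conj_w_apply, conj_w_apply]; simp

theorem lower_diag_upper {l u : GL (Fin ν) F} {a : Fin ν → Fˣ} (hl : LowerUnip l)
    (hu : UpperUnip u) (h : l * diagGL a * u = 1) : l = 1 ∧ diagGL a = 1 ∧ u = 1 := by
  have hu' : UpperUnip u⁻¹ := (upperN F ν).inv_mem hu
  have e : l * diagGL a = u⁻¹ := eq_inv_of_mul_eq_one_left h
  have ha : ∀ i, (a i : F) = 1 := fun i => by
    have := congrArg (fun g : GL (Fin ν) F => g.1 i i) e
    simp only [mul_diag_apply, hl.1 i, hu'.1 i, one_mul] at this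
    exact this
  have hd : diagGL a = 1 := by
    have : a = 1 := funext fun i => Units.ext (ha i)
    rw [this]; exact (diagHom F ν).map_one
  have hu1 : u⁻¹ = 1 := by
    ext i j
    rcases lt_trichotomy i j with h | h | h
    · rw [← e, mul_diag_apply, hl.2 i j h]; simp [h.ne]
    · subst h; rw [hu'.1]; simp
    · rw [hu'.2 i j h]; simp [h.ne']
  refine ⟨?_, hd, inv_eq_one.1 hu1⟩
  rw [hd, hu1, mul_one] at e
  exact e

end Triangular

section Weights

variable {F : Type*} [NontriviallyNormedField F] {ν : ℕ} {ϖ : Fˣ} (hϖ : IsUniformizer ϖ)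

theorem norm_pos_unif (ϖ : Fˣ) : 0 < ‖(ϖ : F)‖ := by simp

/-- The weight `|ϖ|^{s (j - i)⁺}`. -/
def wt (ϖ : Fˣ) (s i j : ℕ) : ℝ := ‖(ϖ : F)‖ ^ (s * (j - i))

theorem wt_pos (s i j : ℕ) : 0 < wt ϖ s i j := pow_pos (norm_pos_unif ϖ) _

theorem wt_of_le {s i j : ℕ} (h : j ≤ i) : wt ϖ s i j = 1 := by
  simp [wt, Nat.sub_eq_zero_of_le h]

theorem wt_le_one (hϖ : IsUniformizer ϖ) (s i j : ℕ) : wt ϖ s i j ≤ 1 := pow_le_one₀ (norm_nonneg _) hϖ.1.le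

/-- This is subadditivity of the positive part, `(j - i)⁺ ≤ (k - i)⁺ + (j - k)⁺`. It is the reason
why weighted bounds survive matrix multiplication. -/
theorem wt_mul_le (hϖ : IsUniformizer ϖ) (s i k j : ℕ) : wt ϖ s i k * wt ϖ s k j ≤ wt ϖ s i j := by
  rw [wt, wt, wt, ← pow_add, ← mul_add]
  refine pow_le_pow_of_le_one (norm_nonneg _) hϖ.1.le (Nat.mul_le_mul_left _ ?_)
  omega

theorem wt_le_wt (hϖ : IsUniformizer ϖ) {s s' i j : ℕ} (h : s ≤ s') : wt ϖ s' i j ≤ wt ϖ s i j :=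
  pow_le_pow_of_le_one (norm_nonneg _) hϖ.1.le (Nat.mul_le_mul_right _ h)

theorem wt_le_pow (hϖ : IsUniformizer ϖ) {s i j : ℕ} (h : i < j) : wt ϖ s i j ≤ ‖(ϖ : F)‖ ^ s := by
  refine pow_le_pow_of_le_one (norm_nonneg _) hϖ.1.le ?_
  calc s = s * 1 := (mul_one s).symm
    _ ≤ _ := Nat.mul_le_mul_left _ (by omega)

theorem zpow_wt (s i j : ℕ) (x : ℝ) (hx1 : x ≤ 1) (hϖ : IsUniformizer ϖ) :
    ‖(ϖ : F)‖ ^ ((s : ℤ) * ((j : ℤ) - i)) * x ≤ 1 ↔ x ≤ wt ϖ s j i := by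
  have h0 := norm_pos_unif ϖ
  rcases le_total i j with h | h
  · rw [wt_of_le h]
    have : ‖(ϖ : F)‖ ^ ((s : ℤ) * ((j : ℤ) - i)) ≤ 1 := by
      obtain ⟨k, rfl⟩ := Nat.exists_eq_add_of_le h
      have : ((s : ℤ) * (((i + k : ℕ) : ℤ) - i)) = ((s * k : ℕ) : ℤ) := by push_cast; ring
      rw [this, zpow_natCast]
      exact pow_le_one₀ h0.le hϖ.1.le
    refine ⟨fun _ => hx1, fun _ => ?_⟩
    rcases le_total 0 x with hx | hx
    · exact mul_le_one₀ this hx hx1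
    · exact (mul_nonpos_of_nonneg_of_nonpos (zpow_pos h0 _).le hx).trans zero_le_one
  · obtain ⟨k, rfl⟩ := Nat.exists_eq_add_of_le h
    have : ((s : ℤ) * ((j : ℤ) - (j + k : ℕ))) = -((s * k : ℕ) : ℤ) := by push_cast; ring
    rw [this, zpow_neg, zpow_natCast, wt, Nat.add_sub_cancel_left, inv_mul_le_iff₀ (pow_pos h0 _),
      mul_one]

/-- The indices of the weight are transposed: for `s ≥ 0` the group `K^{(s)}` is restricted below
the diagonal, and `K^{(-s)}` above it. -/
theorem mem_Kround_iff (hϖ : IsUniformizer ϖ) {s : ℕ} {g : GL (Fin ν) F} :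
    g ∈ Kround ϖ ν s ↔ ∀ i j, ‖g.1 i j‖ ≤ wt ϖ s j i ∧ ‖(g⁻¹).1 i j‖ ≤ wt ϖ s j i := by
  have key : ∀ (g : GL (Fin ν) F) (i j : Fin ν), (‖g.1 i j‖ ≤ 1 ∧
      ‖(tGL ϖ ν ^ (s : ℤ) * g * (tGL ϖ ν ^ (s : ℤ))⁻¹).1 i j‖ ≤ 1) ↔
        ‖g.1 i j‖ ≤ wt ϖ s j i := by
    intro g i j
    rw [norm_conj_t]
    constructor
    · rintro ⟨h1, h2⟩
      exact (zpow_wt _ _ _ _ h1 hϖ).1 h2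
    · intro h
      have h1 := h.trans (wt_le_one hϖ _ _ _)
      exact ⟨h1, (zpow_wt _ _ _ _ h1 hϖ).2 h⟩
  have hinv : (tGL ϖ ν ^ (s : ℤ) * g * (tGL ϖ ν ^ (s : ℤ))⁻¹)⁻¹ =
      tGL ϖ ν ^ (s : ℤ) * g⁻¹ * (tGL ϖ ν ^ (s : ℤ))⁻¹ := by group
  simp only [Kround, GLO, Set.mem_ofPred_eq, zpow_neg, hinv]
  constructor
  · rintro ⟨⟨h1, h2⟩, h3, h4⟩ i j
    exact ⟨(key g i j).1 ⟨h1 i j, h3 i j⟩, (key g⁻¹ i j).1 ⟨h2 i j, h4 i j⟩⟩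
  · intro h
    exact ⟨⟨fun i j => ((key g i j).2 (h i j).1).1, fun i j => ((key g⁻¹ i j).2 (h i j).2).1⟩,
      fun i j => ((key g i j).2 (h i j).1).2, fun i j => ((key g⁻¹ i j).2 (h i j).2).2⟩

theorem mem_Kround_neg_iff (hϖ : IsUniformizer ϖ) {s : ℕ} {g : GL (Fin ν) F} :
    g ∈ Kround ϖ ν (-(s : ℤ)) ↔ ∀ i j, ‖g.1 i j‖ ≤ wt ϖ s i j ∧ ‖(g⁻¹).1 i j‖ ≤ wt ϖ s i j := by
  have key : ∀ (g : GL (Fin ν) F) (i j : Fin ν), (‖g.1 i j‖ ≤ 1 ∧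
      ‖(tGL ϖ ν ^ (-(s : ℤ)) * g * (tGL ϖ ν ^ (-(s : ℤ)))⁻¹).1 i j‖ ≤ 1) ↔
        ‖g.1 i j‖ ≤ wt ϖ s i j := by
    intro g i j
    have e : (-(s : ℤ)) * ((j : ℤ) - i) = (s : ℤ) * ((i : ℤ) - j) := by ring
    rw [norm_conj_t, e]
    constructor
    · rintro ⟨h1, h2⟩
      exact (zpow_wt _ _ _ _ h1 hϖ).1 h2
    · intro h
      have h1 := h.trans (wt_le_one hϖ _ _ _)
      exact ⟨h1, (zpow_wt _ _ _ _ h1 hϖ).2 h⟩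
  have hinv : (tGL ϖ ν ^ (-(s : ℤ)) * g * (tGL ϖ ν ^ (-(s : ℤ)))⁻¹)⁻¹ =
      tGL ϖ ν ^ (-(s : ℤ)) * g⁻¹ * (tGL ϖ ν ^ (-(s : ℤ)))⁻¹ := by group
  have hz : tGL ϖ ν ^ (- -(s : ℤ)) = (tGL ϖ ν ^ (-(s : ℤ)))⁻¹ := zpow_neg _ _
  simp only [Kround, GLO, Set.mem_ofPred_eq, hz, hinv]
  constructor
  · rintro ⟨⟨h1, h2⟩, h3, h4⟩ i j
    exact ⟨(key g i j).1 ⟨h1 i j, h3 i j⟩, (key g⁻¹ i j).1 ⟨h2 i j, h4 i j⟩⟩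
  · intro h
    exact ⟨⟨fun i j => ((key g i j).2 (h i j).1).1, fun i j => ((key g⁻¹ i j).2 (h i j).2).1⟩,
      fun i j => ((key g i j).2 (h i j).1).2, fun i j => ((key g⁻¹ i j).2 (h i j).2).2⟩

end Weights

section Integral

variable {F : Type*} [NontriviallyNormedField F] [IsUltrametricDist F] {ν : ℕ}

theorem norm_mul_apply_le {l m n : Type*} [Fintype m] {A : Matrix l m F} {B : Matrix m n F}
    {i : l} {j : n} {r : ℝ} (hr : 0 ≤ r) (h : ∀ k, ‖A i k‖ * ‖B k j‖ ≤ r) :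
    ‖(A * B) i j‖ ≤ r := by
  rw [Matrix.mul_apply]
  exact IsUltrametricDist.norm_sum_le_of_forall_le_of_nonneg hr fun k _ => by
    rw [norm_mul]; exact h k

theorem norm_mul_apply_le_one {A B : Matrix (Fin ν) (Fin ν) F} (hA : ∀ i j, ‖A i j‖ ≤ 1)
    (hB : ∀ i j, ‖B i j‖ ≤ 1) (i j : Fin ν) : ‖(A * B) i j‖ ≤ 1 :=
  norm_mul_apply_le zero_le_one fun k => mul_le_one₀ (hA i k) (norm_nonneg _) (hB k j)

variable (F ν) in
/-- The group `GL_ν(𝒪₀)`. -/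
def GLOs : Subgroup (GL (Fin ν) F) where
  carrier := GLO F ν
  one_mem' := by
    have : ∀ i j : Fin ν, ‖(1 : Matrix (Fin ν) (Fin ν) F) i j‖ ≤ 1 := fun i j => by
      by_cases h : i = j <;> simp [Matrix.one_apply, h]
    exact ⟨this, by simpa using this⟩
  mul_mem' := by
    rintro a b ⟨ha, ha'⟩ ⟨hb, hb'⟩
    refine ⟨norm_mul_apply_le_one ha hb, ?_⟩
    rw [mul_inv_rev]
    exact norm_mul_apply_le_one hb' ha'
  inv_mem' := by
    rintro a ⟨ha, ha'⟩
    exact ⟨ha', by simpa using ha⟩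

theorem mem_GLOs {g : GL (Fin ν) F} : g ∈ GLOs F ν ↔ g ∈ GLO F ν := Iff.rfl

theorem coe_GLOs : (GLOs F ν : Set (GL (Fin ν) F)) = GLO F ν := rfl

variable (F ν) in
/-- Integral upper-triangular unipotent matrices. -/
def upperO : Subgroup (GL (Fin ν) F) := upperN F ν ⊓ GLOs F ν

variable (ϖ : Fˣ)

variable (ν) in
/-- `K^{(r)}` as a subgroup. -/
def KroundS (r : ℤ) : Subgroup (GL (Fin ν) F) := GLOs F ν ⊓ conjSub (GLOs F ν) (tGL ϖ ν ^ r)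

theorem mem_KroundS {r : ℤ} {g : GL (Fin ν) F} : g ∈ KroundS ν ϖ r ↔ g ∈ Kround ϖ ν r := by
  rw [KroundS, Subgroup.mem_inf, mem_conjSub, mem_GLOs, mem_GLOs, Kround, zpow_neg]
  rfl

end Integral

/-! ### The axioms for `GL_ν` and for the product group -/

section GLData

variable {F : Type*} [NontriviallyNormedField F] [IsUltrametricDist F] {ν : ℕ} {ϖ : Fˣ}
  (hϖ : IsUniformizer ϖ) {c : ℕ}

/-- In each off-diagonal term `A i k * B k i` one of the two entries lies below the diagonal and is
divisible by `ϖ^c`. -/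
theorem diag_mul_bound (hϖ : IsUniformizer ϖ) {A B : Matrix (Fin ν) (Fin ν) F} {i : Fin ν}
    (hA : ‖A i i‖ ≤ ‖(ϖ : F)‖ ^ (c - 1)) (hA' : ∀ k, k ≠ i → ‖A i k‖ ≤ wt ϖ c k i)
    (hB : ∀ k, ‖B k i‖ ≤ wt ϖ c i k) : ‖(A * B) i i‖ ≤ ‖(ϖ : F)‖ ^ (c - 1) := by
  have hc : ‖(ϖ : F)‖ ^ c ≤ ‖(ϖ : F)‖ ^ (c - 1) :=
    pow_le_pow_of_le_one (norm_nonneg _) hϖ.1.le (Nat.sub_le _ _)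
  refine norm_mul_apply_le (pow_nonneg (norm_nonneg _) _) fun k => ?_
  rcases lt_trichotomy k i with h | h | h
  · calc _ ≤ wt ϖ c k i * 1 := mul_le_mul (hA' k h.ne) ((hB k).trans (wt_le_one hϖ _ _ _))
          (norm_nonneg _) (wt_pos _ _ _).le
      _ ≤ _ := by rw [mul_one]; exact (wt_le_pow hϖ h).trans hc
  · subst h
    calc _ ≤ ‖(ϖ : F)‖ ^ (c - 1) * 1 := mul_le_mul hA ((hB k).trans (wt_le_one hϖ _ _ _))
          (norm_nonneg _) (pow_nonneg (norm_nonneg _) _)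
      _ = _ := mul_one _
  · calc _ ≤ 1 * wt ϖ c i k := mul_le_mul ((hA' k h.ne').trans (wt_le_one hϖ _ _ _)) (hB k)
          (norm_nonneg _) zero_le_one
      _ ≤ _ := by rw [one_mul]; exact (wt_le_pow hϖ h).trans hc

variable (ν c) in
/-- `K^{⟨c⟩}` as a subgroup. -/
def KangleS : Subgroup (GL (Fin ν) F) where
  carrier := Kangle ϖ ν c
  one_mem' := ⟨mem_KroundS ϖ |>.1 (Subgroup.one_mem _), fun i => by simp⟩
  mul_mem' := by
    rintro a b ⟨ha, ha'⟩ ⟨hb, hb'⟩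
    refine ⟨(mem_KroundS ϖ).1 (Subgroup.mul_mem _ ((mem_KroundS ϖ).2 ha) ((mem_KroundS ϖ).2 hb)),
      fun i => ?_⟩
    rw [mem_Kround_iff hϖ] at ha hb
    have e : (a * b).1 i i - 1 = ((a.1 - 1) * b.1) i i + (b.1 i i - 1) := by
      rw [Matrix.sub_mul, Matrix.one_mul, Matrix.sub_apply, Units.val_mul]; ring
    rw [e]
    refine (IsUltrametricDist.norm_add_le_max _ _).trans (max_le (diag_mul_bound hϖ ?_ ?_ ?_) (hb' i))
    · simpa using ha' i
    · intro k hk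
      simpa [Matrix.one_apply_ne hk.symm] using (ha i k).1
    · exact fun k => (hb k i).1
  inv_mem' := by
    rintro a ⟨ha, ha'⟩
    refine ⟨(mem_KroundS ϖ).1 (Subgroup.inv_mem _ ((mem_KroundS ϖ).2 ha)), fun i => ?_⟩
    rw [mem_Kround_iff hϖ] at ha
    have e : (a⁻¹).1 i i - 1 = ((1 - a.1) * (a⁻¹).1) i i := by
      rw [Matrix.sub_mul, Matrix.one_mul, ← Units.val_mul, mul_inv_cancel]
      simp
    rw [e]
    refine diag_mul_bound hϖ ?_ ?_ ?_
    · simpa [norm_sub_rev] using ha' i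
    · intro k hk
      simpa [Matrix.one_apply_ne hk.symm] using (ha i k).1
    · exact fun k => (ha k i).2

theorem upperO_le_KangleS : upperO F ν ≤ KangleS ν hϖ c := by
  rintro g ⟨⟨h1, h2⟩, h3, h4⟩
  have h5 : UpperUnip g⁻¹ := (upperN F ν).inv_mem ⟨h1, h2⟩
  refine ⟨(mem_Kround_iff hϖ).2 fun i j => ?_, fun i => ?_⟩
  · rcases le_or_gt i j with h | h
    · rw [wt_of_le h]; exact ⟨h3 i j, h4 i j⟩
    · rw [h2 i j h, h5.2 i j h, norm_zero]; exact ⟨(wt_pos _ _ _).le, (wt_pos _ _ _).le⟩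
  · rw [h1, sub_self, norm_zero]; exact pow_nonneg (norm_nonneg _) _

theorem norm_conj_wc (g : GL (Fin ν) F) (i j : Fin ν) :
    ‖((wGL F ν * tGL ϖ ν ^ c) * g * (wGL F ν * tGL ϖ ν ^ c)⁻¹).1 i j‖ =
      ‖(ϖ : F)‖ ^ ((c : ℤ) * ((i : ℤ) - j)) * ‖g.1 i.rev j.rev‖ := by
  have e : (wGL F ν * tGL ϖ ν ^ c) * g * (wGL F ν * tGL ϖ ν ^ c)⁻¹ =
      wGL F ν * (tGL ϖ ν ^ (c : ℤ) * g * (tGL ϖ ν ^ (c : ℤ))⁻¹) * (wGL F ν)⁻¹ := by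
    rw [zpow_natCast]; group
  rw [e, conj_w_apply, norm_conj_t]
  congr 3
  have hi := i.2
  have hj := j.2
  rw [Fin.val_rev, Fin.val_rev]
  omega

theorem wc_conj_bound (hϖ : IsUniformizer ϖ) {g : GL (Fin ν) F} (h : ∀ i j, ‖g.1 i j‖ ≤ wt ϖ c j i) (i j : Fin ν) :
    ‖((wGL F ν * tGL ϖ ν ^ c) * g * (wGL F ν * tGL ϖ ν ^ c)⁻¹).1 i j‖ ≤ wt ϖ c j i := by
  have h0 := norm_pos_unif ϖ
  rw [norm_conj_wc]
  have h1 := h i.rev j.rev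
  have hi := i.2
  have hj := j.2
  rcases le_total i j with hij | hij
  · have e : ((c : ℤ) * ((i : ℤ) - j)) = -((c * ((j : ℕ) - i) : ℕ) : ℤ) := by
      have : (i : ℕ) ≤ j := hij
      push_cast [this]; ring
    rw [e, zpow_neg, zpow_natCast, inv_mul_le_iff₀ (pow_pos h0 _), wt_of_le (show (i : ℕ) ≤ j from hij),
      mul_one]
    refine h1.trans (le_of_eq ?_)
    rw [wt, Fin.val_rev, Fin.val_rev]
    congr 2
    omega
  · have e : ((c : ℤ) * ((i : ℤ) - j)) = ((c * ((i : ℕ) - j) : ℕ) : ℤ) := by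
      have : (j : ℕ) ≤ i := hij
      push_cast [this]; ring
    rw [e, zpow_natCast]
    calc _ ≤ ‖(ϖ : F)‖ ^ (c * ((i : ℕ) - j)) * 1 :=
          mul_le_mul_of_nonneg_left (h1.trans (wt_le_one hϖ _ _ _)) (pow_pos h0 _).le
      _ = _ := mul_one _

/-- Conjugation by `w t^c` reverses both indices and multiplies entry `(i, j)` by an element of norm
`‖ϖ‖ ^ (c(i-j))`. It exchanges the integrality above the diagonal with the divisibility by
`ϖ^{c(i-j)}` below, and permutes the diagonal. -/
theorem wc_conj_KangleS {g : GL (Fin ν) F} (hg : g ∈ KangleS ν hϖ c) :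
    (wGL F ν * tGL ϖ ν ^ c) * g * (wGL F ν * tGL ϖ ν ^ c)⁻¹ ∈ KangleS ν hϖ c := by
  obtain ⟨h1, h2⟩ := hg
  rw [mem_Kround_iff hϖ] at h1
  refine ⟨(mem_Kround_iff hϖ).2 fun i j => ⟨wc_conj_bound hϖ (fun i j => (h1 i j).1) i j, ?_⟩,
    fun i => ?_⟩
  · have : ((wGL F ν * tGL ϖ ν ^ c) * g * (wGL F ν * tGL ϖ ν ^ c)⁻¹)⁻¹ =
        (wGL F ν * tGL ϖ ν ^ c) * g⁻¹ * (wGL F ν * tGL ϖ ν ^ c)⁻¹ := by group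
    rw [this]
    exact wc_conj_bound hϖ (fun i j => (h1 i j).2) i j
  · have e : (wGL F ν * tGL ϖ ν ^ c) * g * (wGL F ν * tGL ϖ ν ^ c)⁻¹ =
      wGL F ν * (tGL ϖ ν ^ c * g * (tGL ϖ ν ^ c)⁻¹) * (wGL F ν)⁻¹ := by group
    rw [e, conj_w_apply, tGL_pow, conj_diag_apply]
    have := h2 i.rev
    rwa [mul_right_comm, mul_inv_cancel₀ (Units.ne_zero _), one_mul]

theorem IsDom.conj_upperO {a : Fin ν → Fˣ} (ha : IsDom a) {u : GL (Fin ν) F}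
    (hu : u ∈ upperO F ν) : diagGL a * u * (diagGL a)⁻¹ ∈ upperO F ν := by
  have key : ∀ u ∈ upperO F ν, ∀ i j, ‖(diagGL a * u * (diagGL a)⁻¹).1 i j‖ ≤ 1 := by
    rintro u ⟨⟨h1, h2⟩, h3, h4⟩ i j
    rw [conj_diag_apply, mul_right_comm]
    rcases lt_trichotomy i j with h | h | h
    · rw [norm_mul, norm_mul, norm_inv]
      refine mul_le_one₀ ?_ (norm_nonneg _) (h3 i j)
      rw [← div_eq_mul_inv]
      exact div_le_one_of_le₀ (ha i j h) (norm_nonneg _)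
    · subst h; simp [h1]
    · simp [h2 i j h]
  refine ⟨⟨fun i => ?_, fun i j h => ?_⟩, key u hu, ?_⟩
  · rw [conj_diag_apply, hu.1.1]; simp
  · rw [conj_diag_apply, hu.1.2 i j h]; simp
  · have : (diagGL a * u * (diagGL a)⁻¹)⁻¹ = diagGL a * u⁻¹ * (diagGL a)⁻¹ := by group
    rw [this]; exact key _ (Subgroup.inv_mem _ hu)

theorem IsDom.iota {a : Fin ν → Fˣ} (ha : IsDom a) : IsDom (iotaT a) := by
  intro i j h
  simp only [iotaT, Units.val_inv_eq_inv_val, norm_inv]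
  exact inv_anti₀ (by simp) (ha _ _ (by simpa using h))

theorem IsDom.tDom {a : Fin ν → Fˣ} (ha : IsDom a) :
    TDom (upperO F ν) (wGL F ν) (diagGL a) := by
  intro u hu
  refine ⟨ha.conj_upperO hu, ?_⟩
  have := ha.iota.conj_upperO hu
  rwa [← conj_w_diag_inv, inv_inv] at this

theorem isDom_tVec (hϖ : IsUniformizer ϖ) (ν m : ℕ) : IsDom (tVec ϖ ν ^ m) := by
  intro i j h
  simp only [tVec, Pi.pow_apply, Units.val_pow_eq_pow_val, norm_pow, ← pow_mul]
  refine pow_le_pow_of_le_one (norm_nonneg _) hϖ.1.le (Nat.mul_le_mul_right _ ?_)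
  have : (i : ℕ) < j := h
  omega

/-- The exponents `ν - 1 - i` of `t` and `i` of its reversal add up to the constant `ν - 1`. -/
theorem w_t_w_t (m : ℕ) : wGL F ν * tGL ϖ ν ^ m * (wGL F ν * tGL ϖ ν ^ m) =
    scalarGL ν ((ϖ ^ (ν - 1)) ^ m) := by
  have e : wGL F ν * tGL ϖ ν ^ m * (wGL F ν * tGL ϖ ν ^ m) =
      (wGL F ν * tGL ϖ ν ^ m * (wGL F ν)⁻¹) * tGL ϖ ν ^ m := by rw [wGL_inv]; group
  rw [e, tGL_pow, conj_w_diag, ← diagGL_mul]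
  change _ = diagGL _
  congr 1
  funext i
  simp only [tVec, Pi.mul_apply, Pi.pow_apply, ← mul_pow, ← pow_add, Fin.val_rev]
  congr 2
  have := i.2
  omega

theorem triGL {K : Subgroup (GL (Fin ν) F)} (hK : IsCSDIComponent ϖ c K) :
    Tri (upperN F ν) (diagHom F ν).range (lowerN F ν) (scalarGL (F := F) ν).range (upperO F ν) K
      (KangleS ν hϖ c) (wGL F ν) (tGL ϖ ν ^ c) := by
  obtain ⟨⟨_, hIw, hN⟩, hKc, hdec, hw⟩ := hK
  refine
  { conjN := ?_, conjL := ?_, commT := ?_, uniq := ?_, ww := rfl, wN := ?_, wL := ?_, wT := ?_,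
    memτ := ⟨_, diagGL_pow _ _⟩, wτ := ⟨_, (w_t_w_t c).symm⟩, ZT := ?_, Zc := ?_,
    N0N := inf_le_left, dec := ?_, KN := ?_, wKT := ?_, wKL := ?_, KcK := hKc,
    N0Kc := upperO_le_KangleS hϖ, KcT := ?_,
    N0τ := fun u hu => wc_conj_KangleS hϖ (upperO_le_KangleS hϖ hu),
    KcQ := fun k hk => hKc (wc_conj_KangleS hϖ hk), domτ := ?_ }
  · rintro _ ⟨a, rfl⟩ u ⟨h1, h2⟩
    refine ⟨fun i => ?_, fun i j h => ?_⟩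
    · rw [show diagHom F ν a = diagGL a from rfl, conj_diag_apply, h1]; simp
    · rw [show diagHom F ν a = diagGL a from rfl, conj_diag_apply, h2 i j h]; simp
  · rintro _ ⟨a, rfl⟩ l hl
    rw [mem_lowerN] at hl ⊢
    refine ⟨fun i => ?_, fun i j h => ?_⟩
    · rw [show diagHom F ν a = diagGL a from rfl, conj_diag_apply, hl.1]; simp
    · rw [show diagHom F ν a = diagGL a from rfl, conj_diag_apply, hl.2 i j h]; simp
  · rintro _ ⟨a, rfl⟩ _ ⟨b, rfl⟩
    rw [← map_mul, ← map_mul, mul_comm]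
  · rintro l hl _ ⟨a, rfl⟩ u hu h
    exact lower_diag_upper (mem_lowerN.1 hl) hu h
  · intro u hu
    rw [lowerN, mem_conjSub, w_conj_w]; exact hu
  · intro l hl
    exact mem_conjSub.1 hl
  · rintro _ ⟨a, rfl⟩
    exact ⟨_, (conj_w_diag a).symm⟩
  · rintro _ ⟨z, rfl⟩
    exact ⟨fun _ => z, rfl⟩
  · rintro _ ⟨z, rfl⟩ g
    exact (scalarGL_comm z g).symm
  · intro g hg
    obtain ⟨x, hx, a, y, hy, hxu, ha, hyl, e⟩ := hdec g hg
    exact ⟨x, ⟨hxu, (hN x hxu).1 hx⟩, diagGL a, ⟨a, rfl⟩, y, mem_lowerN.2 hyl, ha, hy, e⟩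
  · intro x hx
    rw [hN x hx]
    exact ⟨fun h => ⟨hx, h⟩, fun h => h.2⟩
  · rintro _ ⟨a, rfl⟩ h
    exact hw a h
  · intro l hl hlK
    have h1 := (hIw hlK).1
    refine ⟨mem_conjSub.1 hl, ?_, ?_⟩
    · intro i j; rw [conj_w_apply]; exact h1.1 _ _
    · have : (wGL F ν * l * (wGL F ν)⁻¹)⁻¹ = wGL F ν * l⁻¹ * (wGL F ν)⁻¹ := by group
      intro i j; rw [this, conj_w_apply]; exact h1.2 _ _
  -- As `l` is unipotent, `d` is read off the diagonal of `d l`, and `d⁻¹` off the diagonal of its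
  -- inverse.
  · rintro _ ⟨a, rfl⟩ l hl h
    change diagGL a * l ∈ _ at h
    change diagGL a ∈ _
    have hl' := mem_lowerN.1 hl
    have hl2 := mem_lowerN.1 (Subgroup.inv_mem _ hl)
    have hd : ∀ i, (diagGL a * l).1 i i = a i := fun i => by
      rw [diag_mul_apply, hl'.1, mul_one]
    have hd' : ∀ i, ((diagGL a * l)⁻¹).1 i i = (a i : F)⁻¹ := fun i => by
      rw [mul_inv_rev, ← diagGL_inv, mul_diag_apply, hl2.1, one_mul]; simp
    obtain ⟨h1, h2⟩ := h
    rw [mem_Kround_iff hϖ] at h1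
    refine ⟨(mem_Kround_iff hϖ).2 fun i j => ?_, fun i => ?_⟩
    · rw [← diagGL_inv]
      by_cases hij : i = j
      · subst hij
        have := h1 i i
        rw [hd, hd'] at this
        simpa [diagGL_apply_self] using this
      · rw [diagGL_apply_ne _ hij, diagGL_apply_ne _ hij, norm_zero]
        exact ⟨(wt_pos _ _ _).le, (wt_pos _ _ _).le⟩
    · rw [diagGL_apply_self, ← hd]; exact h2 i
  · rw [tGL_pow]; exact (isDom_tVec hϖ ν c).tDom

variable {n : ℕ} {Kn : Subgroup (GL (Fin n) F)} {Kn1 : Subgroup (GL (Fin (n + 1)) F)}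

theorem Z0_eq (n : ℕ) (F : Type*) [NontriviallyNormedField F] :
    Z0 n F = (scalarGL (F := F) n).range.prod (scalarGL (n + 1)).range := by
  ext ⟨x, y⟩
  constructor
  · rintro ⟨⟨a, b⟩, h⟩
    exact ⟨⟨a, congrArg Prod.fst h⟩, ⟨b, congrArg Prod.snd h⟩⟩
  · rintro ⟨⟨a, ha⟩, ⟨b, hb⟩⟩
    exact ⟨(a, b), Prod.ext ha hb⟩

variable (n F) in
/-- Upper-triangular unipotent elements of `G̃₀`. -/
def N00 : Subgroup (G0 n F) := (upperN F n).prod (upperN F (n + 1))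

variable (n F) in
def L00 : Subgroup (G0 n F) := (lowerN F n).prod (lowerN F (n + 1))

variable (n F) in
def T00 : Subgroup (G0 n F) := (diagHom F n).range.prod (diagHom F (n + 1)).range

variable (n F) in
def NO0 : Subgroup (G0 n F) := (upperO F n).prod (upperO F (n + 1))

variable (n c) in
def Kc0 : Subgroup (G0 n F) := (KangleS n hϖ c).prod (KangleS (n + 1) hϖ c)

theorem t0_pow (m : ℕ) : t0 ϖ n ^ m = (tGL ϖ n ^ m, tGL ϖ (n + 1) ^ m) := rfl

theorem w0_mul_t0 (c : ℕ) : w0 n F * t0 ϖ n ^ c = wc0 ϖ n c := rfl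

theorem triG0 (hKn : IsCSDIComponent ϖ c Kn) (hKn1 : IsCSDIComponent ϖ c Kn1) :
    Tri (N00 F n) (T00 F n) (L00 F n) (Z0 n F) (NO0 F n) (K0 Kn Kn1) (Kc0 hϖ c n) (w0 n F)
      (t0 ϖ n ^ c) := by
  rw [Z0_eq]
  exact (triGL hϖ hKn).prod (triGL hϖ hKn1)

theorem diag0_mem_T00 (a : T0 n F) : diag0 a ∈ T00 F n := ⟨⟨a.1, rfl⟩, ⟨a.2, rfl⟩⟩

theorem tDom_diag0 {a : T0 n F} (h1 : IsDom a.1) (h2 : IsDom a.2) :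
    TDom (NO0 F n) (w0 n F) (diag0 a) := h1.tDom.prod h2.tDom

end GLData

/-! ### Passage to the quotient of `G × G` by the diagonal centre -/

section AbstractQuotient

variable {G Gq Hq : Type*} [Group G] [Group Gq] [Group Hq] {Z : Subgroup G} {π : G × G →* Gq}
  {ρ : G →* Hq} {N T L N0 K Kc : Subgroup G} {w τ y1 y2 : G}

theorem quot_eq_iff (hπ : ∀ p, π p = 1 ↔ ∃ z ∈ Z, p = (z, z)) {p p' : G × G} :
    π p = π p' ↔ ∃ z ∈ Z, p = (z * p'.1, z * p'.2) := by
  rw [← mul_inv_eq_one, ← map_inv, ← map_mul, hπ]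
  refine exists_congr fun z => and_congr_right fun _ => ?_
  rw [mul_inv_eq_iff_eq_mul]; rfl

theorem quot_eq_iff' (hρ : ∀ g, ρ g = 1 ↔ g ∈ Z) {x x' : G} :
    ρ x = ρ x' ↔ ∃ z ∈ Z, x = z * x' := by
  rw [← mul_inv_eq_one, ← map_inv, ← map_mul, hρ]
  constructor
  · exact fun h => ⟨_, h, by group⟩
  · rintro ⟨z, hz, rfl⟩; simpa using hz

theorem Tri.quot_push (D : Tri N T L Z N0 K Kc w τ) (h1 : TDom N0 w (y1 * τ⁻¹)) :
    ∀ k ∈ (K.prod (conjSub K (w * τ))).map π, ∃ a ∈ (Kc.prod Kc).map π,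
      ∃ b ∈ (K.prod (conjSub K (w * τ))).map π,
      π (y1, y2) * k * π (τ, 1) = a * (π (y1, y2) * π (τ, 1)) * b := by
  rintro _ ⟨⟨k, q⟩, ⟨hk, hq⟩, rfl⟩
  obtain ⟨a, ha, b, hb, e⟩ := D.push_left h1 hk
  refine ⟨π (a, 1), ⟨(a, 1), ⟨ha, Kc.one_mem⟩, rfl⟩, π (b, q), ⟨(b, q), ⟨hb, hq⟩, rfl⟩, ?_⟩
  simp only [← map_mul, Prod.mk_mul_mk]
  rw [e]; simp

theorem Tri.quot_single (D : Tri N T L Z N0 K Kc w τ) (hy1 : y1 ∈ T)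
    (h1 : TDom N0 w (y1 * τ⁻¹)) (hπ : ∀ p, π p = 1 ↔ ∃ z ∈ Z, p = (z, z)) :
    ∀ k ∈ (K.prod (conjSub K (w * τ))).map π, ∀ k' ∈ (K.prod (conjSub K (w * τ))).map π,
      ∀ a ∈ (Kc.prod Kc).map π, ∀ b ∈ (K.prod (conjSub K (w * τ))).map π,
      π (y1, y2) * π (τ, 1) * (k * (π (τ, 1))⁻¹ * k') = a * π (y1, y2) * b →
      π (τ, 1) * (k * (π (τ, 1))⁻¹ * k') ∈ (K.prod (conjSub K (w * τ))).map π := by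
  rintro _ ⟨⟨k, q⟩, ⟨hk, hq⟩, rfl⟩ _ ⟨⟨k', q'⟩, ⟨hk', hq'⟩, rfl⟩ _ ⟨⟨a, a'⟩, ⟨ha, ha'⟩, rfl⟩
    _ ⟨⟨b, b'⟩, ⟨hb, hb'⟩, rfl⟩ h
  simp only [← map_mul, ← map_inv, Prod.mk_mul_mk, Prod.inv_mk] at h ⊢
  obtain ⟨ζ, hζ, e⟩ := (quot_eq_iff hπ).1 h
  have e1 := congrArg Prod.fst e
  refine ⟨_, ⟨D.single_coset hy1 h1 hk hk' ha hb hζ e1, ?_⟩, rfl⟩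
  simpa using Subgroup.mul_mem _ hq hq'

/-- The first coordinate runs over `K` and contributes only `Kc`; the second runs over `Q` and
contributes `(N ∩ Q) Kc`. So the set is a union of cosets of the image of `Kc × Kc`, indexed by `(N
∩ Q)/N₀` through `quot_relIndex`. -/
theorem Tri.quot_double (D : Tri N T L Z N0 K Kc w τ) (hy1 : y1 ∈ T) (hy2 : y2 ∈ T)
    (h1 : TDom N0 w (y1 * τ⁻¹)) (h2 : TDom N0 w (y2 * τ⁻¹))
    (hπ : ∀ p, π p = 1 ↔ ∃ z ∈ Z, p = (z, z)) :
    {z | z ∈ (K.prod (conjSub K (w * τ))).map π ∧ ∃ a ∈ (Kc.prod Kc).map π,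
      ∃ b ∈ (Kc.prod Kc).map π, π (y1, y2) * z = a * π (y1, y2) * b} =
    {g | ∃ m ∈ (N ⊓ conjSub K (w * τ)).map (π.comp (MonoidHom.inr G G)),
      m⁻¹ * g ∈ (Kc.prod Kc).map π} := by
  ext z
  constructor
  · rintro ⟨⟨⟨k, q⟩, ⟨hk, hq⟩, rfl⟩, _, ⟨⟨a, a'⟩, ⟨ha, ha'⟩, rfl⟩, _, ⟨⟨b, b'⟩, ⟨hb, hb'⟩, rfl⟩, h⟩
    simp only [← map_mul, Prod.mk_mul_mk] at h
    obtain ⟨ζ, hζ, e⟩ := (quot_eq_iff hπ).1 h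
    obtain ⟨κ, hκ, e1⟩ := D.double_coset_K hy1 h1 ha hb hζ (congrArg Prod.fst e) hk
    obtain ⟨u, hu, κ', hκ', e2⟩ := D.double_coset_Q hy2 h2 ha' hb' hζ (congrArg Prod.snd e) hq
    refine ⟨π (1, u), ⟨u, hu, rfl⟩, ?_⟩
    have e3 : π (k, q) = π (κ, u * κ') := (quot_eq_iff hπ).2 ⟨ζ, hζ, Prod.ext e1 e2⟩
    rw [e3, ← map_inv, ← map_mul]
    exact ⟨(κ, κ'), ⟨hκ, hκ'⟩, by simp⟩
  · rintro ⟨_, ⟨u, hu, rfl⟩, ⟨⟨κ, κ'⟩, ⟨hκ, hκ'⟩, e⟩⟩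
    have e : z = π (κ, u * κ') := by
      rw [eq_inv_mul_iff_mul_eq] at e
      rw [← e, MonoidHom.comp_apply, MonoidHom.inr_apply, ← map_mul]; simp
    refine ⟨⟨(κ, u * κ'), ⟨D.KcK hκ, Subgroup.mul_mem _ hu.2 (D.Kc_le_Q hκ')⟩, e.symm⟩,
      π (1, y2 * u * y2⁻¹), ⟨(1, y2 * u * y2⁻¹), ⟨Kc.one_mem, D.N0Kc (D.contract_N h2 hu.1 hu.2)⟩, rfl⟩, π (κ, κ'), ⟨_, ⟨hκ, hκ'⟩, rfl⟩, ?_⟩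
    rw [e]
    simp [← map_mul, mul_assoc]

theorem Tri.quot_relIndex (D : Tri N T L Z N0 K Kc w τ)
    (hπ : ∀ p, π p = 1 ↔ ∃ z ∈ Z, p = (z, z)) :
    ((Kc.prod Kc).map π).relIndex
      ((N ⊓ conjSub K (w * τ)).map (π.comp (MonoidHom.inr G G))) =
      N0.relIndex (N ⊓ conjSub K (w * τ)) := by
  rw [← Subgroup.relIndex_comap]
  refine relIndex_congr_left fun u hu => ?_
  constructor
  · rintro ⟨⟨k, k'⟩, ⟨hk, hk'⟩, e⟩
    obtain ⟨ζ, hζ, e'⟩ := (quot_eq_iff hπ).1 e.symm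
    have e1 : (1 : G) = ζ * k := congrArg Prod.fst e'
    have e2 : u = ζ * k' := congrArg Prod.snd e'
    have h3 : ζ ∈ Kc := by rw [eq_inv_of_mul_eq_one_left e1.symm]; exact Kc.inv_mem hk
    exact (D.KN u hu.1).1 (D.KcK (by rw [e2]; exact Kc.mul_mem h3 hk'))
  · intro h
    exact ⟨(1, u), ⟨Kc.one_mem, D.N0Kc h⟩, rfl⟩

/-- Moving `(wτ, 1)` to the other side turns the group `K` of the first factor into `Q`. Both
coordinates are then tested against the same `Q`, as the diagonal group `H₂'` requires. -/
theorem Tri.mem_support_iff (D : Tri N T L Z N0 K Kc w τ)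
    (hπ : ∀ p, π p = 1 ↔ ∃ z ∈ Z, p = (z, z)) (g1 g2 : G) :
    (∃ a ∈ (Kc.prod Kc).map π, ∃ b ∈ (K.prod (conjSub K (w * τ))).map π,
      π (g1, g2) * π (w * τ, 1) = a * (π (y1, y2) * π (τ, 1)) * b) ↔
    ∃ ζ ∈ Z, (∃ k ∈ Kc, ∃ q ∈ conjSub K (w * τ), ζ * g2 = k * y2 * q) ∧
      ∃ k ∈ Kc, ∃ q ∈ conjSub K (w * τ), ζ * g1 = k * y1 * w * q := by
  have hw : w * w = 1 := by nth_rewrite 1 [← D.ww]; group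
  constructor
  · rintro ⟨_, ⟨⟨a, a'⟩, ⟨ha, ha'⟩, rfl⟩, _, ⟨⟨b, b'⟩, ⟨hb, hb'⟩, rfl⟩, e⟩
    simp only [← map_mul, Prod.mk_mul_mk] at e
    obtain ⟨ζ, hζ, e'⟩ := (quot_eq_iff hπ).1 e
    have e1 : g1 * (w * τ) = ζ * (a * (y1 * τ) * b) := congrArg Prod.fst e'
    have e2 : g2 * 1 = ζ * (a' * (y2 * 1) * b') := congrArg Prod.snd e'
    refine ⟨ζ⁻¹, Z.inv_mem hζ, ⟨a', ha', b', hb', ?_⟩, a, ha, (w * τ) * b * (w * τ)⁻¹, ?_, ?_⟩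
    · rw [mul_one, mul_one] at e2; rw [e2]; group
    · rw [← D.wc_conj, mem_conjSub]; change b ∈ K at hb; convert hb using 1; group
    · rw [eq_mul_inv_of_mul_eq e1]
      calc _ = a * y1 * τ * b * (w * τ)⁻¹ := by group
        _ = a * y1 * (w * w) * τ * b * (w * τ)⁻¹ := by rw [hw]; group
        _ = _ := by group
  · rintro ⟨ζ, hζ, ⟨k', hk', q', hq', e2⟩, k, hk, q, hq, e1⟩
    refine ⟨π (k, k'), ⟨_, ⟨hk, hk'⟩, rfl⟩, π ((w * τ) * q * (w * τ)⁻¹, q'),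
      ⟨_, ⟨mem_conjSub.1 hq, hq'⟩, rfl⟩, ?_⟩
    simp only [← map_mul, Prod.mk_mul_mk]
    refine (quot_eq_iff hπ).2 ⟨ζ⁻¹, Z.inv_mem hζ, Prod.ext ?_ ?_⟩
    · change g1 * (w * τ) = ζ⁻¹ * (k * (y1 * τ) * ((w * τ) * q * (w * τ)⁻¹))
      rw [← D.wc_conj, eq_inv_mul_iff_mul_eq, ← mul_assoc, e1]
      have : w = w⁻¹ := D.ww.symm
      calc _ = k * y1 * w * q * (w * τ) := by group
        _ = k * y1 * w⁻¹ * q * (w * τ) := by rw [D.ww]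
        _ = _ := by group
    · change g2 * 1 = ζ⁻¹ * (k' * (y2 * 1) * q')
      rw [eq_inv_mul_iff_mul_eq, mul_one, mul_one, e2]

/-- The central factor `ζ` is absorbed in `x`, since `x` is only considered modulo the centre. -/
theorem Tri.quot_fibre (D : Tri N T L Z N0 K Kc w τ) (hy1 : y1 ∈ T) (hy2 : y2 ∈ T)
    (h1 : TDom N0 w (y1 * τ⁻¹)) (h2 : TDom N0 w (y2 * τ⁻¹))
    (hρ : ∀ g, ρ g = 1 ↔ g ∈ Z) {a b : G} (ha : a ∈ K) (hb : b ∈ K) {g1 g2 : G}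
    (hg : g1 * g2⁻¹ = a * (y1 * w * y2⁻¹) * b) :
    ∃ x0 : G, ∀ x : G, (∃ ζ ∈ Z,
      (∃ k ∈ Kc, ∃ q ∈ conjSub K (w * τ), ζ * (g2 * x) = k * y2 * q) ∧
      ∃ k ∈ Kc, ∃ q ∈ conjSub K (w * τ), ζ * (g1 * x) = k * y1 * w * q) ↔
      (ρ x0)⁻¹ * ρ x ∈ (conjSub K (w * τ)).map ρ := by
  obtain ⟨x0, hx0⟩ := D.fibre hy1 hy2 h1 h2 ha hb
  refine ⟨g2⁻¹ * x0, fun x => ?_⟩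
  rw [← map_inv, ← map_mul, Subgroup.mem_map]
  constructor
  · rintro ⟨ζ, hζ, hB, k, hk, q, hq, e⟩
    refine ⟨_, (hx0 (ζ * (g2 * x))).1 ⟨hB, k, hk, q, hq, ?_⟩, ?_⟩
    · rw [← hg, ← e, ← mul_assoc (g1 * g2⁻¹) ζ, ← D.Zc ζ hζ]; group
    · refine (quot_eq_iff' hρ).2 ⟨ζ, hζ, ?_⟩
      rw [← mul_assoc x0⁻¹ ζ, ← D.Zc ζ hζ]; group
  · rintro ⟨q, hq, e⟩
    obtain ⟨ζ, hζ, e⟩ := (quot_eq_iff' hρ).1 e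
    have e3 : x0⁻¹ * (ζ * (g2 * x)) = q := by
      rw [e, ← mul_assoc x0⁻¹ ζ, ← D.Zc ζ hζ]; group
    obtain ⟨hB, k, hk, q', hq', e'⟩ := (hx0 (ζ * (g2 * x))).2 (by rw [e3]; exact hq)
    refine ⟨ζ, hζ, hB, k, hk, q', hq', ?_⟩
    rw [← e', ← hg, ← mul_assoc (g1 * g2⁻¹) ζ, ← D.Zc ζ hζ]; group

theorem Tri.quot_mem_of_support (D : Tri N T L Z N0 K Kc w τ) (hy1 : y1 ∈ T)
    (h1 : TDom N0 w (y1 * τ⁻¹)) (h2 : TDom N0 w (y2 * τ⁻¹)) {g1 g2 : G}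
    (h : ∃ ζ ∈ Z, (∃ k ∈ Kc, ∃ q ∈ conjSub K (w * τ), ζ * g2 = k * y2 * q) ∧
      ∃ k ∈ Kc, ∃ q ∈ conjSub K (w * τ), ζ * g1 = k * y1 * w * q) :
    ∃ a ∈ K, ∃ b ∈ K, g1 * g2⁻¹ = a * (y1 * w * y2⁻¹) * b := by
  obtain ⟨ζ, hζ, ⟨k', hk', q', hq', e'⟩, k, hk, q, hq, e⟩ := h
  obtain ⟨a, ha, b, hb, h⟩ := D.quot_mem hy1 h1 h2 hk hk' hq hq'
  refine ⟨a, ha, b, hb, ?_⟩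
  rw [← h, ← e, ← e', mul_inv_rev]
  calc g1 * g2⁻¹ = ζ * (g1 * g2⁻¹) * ζ⁻¹ := by rw [D.Zc ζ hζ]; group
    _ = _ := by group

theorem relIndex_map_prod_left (hπ : ∀ p, π p = 1 ↔ ∃ z ∈ Z, p = (z, z)) {K GO Q : Subgroup G}
    (hZ : ∀ z ∈ Z, z ∈ Q → z ∈ K) :
    ((K.prod Q).map π).relIndex ((GO.prod Q).map π) = K.relIndex GO := by
  rw [← Subgroup.relIndex_comap]
  rw [relIndex_congr_left (H' := K.prod Q), relIndex_prod, Subgroup.relIndex_self, mul_one]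
  rintro ⟨g, q⟩ ⟨hg, hq⟩
  constructor
  · rintro ⟨⟨k, q'⟩, ⟨hk, hq'⟩, e⟩
    obtain ⟨ζ, hζ, e'⟩ := (quot_eq_iff hπ).1 e.symm
    have e1 : g = ζ * k := congrArg Prod.fst e'
    have e2 : q = ζ * q' := congrArg Prod.snd e'
    refine ⟨?_, hq⟩
    change g ∈ K
    rw [e1]
    refine K.mul_mem (hZ ζ hζ ?_) hk
    rw [eq_mul_inv_of_mul_eq e2.symm]
    exact Q.mul_mem hq (Q.inv_mem hq')
  · intro h
    exact ⟨_, h, rfl⟩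

/-- A central ambiguity in the second coordinate can be undone in the first one, because a central
element of `U` lies in `GO`. -/
theorem relIndex_map_prod_right (hπ : ∀ p, π p = 1 ↔ ∃ z ∈ Z, p = (z, z))
    (hρ : ∀ g, ρ g = 1 ↔ g ∈ Z) {GO U V : Subgroup G} (hVU : V ≤ U)
    (hZ : ∀ z ∈ Z, z ∈ U → z ∈ GO) :
    ((GO.prod V).map π).relIndex ((GO.prod U).map π) = (V.map ρ).relIndex (U.map ρ) := by
  rw [← Subgroup.relIndex_comap, ← Subgroup.relIndex_comap]
  rw [relIndex_congr_left (H' := (⊤ : Subgroup G).prod ((V.map ρ).comap ρ)), relIndex_prod,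
    Subgroup.relIndex_top_left, one_mul]
  rintro ⟨g, u⟩ ⟨hg, hu⟩
  constructor
  · rintro ⟨⟨g', v⟩, ⟨hg', hv⟩, e⟩
    obtain ⟨ζ, hζ, e'⟩ := (quot_eq_iff hπ).1 e.symm
    exact ⟨trivial, v, hv, ((quot_eq_iff' hρ).2 ⟨ζ, hζ, congrArg Prod.snd e'⟩).symm⟩
  · rintro ⟨-, v, hv, e⟩
    obtain ⟨ζ, hζ, e'⟩ := (quot_eq_iff' hρ).1 e.symm
    change u = ζ * v at e'
    have hζU : ζ ∈ U := by
      rw [eq_mul_inv_of_mul_eq e'.symm]; exact U.mul_mem hu (U.inv_mem (hVU hv))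
    refine ⟨(ζ⁻¹ * g, v), ⟨GO.mul_mem (GO.inv_mem (hZ ζ hζ hζU)) hg, hv⟩, ?_⟩
    exact ((quot_eq_iff hπ).2 ⟨ζ, hζ, Prod.ext (by simp) e'⟩).symm

end AbstractQuotient

/-! ### Topology of the groups -/

theorem weaklyLocallyCompact_of_isOpen {G : Type*} [Group G] [TopologicalSpace G]
    [IsTopologicalGroup G] {U : Set G} (ho : IsOpen U) (hc : IsCompact U) (h1 : (1 : G) ∈ U) :
    WeaklyLocallyCompactSpace G where
  exists_compact_mem_nhds x := by
    refine ⟨(fun u => x * u) '' U, hc.image (continuous_const_mul x), ?_⟩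
    exact ((isOpenMap_mul_left x) U ho).mem_nhds ⟨1, h1, mul_one x⟩

theorem relIndex_ne_zero_of_isOpen {G : Type*} [Group G] [TopologicalSpace G]
    [IsTopologicalGroup G] {U V : Subgroup G} (hV : IsOpen (V : Set G))
    (hU : IsCompact (U : Set G)) : V.relIndex U ≠ 0 := by
  have : CompactSpace U := isCompact_iff_compactSpace.1 hU
  have ho : IsOpen ((V.subgroupOf U : Subgroup U) : Set U) := hV.preimage continuous_subtype_val
  have := Subgroup.quotient_finite_of_isOpen (V.subgroupOf U) ho
  exact Subgroup.index_ne_zero_of_finite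

section Top

variable {F : Type*} [NontriviallyNormedField F] {ν n : ℕ}

instance instTopGroupGp (n : ℕ) : IsTopologicalGroup (Gp n F) :=
  inferInstanceAs (IsTopologicalGroup ((G0 n F × G0 n F) ⧸ ZZ n F))

instance instTopGroupH2 (n : ℕ) : IsTopologicalGroup (H2 n F) :=
  inferInstanceAs (IsTopologicalGroup (G0 n F ⧸ Z0 n F))

theorem continuous_mkGp : Continuous (mkGp (F := F) (n := n)) := QuotientGroup.continuous_mk

theorem isOpenMap_mkGp : IsOpenMap (mkGp (F := F) (n := n)) := QuotientGroup.isOpenMap_coe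

theorem continuous_mkH2 : Continuous (mkH2 (F := F) (n := n)) := QuotientGroup.continuous_mk

theorem isOpenMap_mkH2 : IsOpenMap (mkH2 (F := F) (n := n)) := QuotientGroup.isOpenMap_coe

theorem mkGp_surjective : Function.Surjective (mkGp (F := F) (n := n)) :=
  QuotientGroup.mk'_surjective _

theorem mkH2_surjective : Function.Surjective (mkH2 (F := F) (n := n)) :=
  QuotientGroup.mk'_surjective _

theorem mkGp_eq_one (p : G0 n F × G0 n F) : mkGp p = 1 ↔ ∃ z ∈ Z0 n F, p = (z, z) := by
  have : mkGp p = 1 ↔ p ∈ ZZ n F := QuotientGroup.eq_one_iff p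
  rw [this]
  constructor
  · rintro ⟨z, rfl⟩; exact ⟨_, ⟨z, rfl⟩, rfl⟩
  · rintro ⟨_, ⟨z, rfl⟩, rfl⟩; exact ⟨z, rfl⟩

theorem mkH2_eq_one (g : G0 n F) : mkH2 g = 1 ↔ g ∈ Z0 n F := QuotientGroup.eq_one_iff g

theorem j2_mk (x : G0 n F) : j2 (mkH2 x) = mkGp (x, x) := rfl

theorem continuous_j2 : Continuous (j2 (F := F) (n := n)) := by
  have hq : Topology.IsQuotientMap (mkH2 (F := F) (n := n)) :=
    QuotientGroup.isQuotientMap_mk (N := Z0 n F)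
  rw [hq.continuous_iff]
  exact continuous_mkGp.comp (continuous_id.prodMk continuous_id)

theorem continuous_entry (i j : Fin ν) : Continuous fun g : GL (Fin ν) F => g.1 i j :=
  Units.continuous_val.matrix_elem i j

theorem continuous_inv_entry (i j : Fin ν) : Continuous fun g : GL (Fin ν) F => (g⁻¹).1 i j :=
  (continuous_entry i j).comp continuous_inv

theorem continuous_GL_iff {X : Type*} [TopologicalSpace X] {f : X → GL (Fin ν) F} :
    Continuous f ↔ (∀ i j, Continuous fun x => (f x).1 i j) ∧
      ∀ i j, Continuous fun x => ((f x)⁻¹).1 i j := by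
  constructor
  · exact fun h => ⟨fun i j => (continuous_entry i j).comp h,
      fun i j => (continuous_inv_entry i j).comp h⟩
  · rintro ⟨h1, h2⟩
    rw [Units.continuous_iff]
    exact ⟨continuous_pi fun i => continuous_pi fun j => h1 i j,
      continuous_pi fun i => continuous_pi fun j => h2 i j⟩

theorem continuous_embGL : Continuous (embGL (F := F) (n := n)) := by
  rw [continuous_GL_iff]
  constructor
  · intro i j
    refine Fin.lastCases ?_ (fun i => ?_) i <;> refine Fin.lastCases ?_ (fun j => ?_) j
    · simp [embGL, blockGL, continuous_const]
    · simp [embGL, blockGL, continuous_const]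
    · simp [embGL, blockGL, continuous_const]
    · simpa [embGL, blockGL] using continuous_entry i j
  · intro i j
    change Continuous fun g : GL (Fin n) F =>
      ((Matrix.fromBlocks (g⁻¹).1 (-((g⁻¹).1 * 0)) 0 1).submatrix
      finSumFinEquiv.symm finSumFinEquiv.symm) i j
    refine Fin.lastCases ?_ (fun i => ?_) i <;> refine Fin.lastCases ?_ (fun j => ?_) j
    · simp [continuous_const]
    · simp [continuous_const]
    · simp [continuous_const]
    · simpa using continuous_inv_entry i j

theorem continuous_j0 : Continuous (j0 (F := F) (n := n)) :=
  continuous_id.prodMk continuous_embGL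

theorem continuous_j1 : Continuous (j1 (F := F) (n := n)) :=
  continuous_mkGp.comp ((continuous_j0.comp continuous_fst).prodMk
    (continuous_j0.comp continuous_snd))

variable [IsUltrametricDist F]

theorem isOpen_GLO : IsOpen (GLO F ν) := by
  have hb : IsOpen {x : F | ‖x‖ ≤ 1} := by
    have := IsUltrametricDist.isOpen_closedBall (0 : F) one_ne_zero
    convert this using 1
    ext x; simp
  have e : GLO F ν = (⋂ i, ⋂ j, {g : GL (Fin ν) F | ‖g.1 i j‖ ≤ 1}) ∩
      ⋂ i, ⋂ j, {g : GL (Fin ν) F | ‖(g⁻¹).1 i j‖ ≤ 1} := by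
    ext g; simp [GLO]
  rw [e]
  refine IsOpen.inter ?_ ?_
  · exact isOpen_iInter_of_finite fun i => isOpen_iInter_of_finite fun j =>
      hb.preimage (continuous_entry i j)
  · exact isOpen_iInter_of_finite fun i => isOpen_iInter_of_finite fun j =>
      hb.preimage (continuous_inv_entry i j)

theorem isOpen_GLOs : IsOpen (GLOs F ν : Set (GL (Fin ν) F)) := isOpen_GLO

variable [LocallyCompactSpace F]

theorem isCompact_GLO : IsCompact (GLO F ν) := by
  have : ProperSpace F := ProperSpace.of_locallyCompactSpace F
  let B : Set (Matrix (Fin ν) (Fin ν) F) := Set.pi Set.univ fun _ => Set.pi Set.univ fun _ =>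
    Metric.closedBall 0 1
  have hB : IsCompact B := isCompact_univ_pi fun _ => isCompact_univ_pi fun _ =>
    isCompact_closedBall _ _
  have hBB : IsCompact (B ×ˢ (MulOpposite.op '' B)) :=
    hB.prod (hB.image MulOpposite.continuous_op)
  have hcl : Topology.IsClosedEmbedding (Units.embedProduct (Matrix (Fin ν) (Fin ν) F)) := by
    refine ⟨Units.isEmbedding_embedProduct, ?_⟩
    have : Set.range (Units.embedProduct (Matrix (Fin ν) (Fin ν) F)) =
        {p | p.1 * p.2.unop = 1 ∧ p.2.unop * p.1 = 1} := by
      ext ⟨a, b⟩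
      constructor
      · rintro ⟨u, hu⟩
        rw [← hu]
        simp
      · rintro ⟨h1, h2⟩
        exact ⟨⟨a, b.unop, h1, h2⟩, rfl⟩
    rw [this]
    refine IsClosed.inter ?_ ?_
    · exact isClosed_eq (by fun_prop) continuous_const
    · exact isClosed_eq (by fun_prop) continuous_const
  have := hcl.isCompact_preimage hBB
  convert this using 1
  ext g
  constructor
  · rintro ⟨h1, h2⟩
    exact ⟨fun i _ j _ => mem_closedBall_zero_iff.2 (h1 i j), (g⁻¹).1,
      fun i _ j _ => mem_closedBall_zero_iff.2 (h2 i j), rfl⟩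
  · rintro ⟨h1, b, hb, e⟩
    have hbg : b = (g⁻¹).1 := MulOpposite.op_injective e
    subst hbg
    exact ⟨fun i j => mem_closedBall_zero_iff.1 (h1 i trivial j trivial),
      fun i j => mem_closedBall_zero_iff.1 (hb i trivial j trivial)⟩

theorem isCompact_GLOs : IsCompact (GLOs F ν : Set (GL (Fin ν) F)) := isCompact_GLO

theorem secondCountable_GL : SecondCountableTopology (GL (Fin ν) F) := by
  have : ProperSpace F := ProperSpace.of_locallyCompactSpace F
  have : SecondCountableTopology F := secondCountable_of_proper
  have : SecondCountableTopology (Matrix (Fin ν) (Fin ν) F) :=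
    inferInstanceAs (SecondCountableTopology (Fin ν → Fin ν → F))
  have : SecondCountableTopology (Matrix (Fin ν) (Fin ν) F)ᵐᵒᵖ :=
    MulOpposite.opHomeomorph.symm.isInducing.secondCountableTopology
  exact Units.isInducing_embedProduct.secondCountableTopology

theorem weaklyLocallyCompact_GL : WeaklyLocallyCompactSpace (GL (Fin ν) F) :=
  weaklyLocallyCompact_of_isOpen isOpen_GLO isCompact_GLO (GLOs F ν).one_mem

variable (n F) in
/-- `GL_n(𝒪₀) × GL_{n+1}(𝒪₀)` as a subgroup. -/
def GO0 : Subgroup (G0 n F) := (GLOs F n).prod (GLOs F (n + 1))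

theorem isOpen_GO0 : IsOpen (GO0 F n : Set (G0 n F)) := isOpen_GLO.prod isOpen_GLO

theorem isCompact_GO0 : IsCompact (GO0 F n : Set (G0 n F)) := isCompact_GLO.prod isCompact_GLO

theorem secondCountable_H2 : SecondCountableTopology (H2 n F) := by
  have : SecondCountableTopology (GL (Fin n) F) := secondCountable_GL
  have : SecondCountableTopology (GL (Fin (n + 1)) F) := secondCountable_GL
  exact inferInstanceAs (SecondCountableTopology (G0 n F ⧸ Z0 n F))

theorem weaklyLocallyCompact_H2 : WeaklyLocallyCompactSpace (H2 n F) := by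
  refine weaklyLocallyCompact_of_isOpen (isOpenMap_mkH2 _ (isOpen_GO0 (F := F) (n := n)))
    (isCompact_GO0.image continuous_mkH2) ⟨1, (GO0 F n).one_mem, map_one _⟩

end Top

theorem isOpen_of_right_invariant {G : Type*} [Group G] [TopologicalSpace G]
    [IsTopologicalGroup G] {B : Subgroup G} (hB : IsOpen (B : Set G)) {S : Set G}
    (hS : ∀ x ∈ S, ∀ b ∈ B, x * b ∈ S) : IsOpen S := by
  refine isOpen_iff_mem_nhds.2 fun x hx => ?_
  refine Filter.mem_of_superset (((isOpenMap_mul_left x) _ hB).mem_nhds ⟨1, B.one_mem, mul_one x⟩) ?_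
  rintro _ ⟨b, hb, rfl⟩
  exact hS x hx b hb

theorem isClopen_of_right_invariant {G : Type*} [Group G] [TopologicalSpace G]
    [IsTopologicalGroup G] {B : Subgroup G} (hB : IsOpen (B : Set G)) {S : Set G}
    (hS : ∀ x ∈ S, ∀ b ∈ B, x * b ∈ S) : IsClopen S := by
  refine ⟨⟨isOpen_of_right_invariant hB fun x hx b hb h => hx ?_⟩, isOpen_of_right_invariant hB hS⟩
  simpa using hS _ h _ (B.inv_mem hb)

theorem isClopen_double_coset {G : Type*} [Group G] [TopologicalSpace G]
    [IsTopologicalGroup G] {A B : Subgroup G} (hB : IsOpen (B : Set G)) (y : G) :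
    IsClopen {x | ∃ a ∈ A, ∃ b ∈ B, x = a * y * b} := by
  refine isClopen_of_right_invariant hB ?_
  rintro _ ⟨a, ha, b, hb, rfl⟩ b' hb'
  exact ⟨a, ha, b * b', B.mul_mem hb hb', by group⟩

theorem isOpen_conjSub {G : Type*} [Group G] [TopologicalSpace G] [IsTopologicalGroup G]
    {K : Subgroup G} (hK : IsOpen (K : Set G)) (g : G) : IsOpen (conjSub K g : Set G) := by
  have e : (conjSub K g : Set G) = (fun x => g * x * g⁻¹) ⁻¹' (K : Set G) := by
    ext x; exact mem_conjSub
  rw [e]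
  exact hK.preimage (by fun_prop)

theorem isCompact_conjSub {G : Type*} [Group G] [TopologicalSpace G] [IsTopologicalGroup G]
    {K : Subgroup G} (hK : IsCompact (K : Set G)) (g : G) : IsCompact (conjSub K g : Set G) := by
  have e : (conjSub K g : Set G) = (fun x => g⁻¹ * x * g) '' (K : Set G) := by
    ext x
    constructor
    · intro h; exact ⟨_, mem_conjSub.1 h, by group⟩
    · rintro ⟨k, hk, rfl⟩
      refine mem_conjSub.2 ?_
      change k ∈ K at hk
      convert hk using 1; group
  rw [e]
  exact hK.image (by fun_prop)

/-! ### The test measure as a multiple of an indicator function -/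

section TestFunction

variable {F : Type*} [NontriviallyNormedField F] [IsUltrametricDist F] [LocallyCompactSpace F]
  {ϖ : Fˣ} {ν n c : ℕ}

theorem isOpen_KangleS (hϖ : IsUniformizer ϖ) :
    IsOpen (KangleS ν hϖ c : Set (GL (Fin ν) F)) := by
  have e : (KangleS ν hϖ c : Set (GL (Fin ν) F)) = (KroundS ν ϖ c : Set (GL (Fin ν) F)) ∩
      ⋂ i, {g | ‖g.1 i i - 1‖ ≤ ‖(ϖ : F)‖ ^ (c - 1)} := by
    ext g
    simp only [Set.mem_inter_iff, Set.mem_iInter, SetLike.mem_coe, mem_KroundS]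
    rfl
  rw [e]
  refine (isOpen_GLOs.inter (isOpen_conjSub isOpen_GLOs _)).inter
    (isOpen_iInter_of_finite fun i => ?_)
  have := (IsUltrametricDist.isOpen_closedBall (1 : F)
    (pow_pos (norm_pos_unif ϖ) (c - 1)).ne').preimage (continuous_entry (ν := ν) i i)
  convert this using 1
  ext g
  simp [dist_eq_norm]

theorem isCompact_of_csdi {K : Subgroup (GL (Fin ν) F)} (hK : IsCSDIComponent ϖ c K) :
    IsCompact (K : Set (GL (Fin ν) F)) :=
  isCompact_GLO.of_isClosed_subset (Subgroup.isClosed_of_isOpen K hK.1.1)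
    fun _ hg => (hK.1.2.1 hg).1

variable {Kn : Subgroup (GL (Fin n) F)} {Kn1 : Subgroup (GL (Fin (n + 1)) F)}
  (hKn : IsCSDIComponent ϖ c Kn) (hKn1 : IsCSDIComponent ϖ c Kn1)

theorem isOpen_K0 (hKn : IsCSDIComponent ϖ c Kn) (hKn1 : IsCSDIComponent ϖ c Kn1) :
    IsOpen (K0 Kn Kn1 : Set (G0 n F)) := hKn.1.1.prod hKn1.1.1

theorem isCompact_K0 (hKn : IsCSDIComponent ϖ c Kn) (hKn1 : IsCSDIComponent ϖ c Kn1) :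
    IsCompact (K0 Kn Kn1 : Set (G0 n F)) := (isCompact_of_csdi hKn).prod (isCompact_of_csdi hKn1)

theorem K0_le_GO0 (hKn : IsCSDIComponent ϖ c Kn) (hKn1 : IsCSDIComponent ϖ c Kn1) :
    K0 Kn Kn1 ≤ GO0 F n := fun _ h => ⟨(hKn.1.2.1 h.1).1, (hKn1.1.2.1 h.2).1⟩

variable (ϖ c Kn Kn1) in
/-- The group `K₀^{w_{0,c}}`. -/
def Qs : Subgroup (G0 n F) := conjSub (K0 Kn Kn1) (wc0 ϖ n c)

variable (ϖ c Kn Kn1) in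
/-- The index `[N ∩ K₀^{w_{0,c}} : N(𝒪₀)]`. -/
noncomputable def iotaIdx : ℕ := (NO0 F n).relIndex (N00 F n ⊓ Qs ϖ c Kn Kn1)

theorem isOpen_KCS (hKn : IsCSDIComponent ϖ c Kn) (hKn1 : IsCSDIComponent ϖ c Kn1) :
    IsOpen (KCS ϖ c Kn Kn1 : Set (Gp n F)) := by
  rw [KCS, Subgroup.coe_map]
  exact isOpenMap_mkGp _ ((isOpen_K0 hKn hKn1).prod (isOpen_conjSub (isOpen_K0 hKn hKn1) _))

theorem isCompact_KCS (hKn : IsCSDIComponent ϖ c Kn) (hKn1 : IsCSDIComponent ϖ c Kn1) :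
    IsCompact (KCS ϖ c Kn Kn1 : Set (Gp n F)) := by
  rw [KCS, Subgroup.coe_map]
  exact ((isCompact_K0 hKn hKn1).prod (isCompact_conjSub (isCompact_K0 hKn hKn1) _)).image
    continuous_mkGp

variable (n c) in
/-- The image of `K^{⟨c⟩} × K^{⟨c⟩}` in `G'`. -/
def Kcb (hϖ : IsUniformizer ϖ) : Subgroup (Gp n F) :=
  ((Kc0 hϖ c n).prod (Kc0 hϖ c n)).map mkGp

theorem coe_Kcb (hϖ : IsUniformizer ϖ) : (Kcb n c hϖ : Set (Gp n F)) = KangleGp ϖ n c := rfl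

theorem isOpen_Kcb (hϖ : IsUniformizer ϖ) : IsOpen (Kcb n c hϖ : Set (Gp n F)) := by
  rw [Kcb, Subgroup.coe_map]
  have : IsOpen (Kc0 hϖ c n : Set (G0 n F)) := (isOpen_KangleS hϖ).prod (isOpen_KangleS hϖ)
  exact isOpenMap_mkGp _ (this.prod this)

/-- The element `t'_i t₀^{-s}`. -/
def yel (ϖ : Fˣ) (s : ℕ) (a : T0 n F) : G0 n F := diag0 (a / tVec0 ϖ n ^ s)

theorem yel_mul (s c : ℕ) (a : T0 n F) :
    yel ϖ s a * (t0 ϖ n ^ c)⁻¹ = diag0 (a / tVec0 ϖ n ^ (s + c)) := by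
  have h : ∀ (ν : ℕ) (b : Fin ν → Fˣ), diagGL (b / tVec ϖ ν ^ s) * (tGL ϖ ν ^ c)⁻¹ =
      diagGL (b / tVec ϖ ν ^ (s + c)) := fun ν b => by
    rw [tGL_pow, ← diagGL_inv, ← diagGL_mul]
    congr 1
    rw [pow_add, div_mul_eq_div_div, ← div_eq_mul_inv]
  exact Prod.ext (h _ _) (h _ _)

theorem yel_mem (s : ℕ) (a : T0 n F) : yel ϖ s a ∈ T00 F n := diag0_mem_T00 _

theorem SuffPos.tDom {t' : T0 n F × T0 n F} {s : ℕ} (hs : SuffPos ϖ c Kn Kn1 t' s) :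
    TDom (NO0 F n) (w0 n F) (yel ϖ s t'.1 * (t0 ϖ n ^ c)⁻¹) ∧
    TDom (NO0 F n) (w0 n F) (yel ϖ s t'.2 * (t0 ϖ n ^ c)⁻¹) := by
  rw [yel_mul, yel_mul]
  exact ⟨tDom_diag0 hs.2.1.1 hs.2.1.2, tDom_diag0 hs.2.2.1 hs.2.2.2⟩

variable (ϖ c Kn Kn1) in
/-- The condition that `[g₁; g₂]` lies in the support of the test measure. -/
def InSupp (hϖ : IsUniformizer ϖ) (t' : T0 n F × T0 n F) (s : ℕ) (g1 g2 : G0 n F) : Prop :=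
  ∃ ζ ∈ Z0 n F,
    (∃ k ∈ Kc0 hϖ c n, ∃ q ∈ Qs ϖ c Kn Kn1, ζ * ((m0s ϖ n s)⁻¹ * g2) = k * yel ϖ s t'.2 * q) ∧
    ∃ k ∈ Kc0 hϖ c n, ∃ q ∈ Qs ϖ c Kn Kn1,
      ζ * ((m0s ϖ n s)⁻¹ * g1) = k * yel ϖ s t'.1 * w0 n F * q

variable (ϖ c Kn Kn1) in
/-- The support of the test measure. -/
def suppSet (hϖ : IsUniformizer ϖ) (t' : T0 n F × T0 n F) (s : ℕ) : Set (Gp n F) :=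
  {x | ∃ a ∈ Kcb n c hϖ, ∃ b ∈ KCS ϖ c Kn Kn1,
    (mkGp (m0s ϖ n s, m0s ϖ n s))⁻¹ * x * mkGp (wc0 ϖ n c, 1) =
      a * (mkGp (yel ϖ s t'.1, yel ϖ s t'.2) * mkGp (t0 ϖ n ^ c, 1)) * b}

theorem mem_suppSet_iff (hϖ : IsUniformizer ϖ) (hKn : IsCSDIComponent ϖ c Kn)
    (hKn1 : IsCSDIComponent ϖ c Kn1) (t' : T0 n F × T0 n F) (s : ℕ) (g1 g2 : G0 n F) :
    mkGp (g1, g2) ∈ suppSet ϖ c Kn Kn1 hϖ t' s ↔ InSupp ϖ c Kn Kn1 hϖ t' s g1 g2 := by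
  have h := (triG0 hϖ hKn hKn1).mem_support_iff (π := mkGp) mkGp_eq_one
    (y1 := yel ϖ s t'.1) (y2 := yel ϖ s t'.2) ((m0s ϖ n s)⁻¹ * g1) ((m0s ϖ n s)⁻¹ * g2)
  rw [InSupp]
  refine Iff.trans ?_ h
  rw [suppSet, Set.mem_ofPred_eq, ← map_inv, ← map_mul]
  exact Iff.rfl

theorem isClopen_suppSet (hϖ : IsUniformizer ϖ) (hKn : IsCSDIComponent ϖ c Kn)
    (hKn1 : IsCSDIComponent ϖ c Kn1) (t' : T0 n F × T0 n F) (s : ℕ) :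
    IsClopen (suppSet ϖ c Kn Kn1 hϖ t' s) :=
  (isClopen_double_coset (A := Kcb n c hϖ) (isOpen_KCS hKn hKn1)
    (mkGp (yel ϖ s t'.1, yel ϖ s t'.2) * mkGp (t0 ϖ n ^ c, 1))).preimage (f := fun x =>
    (mkGp (m0s ϖ n s, m0s ϖ n s))⁻¹ * x * mkGp (wc0 ϖ n c, 1)) (by fun_prop)

variable (ϖ c Kn Kn1) in
/-- The value of the test measure on its support. -/
noncomputable def suppVal (μ : Measure (Gp n F)) (s : ℕ) : ℂ :=
  (q0 ϖ : ℂ) ^ ((dn n : ℤ) * (2 * s - c)) *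
    ((iotaIdx ϖ c Kn Kn1 : ℂ) / (μ.real (KCS ϖ c Kn Kn1 : Set (Gp n F)) : ℂ))

/-- `conv_hecke` applies with the image of `K^{⟨c⟩} × K^{⟨c⟩}` as the small group. Its hypotheses
are `quot_push` and `quot_single`. -/
theorem testMeasure_eq (hϖ : IsUniformizer ϖ) (hKn : IsCSDIComponent ϖ c Kn)
    (hKn1 : IsCSDIComponent ϖ c Kn1) {t' : T0 n F × T0 n F} {s : ℕ}
    (hs : SuffPos ϖ c Kn Kn1 t' s) (μ : Measure (Gp n F)) [μ.IsHaarMeasure]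
    (hi : iotaIdx ϖ c Kn Kn1 ≠ 0) :
    testMeasure ϖ c Kn Kn1 t' μ s =
      (suppSet ϖ c Kn Kn1 hϖ t' s).indicator fun _ => suppVal ϖ c Kn Kn1 μ s := by
  have D := triG0 hϖ hKn hKn1
  obtain ⟨h1, h2⟩ := hs.tDom
  have hKo := isOpen_KCS hKn hKn1
  have hAo := isOpen_Kcb (n := n) (c := c) hϖ
  have hK0 : μ (KCS ϖ c Kn Kn1 : Set (Gp n F)) ≠ 0 :=
    (hKo.measure_pos μ ⟨1, Subgroup.one_mem _⟩).ne'
  have hKtop := (isCompact_KCS hKn hKn1).measure_lt_top (μ := μ) |>.ne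
  have hAK : Kcb n c hϖ ≤ KCS ϖ c Kn Kn1 := by
    rintro _ ⟨p, hp, rfl⟩
    exact ⟨p, ⟨D.KcK hp.1, D.Kc_le_Q hp.2⟩, rfl⟩
  have hA0 : μ (Kcb n c hϖ : Set (Gp n F)) ≠ 0 :=
    (hAo.measure_pos μ ⟨1, Subgroup.one_mem _⟩).ne'
  have hAtop : μ (Kcb n c hϖ : Set (Gp n F)) ≠ ⊤ :=
    ((measure_mono hAK).trans_lt hKtop.lt_top).ne
  have key := conv_hecke (μ := μ) hAK hKo.measurableSet
    (y := mkGp (yel ϖ s t'.1, yel ϖ s t'.2)) (τ := mkGp (t0 ϖ n ^ c, 1))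
    (isClopen_double_coset hAo _).2.measurableSet (isClopen_double_coset hKo _).2.measurableSet
    (isClopen_double_coset hKo _).2.measurableSet hK0 hKtop
    (D.quot_push (π := mkGp) h1) (D.quot_single (yel_mem s t'.1) h1 mkGp_eq_one)
  have hset := D.quot_double (π := mkGp) (yel_mem s t'.1) (yel_mem s t'.2) h1 h2 mkGp_eq_one
  have hidx := D.quot_relIndex (π := mkGp) mkGp_eq_one
  have hm := measure_mul_subgroup (μ := μ) hAo.measurableSet
    (M := (N00 F n ⊓ Qs ϖ c Kn Kn1).map (mkGp.comp (MonoidHom.inr _ _)))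
    (by rw [Kcb, Qs, ← w0_mul_t0, hidx]; exact hi)
  -- The volume is `[N ∩ Q : N(𝒪₀)]` times that of the small group, by `quot_double`. The latter
  -- cancels, so the value does not depend on the choice of the small group.
  have hval : (μ.real {z | z ∈ KCS ϖ c Kn Kn1 ∧ ∃ a ∈ Kcb n c hϖ, ∃ b ∈ Kcb n c hϖ,
      mkGp (yel ϖ s t'.1, yel ϖ s t'.2) * z = a * mkGp (yel ϖ s t'.1, yel ϖ s t'.2) * b} : ℂ) /
      (μ.real (Kcb n c hϖ : Set (Gp n F)) * μ.real (KCS ϖ c Kn Kn1 : Set (Gp n F))) =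
      (iotaIdx ϖ c Kn Kn1 : ℂ) / (μ.real (KCS ϖ c Kn Kn1 : Set (Gp n F)) : ℂ) := by
    have e1 : {z | z ∈ KCS ϖ c Kn Kn1 ∧ ∃ a ∈ Kcb n c hϖ, ∃ b ∈ Kcb n c hϖ,
      mkGp (yel ϖ s t'.1, yel ϖ s t'.2) * z = a * mkGp (yel ϖ s t'.1, yel ϖ s t'.2) * b} =
      {g | ∃ m ∈ (N00 F n ⊓ Qs ϖ c Kn Kn1).map (mkGp.comp (MonoidHom.inr _ _)),
        m⁻¹ * g ∈ Kcb n c hϖ} := hset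
    have e2 : (Kcb n c hϖ).relIndex
        ((N00 F n ⊓ Qs ϖ c Kn Kn1).map (mkGp.comp (MonoidHom.inr _ _))) =
        iotaIdx ϖ c Kn Kn1 := hidx
    rw [e1, Measure.real, hm, e2, ENNReal.toReal_mul, ENNReal.toReal_natCast, ← Measure.real]
    have hAr : (μ.real (Kcb n c hϖ : Set (Gp n F)) : ℂ) ≠ 0 := by
      rw [Ne, Complex.ofReal_eq_zero, Measure.real, ENNReal.toReal_eq_zero_iff]
      tauto
    push_cast
    rw [mul_comm, mul_div_mul_left _ _ hAr]
  rw [hval, coe_Kcb] at key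
  funext x
  rw [testMeasure]
  change _ * conv μ (conv μ (heckeOp μ (KangleGp ϖ n c)
    (mkGp (yel ϖ s t'.1, yel ϖ s t'.2))) (eK μ (KCS ϖ c Kn Kn1)))
      (heckeOp μ (KCS ϖ c Kn Kn1) (mkGp (t0 ϖ n ^ c, 1))) _ = _
  have key' := congrFun key ((mkGp (m0s ϖ n s, m0s ϖ n s))⁻¹ * x * mkGp (wc0 ϖ n c, 1))
  refine (congrArg _ key').trans ?_
  by_cases hx : x ∈ suppSet ϖ c Kn Kn1 hϖ t' s
  · rw [Set.indicator_of_mem hx, Set.indicator_of_mem (by exact hx), suppVal]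
  · rw [Set.indicator_of_notMem hx, Set.indicator_of_notMem (by exact hx), mul_zero]

end TestFunction

/-! ### Comparison of Haar measures on `G'` and `H₂'` -/

section Volume

variable {F : Type*} [NontriviallyNormedField F] [IsUltrametricDist F] [LocallyCompactSpace F]
  {ϖ : Fˣ} {n c : ℕ} {Kn : Subgroup (GL (Fin n) F)} {Kn1 : Subgroup (GL (Fin (n + 1)) F)}

theorem isOpen_map_mkGp {U V : Subgroup (G0 n F)} (hU : IsOpen (U : Set (G0 n F)))
    (hV : IsOpen (V : Set (G0 n F))) : IsOpen ((U.prod V).map mkGp : Set (Gp n F)) := by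
  rw [Subgroup.coe_map]; exact isOpenMap_mkGp _ (hU.prod hV)

theorem isOpen_map_mkH2 {U : Subgroup (G0 n F)} (hU : IsOpen (U : Set (G0 n F))) :
    IsOpen (U.map mkH2 : Set (H2 n F)) := by
  rw [Subgroup.coe_map]; exact isOpenMap_mkH2 _ hU

theorem isCompact_map_mkH2 {U : Subgroup (G0 n F)} (hU : IsCompact (U : Set (G0 n F))) :
    IsCompact (U.map mkH2 : Set (H2 n F)) := by
  rw [Subgroup.coe_map]; exact hU.image continuous_mkH2

/-- Volumes of images in `G'` and in `H₂'` agree. -/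
theorem measure_prod_eq (μG : Measure (Gp n F)) [μG.IsHaarMeasure]
    (hμG : μG (mkGp '' (G0O n F ×ˢ G0O n F)) = 1)
    (μH : Measure (H2 n F)) [μH.IsHaarMeasure] (hμH : μH (mkH2 '' G0O n F) = 1)
    {U : Subgroup (G0 n F)} (hU : IsOpen (U : Set (G0 n F))) (hUc : IsCompact (U : Set (G0 n F)))
    (hZ : ∀ z ∈ Z0 n F, z ∈ U → z ∈ GO0 F n) :
    μG (((GO0 F n).prod U).map mkGp : Set (Gp n F)) = μH (U.map mkH2 : Set (H2 n F)) := by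
  -- The groups `GO` and `U` need not be comparable, so both are compared with their intersection.
  -- Passing from `V` to `GO` fixes the common volume by the normalizations; passing from `V` to `U`
  -- multiplies both sides by the same index.
  set V := GO0 F n ⊓ U with hVdef
  have hV : IsOpen (V : Set (G0 n F)) := isOpen_GO0.inter hU
  have hGO := isOpen_GO0 (F := F) (n := n)
  have hGOc := isCompact_GO0 (F := F) (n := n)
  have step : ∀ W : Subgroup (G0 n F), IsCompact (W : Set (G0 n F)) → V ≤ W →
      (∀ z ∈ Z0 n F, z ∈ W → z ∈ GO0 F n) →
      ∃ r : ℕ, r ≠ 0 ∧ μG (((GO0 F n).prod W).map mkGp : Set (Gp n F)) =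
        r * μG (((GO0 F n).prod V).map mkGp : Set (Gp n F)) ∧
        μH (W.map mkH2 : Set (H2 n F)) = r * μH (V.map mkH2 : Set (H2 n F)) := by
    intro W hW hVW hZW
    have e := relIndex_map_prod_right (GO := GO0 F n) mkGp_eq_one mkH2_eq_one hVW hZW
    have h0 : (V.map mkH2).relIndex (W.map mkH2) ≠ 0 :=
      relIndex_ne_zero_of_isOpen (isOpen_map_mkH2 hV) (isCompact_map_mkH2 hW)
    refine ⟨_, h0, ?_, measure_subgroup_eq (isOpen_map_mkH2 hV).measurableSet
      (Subgroup.map_mono hVW) h0⟩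
    rw [← e] at h0 ⊢
    exact measure_subgroup_eq (isOpen_map_mkGp hGO hV).measurableSet
      (Subgroup.map_mono (Subgroup.prod_mono le_rfl hVW)) h0
  obtain ⟨r, hr, e1, e2⟩ := step (GO0 F n) hGOc inf_le_left fun z _ h => h
  obtain ⟨r', hr', e1', e2'⟩ := step U hUc inf_le_right hZ
  have h1 : μG (((GO0 F n).prod (GO0 F n)).map mkGp : Set (Gp n F)) = 1 := hμG
  have h2 : μH ((GO0 F n).map mkH2 : Set (H2 n F)) = 1 := hμH
  rw [h1] at e1
  rw [h2] at e2
  have hr0 : (r : ENNReal) ≠ 0 := by exact_mod_cast hr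
  have e3 : μG (((GO0 F n).prod V).map mkGp : Set (Gp n F)) = μH (V.map mkH2 : Set (H2 n F)) := by
    rw [ENNReal.eq_inv_of_mul_eq_one_left ((mul_comm _ _).trans e1.symm),
      ENNReal.eq_inv_of_mul_eq_one_left ((mul_comm _ _).trans e2.symm)]
  rw [e1', e2', e3]

/-- Enlarging `K₀ × Q` to `GL(𝒪₀) × Q` multiplies the volume by an index in the first factor, after
which `measure_prod_eq` applies. Conjugation fixes the centre, so central elements of `Q` lie in
`K₀`. -/
theorem measure_KCS (hϖ : IsUniformizer ϖ) (hKn : IsCSDIComponent ϖ c Kn)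
    (hKn1 : IsCSDIComponent ϖ c Kn1) (μG : Measure (Gp n F)) [μG.IsHaarMeasure]
    (hμG : μG (mkGp '' (G0O n F ×ˢ G0O n F)) = 1)
    (μH : Measure (H2 n F)) [μH.IsHaarMeasure] (hμH : μH (mkH2 '' G0O n F) = 1) :
    μH ((Qs ϖ c Kn Kn1).map mkH2 : Set (H2 n F)) =
      (K0 Kn Kn1).relIndex (GO0 F n) * μG (KCS ϖ c Kn Kn1 : Set (Gp n F)) := by
  have D := triG0 hϖ hKn hKn1
  have hKo := isOpen_K0 hKn hKn1
  have hKc := isCompact_K0 hKn hKn1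
  have hQo : IsOpen (Qs ϖ c Kn Kn1 : Set (G0 n F)) := isOpen_conjSub hKo _
  have hQc : IsCompact (Qs ϖ c Kn Kn1 : Set (G0 n F)) := isCompact_conjSub hKc _
  have hZ : ∀ z ∈ Z0 n F, z ∈ Qs ϖ c Kn Kn1 → z ∈ K0 Kn Kn1 := by
    intro z hz h
    have := mem_conjSub.1 h
    rwa [← D.Zc z hz, mul_inv_cancel_right] at this
  rw [← measure_prod_eq μG hμG μH hμH hQo hQc fun z hz h => K0_le_GO0 hKn hKn1 (hZ z hz h)]
  have e := relIndex_map_prod_left (π := mkGp) mkGp_eq_one (GO := GO0 F n) hZ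
  have h0 : (K0 Kn Kn1).relIndex (GO0 F n) ≠ 0 := relIndex_ne_zero_of_isOpen hKo isCompact_GO0
  rw [← e] at h0 ⊢
  exact measure_subgroup_eq (isOpen_map_mkGp hKo hQo).measurableSet
    (Subgroup.map_mono (Subgroup.prod_mono (K0_le_GO0 hKn hKn1) le_rfl)) h0

theorem measure_K0 (hKn : IsCSDIComponent ϖ c Kn) (hKn1 : IsCSDIComponent ϖ c Kn1)
    (μn : Measure (GL (Fin n) F)) [μn.IsHaarMeasure] (hμn : μn (GLO F n) = 1)
    (μn1 : Measure (GL (Fin (n + 1)) F)) [μn1.IsHaarMeasure] (hμn1 : μn1 (GLO F (n + 1)) = 1) :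
    (μn.prod μn1).real (K0 Kn Kn1 : Set (G0 n F)) =
      ((K0 Kn Kn1).relIndex (GO0 F n) : ℝ)⁻¹ := by
  have : SecondCountableTopology (GL (Fin (n + 1)) F) := secondCountable_GL
  have : WeaklyLocallyCompactSpace (GL (Fin (n + 1)) F) := weaklyLocallyCompact_GL
  have hone : ∀ {ν : ℕ} {K : Subgroup (GL (Fin ν) F)} (_ : IsCSDIComponent ϖ c K)
      (μ : Measure (GL (Fin ν) F)) [μ.IsHaarMeasure] (_ : μ (GLO F ν) = 1),
      μ (K : Set (GL (Fin ν) F)) = ((K.relIndex (GLOs F ν) : ENNReal))⁻¹ := by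
    intro ν K hK μ _ hμ
    have h0 : K.relIndex (GLOs F ν) ≠ 0 := relIndex_ne_zero_of_isOpen hK.1.1 isCompact_GLOs
    have h := measure_subgroup_eq (μ := μ) hK.1.1.measurableSet
      (fun g hg => (hK.1.2.1 hg).1 : K ≤ GLOs F ν) h0
    rw [coe_GLOs, hμ] at h
    exact ENNReal.eq_inv_of_mul_eq_one_left ((mul_comm _ _).trans h.symm)
  have e : (K0 Kn Kn1 : Set (G0 n F)) = (Kn : Set _) ×ˢ (Kn1 : Set _) := rfl
  rw [Measure.real, e, Measure.prod_prod, hone hKn μn hμn, hone hKn1 μn1 hμn1, K0, GO0, relIndex_prod]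
  simp [ENNReal.toReal_mul, mul_comm]

end Volume

/-! ### Ultrametric contraction and determinants -/

section Contraction

/-- Taking `R` to be the largest of the `a i` excludes `R > 1`, since then `max 1 (ε * R) < R`. This
replaces the iteration of a contraction. -/
theorem le_one_of_contract {ι : Type*} [Finite ι] {a : ι → ℝ} {ε : ℝ} (hε : ε < 1)
    (h : ∀ R, 1 ≤ R → (∀ i, a i ≤ R) → ∀ i, a i ≤ max 1 (ε * R)) (i : ι) : a i ≤ 1 := by
  have : Nonempty ι := ⟨i⟩
  obtain ⟨k, hk⟩ := Finite.exists_max a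
  by_contra hi
  have h1 : 1 < a k := lt_of_lt_of_le (not_le.1 hi) (hk i)
  rcases le_max_iff.1 (h (a k) h1.le hk k) with h2 | h2
  · exact absurd h1 (not_lt.2 h2)
  · have : ε * a k < 1 * a k := mul_lt_mul_of_pos_right hε (zero_lt_one.trans h1)
    rw [one_mul] at this
    exact absurd this (not_lt.2 h2)

theorem le_zero_of_contract {ι : Type*} [Finite ι] {a : ι → ℝ} {ε : ℝ} (hε : ε < 1)
    (h : ∀ R, 0 ≤ R → (∀ i, a i ≤ R) → ∀ i, a i ≤ ε * R) (i : ι) : a i ≤ 0 := by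
  have : Nonempty ι := ⟨i⟩
  obtain ⟨k, hk⟩ := Finite.exists_max a
  by_contra hi
  have h1 : 0 < a k := lt_of_lt_of_le (not_le.1 hi) (hk i)
  have h2 := h (a k) h1.le hk k
  have : ε * a k < 1 * a k := mul_lt_mul_of_pos_right hε h1
  rw [one_mul] at this
  exact absurd this (not_lt.2 h2)

end Contraction

section Determinant

variable {F : Type*} [NontriviallyNormedField F] [IsUltrametricDist F] {ν : ℕ}

theorem norm_sub_le_max (x y : F) : ‖x - y‖ ≤ max ‖x‖ ‖y‖ := by
  rw [sub_eq_add_neg, ← norm_neg y]; exact IsUltrametricDist.norm_add_le_max _ _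

theorem norm_prod_sub_prod_le {ι : Type*} (S : Finset ι) {a b : ι → F} {r : ℝ} (hr : 0 ≤ r)
    (ha : ∀ i, ‖a i‖ ≤ 1) (hb : ∀ i, ‖b i‖ ≤ 1) (h : ∀ i, ‖a i - b i‖ ≤ r) :
    ‖∏ i ∈ S, a i - ∏ i ∈ S, b i‖ ≤ r := by
  classical
  induction S using Finset.induction_on with
  | empty => simpa using hr
  | insert i S hi ih =>
    rw [Finset.prod_insert hi, Finset.prod_insert hi]
    have hP : ‖∏ i ∈ S, a i‖ ≤ 1 := by
      rw [norm_prod]; exact Finset.prod_le_one (fun _ _ => norm_nonneg _) fun i _ => ha i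
    have e : a i * ∏ i ∈ S, a i - b i * ∏ i ∈ S, b i =
        (a i - b i) * ∏ i ∈ S, a i + b i * (∏ i ∈ S, a i - ∏ i ∈ S, b i) := by ring
    rw [e]
    refine (IsUltrametricDist.norm_add_le_max _ _).trans (max_le ?_ ?_)
    · rw [norm_mul]
      exact (mul_le_mul (h i) hP (norm_nonneg _) hr).trans_eq (mul_one r)
    · rw [norm_mul]
      exact (mul_le_mul (hb i) ih (norm_nonneg _) zero_le_one).trans_eq (one_mul r)

theorem norm_sign_smul (σ : Equiv.Perm (Fin ν)) (x : F) : ‖Equiv.Perm.sign σ • x‖ = ‖x‖ := by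
  rcases Int.units_eq_one_or (Equiv.Perm.sign σ) with h | h <;> simp [h]

theorem norm_det_sub_det_le {A B : Matrix (Fin ν) (Fin ν) F} {r : ℝ} (hr : 0 ≤ r)
    (hA : ∀ i j, ‖A i j‖ ≤ 1) (hB : ∀ i j, ‖B i j‖ ≤ 1) (h : ∀ i j, ‖A i j - B i j‖ ≤ r) :
    ‖A.det - B.det‖ ≤ r := by
  rw [Matrix.det_apply, Matrix.det_apply, ← Finset.sum_sub_distrib]
  refine IsUltrametricDist.norm_sum_le_of_forall_le_of_nonneg hr fun σ _ => ?_
  rw [← smul_sub, norm_sign_smul]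
  exact norm_prod_sub_prod_le _ hr (fun i => hA _ _) (fun i => hB _ _) fun i => h _ _

theorem norm_det_le_one {A : Matrix (Fin ν) (Fin ν) F} (hA : ∀ i j, ‖A i j‖ ≤ 1) :
    ‖A.det‖ ≤ 1 := by
  rw [Matrix.det_apply]
  refine IsUltrametricDist.norm_sum_le_of_forall_le_of_nonneg zero_le_one fun σ _ => ?_
  rw [norm_sign_smul, norm_prod]
  exact Finset.prod_le_one (fun _ _ => norm_nonneg _) fun i _ => hA _ _

theorem norm_one_apply_le (i j : Fin ν) : ‖(1 : Matrix (Fin ν) (Fin ν) F) i j‖ ≤ 1 := by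
  by_cases h : i = j <;> simp [Matrix.one_apply, h]

theorem norm_apply_le_of_sub_one {A : Matrix (Fin ν) (Fin ν) F} {r : ℝ} (hr : r ≤ 1) {i j : Fin ν}
    (h : ‖A i j - (1 : Matrix (Fin ν) (Fin ν) F) i j‖ ≤ r) : ‖A i j‖ ≤ 1 := by
  have : A i j = (A i j - (1 : Matrix (Fin ν) (Fin ν) F) i j) + (1 : Matrix (Fin ν) (Fin ν) F) i j :=
    by ring
  rw [this]
  exact (IsUltrametricDist.norm_add_le_max _ _).trans (max_le (h.trans hr) (norm_one_apply_le i j))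

theorem norm_det_sub_one_le {A : Matrix (Fin ν) (Fin ν) F} {r : ℝ} (hr0 : 0 ≤ r) (hr : r ≤ 1)
    (h : ∀ i j, ‖A i j - (1 : Matrix (Fin ν) (Fin ν) F) i j‖ ≤ r) : ‖A.det - 1‖ ≤ r := by
  rw [← Matrix.det_one (n := Fin ν) (R := F)]
  exact norm_det_sub_det_le hr0 (fun i j => norm_apply_le_of_sub_one hr (h i j)) norm_one_apply_le h

theorem norm_eq_one_of_sub_one {x : F} (h : ‖x - 1‖ < 1) : ‖x‖ = 1 := by
  have := IsUltrametricDist.norm_add_eq_max_of_norm_ne_norm (x := x - 1) (y := 1)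
    (by rw [norm_one]; exact h.ne)
  rwa [sub_add_cancel, norm_one, max_eq_right h.le] at this

theorem norm_inv_apply_le_one (g : GL (Fin ν) F) (hg : ∀ i j, ‖g.1 i j‖ ≤ 1)
    (hd : ‖g.1.det‖ = 1) (i j : Fin ν) : ‖(g⁻¹).1 i j‖ ≤ 1 := by
  rw [Matrix.coe_units_inv, Matrix.inv_def, Matrix.smul_apply, smul_eq_mul, norm_mul,
    Ring.inverse_eq_inv', norm_inv, hd, inv_one, one_mul, Matrix.adjugate_apply]
  refine norm_det_le_one fun k l => ?_
  by_cases hk : k = j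
  · subst hk
    rw [Matrix.updateRow_self]
    by_cases hl : l = i
    · subst hl; simp
    · simp [Pi.single_eq_of_ne hl]
  · rw [Matrix.updateRow_ne hk]; exact hg k l

end Determinant

/-! ### The embedding of `GL_n` conjugated by `m₀` -/

section Blocks

variable {F : Type*} [NontriviallyNormedField F] {n : ℕ}

theorem blockGL_apply_castSucc_castSucc (A : GL (Fin n) F) (u : Matrix (Fin n) (Fin 1) F)
    (i j : Fin n) : (blockGL A u).1 i.castSucc j.castSucc = A.1 i j := by
  have h : ∀ i : Fin n, finSumFinEquiv.symm i.castSucc = Sum.inl (β := Fin 1) i := fun i =>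
    finSumFinEquiv_symm_apply_castAdd i
  simp [blockGL, h]

theorem blockGL_apply_castSucc_last (A : GL (Fin n) F) (u : Matrix (Fin n) (Fin 1) F)
    (i : Fin n) : (blockGL A u).1 i.castSucc (Fin.last n) = u i 0 := by
  have h : ∀ i : Fin n, finSumFinEquiv.symm i.castSucc = Sum.inl (β := Fin 1) i := fun i =>
    finSumFinEquiv_symm_apply_castAdd i
  simp [blockGL, h]

theorem blockGL_apply_last_castSucc (A : GL (Fin n) F) (u : Matrix (Fin n) (Fin 1) F)
    (j : Fin n) : (blockGL A u).1 (Fin.last n) j.castSucc = 0 := by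
  have h : ∀ i : Fin n, finSumFinEquiv.symm i.castSucc = Sum.inl (β := Fin 1) i := fun i =>
    finSumFinEquiv_symm_apply_castAdd i
  simp [blockGL, h]

theorem blockGL_apply_last_last (A : GL (Fin n) F) (u : Matrix (Fin n) (Fin 1) F) :
    (blockGL A u).1 (Fin.last n) (Fin.last n) = 1 := by
  simp [blockGL]

theorem blockGL_mul (A B : GL (Fin n) F) (u v : Matrix (Fin n) (Fin 1) F) :
    blockGL A u * blockGL B v = blockGL (A * B) (A.1 * v + u) := by
  apply Units.ext
  simp [blockGL, Matrix.submatrix_mul_equiv, Matrix.fromBlocks_multiply]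

theorem blockGL_inv (A : GL (Fin n) F) (u : Matrix (Fin n) (Fin 1) F) :
    (blockGL A u)⁻¹ = blockGL A⁻¹ (-((A⁻¹).1 * u)) := Units.ext rfl

/-- `embGL` as a homomorphism. -/
def embHom (n : ℕ) (F : Type*) [NontriviallyNormedField F] :
    GL (Fin n) F →* GL (Fin (n + 1)) F where
  toFun := embGL
  map_one' := by
    apply Units.ext
    simp [embGL, blockGL]
  map_mul' a b := by simp [embGL, blockGL_mul]

theorem embGL_mul (a b : GL (Fin n) F) : embGL (a * b) = embGL a * embGL b := (embHom n F).map_mul a b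

theorem embGL_inv (a : GL (Fin n) F) : embGL a⁻¹ = (embGL a)⁻¹ := (embHom n F).map_inv a

theorem embGL_one : embGL (1 : GL (Fin n) F) = 1 := (embHom n F).map_one

theorem j0_mul (a b : GL (Fin n) F) : j0 (a * b) = j0 a * j0 b := Prod.ext rfl (embGL_mul a b)

theorem j0_inv (a : GL (Fin n) F) : j0 a⁻¹ = (j0 a)⁻¹ := Prod.ext rfl (embGL_inv a)

theorem j0_one : j0 (1 : GL (Fin n) F) = 1 := Prod.ext rfl embGL_one

theorem embGL_injective : Function.Injective (embGL : GL (Fin n) F → GL (Fin (n + 1)) F) := by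
  intro a b h
  ext i j
  rw [← blockGL_apply_castSucc_castSucc a 0 i j, ← blockGL_apply_castSucc_castSucc b 0 i j]
  exact congrArg (fun g : GL (Fin (n + 1)) F => g.1 i.castSucc j.castSucc) h

theorem emb_apply_last (a : GL (Fin n) F) (j : Fin (n + 1)) :
    (embGL a).1 (Fin.last n) j = (1 : Matrix (Fin (n + 1)) (Fin (n + 1)) F) (Fin.last n) j := by
  refine Fin.lastCases ?_ (fun j => ?_) j
  · rw [embGL, blockGL_apply_last_last, Matrix.one_apply_eq]
  · rw [embGL, blockGL_apply_last_castSucc, Matrix.one_apply_ne]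
    exact (Fin.castSucc_lt_last j).ne'

/-- The column `(1, …, 1)^t`. -/
def ones (n : ℕ) (F : Type*) [NontriviallyNormedField F] : Matrix (Fin n) (Fin 1) F :=
  Matrix.of fun _ _ => 1

/-- The `GL_{n+1}`-component of `m₀`. -/
def mB (n : ℕ) (F : Type*) [NontriviallyNormedField F] : GL (Fin (n + 1)) F :=
  blockGL (wGL F n) (ones n F)

/-- The differential of `h ↦ m⁻¹ diag(h, 1) m`. -/
def Lmat (A : Matrix (Fin n) (Fin n) F) : Matrix (Fin (n + 1)) (Fin (n + 1)) F :=
  Matrix.of fun i j => Fin.lastCases (motive := fun _ => F) 0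
    (fun i => Fin.lastCases (motive := fun _ => F) (∑ k, A i.rev k) (fun j => A i.rev j.rev) j) i

theorem Lmat_castSucc_castSucc (A : Matrix (Fin n) (Fin n) F) (i j : Fin n) :
    Lmat A i.castSucc j.castSucc = A i.rev j.rev := by simp [Lmat]

theorem Lmat_castSucc_last (A : Matrix (Fin n) (Fin n) F) (i : Fin n) :
    Lmat A i.castSucc (Fin.last n) = ∑ k, A i.rev k := by simp [Lmat]

theorem Lmat_last (A : Matrix (Fin n) (Fin n) F) (j : Fin (n + 1)) :
    Lmat A (Fin.last n) j = 0 := by simp [Lmat]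

theorem Lmat_add (A B : Matrix (Fin n) (Fin n) F) : Lmat (A + B) = Lmat A + Lmat B := by
  ext i j
  refine Fin.lastCases ?_ (fun i => ?_) i
  · simp [Lmat_last]
  · refine Fin.lastCases ?_ (fun j => ?_) j
    · simp [Lmat_castSucc_last, Finset.sum_add_distrib]
    · simp [Lmat_castSucc_castSucc]

theorem Lmat_smul (c : F) (A : Matrix (Fin n) (Fin n) F) : Lmat (c • A) = c • Lmat A := by
  ext i j
  refine Fin.lastCases ?_ (fun i => ?_) i
  · simp [Lmat_last]
  · refine Fin.lastCases ?_ (fun j => ?_) j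
    · simp [Lmat_castSucc_last, Finset.mul_sum]
    · simp [Lmat_castSucc_castSucc]

/-- The affine extension of `h ↦ m⁻¹ diag(h, 1) m` to all matrices. -/
def Maff (A : Matrix (Fin n) (Fin n) F) : Matrix (Fin (n + 1)) (Fin (n + 1)) F :=
  1 + Lmat (A - 1)

/-- `h ↦ m⁻¹ diag(h, 1) m`. -/
def Mhom (n : ℕ) (F : Type*) [NontriviallyNormedField F] :
    GL (Fin n) F →* GL (Fin (n + 1)) F :=
  (MulAut.conj (mB n F)⁻¹).toMonoidHom.comp (embHom n F)

theorem Mhom_apply (h : GL (Fin n) F) : Mhom n F h = (mB n F)⁻¹ * embGL h * mB n F := by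
  simp [Mhom, embHom]; rfl

/-- The product is the block matrix with blocks `w h w` and `w (h - 1) u` above the row `(0, 1)`.
The last column thus consists of the row sums of `h - 1`, in reversed order. -/
theorem Mhom_val (h : GL (Fin n) F) : (Mhom n F h).1 = Maff h.1 := by
  have e : Mhom n F h = blockGL (wGL F n * h * wGL F n)
      ((wGL F n * h).1 * ones n F + -((wGL F n).1 * ones n F)) := by
    rw [Mhom_apply, mB, blockGL_inv, embGL, blockGL_mul, blockGL_mul, Matrix.mul_zero, zero_add]
    rfl
  have hone : ∀ i j : Fin n, (1 : Matrix (Fin n) (Fin n) F) i.rev j.rev =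
      (1 : Matrix (Fin n) (Fin n) F) i j := fun i j => by
    by_cases h : i = j <;> simp [Matrix.one_apply, h]
  rw [e, Maff]
  ext i j
  rw [Matrix.add_apply]
  refine Fin.lastCases ?_ (fun i => ?_) i
  · rw [Lmat_last, add_zero, ← emb_apply_last h j]
    refine Fin.lastCases ?_ (fun j => ?_) j
    · simp only [embGL, blockGL_apply_last_last]
    · simp only [embGL, blockGL_apply_last_castSucc]
  · refine Fin.lastCases ?_ (fun j => ?_) j
    · rw [blockGL_apply_castSucc_last, Lmat_castSucc_last,
        Matrix.one_apply_ne (Fin.castSucc_lt_last i).ne, zero_add, Matrix.add_apply,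
        Matrix.neg_apply, Matrix.mul_apply, Matrix.mul_apply]
      simp only [w_mul_apply, ones, Matrix.of_apply, mul_one, Matrix.sub_apply, Finset.sum_sub_distrib]
      rw [← sub_eq_add_neg]
      congr 1
      have h1 : ∀ k : Fin n, (wGL F n).1 i k = (1 : Matrix (Fin n) (Fin n) F) i.rev k := fun k => by
        have := w_mul_apply (1 : GL (Fin n) F) i k
        simpa using this
      simp only [h1]
    · rw [blockGL_apply_castSucc_castSucc, Lmat_castSucc_castSucc, mul_w_apply, w_mul_apply,
        Matrix.sub_apply, hone]
      have : (1 : Matrix (Fin (n + 1)) (Fin (n + 1)) F) i.castSucc j.castSucc =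
        (1 : Matrix (Fin n) (Fin n) F) i j := by
        by_cases h : i = j <;> simp [Matrix.one_apply, h]
      rw [this]; ring

/-- `h ↦ m₀⁻¹ j(h) m₀`. -/
def phi (n : ℕ) (F : Type*) [NontriviallyNormedField F] : GL (Fin n) F →* G0 n F :=
  (MonoidHom.id _).prod (Mhom n F)

theorem phi_apply (h : GL (Fin n) F) : phi n F h = (m0 n F)⁻¹ * j0 h * m0 n F := by
  refine Prod.ext ?_ (Mhom_apply h)
  change h = 1⁻¹ * h * 1
  simp

end Blocks

/-! ### Weighted bounds in the big cell -/

section Weighted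

variable {F : Type*} [NontriviallyNormedField F] [IsUltrametricDist F] {ν : ℕ} {ϖ : Fˣ} {s : ℕ}

theorem norm_mul_apply_le_mul {A B : Matrix (Fin ν) (Fin ν) F} {R R' : ℝ}
    (hA : ∀ i j, ‖A i j‖ ≤ R) (hB : ∀ i j, ‖B i j‖ ≤ R') (hR : 0 ≤ R) (hR' : 0 ≤ R') (i j : Fin ν) :
    ‖(A * B) i j‖ ≤ R * R' :=
  norm_mul_apply_le (mul_nonneg hR hR') fun k => mul_le_mul (hA i k) (hB k j) (norm_nonneg _) hR

theorem norm_mul_wt (hϖ : IsUniformizer ϖ) {A B : Matrix (Fin ν) (Fin ν) F} {R R' : ℝ}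
    (hR : 0 ≤ R) (hR' : 0 ≤ R') (hA : ∀ i j, ‖A i j‖ ≤ R * wt ϖ s i j)
    (hB : ∀ i j, ‖B i j‖ ≤ R' * wt ϖ s i j) (i j : Fin ν) :
    ‖(A * B) i j‖ ≤ R * R' * wt ϖ s i j := by
  have h0 : ∀ i j : ℕ, 0 ≤ wt ϖ s i j := fun i j => (wt_pos s i j).le
  refine norm_mul_apply_le (mul_nonneg (mul_nonneg hR hR') (h0 _ _)) fun k => ?_
  calc ‖A i k‖ * ‖B k j‖ ≤ (R * wt ϖ s i k) * (R' * wt ϖ s k j) :=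
        mul_le_mul (hA i k) (hB k j) (norm_nonneg _) (mul_nonneg hR (h0 _ _))
    _ = R * R' * (wt ϖ s i k * wt ϖ s k j) := by ring
    _ ≤ _ := mul_le_mul_of_nonneg_left (wt_mul_le hϖ _ _ _ _) (mul_nonneg hR hR')

variable (ν ϖ s) in
/-- Upper-triangular unipotent matrices `u` with `u_{ij} ∈ ϖ^{s(j-i)} 𝒪₀`. -/
def NU : Subgroup (GL (Fin ν) F) := upperN F ν ⊓ KroundS ν ϖ (-(s : ℤ))

theorem mem_NU (hϖ : IsUniformizer ϖ) {g : GL (Fin ν) F} : g ∈ NU ν ϖ s ↔ UpperUnip g ∧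
    ∀ i j, ‖g.1 i j‖ ≤ wt ϖ s i j ∧ ‖(g⁻¹).1 i j‖ ≤ wt ϖ s i j := by
  rw [NU, Subgroup.mem_inf, mem_upperN, mem_KroundS, mem_Kround_neg_iff hϖ]

variable (ϖ s) in
/-- The cell `N D w N` of elements with torus part of given absolute values. -/
def InCell (ρ : Fin ν → ℝ) (g : GL (Fin ν) F) : Prop :=
  ∃ a ∈ NU ν ϖ s, ∃ b ∈ NU ν ϖ s, ∃ D : Fin ν → Fˣ, (∀ i, ‖(D i : F)‖ = ρ i) ∧
    g = a * diagGL D * wGL F ν * b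

/-- Removing the unipotent factors leaves `P D w = D' w P'`, that is, `P i j * D j = D' i * P' i.rev
j.rev`. For `i < j` the quotient `‖D' i‖ / ‖D j‖` is at most the weight, which bounds `P i j`; the
same relation read in reversed indices bounds `P'`. -/
theorem cell_bound (hϖ : IsUniformizer ϖ) {ρ : Fin ν → ℝ}
    (hρ : ∀ i j, i < j → ρ i ≤ wt ϖ s i j * ρ j) {g g' h h' : GL (Fin ν) F}
    (hg : InCell ϖ s ρ g) (hg' : InCell ϖ s ρ g') (e : h * g = g' * h') {R : ℝ} (hR : 0 ≤ R)
    (hh : ∀ i j, ‖h.1 i j‖ ≤ R) (hh' : ∀ i j, ‖h'.1 i j‖ ≤ R) :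
    (∀ i j, ‖h.1 i j‖ ≤ R * wt ϖ s i j) ∧ ∀ i j, ‖h'.1 i j‖ ≤ R * wt ϖ s i j := by
  obtain ⟨a, ha, b, hb, D, hD, rfl⟩ := hg
  obtain ⟨a', ha', b', hb', D', hD', rfl⟩ := hg'
  rw [mem_NU hϖ] at ha hb ha' hb'
  have le1 : ∀ {x : ℝ} {i j : ℕ}, x ≤ wt ϖ s i j → x ≤ 1 := fun h => h.trans (wt_le_one hϖ _ _ _)
  set P := a'⁻¹ * h * a with hP
  set P' := b' * h' * b⁻¹ with hP'
  have eP : P * diagGL D * wGL F ν = diagGL D' * (wGL F ν * P') := by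
    have : P * diagGL D * wGL F ν = a'⁻¹ * (h * (a * diagGL D * wGL F ν * b)) * b⁻¹ := by
      rw [hP]; group
    rw [this, e, hP']; group
  have ePe : ∀ i j, P.1 i j * D j = D' i * P'.1 i.rev j.rev := fun i j => by
    have := congrArg (fun g : GL (Fin ν) F => g.1 i j.rev) eP
    simpa only [mul_w_apply, mul_diag_apply, diag_mul_apply, w_mul_apply, Fin.rev_rev] using this
  have ePn : ∀ i j, ‖P.1 i j‖ * ρ j = ρ i * ‖P'.1 i.rev j.rev‖ := fun i j => by
    rw [← hD, ← hD', ← norm_mul, ← norm_mul, ePe]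
  have hρ0 : ∀ i, 0 < ρ i := fun i => by rw [← hD]; simp
  have bP : ∀ i j, ‖P.1 i j‖ ≤ R := by
    intro i j
    have := norm_mul_apply_le_mul (norm_mul_apply_le_mul (fun i j => le1 (ha'.2 i j).2) hh
      zero_le_one hR) (fun i j => le1 (ha.2 i j).1) (by rwa [one_mul]) zero_le_one i j
    rwa [one_mul, mul_one] at this
  have bP' : ∀ i j, ‖P'.1 i j‖ ≤ R := by
    intro i j
    have := norm_mul_apply_le_mul (norm_mul_apply_le_mul (fun i j => le1 (hb'.2 i j).1) hh'
      zero_le_one hR) (fun i j => le1 (hb.2 i j).2) (by rwa [one_mul]) zero_le_one i j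
    rwa [one_mul, mul_one] at this
  have wP : ∀ i j, ‖P.1 i j‖ ≤ R * wt ϖ s i j := by
    intro i j
    rcases lt_or_ge i j with hij | hij
    · refine le_of_mul_le_mul_right ?_ (hρ0 j)
      rw [ePn]
      calc _ ≤ (wt ϖ s i j * ρ j) * R := mul_le_mul (hρ i j hij) (bP' _ _) (norm_nonneg _)
            (mul_nonneg (wt_pos _ _ _).le (hρ0 j).le)
        _ = _ := by ring
    · rw [wt_of_le (show (j : ℕ) ≤ i from hij), mul_one]; exact bP i j
  have wP' : ∀ i j, ‖P'.1 i j‖ ≤ R * wt ϖ s i j := by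
    intro i j
    rcases lt_or_ge i j with hij | hij
    · have hr : j.rev < i.rev := by simpa using hij
      have hw : wt ϖ s j.rev i.rev = wt ϖ s i j := by
        rw [wt, wt, Fin.val_rev, Fin.val_rev]
        congr 2
        have := i.2; have := j.2
        omega
      have h1 := ePn i.rev j.rev
      rw [Fin.rev_rev, Fin.rev_rev] at h1
      refine le_of_mul_le_mul_left ?_ (hρ0 i.rev)
      rw [← h1]
      calc _ ≤ R * (wt ϖ s j.rev i.rev * ρ i.rev) := mul_le_mul (bP _ _) (hρ _ _ hr)
            (hρ0 _).le hR
        _ = _ := by rw [hw]; ring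
    · rw [wt_of_le (show (j : ℕ) ≤ i from hij), mul_one]; exact bP' i j
  have o : ∀ {x : ℝ} {i j : ℕ}, x ≤ wt ϖ s i j → x ≤ 1 * wt ϖ s i j := fun h => by rwa [one_mul]
  have eh : h = a' * P * a⁻¹ := by rw [hP]; group
  have eh' : h' = b'⁻¹ * P' * b := by rw [hP']; group
  constructor
  · intro i j
    rw [eh]
    have := norm_mul_wt hϖ (by rwa [one_mul]) zero_le_one
      (norm_mul_wt hϖ zero_le_one hR (fun i j => o (ha'.2 i j).1) wP)
      (fun i j => o (ha.2 i j).2) i j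
    rwa [one_mul, mul_one] at this
  · intro i j
    rw [eh']
    have := norm_mul_wt hϖ (by rwa [one_mul]) zero_le_one
      (norm_mul_wt hϖ zero_le_one hR (fun i j => o (hb'.2 i j).2) wP')
      (fun i j => o (hb.2 i j).1) i j
    rwa [one_mul, mul_one] at this

/-- Write `A = a (a⁻¹ A)` with the second factor lower triangular. Only `k ≥ j` contribute to entry
`(i, j)`, and for these `a i k` is already as small as the weight at `(i, j)`. -/
theorem lower_part_bound (hϖ : IsUniformizer ϖ) {a : GL (Fin ν) F} (ha : a ∈ NU ν ϖ s)
    {A : Matrix (Fin ν) (Fin ν) F} {R : ℝ} (hR : 0 ≤ R) (hA : ∀ i j, ‖A i j‖ ≤ R)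
    (h0 : ∀ i j, i < j → ((a⁻¹).1 * A) i j = 0) (i j : Fin ν) : ‖A i j‖ ≤ R * wt ϖ s i j := by
  rw [mem_NU hϖ] at ha
  have le1 : ∀ {x : ℝ} {i j : ℕ}, x ≤ wt ϖ s i j → x ≤ 1 := fun h => h.trans (wt_le_one hϖ _ _ _)
  have e : A = a.1 * ((a⁻¹).1 * A) := by
    rw [← Matrix.mul_assoc, ← Units.val_mul, mul_inv_cancel, Units.val_one, Matrix.one_mul]
  have hP := norm_mul_apply_le_mul (fun i j => le1 (ha.2 i j).2) hA zero_le_one hR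
  rw [one_mul] at hP
  rw [e]
  refine norm_mul_apply_le (mul_nonneg hR (wt_pos _ _ _).le) fun k => ?_
  rcases lt_or_ge k j with hk | hk
  · rw [h0 k j hk, norm_zero, mul_zero]; exact mul_nonneg hR (wt_pos _ _ _).le
  · rw [mul_comm]
    refine mul_le_mul (hP k j) ((ha.2 i k).1.trans ?_) (norm_nonneg _) hR
    refine pow_le_pow_of_le_one (norm_nonneg _) hϖ.1.le (Nat.mul_le_mul_left _ ?_)
    have : (j : ℕ) ≤ k := hk
    omega

/-- The determinant is unchanged under conjugation by the torus, so its being a unit makes the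
inverses of both `g` and its conjugate integral. -/
theorem mem_Kround_neg_of_det (hϖ : IsUniformizer ϖ) {g : GL (Fin ν) F}
    (h : ∀ i j, ‖g.1 i j‖ ≤ wt ϖ s i j) (hd : ‖g.1.det‖ = 1) : g ∈ Kround ϖ ν (-(s : ℤ)) := by
  have h1 : ∀ i j, ‖g.1 i j‖ ≤ 1 := fun i j => (h i j).trans (wt_le_one hϖ _ _ _)
  have hz : tGL ϖ ν ^ (- -(s : ℤ)) = (tGL ϖ ν ^ (-(s : ℤ)))⁻¹ := zpow_neg _ _
  have h2 : ∀ i j, ‖(tGL ϖ ν ^ (-(s : ℤ)) * g * (tGL ϖ ν ^ (-(s : ℤ)))⁻¹).1 i j‖ ≤ 1 := by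
    intro i j
    have e : (-(s : ℤ)) * ((j : ℤ) - i) = (s : ℤ) * ((i : ℤ) - j) := by ring
    rw [norm_conj_t, e]
    exact (zpow_wt _ _ _ _ (h1 i j) hϖ).2 (h i j)
  refine ⟨⟨h1, norm_inv_apply_le_one g h1 hd⟩, ?_⟩
  rw [hz]
  refine ⟨h2, norm_inv_apply_le_one _ h2 ?_⟩
  rw [← hd]
  congr 1
  have := congrArg Units.val (show Matrix.GeneralLinearGroup.det
    (tGL ϖ ν ^ (-(s : ℤ)) * g * (tGL ϖ ν ^ (-(s : ℤ)))⁻¹) = Matrix.GeneralLinearGroup.det g by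
      rw [map_mul, map_mul, map_inv, mul_right_comm, mul_inv_cancel, one_mul])
  exact this

end Weighted

/-! ### Rigidity of the action of `GL_n × GL_n` on the cell -/

section Rigidity

variable {F : Type*} [NontriviallyNormedField F] [IsUltrametricDist F] {n : ℕ} {ϖ : Fˣ} {s : ℕ}

theorem norm_Lmat_le {A : Matrix (Fin n) (Fin n) F} {R : ℝ} (hR : 0 ≤ R) (hA : ∀ i j, ‖A i j‖ ≤ R)
    (i j : Fin (n + 1)) : ‖Lmat A i j‖ ≤ R := by
  refine Fin.lastCases ?_ (fun i => ?_) i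
  · rw [Lmat_last, norm_zero]; exact hR
  · refine Fin.lastCases ?_ (fun j => ?_) j
    · rw [Lmat_castSucc_last]
      exact IsUltrametricDist.norm_sum_le_of_forall_le_of_nonneg hR fun k _ => hA _ _
    · rw [Lmat_castSucc_castSucc]; exact hA _ _

/-- The upper part of `A` shows the entries above the diagonal, the upper part of `Lmat A` shows
those below because both indices are reversed, and its last column shows the row sums, hence the
diagonal. In all these are `n(n-1)/2 + n(n+1)/2 = n²` conditions on `n²` entries. -/
theorem norm_le_of_upper_parts {A : Matrix (Fin n) (Fin n) F} {r : ℝ} (hr : 0 ≤ r)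
    (hA : ∀ i j, i < j → ‖A i j‖ ≤ r) (hL : ∀ i j, i < j → ‖Lmat A i j‖ ≤ r) (i j : Fin n) :
    ‖A i j‖ ≤ r := by
  have off : ∀ i j, i ≠ j → ‖A i j‖ ≤ r := by
    intro i j hij
    rcases lt_or_gt_of_ne hij with h | h
    · exact hA i j h
    · have := hL i.rev.castSucc j.rev.castSucc (by simpa using h)
      rwa [Lmat_castSucc_castSucc, Fin.rev_rev, Fin.rev_rev] at this
  by_cases hij : i = j
  · subst hij
    have h1 := hL i.rev.castSucc (Fin.last n) (Fin.castSucc_lt_last _)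
    rw [Lmat_castSucc_last, Fin.rev_rev] at h1
    have e : A i i = ∑ k, A i k - ∑ k ∈ Finset.univ.erase i, A i k := by
      rw [← Finset.add_sum_erase _ _ (Finset.mem_univ i)]; ring
    rw [e]
    refine (norm_sub_le_max _ _).trans (max_le h1 ?_)
    exact IsUltrametricDist.norm_sum_le_of_forall_le_of_nonneg hr fun k hk =>
      off i k (Finset.ne_of_mem_erase hk).symm
  · exact off i j hij

theorem norm_sub_one_le (hϖ : IsUniformizer ϖ) {A : Matrix (Fin n) (Fin n) F} {R : ℝ} (hR : 0 ≤ R)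
    (hA : ∀ i j, ‖A i j‖ ≤ R * wt ϖ s i j)
    (hL : ∀ i j, ‖Maff A i j‖ ≤ R * wt ϖ s i j) (i j : Fin n) :
    ‖A i j - (1 : Matrix (Fin n) (Fin n) F) i j‖ ≤ R * ‖(ϖ : F)‖ ^ s := by
  refine norm_le_of_upper_parts (A := A - 1) (mul_nonneg hR (pow_nonneg (norm_nonneg (ϖ : F)) s))
    (fun i j h => ?_) (fun i j h => ?_) i j
  · rw [Matrix.sub_apply, Matrix.one_apply_ne h.ne, sub_zero]
    exact (hA i j).trans (mul_le_mul_of_nonneg_left (wt_le_pow hϖ h) hR)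
  · have := hL i j
    rw [Maff, Matrix.add_apply, Matrix.one_apply_ne h.ne, zero_add] at this
    exact this.trans (mul_le_mul_of_nonneg_left (wt_le_pow hϖ h) hR)

theorem norm_le_max_of_sub_one {A : Matrix (Fin n) (Fin n) F} {r : ℝ} {i j : Fin n}
    (h : ‖A i j - (1 : Matrix (Fin n) (Fin n) F) i j‖ ≤ r) : ‖A i j‖ ≤ max 1 r := by
  rw [← sub_add_cancel (A i j) ((1 : Matrix (Fin n) (Fin n) F) i j), max_comm]
  exact (IsUltrametricDist.norm_add_le_max _ _).trans (max_le_max h (norm_one_apply_le i j))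

theorem norm_Maff_le {A : Matrix (Fin n) (Fin n) F} {R : ℝ} (hR : 1 ≤ R)
    (hA : ∀ i j, ‖A i j‖ ≤ R) (i j : Fin (n + 1)) : ‖Maff A i j‖ ≤ R := by
  rw [Maff, Matrix.add_apply]
  refine (IsUltrametricDist.norm_add_le_max _ _).trans
    (max_le ((norm_one_apply_le i j).trans hR) (norm_Lmat_le (zero_le_one.trans hR) (fun i j => ?_) i j))
  exact (norm_sub_le_max _ _).trans
    (max_le (hA i j) ((norm_one_apply_le i j).trans hR))

variable (n ϖ s) in
/-- `K_{H,0}^{(s)}` as a subgroup. -/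
def KHs : Subgroup (GL (Fin n) F) :=
  ((KroundS n ϖ (-(s : ℤ))).prod (KroundS (n + 1) ϖ (-(s : ℤ)))).comap (phi n F)

theorem mem_KHs_iff {h : GL (Fin n) F} : h ∈ KHs n ϖ s ↔
    h ∈ Kround ϖ n (-(s : ℤ)) ∧ Mhom n F h ∈ Kround ϖ (n + 1) (-(s : ℤ)) := by
  rw [← mem_KroundS, ← mem_KroundS]; rfl

theorem coe_KHs : (KHs n ϖ s : Set (GL (Fin n) F)) = KH ϖ n s := by
  ext h
  rw [SetLike.mem_coe, mem_KHs_iff, KH, Set.mem_ofPred_eq, ← phi_apply]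
  exact ⟨fun h => ⟨h.1.1, h⟩, fun h => h.2⟩

theorem KHs_sub_one (hϖ : IsUniformizer ϖ) {h : GL (Fin n) F} (hh : h ∈ KHs n ϖ s) (i j : Fin n) :
    ‖h.1 i j - (1 : Matrix (Fin n) (Fin n) F) i j‖ ≤ ‖(ϖ : F)‖ ^ s := by
  rw [mem_KHs_iff, mem_Kround_neg_iff hϖ, mem_Kround_neg_iff hϖ, Mhom_val] at hh
  have := norm_sub_one_le hϖ zero_le_one (fun i j => by rw [one_mul]; exact (hh.1 i j).1)
    (fun i j => by rw [one_mul]; exact (hh.2 i j).1) i j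
  rwa [one_mul] at this

theorem Mhom_sub_one (hϖ : IsUniformizer ϖ) {h : GL (Fin n) F} (hh : h ∈ KHs n ϖ s)
    (i j : Fin (n + 1)) :
    ‖(Mhom n F h).1 i j - (1 : Matrix (Fin (n + 1)) (Fin (n + 1)) F) i j‖ ≤ ‖(ϖ : F)‖ ^ s := by
  rw [Mhom_val, Maff, Matrix.add_apply, add_sub_cancel_left]
  exact norm_Lmat_le (pow_nonneg (norm_nonneg _) _) (KHs_sub_one hϖ hh) i j

theorem pow_unif_lt_one (hϖ : IsUniformizer ϖ) (hs : 1 ≤ s) : ‖(ϖ : F)‖ ^ s < 1 :=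
  pow_lt_one₀ (norm_nonneg _) hϖ.1 (by omega)

/-- If all entries of `h` and `h'` are at most `R ≥ 1`, `cell_bound` in both sizes makes the upper
parts of `h - 1` and of its image at most `R ‖ϖ‖ ^ s`, hence all of `h - 1`, and likewise for `h'`.
So `R` can be replaced by `max 1 (R ‖ϖ‖ ^ s)`, and `le_one_of_contract` ends with `R = 1`. -/
theorem rigidity_bound (hϖ : IsUniformizer ϖ) (hs : 1 ≤ s) {ρ : Fin n → ℝ} {σ : Fin (n + 1) → ℝ}
    (hρ : ∀ i j, i < j → ρ i ≤ wt ϖ s i j * ρ j) (hσ : ∀ i j, i < j → σ i ≤ wt ϖ s i j * σ j)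
    {g g' h h' : GL (Fin n) F} {γ γ' : GL (Fin (n + 1)) F}
    (hg : InCell ϖ s ρ g) (hg' : InCell ϖ s ρ g') (hγ : InCell ϖ s σ γ) (hγ' : InCell ϖ s σ γ')
    (e : h * g = g' * h') (e' : Mhom n F h * γ = γ' * Mhom n F h') :
    ((∀ i j, ‖h.1 i j‖ ≤ wt ϖ s i j) ∧ ∀ i j, ‖(Mhom n F h).1 i j‖ ≤ wt ϖ s i j) ∧
    (∀ i j, ‖h'.1 i j‖ ≤ wt ϖ s i j) ∧ ∀ i j, ‖(Mhom n F h').1 i j‖ ≤ wt ϖ s i j := by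
  have step : ∀ R, 1 ≤ R → (∀ i j, ‖h.1 i j‖ ≤ R) → (∀ i j, ‖h'.1 i j‖ ≤ R) →
      ((∀ i j, ‖h.1 i j‖ ≤ R * wt ϖ s i j) ∧ ∀ i j, ‖(Mhom n F h).1 i j‖ ≤ R * wt ϖ s i j) ∧
      (∀ i j, ‖h'.1 i j‖ ≤ R * wt ϖ s i j) ∧ ∀ i j, ‖(Mhom n F h').1 i j‖ ≤ R * wt ϖ s i j := by
    intro R hR h1 h2
    have hR0 := zero_le_one.trans hR
    obtain ⟨a, b⟩ := cell_bound hϖ hρ hg hg' e hR0 h1 h2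
    obtain ⟨c, d⟩ := cell_bound hϖ hσ hγ hγ' e' hR0
      (fun i j => by rw [Mhom_val]; exact norm_Maff_le hR h1 i j)
      (fun i j => by rw [Mhom_val]; exact norm_Maff_le hR h2 i j)
    exact ⟨⟨a, c⟩, b, d⟩
  have key : ∀ x : (Fin n × Fin n) ⊕ (Fin n × Fin n),
      Sum.elim (fun p => ‖h.1 p.1 p.2‖) (fun p => ‖h'.1 p.1 p.2‖) x ≤ 1 := by
    refine le_one_of_contract (pow_unif_lt_one hϖ hs) fun R hR hx => ?_
    have hR0 := zero_le_one.trans hR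
    obtain ⟨⟨a, c⟩, b, d⟩ := step R hR (fun i j => hx (Sum.inl (i, j))) fun i j => hx (Sum.inr (i, j))
    rw [Mhom_val] at c d
    rw [mul_comm]
    rintro (⟨i, j⟩ | ⟨i, j⟩)
    · exact norm_le_max_of_sub_one (norm_sub_one_le hϖ hR0 a c i j)
    · exact norm_le_max_of_sub_one (norm_sub_one_le hϖ hR0 b d i j)
  have := step 1 le_rfl (fun i j => key (Sum.inl (i, j))) fun i j => key (Sum.inr (i, j))
  simpa only [one_mul] using this

/-- Elements of `GL_n` that carry a point of the cell to another one are small. -/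
theorem rigidity (hϖ : IsUniformizer ϖ) (hs : 1 ≤ s) {ρ : Fin n → ℝ} {σ : Fin (n + 1) → ℝ}
    (hρ : ∀ i j, i < j → ρ i ≤ wt ϖ s i j * ρ j) (hσ : ∀ i j, i < j → σ i ≤ wt ϖ s i j * σ j)
    {g g' h h' : GL (Fin n) F} {γ γ' : GL (Fin (n + 1)) F}
    (hg : InCell ϖ s ρ g) (hg' : InCell ϖ s ρ g') (hγ : InCell ϖ s σ γ) (hγ' : InCell ϖ s σ γ')
    (e : h * g = g' * h') (e' : Mhom n F h * γ = γ' * Mhom n F h') :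
    h ∈ KHs n ϖ s ∧ h' ∈ KHs n ϖ s := by
  obtain ⟨⟨a, b⟩, c, d⟩ := rigidity_bound hϖ hs hρ hσ hg hg' hγ hγ' e e'
  -- Membership in `K^{(-s)}` also bounds the inverses, which satisfy the same relations with the
  -- two points of the cell exchanged.
  have f : h⁻¹ * g' = g * h'⁻¹ := by
    rw [inv_mul_eq_iff_eq_mul, ← mul_assoc, e, mul_inv_cancel_right]
  have f' : Mhom n F h⁻¹ * γ' = γ * Mhom n F h'⁻¹ := by
    rw [map_inv, map_inv, inv_mul_eq_iff_eq_mul, ← mul_assoc, e', mul_inv_cancel_right]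
  obtain ⟨⟨a', b'⟩, c', d'⟩ := rigidity_bound hϖ hs hρ hσ hg' hg hγ' hγ f f'
  rw [map_inv] at b' d'
  simp only [mem_KHs_iff, mem_Kround_neg_iff hϖ]
  exact ⟨⟨fun i j => ⟨a i j, a' i j⟩, fun i j => ⟨b i j, b' i j⟩⟩,
    fun i j => ⟨c i j, c' i j⟩, fun i j => ⟨d i j, d' i j⟩⟩

end Rigidity

/-! ### Solving for elements of `GL_n` modulo lower triangular matrices -/

section Transitivity

variable {F : Type*} [NontriviallyNormedField F] [IsUltrametricDist F] {n : ℕ} {ϖ : Fˣ} {s : ℕ}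

/-- The upper-triangular parts of `α A` and of `β L(A)`, arranged in a square matrix. -/
def upperParts (α : Matrix (Fin n) (Fin n) F) (β : Matrix (Fin (n + 1)) (Fin (n + 1)) F) :
    Matrix (Fin n) (Fin n) F →ₗ[F] Matrix (Fin n) (Fin n) F where
  -- The `n²` slots hold the upper part of `αA` above the diagonal, the upper part of `βL(A)` inside
  -- its `n × n` block below it, and the last column of `βL(A)` on it, so that injectivity implies
  -- surjectivity.
  toFun A := Matrix.of fun i j => if i < j then (α * A) i j else
    if j < i then (β * Lmat A) i.rev.castSucc j.rev.castSucc
    else (β * Lmat A) i.rev.castSucc (Fin.last n)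
  map_add' A B := by
    ext i j
    simp only [Matrix.of_apply, Matrix.add_apply, Lmat_add, Matrix.mul_add]
    split_ifs <;> rfl
  map_smul' c A := by
    ext i j
    simp only [Matrix.of_apply, Matrix.smul_apply, Lmat_smul, Matrix.mul_smul, RingHom.id_apply]
    split_ifs <;> rfl

theorem upperParts_spec {α : Matrix (Fin n) (Fin n) F}
    {β γ : Matrix (Fin (n + 1)) (Fin (n + 1)) F} {δ A : Matrix (Fin n) (Fin n) F}
    (h : upperParts α β A = Matrix.of fun i j => if i < j then δ i j else
      if j < i then γ i.rev.castSucc j.rev.castSucc else γ i.rev.castSucc (Fin.last n)) :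
    (∀ i j, i < j → (α * A) i j = δ i j) ∧ ∀ i j, i < j → (β * Lmat A) i j = γ i j := by
  have h' := fun i j => congrFun (congrFun h i) j
  simp only [upperParts, LinearMap.coe_mk, AddHom.coe_mk, Matrix.of_apply] at h'
  constructor
  · intro i j hij
    simpa [hij] using h' i j
  · intro i j
    refine Fin.lastCases (fun hi => absurd hi (not_lt.2 (Fin.le_last _))) (fun i => ?_) i
    refine Fin.lastCases (fun _ => ?_) (fun j hij => ?_) j
    · simpa using h' i.rev i.rev
    · have hij' : j.rev < i.rev := by simpa using hij
      have := h' i.rev j.rev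
      simpa only [if_neg (not_lt.2 hij'.le), if_pos hij', Fin.rev_rev] using this

/-- The requirements form an inhomogeneous linear system of `n²` equations in the `n²` entries of `h
- 1`. By contraction the homogeneous system has only the zero solution, and the solution of the
given one is integral and congruent to `1` modulo `ϖ^s`. -/
theorem exists_lower (hϖ : IsUniformizer ϖ) (hs : 1 ≤ s) {a : GL (Fin n) F}
    {b : GL (Fin (n + 1)) F} (ha : a ∈ NU n ϖ s) (hb : b ∈ NU (n + 1) ϖ s) :
    ∃ h ∈ KHs n ϖ s, (∀ i j, i < j → (a⁻¹ * h).1 i j = 0) ∧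
      ∀ i j, i < j → (b⁻¹ * Mhom n F h).1 i j = 0 := by
  have hlt := pow_unif_lt_one (s := s) hϖ hs
  -- A solution of the homogeneous system bounded by `R` is bounded by `R ‖ϖ‖ ^ s`, hence is zero.
  have hinj : Function.Injective (upperParts (a⁻¹).1 (b⁻¹).1) := by
    rw [injective_iff_map_eq_zero]
    intro A hA
    obtain ⟨h1, h2⟩ := upperParts_spec (δ := 0) (γ := 0) (hA.trans (by ext; simp))
    have key : ∀ p : Fin n × Fin n, ‖A p.1 p.2‖ ≤ 0 := by
      refine le_zero_of_contract hlt fun R hR hx => ?_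
      have hx' : ∀ i j, ‖A i j‖ ≤ R := fun i j => hx (i, j)
      have b1 := lower_part_bound hϖ ha hR hx' h1
      have b2 := lower_part_bound hϖ hb hR (norm_Lmat_le hR hx') h2
      rintro ⟨i, j⟩
      rw [mul_comm]
      exact norm_le_of_upper_parts (mul_nonneg hR (pow_nonneg (norm_nonneg _) _))
        (fun i j h => (b1 i j).trans (mul_le_mul_of_nonneg_left (wt_le_pow hϖ h) hR))
        (fun i j h => (b2 i j).trans (mul_le_mul_of_nonneg_left (wt_le_pow hϖ h) hR)) i j
    ext i j
    exact norm_le_zero_iff.1 (key (i, j))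
  -- With `H = 1 + A` and `Maff H = 1 + Lmat A`, the right-hand side cancels the upper parts of
  -- `a⁻¹` and `b⁻¹`.
  obtain ⟨A, hA⟩ := LinearMap.injective_iff_surjective.1 hinj
    (Matrix.of fun i j => if i < j then (-(a⁻¹).1) i j else
      if j < i then (-(b⁻¹).1) i.rev.castSucc j.rev.castSucc
      else (-(b⁻¹).1) i.rev.castSucc (Fin.last n))
  obtain ⟨h1, h2⟩ := upperParts_spec hA
  set H : Matrix (Fin n) (Fin n) F := 1 + A with hH
  have hHA : H - 1 = A := by rw [hH]; abel
  have h1' : ∀ i j, i < j → ((a⁻¹).1 * H) i j = 0 := fun i j hij => by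
    rw [hH, Matrix.mul_add, Matrix.mul_one, Matrix.add_apply, h1 i j hij, Matrix.neg_apply]; ring
  have h2' : ∀ i j, i < j → ((b⁻¹).1 * Maff H) i j = 0 := fun i j hij => by
    rw [Maff, hHA, Matrix.mul_add, Matrix.mul_one, Matrix.add_apply, h2 i j hij, Matrix.neg_apply]; ring
  have key : ∀ p : Fin n × Fin n, ‖H p.1 p.2‖ ≤ 1 := by
    refine le_one_of_contract hlt fun R hR hx => ?_
    have hR0 := zero_le_one.trans hR
    have hx' : ∀ i j, ‖H i j‖ ≤ R := fun i j => hx (i, j)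
    rintro ⟨i, j⟩
    rw [mul_comm]
    exact norm_le_max_of_sub_one (norm_sub_one_le hϖ hR0 (lower_part_bound hϖ ha hR0 hx' h1')
      (lower_part_bound hϖ hb hR0 (norm_Maff_le hR hx') h2') i j)
  have hx' : ∀ i j, ‖H i j‖ ≤ 1 := fun i j => key (i, j)
  have w1 := lower_part_bound hϖ ha zero_le_one hx' h1'
  have w2 := lower_part_bound hϖ hb zero_le_one (norm_Maff_le le_rfl hx') h2'
  have hsub := norm_sub_one_le hϖ zero_le_one w1 w2
  simp only [one_mul] at w1 w2 hsub
  have hdet : ‖H.det‖ = 1 := norm_eq_one_of_sub_one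
    ((norm_det_sub_one_le (pow_nonneg (norm_nonneg _) _) hlt.le hsub).trans_lt hlt)
  have hdet' : ‖(Maff H).det‖ = 1 := norm_eq_one_of_sub_one
    ((norm_det_sub_one_le (pow_nonneg (norm_nonneg _) _) hlt.le fun i j => by
      rw [Maff, Matrix.add_apply, add_sub_cancel_left]
      exact norm_Lmat_le (pow_nonneg (norm_nonneg _) _) hsub i j).trans_lt hlt)
  have hne : H.det ≠ 0 := fun h => by rw [h, norm_zero] at hdet; exact zero_ne_one hdet
  let h := Matrix.GeneralLinearGroup.mkOfDetNeZero H hne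
  have hv : h.1 = H := rfl
  refine ⟨h, mem_KHs_iff.2 ⟨mem_Kround_neg_of_det hϖ w1 hdet, mem_Kround_neg_of_det hϖ ?_ ?_⟩,
    h1', fun i j hij => ?_⟩
  · rw [Mhom_val]; exact w2
  · rw [Mhom_val]; exact hdet'
  · rw [Units.val_mul, Mhom_val]; exact h2' i j hij

end Transitivity

/-! ### The discriminant `D⁺` and the transfer factor -/

section Dplus

variable {F : Type*} [NontriviallyNormedField F] {n : ℕ}

theorem sign_revPerm (n : ℕ) :
    Equiv.Perm.sign (Fin.revPerm : Equiv.Perm (Fin (n + 1))) = (-1) ^ (n * (n + 1) / 2) := by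
  rw [Equiv.Perm.sign_eq_prod_prod_Iio]
  have h : ∀ j : Fin (n + 1), (∏ i ∈ Finset.Iio j, if Fin.revPerm i < Fin.revPerm j then (1 : ℤˣ)
      else -1) = (-1) ^ (j : ℕ) := fun j => by
    rw [Finset.prod_congr rfl (g := fun _ => (-1 : ℤˣ)), Finset.prod_const, Fin.card_Iio]
    intro i hi
    have := Finset.mem_Iio.1 hi
    rw [if_neg]
    simpa using this.le
  rw [Finset.prod_congr rfl fun j _ => h j, Finset.prod_pow_eq_pow_sum,
    Fin.sum_univ_eq_sum_range (fun i => i), Finset.sum_range_id, Nat.add_sub_cancel, mul_comm]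

/-- The matrix with rows `e^t s^i`. -/
def Rplus (s : GL (Fin (n + 1)) F) : Matrix (Fin (n + 1)) (Fin (n + 1)) F :=
  Matrix.of fun i j => (s.1 ^ (i : ℕ)) (Fin.last n) j

theorem Dplus_eq (s : GL (Fin (n + 1)) F) : Dplus s = (Rplus s).det := rfl

theorem Rplus_mul (s : GL (Fin (n + 1)) F) (A : Matrix (Fin (n + 1)) (Fin (n + 1)) F)
    (i j : Fin (n + 1)) : (Rplus s * A) i j = (s.1 ^ (i : ℕ) * A) (Fin.last n) j := by
  rw [Matrix.mul_apply, Matrix.mul_apply]; rfl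

theorem emb_mul_last (h : GL (Fin n) F) (A : Matrix (Fin (n + 1)) (Fin (n + 1)) F)
    (j : Fin (n + 1)) : ((embGL h).1 * A) (Fin.last n) j = A (Fin.last n) j := by
  rw [Matrix.mul_apply]
  simp only [emb_apply_last]
  rw [← Matrix.mul_apply, Matrix.one_mul]

/-- The row `eᵗ` is fixed by `diag(h, 1)`, so conjugation multiplies every row `eᵗ sⁱ` on the right
by one matrix. -/
theorem Dplus_conj (h : GL (Fin n) F) (s : GL (Fin (n + 1)) F) :
    Dplus (embGL h * s * (embGL h)⁻¹) = Dplus s * ((embGL h)⁻¹).1.det := by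
  rw [Dplus_eq, Dplus_eq, ← Matrix.det_mul]
  congr 1
  ext i j
  have e : (embGL h * s * (embGL h)⁻¹).1 ^ (i : ℕ) =
      (embGL h).1 * (s.1 ^ (i : ℕ) * ((embGL h)⁻¹).1) := by
    rw [← Units.val_pow_eq_pow_val, conj_pow, mul_assoc]; rfl
  rw [Rplus_mul]
  change ((embGL h * s * (embGL h)⁻¹).1 ^ (i : ℕ)) (Fin.last n) j = _
  rw [e, emb_mul_last]

theorem Dplus_conj_ne_zero (h : GL (Fin n) F) (s : GL (Fin (n + 1)) F) :
    Dplus (embGL h * s * (embGL h)⁻¹) ≠ 0 ↔ Dplus s ≠ 0 := by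
  have : ((embGL h)⁻¹).1.det ≠ 0 :=
    (Matrix.GeneralLinearGroup.det (embGL h)⁻¹).ne_zero
  rw [Dplus_conj, mul_ne_zero_iff, and_iff_left this]

/-- Multiplying the rows `eᵗ s⁻ⁱ` by `sⁿ` gives `eᵗ s^{n-i}`: the same rows in reversed order,
whence the sign of the reversal. -/
theorem Dplus_inv (s : GL (Fin (n + 1)) F) :
    Dplus s⁻¹ * s.1.det ^ n = (-1) ^ (n * (n + 1) / 2) * Dplus s := by
  have e : Rplus s⁻¹ * s.1 ^ n = (Rplus s).submatrix Fin.revPerm id := by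
    ext i j
    rw [Rplus_mul, Matrix.submatrix_apply]
    change _ = (s.1 ^ ((Fin.rev i : Fin (n + 1)) : ℕ)) (Fin.last n) j
    have e : s⁻¹ ^ (i : ℕ) * s ^ n = s ^ ((Fin.rev i : Fin (n + 1)) : ℕ) := by
      rw [Fin.val_rev, inv_pow, inv_mul_eq_iff_eq_mul, ← pow_add]
      congr 1
      have := i.2
      omega
    rw [← Units.val_pow_eq_pow_val, ← Units.val_pow_eq_pow_val, ← Units.val_pow_eq_pow_val,
      ← Units.val_mul, e]
  have := congrArg Matrix.det e
  rw [Matrix.det_mul, Matrix.det_pow, Matrix.det_permute, sign_revPerm] at this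
  rw [Dplus_eq, Dplus_eq, this]
  push_cast
  rfl

theorem Dplus_inv_ne_zero (s : GL (Fin (n + 1)) F) : Dplus s⁻¹ ≠ 0 ↔ Dplus s ≠ 0 := by
  have h := Dplus_inv s
  have hd : s.1.det ^ n ≠ 0 := pow_ne_zero _ (Matrix.GeneralLinearGroup.det s).ne_zero
  have h1 : ((-1 : F)) ^ (n * (n + 1) / 2) ≠ 0 := pow_ne_zero _ (by simp)
  constructor
  · intro h2 h3
    rw [h3, mul_zero] at h
    exact mul_ne_zero h2 hd h
  · intro h2 h3
    rw [h3, zero_mul] at h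
    exact mul_ne_zero h1 h2 h.symm

theorem sMat_snd (g : G0 n F × G0 n F) : (sMat g).2 = (sMat g).1⁻¹ := by
  simp [sMat]

theorem mem_RegPlus_iff (g : G0 n F × G0 n F) : g ∈ RegPlus n F ↔ Dplus (sMat g).1 ≠ 0 := by
  rw [RegPlus, Set.mem_ofPred_eq, sMat_snd, Dplus_inv_ne_zero, and_self]

/-- From `g_{1,⋆} = s₁ g_{2,⋆}` and `s₂ = s₁⁻¹`, the powers of `det s₁` balance because `n + ε` is
twice its half. Only the sign from `Dplus_inv` remains, and it makes the transfer factor constant.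
-/
theorem kappaArg_eq (g : G0 n F × G0 n F) :
    kappaArg (gstar g.1) (sMat g).1 =
      (-1) ^ (n * (n + 1) / 2) * kappaArg (gstar g.2) (sMat g).2 := by
  have h1 : gstar g.1 = (sMat g).1 * gstar g.2 := by simp [sMat]
  rw [sMat_snd, h1, kappaArg, kappaArg, Units.val_mul, Matrix.det_mul]
  have hinv : ((sMat g).1⁻¹).1.det = ((sMat g).1.1.det)⁻¹ := by
    have := congrArg Units.val (map_inv Matrix.GeneralLinearGroup.det (sMat g).1)
    rw [Units.val_inv_eq_inv_val] at this
    exact this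
  have hD := Dplus_inv (sMat g).1
  have hσ : (sMat g).1.1.det ≠ 0 := (Matrix.GeneralLinearGroup.det (sMat g).1).ne_zero
  rw [hinv]
  generalize (sMat g).1.1.det = σ at *
  generalize Dplus (sMat g).1 = D at *
  generalize Dplus (sMat g).1⁻¹ = D' at *
  generalize (gstar g.2).1.det = α
  have hD2 : D = (-1) ^ (n * (n + 1) / 2) * (D' * σ ^ n) := by
    rw [hD, ← mul_assoc, ← mul_pow]; simp
  have hm : n + n % 2 = (n + n % 2) / 2 + (n + n % 2) / 2 := by omega
  have hp : σ ^ n * σ ^ (n % 2) = σ ^ ((n + n % 2) / 2) * σ ^ ((n + n % 2) / 2) := by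
    rw [← pow_add, ← pow_add, ← hm]
  have hne : σ ^ ((n + n % 2) / 2) ≠ 0 := pow_ne_zero _ hσ
  rw [hD2, mul_pow, inv_pow, inv_inv]
  calc _ = (-1) ^ (n * (n + 1) / 2) * α ^ (n % 2) * D' * (σ ^ ((n + n % 2) / 2))⁻¹ *
        (σ ^ n * σ ^ (n % 2)) := by ring
    _ = (-1) ^ (n * (n + 1) / 2) * α ^ (n % 2) * D' * ((σ ^ ((n + n % 2) / 2))⁻¹ *
        σ ^ ((n + n % 2) / 2)) * σ ^ ((n + n % 2) / 2) := by rw [hp]; ring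
    _ = _ := by rw [inv_mul_cancel₀ hne]; ring

theorem kappa_eq (θ : Fˣ →* ℂˣ) {g : G0 n F × G0 n F} (hg : g ∈ RegPlus n F) :
    kappa θ g = (θ (-1) : ℂ) ^ (n * (n + 1) / 2) := by
  have hy : kappaArg (gstar g.2) (sMat g).2 ≠ 0 := by
    have h1 := (Matrix.GeneralLinearGroup.det (gstar g.2)).ne_zero
    have h2 := (Matrix.GeneralLinearGroup.det (sMat g).2).ne_zero
    exact mul_ne_zero (mul_ne_zero (pow_ne_zero _ h1) (inv_ne_zero (pow_ne_zero _ h2))) hg.2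
  have hx : kappaArg (gstar g.1) (sMat g).1 ≠ 0 := by
    rw [kappaArg_eq]; exact mul_ne_zero (pow_ne_zero _ (by simp)) hy
  have e : Units.mk0 _ hx = (-1) ^ (n * (n + 1) / 2) * Units.mk0 _ hy := by
    ext; simp [kappaArg_eq]
  rw [kappa, charExt, charExt, dif_neg hx, dif_neg hy, e, map_mul, map_pow, Units.val_mul,
    Units.val_pow_eq_pow_val, mul_inv_cancel_right₀ (Units.ne_zero _)]

end Dplus

/-! ### Orbits and invariants -/

section Invariants

variable {F : Type*} [NontriviallyNormedField F] {n : ℕ}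

theorem gstar_translate (x y : GL (Fin n) F) (δ : G0 n F) :
    gstar ((j0 x)⁻¹ * δ * j0 y) = embGL y⁻¹ * gstar δ * (embGL y⁻¹)⁻¹ := by
  change (embGL (x⁻¹ * δ.1 * y))⁻¹ * ((embGL x)⁻¹ * δ.2 * embGL y) =
    embGL y⁻¹ * ((embGL δ.1)⁻¹ * δ.2) * (embGL y⁻¹)⁻¹
  simp only [embGL_mul, embGL_inv]
  group

/-- This eliminates `H₂'`: up to conjugation by `GL_n`, the pair is seen only through `g₁ g₂⁻¹`, so
invariants and plus-regularity are questions about one element of `G̃₀`. -/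
theorem sMat_fst (g1 g2 : G0 n F) :
    (sMat (g1, g2)).1 = embGL g2.1⁻¹ * gstar (g1 * g2⁻¹) * (embGL g2.1⁻¹)⁻¹ := by
  change (embGL g1.1)⁻¹ * g1.2 * ((embGL g2.1)⁻¹ * g2.2)⁻¹ =
    embGL g2.1⁻¹ * ((embGL (g1.1 * g2.1⁻¹))⁻¹ * (g1.2 * g2.2⁻¹)) * (embGL g2.1⁻¹)⁻¹
  simp only [embGL_mul, embGL_inv]
  group

theorem emb_mul_castSucc (h : GL (Fin n) F) (A : Matrix (Fin (n + 1)) (Fin (n + 1)) F)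
    (i : Fin n) (j : Fin (n + 1)) :
    ((embGL h).1 * A) i.castSucc j = ∑ k, h.1 i k * A k.castSucc j := by
  rw [Matrix.mul_apply, Fin.sum_univ_castSucc, embGL, blockGL_apply_castSucc_last]
  simp [blockGL_apply_castSucc_castSucc]

theorem mul_emb_castSucc (h : GL (Fin n) F) (A : Matrix (Fin (n + 1)) (Fin (n + 1)) F)
    (i : Fin (n + 1)) (j : Fin n) :
    (A * (embGL h).1) i j.castSucc = ∑ k, A i k.castSucc * h.1 k j := by
  rw [Matrix.mul_apply, Fin.sum_univ_castSucc, embGL, blockGL_apply_last_castSucc]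
  simp [blockGL_apply_castSucc_castSucc]

theorem mul_emb_last (h : GL (Fin n) F) (A : Matrix (Fin (n + 1)) (Fin (n + 1)) F)
    (i : Fin (n + 1)) : (A * (embGL h).1) i (Fin.last n) = A i (Fin.last n) := by
  rw [Matrix.mul_apply, Fin.sum_univ_castSucc, embGL, blockGL_apply_last_last]
  simp [blockGL_apply_castSucc_last]

theorem invMat_conj (h : GL (Fin n) F) (s : GL (Fin (n + 1)) F) :
    invMat (embGL h * s * (embGL h)⁻¹) = invMat s := by
  set s' := embGL h * s * (embGL h)⁻¹ with hs'
  have hv : s'.1 = (embGL h).1 * s.1 * (embGL h⁻¹).1 := by rw [hs', embGL_inv]; rfl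
  set A := s.1.submatrix Fin.castSucc Fin.castSucc with hA
  have eA : s'.1.submatrix Fin.castSucc Fin.castSucc = h.1 * A * (h⁻¹).1 := by
    ext i j
    rw [Matrix.submatrix_apply, hv, mul_emb_castSucc, Matrix.mul_apply]
    simp only [emb_mul_castSucc]
    rfl
  have eb : (fun k => s'.1 (Fin.castSucc k) (Fin.last n)) =
      h.1.mulVec fun k => s.1 (Fin.castSucc k) (Fin.last n) := by
    funext k
    rw [hv, mul_emb_last, emb_mul_castSucc]; rfl
  have ec : (fun k => s'.1 (Fin.last n) (Fin.castSucc k)) =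
      Matrix.vecMul (fun k => s.1 (Fin.last n) (Fin.castSucc k)) (h⁻¹).1 := by
    funext k
    rw [hv, mul_emb_castSucc]
    simp only [emb_mul_last]
    rfl
  have ed : s'.1 (Fin.last n) (Fin.last n) = s.1 (Fin.last n) (Fin.last n) := by
    rw [hv, mul_emb_last, emb_mul_last]
  have hpow : ∀ j : ℕ, (h.1 * A * (h⁻¹).1) ^ j = h.1 * A ^ j * (h⁻¹).1 := fun j =>
    Units.conj_pow h A j
  have hch : (h.1 * A * (h⁻¹).1).charpoly = A.charpoly := by
    rw [Matrix.coe_units_inv]; exact Matrix.charpoly_units_conj h A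
  have hhi : (h⁻¹).1 * h.1 = 1 := by rw [← Units.val_mul, inv_mul_cancel]; rfl
  simp only [invMat, eA, eb, ec, ed, hpow, hch, ← hA]
  refine Prod.ext rfl (Prod.ext (funext fun j => ?_) rfl)
  simp only
  rw [Matrix.mulVec_mulVec, ← Matrix.dotProduct_mulVec, Matrix.mulVec_mulVec]
  congr 2
  rw [Matrix.mul_assoc, Matrix.mul_assoc, hhi, Matrix.mul_one, ← Matrix.mul_assoc, hhi,
    Matrix.one_mul]

theorem invB_eq (g1 g2 : G0 n F) :
    invB (g1, g2) = (invMat (gstar (g1 * g2⁻¹)), invMat (gstar (g1 * g2⁻¹))⁻¹) := by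
  rw [invB, sMat_snd, sMat_fst]
  refine Prod.ext (invMat_conj _ _) ?_
  rw [show (embGL g2.1⁻¹ * gstar (g1 * g2⁻¹) * (embGL g2.1⁻¹)⁻¹)⁻¹ =
    embGL g2.1⁻¹ * (gstar (g1 * g2⁻¹))⁻¹ * (embGL g2.1⁻¹)⁻¹ by group]
  exact invMat_conj _ _

theorem invB_translate (x y : GL (Fin n) F) (δ : G0 n F) :
    invB ((j0 x)⁻¹ * δ * j0 y, 1) = invB (δ, 1) := by
  rw [invB_eq, invB_eq, inv_one, mul_one, mul_one, gstar_translate]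
  refine Prod.ext (invMat_conj _ _) ?_
  rw [show (embGL y⁻¹ * gstar δ * (embGL y⁻¹)⁻¹)⁻¹ =
    embGL y⁻¹ * (gstar δ)⁻¹ * (embGL y⁻¹)⁻¹ by group]
  exact invMat_conj _ _

theorem invB_mul_inv (g1 g2 : G0 n F) : invB (g1 * g2⁻¹, 1) = invB (g1, g2) := by
  rw [invB_eq, invB_eq, inv_one, mul_one]

theorem mem_RegPlus_iff' (g1 g2 : G0 n F) :
    (g1, g2) ∈ RegPlus n F ↔ Dplus (gstar (g1 * g2⁻¹)) ≠ 0 := by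
  rw [mem_RegPlus_iff, sMat_fst, Dplus_conj_ne_zero]

theorem continuous_charpoly_coeff (k : ℕ) :
    Continuous fun A : Matrix (Fin n) (Fin n) F => A.charpoly.coeff k := by
  have : (fun A : Matrix (Fin n) (Fin n) F => A.charpoly.coeff k) = fun A =>
      MvPolynomial.eval (fun p : Fin n × Fin n => A p.1 p.2)
        ((Matrix.charpoly.univ F (Fin n)).coeff k) := by
    funext A
    exact (Matrix.charpoly.univ_coeff_eval₂Hom (Fin n) (RingHom.id F) (fun p => A p.1 p.2) k).symm
  rw [this]
  exact (MvPolynomial.continuous_eval _).comp (by fun_prop)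

theorem continuous_invMat : Continuous (invMat : GL (Fin (n + 1)) F → Aff n F) := by
  have hs : Continuous fun s : GL (Fin (n + 1)) F =>
      s.1.submatrix (Fin.castSucc : Fin n → _) (Fin.castSucc : Fin n → _) :=
    Units.continuous_val.matrix_submatrix _ _
  have he : ∀ i j, Continuous fun s : GL (Fin (n + 1)) F => s.1 i j := continuous_entry
  refine Continuous.prodMk (continuous_pi fun i => ?_)
    (Continuous.prodMk (continuous_pi fun j => ?_) (he _ _))
  · exact continuous_const.mul ((continuous_charpoly_coeff _).comp hs)
  · refine Continuous.dotProduct (continuous_pi fun k => he _ _) ?_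
    exact Continuous.matrix_mulVec (hs.pow _) (continuous_pi fun k => he _ _)

theorem continuous_gstar : Continuous (gstar : G0 n F → GL (Fin (n + 1)) F) :=
  (continuous_embGL.comp continuous_fst).inv.mul continuous_snd

theorem continuous_invB : Continuous fun x : G0 n F => invB (x, 1) := by
  have : (fun x : G0 n F => invB (x, 1)) = fun x => (invMat (gstar x), invMat (gstar x)⁻¹) := by
    funext x; rw [invB_eq, inv_one, mul_one]
  rw [this]
  exact (continuous_invMat.comp continuous_gstar).prodMk
    (continuous_invMat.comp continuous_gstar.inv)

/-- An element `(x, y)` of the stabilizer makes `diag(y, 1)` commute with `δ_⋆`. It fixes `eᵗ`,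
hence all rows `eᵗ δ_⋆ⁱ`, which form a basis; so `y = 1`, and then `x = 1`. -/
theorem isRegularG_of_Dplus {δ : G0 n F} (h : Dplus (gstar δ) ≠ 0) : IsRegularG δ := by
  intro x y e
  have e1 : embGL y⁻¹ * gstar δ * (embGL y⁻¹)⁻¹ = gstar δ := by rw [← gstar_translate x y, e]
  have hc : gstar δ * embGL y = embGL y * gstar δ := by
    conv_rhs => rw [← e1]
    rw [embGL_inv]; group
  have hR : Rplus (gstar δ) * (embGL y).1 = Rplus (gstar δ) * 1 := by
    ext i j
    rw [Rplus_mul, ← Units.val_pow_eq_pow_val, ← Units.val_mul, (Commute.pow_left hc _ :),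
      Units.val_mul, emb_mul_last, Matrix.mul_one, Units.val_pow_eq_pow_val]
    rfl
  have hu : IsUnit (Rplus (gstar δ)) := by
    rw [Matrix.isUnit_iff_isUnit_det, isUnit_iff_ne_zero]; exact h
  have hy : y = 1 := embGL_injective (by rw [embGL_one]; exact Units.ext (hu.mul_left_cancel hR))
  refine ⟨?_, hy⟩
  subst hy
  have := congrArg Prod.fst e
  change x⁻¹ * δ.1 * 1 = δ.1 at this
  rw [mul_one, mul_eq_right, inv_eq_one] at this
  exact this

end Invariants

/-! ### Plus-regularity of the cell -/

section SmallCoordinates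

variable {F : Type*} [NontriviallyNormedField F] [IsUltrametricDist F] {ν : ℕ} {ϖ : Fˣ} {s : ℕ}

/-- The coordinates of `x` at the places in `S` are smaller than the norm of `x`. -/
def SmallOn (S : Fin ν → Prop) (x : Fin ν → F) : Prop := ∀ i, S i → ‖x i‖ < ‖x‖

theorem norm_mulVec_sub_le {A : Matrix (Fin ν) (Fin ν) F} {ε : ℝ} (hε : 0 ≤ ε)
    (hA : ∀ i j, ‖A i j - (1 : Matrix (Fin ν) (Fin ν) F) i j‖ ≤ ε) (x : Fin ν → F) (i : Fin ν) :
    ‖A.mulVec x i - x i‖ ≤ ε * ‖x‖ := by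
  have e : A.mulVec x i - x i = ∑ j, (A i j - (1 : Matrix (Fin ν) (Fin ν) F) i j) * x j := by
    simp only [sub_mul, Finset.sum_sub_distrib]
    congr 1
    simp [Matrix.one_apply]
  rw [e]
  refine IsUltrametricDist.norm_sum_le_of_forall_le_of_nonneg (mul_nonneg hε (norm_nonneg _))
    fun j _ => ?_
  rw [norm_mul]
  exact mul_le_mul (hA i j) (norm_le_pi_norm x j) (norm_nonneg _) hε

theorem norm_mulVec_eq {A : Matrix (Fin ν) (Fin ν) F} {ε : ℝ} (hε : 0 ≤ ε) (hε1 : ε < 1)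
    (hA : ∀ i j, ‖A i j - (1 : Matrix (Fin ν) (Fin ν) F) i j‖ ≤ ε) (x : Fin ν → F) :
    ‖A.mulVec x‖ = ‖x‖ := by
  have h := norm_mulVec_sub_le hε hA x
  have h1 : ε * ‖x‖ ≤ ‖x‖ := mul_le_of_le_one_left (norm_nonneg _) hε1.le
  refine le_antisymm ((pi_norm_le_iff_of_nonneg (norm_nonneg _)).2 fun i => ?_) ?_
  · rw [← sub_add_cancel (A.mulVec x i) (x i)]
    exact (IsUltrametricDist.norm_add_le_max _ _).trans
      (max_le ((h i).trans h1) (norm_le_pi_norm x i))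
  · have h2 : ‖x‖ ≤ max ‖A.mulVec x‖ (ε * ‖x‖) := by
      refine (pi_norm_le_iff_of_nonneg (le_max_of_le_left (norm_nonneg _))).2 fun i => ?_
      have : x i = A.mulVec x i - (A.mulVec x i - x i) := by ring
      rw [this]
      exact (norm_sub_le_max _ _).trans (max_le_max (norm_le_pi_norm _ i) (h i))
    rcases le_max_iff.1 h2 with h3 | h3
    · exact h3
    · have : ‖x‖ ≤ 0 := by
        by_contra h4
        have := mul_lt_mul_of_pos_right hε1 (not_le.1 h4)
        rw [one_mul] at this
        exact absurd this (not_lt.2 h3)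
      exact this.trans (norm_nonneg _)

theorem SmallOn.mulVec {S : Fin ν → Prop} {x : Fin ν → F} (hx : SmallOn S x)
    {A : Matrix (Fin ν) (Fin ν) F} {ε : ℝ} (hε : 0 ≤ ε) (hε1 : ε < 1)
    (hA : ∀ i j, ‖A i j - (1 : Matrix (Fin ν) (Fin ν) F) i j‖ ≤ ε) : SmallOn S (A.mulVec x) := by
  intro i hi
  have h0 : 0 < ‖x‖ := (norm_nonneg _).trans_lt (hx i hi)
  rw [norm_mulVec_eq hε hε1 hA, ← sub_add_cancel (A.mulVec x i) (x i)]
  refine (IsUltrametricDist.norm_add_le_max _ _).trans_lt (max_lt ?_ (hx i hi))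
  refine (norm_mulVec_sub_le hε hA x i).trans_lt ?_
  exact (mul_lt_mul_of_pos_right hε1 h0).trans_eq (one_mul _)

/-- The norm of `x` is attained at some `j` outside `S`, where the scaling is at least as large as
at the places of `S`. -/
theorem SmallOn.diag {S : Fin ν → Prop} {x : Fin ν → F} (hx : SmallOn S x) {D : Fin ν → Fˣ}
    (hD : ∀ i j, S i → ¬ S j → ‖(D i : F)‖ ≤ ‖(D j : F)‖) :
    SmallOn S ((diagGL D).1.mulVec x) := by
  have e : ∀ i, (diagGL D).1.mulVec x i = D i * x i := fun i => by
    simp [diagGL, Matrix.mulVec_diagonal]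
  intro i hi
  have : Nonempty (Fin ν) := ⟨i⟩
  obtain ⟨j, hj⟩ := Finite.exists_max fun i => ‖x i‖
  have hxj : ‖x‖ ≤ ‖x j‖ := (pi_norm_le_iff_of_nonneg (norm_nonneg _)).2 hj
  have hjS : ¬ S j := fun h => absurd (hx j h) (not_lt.2 hxj)
  refine lt_of_lt_of_le ?_ (norm_le_pi_norm _ j)
  rw [e, e, norm_mul, norm_mul]
  exact mul_lt_mul_of_le_of_lt_of_nonneg_of_pos (hD i j hi hjS) ((hx i hi).trans_le hxj)
    (norm_nonneg _) (by simp)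

theorem w_mulVec (x : Fin ν → F) : (wGL F ν).1.mulVec x = fun i => x i.rev := by
  funext i
  have : ∀ k : Fin ν, (i = k.rev) ↔ (k = i.rev) := fun k => by
    constructor <;> (rintro rfl; simp)
  simp [wGL, Matrix.mulVec, dotProduct, this]

theorem norm_comp_rev (x : Fin ν → F) : ‖fun i : Fin ν => x i.rev‖ = ‖x‖ := by
  refine le_antisymm ((pi_norm_le_iff_of_nonneg (norm_nonneg _)).2 fun i => norm_le_pi_norm x _)
    ((pi_norm_le_iff_of_nonneg (norm_nonneg _)).2 fun i => ?_)
  have := norm_le_pi_norm (fun i : Fin ν => x i.rev) i.rev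
  rwa [Fin.rev_rev] at this

theorem SmallOn.w {S : Fin ν → Prop} {x : Fin ν → F} (hx : SmallOn S x) :
    SmallOn (fun i => S i.rev) ((wGL F ν).1.mulVec x) := by
  intro i hi
  rw [w_mulVec, norm_comp_rev]
  exact hx _ hi

theorem NU_sub_one (hϖ : IsUniformizer ϖ) {a : GL (Fin ν) F} (ha : a ∈ NU ν ϖ s) (i j : Fin ν) :
    ‖a.1 i j - (1 : Matrix (Fin ν) (Fin ν) F) i j‖ ≤ ‖(ϖ : F)‖ ^ s := by
  have h0 : 0 ≤ ‖(ϖ : F)‖ ^ s := pow_nonneg (norm_nonneg _) _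
  rw [mem_NU hϖ] at ha
  rcases lt_trichotomy i j with h | h | h
  · rw [Matrix.one_apply_ne h.ne, sub_zero]; exact (ha.2 i j).1.trans (wt_le_pow hϖ h)
  · subst h; rw [ha.1.1, Matrix.one_apply_eq, sub_self, norm_zero]; exact h0
  · rw [Matrix.one_apply_ne h.ne', ha.1.2 i j h, sub_zero, norm_zero]; exact h0

/-- Matrices congruent to `1` preserve smallness of coordinates, `w` exchanges the two ends, and the
dominant diagonal favours the later coordinates. For `g⁻¹` the diagonal is inverted, but it acts
before `w` does. -/
theorem SmallOn.cell (hϖ : IsUniformizer ϖ) (hs : 1 ≤ s) {ρ : Fin ν → ℝ}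
    (hρ : ∀ i j, i < j → ρ i ≤ ρ j) {g : GL (Fin ν) F} (hg : InCell ϖ s ρ g) {k : ℕ}
    {x : Fin ν → F} (hx : SmallOn (fun i => ν ≤ i + k) x) :
    SmallOn (fun i => (i : ℕ) < k) (g.1.mulVec x) ∧
    SmallOn (fun i => (i : ℕ) < k) ((g⁻¹).1.mulVec x) := by
  obtain ⟨a, ha, b, hb, D, hD, rfl⟩ := hg
  have h0 : 0 ≤ ‖(ϖ : F)‖ ^ s := pow_nonneg (norm_nonneg _) _
  have h1 := pow_unif_lt_one (s := s) hϖ hs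
  have hrev : ∀ y : Fin ν → F, SmallOn (fun i : Fin ν => ν ≤ (i.rev : ℕ) + k) y →
      SmallOn (fun i => (i : ℕ) < k) y := fun y hy i hi => hy i (by
    have := i.2
    change (i : ℕ) < k at hi
    change ν ≤ (i.rev : ℕ) + k
    rw [Fin.val_rev]; omega)
  constructor
  · have step := (hrev _ ((hx.mulVec h0 h1 (NU_sub_one hϖ hb)).w)).diag (D := D) fun i j hi hj => by
      rw [hD, hD]; exact hρ i j (Fin.lt_def.2 (lt_of_lt_of_le hi (not_lt.1 hj)))
    have := step.mulVec h0 h1 (NU_sub_one hϖ ha)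
    rwa [Matrix.mulVec_mulVec, Matrix.mulVec_mulVec, Matrix.mulVec_mulVec] at this
  · have step := (hx.mulVec h0 h1 (NU_sub_one hϖ (Subgroup.inv_mem _ ha))).diag (D := D⁻¹)
      fun i j hi hj => by
        have hij : j < i := by rw [Fin.lt_def]; omega
        simp only [Pi.inv_apply, Units.val_inv_eq_inv_val, norm_inv]
        rw [hD, hD]
        exact inv_anti₀ (by rw [← hD]; simp) (hρ j i hij)
    have := (hrev _ step.w).mulVec h0 h1 (NU_sub_one hϖ (Subgroup.inv_mem _ hb))
    rw [Matrix.mulVec_mulVec, Matrix.mulVec_mulVec, Matrix.mulVec_mulVec, diagGL_inv] at this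
    have e : (a * diagGL D * wGL F ν * b)⁻¹ = b⁻¹ * (wGL F ν * ((diagGL D)⁻¹ * a⁻¹)) := by
      rw [mul_inv_rev, mul_inv_rev, mul_inv_rev, wGL_inv]
    rw [e]
    simpa only [Units.val_mul, Matrix.mul_assoc] using this

end SmallCoordinates

section Regularity

variable {F : Type*} [NontriviallyNormedField F] [IsUltrametricDist F] {n : ℕ} {ϖ : Fˣ} {s : ℕ}

/-- Extension of a vector by zero. -/
def extZero (x : Fin n → F) : Fin (n + 1) → F :=
  fun i => Fin.lastCases (motive := fun _ => F) 0 x i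

theorem extZero_castSucc (x : Fin n → F) (i : Fin n) : extZero x i.castSucc = x i := by
  simp [extZero]

theorem extZero_last (x : Fin n → F) : extZero x (Fin.last n) = 0 := by simp [extZero]

theorem norm_extZero (x : Fin n → F) : ‖extZero x‖ = ‖x‖ := by
  refine le_antisymm ((pi_norm_le_iff_of_nonneg (norm_nonneg _)).2 fun i => ?_)
    ((pi_norm_le_iff_of_nonneg (norm_nonneg _)).2 fun i => ?_)
  · refine Fin.lastCases ?_ (fun i => ?_) i
    · rw [extZero_last, norm_zero]; exact norm_nonneg _
    · rw [extZero_castSucc]; exact norm_le_pi_norm x i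
  · rw [← extZero_castSucc x i]; exact norm_le_pi_norm _ _

theorem eq_extZero {v : Fin (n + 1) → F} (h : v (Fin.last n) = 0) :
    v = extZero fun i => v i.castSucc := by
  funext i
  refine Fin.lastCases ?_ (fun i => ?_) i
  · rw [extZero_last, h]
  · rw [extZero_castSucc]

theorem blockGL_mulVec_extZero (A : GL (Fin n) F) (u : Matrix (Fin n) (Fin 1) F)
    (x : Fin n → F) : (blockGL A u).1.mulVec (extZero x) = extZero (A.1.mulVec x) := by
  funext i
  simp only [Matrix.mulVec, dotProduct]
  rw [Fin.sum_univ_castSucc, extZero_last, mul_zero, add_zero]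
  simp only [extZero_castSucc]
  refine Fin.lastCases ?_ (fun i => ?_) i
  · simp [extZero_last, blockGL_apply_last_castSucc]
  · simp only [blockGL_apply_castSucc_castSucc, extZero_castSucc, Matrix.mulVec, dotProduct]

/-- By Cayley–Hamilton every power is a combination of the powers with exponent at most `n`. -/
theorem pow_mulVec_last_eq_zero {A : Matrix (Fin (n + 1)) (Fin (n + 1)) F} {v : Fin (n + 1) → F}
    (h : ∀ i : Fin (n + 1), (A ^ (i : ℕ)).mulVec v (Fin.last n) = 0) (k : ℕ) :
    (A ^ k).mulVec v (Fin.last n) = 0 := by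
  have hd : (Polynomial.X ^ k %ₘ A.charpoly).natDegree < n + 1 := by
    have h1 := Polynomial.natDegree_modByMonic_lt (Polynomial.X ^ k) A.charpoly_monic
      (fun h => by
        have := A.charpoly_natDegree_eq_dim
        rw [h, Polynomial.natDegree_one, Fintype.card_fin] at this
        omega)
    rwa [A.charpoly_natDegree_eq_dim, Fintype.card_fin] at h1
  rw [A.pow_eq_aeval_mod_charpoly, Polynomial.aeval_eq_sum_range' hd, Matrix.sum_mulVec,
    Finset.sum_apply]
  refine Finset.sum_eq_zero fun i hi => ?_
  rw [Matrix.smul_mulVec, Pi.smul_apply, h ⟨i, Finset.mem_range.1 hi⟩, smul_zero]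

/-- If `D⁺` vanished, there would be a nonzero `v` with `eᵗ Sᵏ v = 0` for all `k`, where `S = δ_⋆`.
Such vectors form an `S`-stable space inside `F₀ⁿ`. By induction on `k` the last `k` coordinates of
each nonzero one are smaller than its norm: the step applies the cell of `GL_n` to `Sx`, appends a
zero coordinate, and applies the inverse cell of `GL_{n+1}`. At `k = n` this is absurd. -/
theorem Dplus_ne_zero_of_cell (hϖ : IsUniformizer ϖ) (hs : 1 ≤ s) {ρ : Fin n → ℝ}
    {σ : Fin (n + 1) → ℝ} (hρ : ∀ i j, i < j → ρ i ≤ ρ j) (hσ : ∀ i j, i < j → σ i ≤ σ j)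
    {δ : G0 n F} (h1 : InCell ϖ s ρ δ.1) (h2 : InCell ϖ s σ ((mB n F)⁻¹ * δ.2 * mB n F)) :
    Dplus (gstar δ) ≠ 0 := by
  intro h0
  obtain ⟨v, hv0, hv⟩ := Matrix.exists_mulVec_eq_zero_iff.2 (Dplus_eq (gstar δ) ▸ h0)
  set S := (gstar δ).1 with hS
  have hvk : ∀ k : ℕ, (S ^ k).mulVec v (Fin.last n) = 0 :=
    pow_mulVec_last_eq_zero fun i => congrFun hv i
  have hSinj : ∀ x, S.mulVec x = 0 → x = 0 := fun x hx => by
    have := congrArg ((gstar δ)⁻¹).1.mulVec hx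
    rw [Matrix.mulVec_mulVec, Matrix.mulVec_zero, hS, ← Units.val_mul, inv_mul_cancel,
      Units.val_one, Matrix.one_mulVec] at this
    exact this
  have main : ∀ k ≤ n, ∀ x : Fin n → F, x ≠ 0 →
      (∀ l : ℕ, (S ^ l).mulVec (extZero x) (Fin.last n) = 0) →
      SmallOn (fun i : Fin n => n ≤ (i : ℕ) + k) x := by
    intro k
    induction k with
    | zero => exact fun _ x _ _ i hi => absurd i.2 (not_lt.2 hi)
    | succ k ih =>
      intro hk x hx hxl
      obtain ⟨x', hx'⟩ : ∃ x', S.mulVec (extZero x) = extZero x' :=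
        ⟨_, eq_extZero (by simpa using hxl 1)⟩
      have hx0' : x' ≠ 0 := by
        rintro rfl
        have : extZero x = 0 := hSinj _ (hx'.trans (by
          rw [← norm_eq_zero, norm_extZero, norm_zero]))
        rw [← norm_eq_zero, norm_extZero, norm_eq_zero] at this
        exact hx this
      have hxl' : ∀ l : ℕ, (S ^ l).mulVec (extZero x') (Fin.last n) = 0 := fun l => by
        rw [← hx', Matrix.mulVec_mulVec, ← pow_succ]; exact hxl _
      have hu := ((ih (by omega) x' hx0' hxl').cell hϖ hs hρ h1).1
      set u := δ.1.1.mulVec x' with hudef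
      have hu0 : u ≠ 0 := fun h => hx0' (by
        have := congrArg (δ.1⁻¹).1.mulVec h
        rw [hudef, Matrix.mulVec_mulVec, Matrix.mulVec_zero, ← Units.val_mul, inv_mul_cancel,
          Units.val_one, Matrix.one_mulVec] at this
        exact this)
      have hwinv : ∀ y : Fin n → F, ((mB n F)⁻¹).1.mulVec (extZero y) =
          extZero fun i => y i.rev := fun y => by
        rw [mB, blockGL_inv, blockGL_mulVec_extZero, wGL_inv, w_mulVec]
      -- The appended zero is what raises the number of small coordinates from `k` to `k + 1`.
      have hz : SmallOn (fun i : Fin (n + 1) => n + 1 ≤ (i : ℕ) + (k + 1))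
          (extZero fun i => u i.rev) := by
        intro i
        rw [norm_extZero, norm_comp_rev]
        refine Fin.lastCases (fun _ => ?_) (fun i hi => ?_) i
        · rw [extZero_last, norm_zero]; exact norm_pos_iff.2 hu0
        · rw [extZero_castSucc]
          refine hu _ ?_
          have := i.2
          change n + 1 ≤ (i : ℕ) + (k + 1) at hi
          change (i.rev : ℕ) < k
          rw [Fin.val_rev]; omega
      have hfin := (hz.cell hϖ hs hσ h2).2
      have eg : ((mB n F)⁻¹ * δ.2 * mB n F)⁻¹ * ((mB n F)⁻¹ * (embGL δ.1 * gstar δ)) =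
          (mB n F)⁻¹ := by
        rw [gstar]; group
      have hue : extZero (fun i => u i.rev) =
          ((mB n F)⁻¹ * (embGL δ.1 * gstar δ)).1.mulVec (extZero x) := by
        rw [← hwinv, hudef, ← blockGL_mulVec_extZero δ.1 0, ← hx', Units.val_mul, Units.val_mul,
          ← Matrix.mulVec_mulVec, ← Matrix.mulVec_mulVec]
        rfl
      have e : (((mB n F)⁻¹ * δ.2 * mB n F)⁻¹).1.mulVec (extZero fun i => u i.rev) =
          extZero fun i => x i.rev := by
        rw [hue, Matrix.mulVec_mulVec, ← Units.val_mul, eg, hwinv]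
      rw [e] at hfin
      intro i hi
      have hlt : (i.rev.castSucc : ℕ) < k + 1 := by
        have := i.2
        rw [Fin.val_castSucc, Fin.val_rev]; omega
      have := hfin i.rev.castSucc hlt
      rwa [norm_extZero, norm_comp_rev, extZero_castSucc, Fin.rev_rev] at this
  have hvlast : v (Fin.last n) = 0 := by simpa using hvk 0
  obtain ⟨x, hx⟩ : ∃ x, v = extZero x := ⟨_, eq_extZero hvlast⟩
  have hx0 : x ≠ 0 := by
    rintro rfl
    apply hv0
    rw [hx, ← norm_eq_zero, norm_extZero, norm_zero]
  have hsm := main n le_rfl x hx0 (hx ▸ hvk)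
  have hpos := norm_pos_iff.2 hx0
  have : ‖x‖ < ‖x‖ := (pi_norm_lt_iff hpos).2 fun i => hsm i (by omega)
  exact lt_irrefl _ this

end Regularity

/-! ### Conjugation by powers of `t` -/

section Conjugation

variable {F : Type*} [NontriviallyNormedField F] [IsUltrametricDist F] {ν : ℕ} {ϖ : Fˣ} {s c : ℕ}

theorem zpow_mul_wt_le (hϖ : IsUniformizer ϖ) (hc : c ≤ s) (i j : ℕ) :
    ‖(ϖ : F)‖ ^ (-(s : ℤ) * ((j : ℤ) - i)) * wt ϖ s i j ≤ wt ϖ c j i := by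
  have h0 := norm_pos_unif ϖ
  rcases le_total i j with h | h
  · have e : -(s : ℤ) * ((j : ℤ) - i) = -((s * (j - i) : ℕ) : ℤ) := by push_cast [h]; ring
    rw [wt_of_le h, wt, e, zpow_neg, zpow_natCast, inv_mul_cancel₀ (pow_pos h0 _).ne']
  · have e : -(s : ℤ) * ((j : ℤ) - i) = ((s * (i - j) : ℕ) : ℤ) := by push_cast [h]; ring
    rw [wt_of_le h, mul_one, e, zpow_natCast]
    exact wt_le_wt hϖ hc

/-- Conjugation by `t^{-s}` removes the divisibility above the diagonal and creates divisibility by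
`ϖ^{s(i-j)}` below it, which suffices for level `c ≤ s`. -/
theorem conj_mem_Kangle (hϖ : IsUniformizer ϖ) (hc : c ≤ s) {g : GL (Fin ν) F}
    (hg : g ∈ Kround ϖ ν (-(s : ℤ))) (hd : ∀ i, ‖g.1 i i - 1‖ ≤ ‖(ϖ : F)‖ ^ (c - 1)) :
    (tGL ϖ ν ^ s)⁻¹ * g * tGL ϖ ν ^ s ∈ Kangle ϖ ν c := by
  have hz : ∀ g : GL (Fin ν) F, (tGL ϖ ν ^ s)⁻¹ * g * tGL ϖ ν ^ s =
      tGL ϖ ν ^ (-(s : ℤ)) * g * (tGL ϖ ν ^ (-(s : ℤ)))⁻¹ := fun g => by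
    rw [zpow_neg, zpow_natCast, inv_inv]
  have key : ∀ g : GL (Fin ν) F, (∀ i j, ‖g.1 i j‖ ≤ wt ϖ s i j) → ∀ i j,
      ‖((tGL ϖ ν ^ s)⁻¹ * g * tGL ϖ ν ^ s).1 i j‖ ≤ wt ϖ c j i := by
    intro g hg i j
    rw [hz, norm_conj_t]
    exact (mul_le_mul_of_nonneg_left (hg i j) (zpow_nonneg (norm_nonneg _) _)).trans
      (zpow_mul_wt_le hϖ hc i j)
  rw [mem_Kround_neg_iff hϖ] at hg
  refine ⟨(mem_Kround_iff hϖ).2 fun i j => ⟨key g (fun i j => (hg i j).1) i j, ?_⟩, fun i => ?_⟩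
  · have : ((tGL ϖ ν ^ s)⁻¹ * g * tGL ϖ ν ^ s)⁻¹ = (tGL ϖ ν ^ s)⁻¹ * g⁻¹ * tGL ϖ ν ^ s := by group
    rw [this]
    exact key _ (fun i j => (hg i j).2) i j
  · rw [hz, tGL_zpow, conj_diag_apply, mul_right_comm, mul_inv_cancel₀ (Units.ne_zero _), one_mul]
    exact hd i

theorem conj_mem_NU_iff (hϖ : IsUniformizer ϖ) {u : GL (Fin ν) F} :
    tGL ϖ ν ^ s * u * (tGL ϖ ν ^ s)⁻¹ ∈ NU ν ϖ s ↔ u ∈ upperO F ν := by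
  have h0 := norm_pos_unif ϖ
  have hU : UpperUnip (tGL ϖ ν ^ s * u * (tGL ϖ ν ^ s)⁻¹) ↔ UpperUnip u := by
    rw [tGL_pow]
    simp only [UpperUnip, conj_diag_apply]
    refine and_congr (forall_congr' fun i => ?_) (forall_congr' fun i => forall_congr' fun j =>
      imp_congr_right fun _ => by simp)
    rw [mul_right_comm, mul_inv_cancel₀ (Units.ne_zero _), one_mul]
  have key : ∀ v : GL (Fin ν) F, UpperUnip v → ∀ i j,
      (‖(tGL ϖ ν ^ s * v * (tGL ϖ ν ^ s)⁻¹).1 i j‖ ≤ wt ϖ s i j ↔ ‖v.1 i j‖ ≤ 1) := by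
    intro v hv i j
    rw [← zpow_natCast, norm_conj_t]
    rcases le_or_gt i j with h | h
    · have e : (s : ℤ) * ((j : ℤ) - i) = ((s * (j - i : ℕ) : ℕ) : ℤ) := by
        have : (i : ℕ) ≤ j := h
        push_cast [this]; ring
      rw [e, zpow_natCast, wt]
      exact mul_le_iff_le_one_right (pow_pos h0 _)
    · rw [hv.2 i j h, norm_zero, mul_zero]
      exact ⟨fun _ => zero_le_one, fun _ => (wt_pos _ _ _).le⟩
  have hinv : (tGL ϖ ν ^ s * u * (tGL ϖ ν ^ s)⁻¹)⁻¹ = tGL ϖ ν ^ s * u⁻¹ * (tGL ϖ ν ^ s)⁻¹ := by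
    group
  rw [mem_NU hϖ, hU, upperO, Subgroup.mem_inf, mem_upperN, hinv]
  refine and_congr_right fun hu => ?_
  have hu' : UpperUnip u⁻¹ := (upperN F ν).inv_mem hu
  simp only [key u hu, key u⁻¹ hu', forall_and]
  rfl

theorem NU_anti (hϖ : IsUniformizer ϖ) {s' : ℕ} (h : s ≤ s') : NU ν ϖ s' ≤ NU ν ϖ s := by
  intro u hu
  rw [mem_NU hϖ] at hu ⊢
  exact ⟨hu.1, fun i j => ⟨(hu.2 i j).1.trans (wt_le_wt hϖ h), (hu.2 i j).2.trans (wt_le_wt hϖ h)⟩⟩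

theorem IsDom.norm_le (ϖ : Fˣ) {a : Fin ν → Fˣ} {r : ℕ} (h : IsDom (a / tVec ϖ ν ^ r))
    {i j : Fin ν} (hij : i < j) : ‖(a i : F)‖ ≤ wt ϖ r i j * ‖(a j : F)‖ := by
  have h0 := norm_pos_unif ϖ
  have h1 := h i j hij
  simp only [Pi.div_apply, Pi.pow_apply, tVec, Units.val_div_eq_div_val, Units.val_pow_eq_pow_val,
    norm_div, norm_pow, ← pow_mul] at h1
  rw [div_le_iff₀ (pow_pos h0 _)] at h1
  refine h1.trans_eq ?_
  have e : (ν - 1 - (i : ℕ)) * r = r * ((j : ℕ) - i) + (ν - 1 - (j : ℕ)) * r := by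
    have h2 : (i : ℕ) < j := hij
    have h3 := j.2
    have : ν - 1 - (i : ℕ) = ((j : ℕ) - i) + (ν - 1 - (j : ℕ)) := by omega
    rw [this]; ring
  rw [e, pow_add, wt, div_mul_eq_mul_div, ← mul_assoc,
    mul_div_cancel_right₀ _ (pow_pos h0 _).ne', mul_comm]

/-- The factor `a` supplies the whole gap `ϖ^{s(j-i)}`; of `b` only its dominance is needed. -/
theorem IsDom.mul_iota_norm_le (hϖ : IsUniformizer ϖ) {a b : Fin ν → Fˣ} {c : ℕ}
    (ha : IsDom (a / tVec ϖ ν ^ (s + c))) (hb : IsDom (b / tVec ϖ ν ^ (s + c))) {i j : Fin ν}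
    (hij : i < j) :
    ‖((a * iotaT b) i : F)‖ ≤ wt ϖ s i j * ‖((a * iotaT b) j : F)‖ := by
  have h1 := (ha.norm_le ϖ hij).trans (mul_le_mul_of_nonneg_right
    (wt_le_wt hϖ (Nat.le_add_right s c)) (norm_nonneg _))
  have h2 : ‖(b j.rev : F)‖ ≤ ‖(b i.rev : F)‖ :=
    (hb.norm_le ϖ (show j.rev < i.rev by simpa using hij)).trans
      (mul_le_of_le_one_left (norm_nonneg _) (wt_le_one hϖ _ _ _))
  have h3 : ‖((iotaT b i : Fˣ) : F)‖ ≤ ‖((iotaT b j : Fˣ) : F)‖ := by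
    simp only [iotaT, Units.val_inv_eq_inv_val, norm_inv]
    exact inv_anti₀ (by simp) h2
  rw [Pi.mul_apply, Pi.mul_apply, Units.val_mul, Units.val_mul, norm_mul, norm_mul, ← mul_assoc]
  exact mul_le_mul h1 h3 (norm_nonneg _) (mul_nonneg (wt_pos _ _ _).le (norm_nonneg _))

theorem lower_inv {b : GL (Fin ν) F} (h0 : ∀ i j, i < j → b.1 i j = 0) (i j : Fin ν)
    (hij : i < j) : (b⁻¹).1 i j = 0 := by
  have hw := upper_inv (wGL F ν * b * (wGL F ν)⁻¹) fun i j hij => by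
    rw [conj_w_apply]; exact h0 _ _ (by simpa using hij)
  have e : (wGL F ν * b * (wGL F ν)⁻¹)⁻¹ = wGL F ν * b⁻¹ * (wGL F ν)⁻¹ := by group
  have := hw.1 i.rev j.rev (by simpa using hij)
  rwa [e, conj_w_apply, Fin.rev_rev, Fin.rev_rev] at this

theorem lower_mem_Kround (hϖ : IsUniformizer ϖ) {b : GL (Fin ν) F} (hb : b ∈ GLO F ν)
    (h0 : ∀ i j, i < j → b.1 i j = 0) (s : ℕ) : b ∈ Kround ϖ ν (-(s : ℤ)) := by
  rw [mem_Kround_neg_iff hϖ]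
  intro i j
  rcases lt_or_ge i j with hij | hij
  · rw [h0 i j hij, lower_inv h0 i j hij, norm_zero]
    exact ⟨(wt_pos _ _ _).le, (wt_pos _ _ _).le⟩
  · rw [wt_of_le (show (j : ℕ) ≤ i from hij)]
    exact ⟨hb.1 i j, hb.2 i j⟩

end Conjugation

/-! ### The orbit set and its dependence on `s` -/

section OrbitSet

variable {F : Type*} [NontriviallyNormedField F] [IsUltrametricDist F] [LocallyCompactSpace F]
  {n c s : ℕ} {ϖ : Fˣ}
  {Kn : Subgroup (GL (Fin n) F)} {Kn1 : Subgroup (GL (Fin (n + 1)) F)} {t' : T0 n F × T0 n F}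

/-- The element `t'₁ t'₂^ι w₀`. -/
def X0 (t' : T0 n F × T0 n F) : G0 n F := diag0 (t'.1 * iota0 t'.2) * w0 n F

theorem diag_w_diag_inv {ν : ℕ} (a b : Fin ν → Fˣ) :
    diagGL (a * iotaT b) * wGL F ν = diagGL a * wGL F ν * (diagGL b)⁻¹ := by
  rw [diagGL_mul, ← conj_w_diag_inv]
  group

/-- Since `X° = y₁ w y₂⁻¹` with `y_i = t'_i t^{-s}`, conjugation by `t^s` cancels every power of
`t`. In the coordinates of `m₀` the centre of the double coset therefore does not depend on `s`. -/
theorem conj_t_X {ν : ℕ} (a b : Fin ν → Fˣ) (s : ℕ) :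
    tGL ϖ ν ^ s * (diagGL ((a / tVec ϖ ν ^ s) * iotaT (b / tVec ϖ ν ^ s)) * wGL F ν) *
      (tGL ϖ ν ^ s)⁻¹ = diagGL (a * iotaT b) * wGL F ν := by
  rw [diag_w_diag_inv, diag_w_diag_inv, diagGL_div, diagGL_div, ← tGL_pow]
  have h : ∀ a : Fin ν → Fˣ, tGL ϖ ν ^ s * diagGL a = diagGL a * tGL ϖ ν ^ s := fun a => by
    rw [tGL_pow, ← diagGL_mul, ← diagGL_mul, mul_comm]
  calc _ = tGL ϖ ν ^ s * diagGL a * (tGL ϖ ν ^ s)⁻¹ * wGL F ν *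
        (tGL ϖ ν ^ s * (diagGL b * (tGL ϖ ν ^ s)⁻¹))⁻¹ := by group
    _ = _ := by rw [h, ← mul_assoc, h]; group

theorem conj_t0_X (s : ℕ) :
    t0 ϖ n ^ s * (diag0 ((t'.1 / tVec0 ϖ n ^ s) * iota0 (t'.2 / tVec0 ϖ n ^ s)) * w0 n F) *
      (t0 ϖ n ^ s)⁻¹ = X0 t' :=
  Prod.ext (conj_t_X _ _ s) (conj_t_X _ _ s)

theorem yel_w_yel (s : ℕ) :
    yel ϖ s t'.1 * w0 n F * (yel ϖ s t'.2)⁻¹ =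
      diag0 ((t'.1 / tVec0 ϖ n ^ s) * iota0 (t'.2 / tVec0 ϖ n ^ s)) * w0 n F :=
  Prod.ext (diag_w_diag_inv _ _).symm (diag_w_diag_inv _ _).symm

theorem mem_orbitSet_iff {x : G0 n F} : x ∈ orbitSet ϖ Kn Kn1 t' s ↔
    ∃ a ∈ K0 Kn Kn1, ∃ b ∈ K0 Kn Kn1, (m0 n F)⁻¹ * x * m0 n F =
      t0 ϖ n ^ s * a * (t0 ϖ n ^ s)⁻¹ * X0 t' * (t0 ϖ n ^ s * b * (t0 ϖ n ^ s)⁻¹) := by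
  have e : ∀ a b : G0 n F, t0 ϖ n ^ s * a * (t0 ϖ n ^ s)⁻¹ * X0 t' *
      (t0 ϖ n ^ s * b * (t0 ϖ n ^ s)⁻¹) = t0 ϖ n ^ s * a *
      (diag0 ((t'.1 / tVec0 ϖ n ^ s) * iota0 (t'.2 / tVec0 ϖ n ^ s)) * w0 n F) * b *
      (t0 ϖ n ^ s)⁻¹ := fun a b => by
    rw [← conj_t0_X (ϖ := ϖ) s]; group
  simp only [e]
  constructor
  · rintro ⟨a, ha, b, hb, rfl⟩
    exact ⟨a, ha, b, hb, by rw [m0s]; group⟩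
  · rintro ⟨a, ha, b, hb, h⟩
    refine ⟨a, ha, b, hb, ?_⟩
    have : x = m0 n F * ((m0 n F)⁻¹ * x * m0 n F) * (m0 n F)⁻¹ := by group
    rw [this, h, m0s]; group

/-- The group `t₀^s N(𝒪₀) t₀^{-s}`. -/
def NU0 (n : ℕ) (ϖ : Fˣ) (s : ℕ) : Subgroup (G0 n F) := (NU n ϖ s).prod (NU (n + 1) ϖ s)

theorem conj_mem_NU0_iff (hϖ : IsUniformizer ϖ) {u : G0 n F} :
    t0 ϖ n ^ s * u * (t0 ϖ n ^ s)⁻¹ ∈ NU0 n ϖ s ↔ u ∈ NO0 F n := by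
  rw [NU0, NO0, Subgroup.mem_prod, Subgroup.mem_prod, ← conj_mem_NU_iff hϖ (s := s),
    ← conj_mem_NU_iff hϖ (s := s)]
  rfl

theorem t0_comm {d : G0 n F} (hd : d ∈ T00 F n) : t0 ϖ n ^ s * d * (t0 ϖ n ^ s)⁻¹ = d := by
  obtain ⟨⟨a, ha⟩, ⟨b, hb⟩⟩ := hd
  have h : ∀ (ν : ℕ) (a : Fin ν → Fˣ), tGL ϖ ν ^ s * diagGL a * (tGL ϖ ν ^ s)⁻¹ = diagGL a :=
    fun ν a => by rw [tGL_pow, ← diagGL_mul, mul_comm, diagGL_mul, mul_inv_cancel_right]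
  have e : d = (diagGL a, diagGL b) := Prod.ext ha.symm hb.symm
  rw [e]
  exact Prod.ext (h n a) (h (n + 1) b)

theorem SuffPos.yel_tDom (hϖ : IsUniformizer ϖ) (hs : SuffPos ϖ c Kn Kn1 t' s) :
    TDom (NO0 F n) (w0 n F) (yel ϖ s t'.1) ∧ TDom (NO0 F n) (w0 n F) (yel ϖ s t'.2) := by
  have hτ : TDom (NO0 F n) (w0 n F) (t0 ϖ n ^ c) := by
    rw [t0_pow, tGL_pow, tGL_pow]
    exact (isDom_tVec hϖ _ _).tDom.prod (isDom_tVec hϖ _ _).tDom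
  have h := hs.tDom
  have h1 := h.1.mul hτ
  have h2 := h.2.mul hτ
  rw [inv_mul_cancel_right] at h1 h2
  exact ⟨h1, h2⟩

/-- By `Tri.KXK` the `L` parts of `K₀` can be absorbed, so `s` enters only through the unipotent
groups, which decrease with `s`. This gives `orbitSet_anti`. -/
theorem mem_orbitSet_iff_cell (hϖ : IsUniformizer ϖ) (hKn : IsCSDIComponent ϖ c Kn)
    (hKn1 : IsCSDIComponent ϖ c Kn1) (hs : SuffPos ϖ c Kn Kn1 t' s) {x : G0 n F} :
    x ∈ orbitSet ϖ Kn Kn1 t' s ↔ ∃ u ∈ NU0 n ϖ s, ∃ d ∈ T00 F n, d ∈ K0 Kn Kn1 ∧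
      ∃ v ∈ NU0 n ϖ s, (m0 n F)⁻¹ * x * m0 n F = u * d * X0 t' * v := by
  have D := triG0 hϖ hKn hKn1
  rw [mem_orbitSet_iff]
  constructor
  · rintro ⟨a, ha, b, hb, e⟩
    obtain ⟨h1, h2⟩ := hs.yel_tDom hϖ
    obtain ⟨u, hu, d, hd, hdK, v, hv, e'⟩ := D.KXK (yel_mem s t'.1) (yel_mem s t'.2) h1 h2 ha hb
    rw [yel_w_yel] at e'
    refine ⟨_, (conj_mem_NU0_iff hϖ).2 hu, d, hd, hdK, _, (conj_mem_NU0_iff hϖ).2 hv, ?_⟩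
    rw [e]
    nth_rewrite 1 [← t0_comm (ϖ := ϖ) (s := s) hd]
    rw [← conj_t0_X (ϖ := ϖ) s]
    have := congrArg (fun z => t0 ϖ n ^ s * z * (t0 ϖ n ^ s)⁻¹) e'
    refine Eq.trans (by group) (this.trans ?_)
    group
  · rintro ⟨u, hu, d, hd, hdK, v, hv, e⟩
    have hu' : (t0 ϖ n ^ s)⁻¹ * u * t0 ϖ n ^ s ∈ NO0 F n := by
      rw [← conj_mem_NU0_iff hϖ (s := s)]; convert hu using 1; group
    have hv' : (t0 ϖ n ^ s)⁻¹ * v * t0 ϖ n ^ s ∈ NO0 F n := by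
      rw [← conj_mem_NU0_iff hϖ (s := s)]; convert hv using 1; group
    refine ⟨_, (K0 Kn Kn1).mul_mem (D.N0K hu') hdK, _, D.N0K hv', ?_⟩
    rw [e]
    nth_rewrite 1 [← t0_comm (ϖ := ϖ) (s := s) hd]
    group

theorem orbitSet_anti (hϖ : IsUniformizer ϖ) (hKn : IsCSDIComponent ϖ c Kn)
    (hKn1 : IsCSDIComponent ϖ c Kn1) {s' : ℕ} (hs : SuffPos ϖ c Kn Kn1 t' s)
    (hs' : SuffPos ϖ c Kn Kn1 t' s') (h : s ≤ s') :
    orbitSet ϖ Kn Kn1 t' s' ⊆ orbitSet ϖ Kn Kn1 t' s := by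
  intro x hx
  rw [mem_orbitSet_iff_cell hϖ hKn hKn1 hs'] at hx
  rw [mem_orbitSet_iff_cell hϖ hKn hKn1 hs]
  obtain ⟨u, hu, d, hd, hdK, v, hv, e⟩ := hx
  exact ⟨u, ⟨NU_anti hϖ h hu.1, NU_anti hϖ h hu.2⟩, d, hd, hdK, v,
    ⟨NU_anti hϖ h hv.1, NU_anti hϖ h hv.2⟩, e⟩

theorem norm_diag_eq_one {ν : ℕ} {a : Fin ν → Fˣ} (h : diagGL a ∈ GLO F ν) (i : Fin ν) :
    ‖(a i : F)‖ = 1 := by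
  have h1 := h.1 i i
  have h2 := h.2 i i
  rw [diagGL_apply_self] at h1
  rw [← diagGL_inv, diagGL_apply_self, Pi.inv_apply, Units.val_inv_eq_inv_val, norm_inv] at h2
  exact le_antisymm h1 ((inv_le_one₀ (by simp)).1 h2)

theorem orbitSet_inCell (hϖ : IsUniformizer ϖ) (hKn : IsCSDIComponent ϖ c Kn)
    (hKn1 : IsCSDIComponent ϖ c Kn1) (hs : SuffPos ϖ c Kn Kn1 t' s) {x : G0 n F}
    (hx : x ∈ orbitSet ϖ Kn Kn1 t' s) :
    InCell ϖ s (fun i => ‖((t'.1.1 * iotaT t'.2.1) i : F)‖) x.1 ∧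
    InCell ϖ s (fun i => ‖((t'.1.2 * iotaT t'.2.2) i : F)‖) ((mB n F)⁻¹ * x.2 * mB n F) := by
  rw [mem_orbitSet_iff_cell hϖ hKn hKn1 hs] at hx
  obtain ⟨u, hu, d, ⟨⟨a, ha⟩, ⟨b, hb⟩⟩, hdK, v, hv, e⟩ := hx
  have hda : ∀ i, ‖(a i : F)‖ = 1 := norm_diag_eq_one (by
    rw [show diagGL a = d.1 from ha]; exact (hKn.1.2.1 hdK.1).1)
  have hdb : ∀ i, ‖(b i : F)‖ = 1 := norm_diag_eq_one (by
    rw [show diagGL b = d.2 from hb]; exact (hKn1.1.2.1 hdK.2).1)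
  constructor
  · refine ⟨u.1, hu.1, v.1, hv.1, a * (t'.1.1 * iotaT t'.2.1), fun i => ?_, ?_⟩
    · rw [Pi.mul_apply, Units.val_mul, norm_mul, hda, one_mul]
    · have := congrArg Prod.fst e
      change 1⁻¹ * x.1 * 1 = u.1 * d.1 * (diagGL (t'.1.1 * iotaT t'.2.1) * wGL F n) * v.1 at this
      rw [inv_one, one_mul, mul_one, ← show diagGL a = d.1 from ha] at this
      rw [this, diagGL_mul a]; group
  · refine ⟨u.2, hu.2, v.2, hv.2, b * (t'.1.2 * iotaT t'.2.2), fun i => ?_, ?_⟩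
    · rw [Pi.mul_apply, Units.val_mul, norm_mul, hdb, one_mul]
    · have := congrArg Prod.snd e
      change (mB n F)⁻¹ * x.2 * mB n F =
        u.2 * d.2 * (diagGL (t'.1.2 * iotaT t'.2.2) * wGL F (n + 1)) * v.2 at this
      rw [← show diagGL b = d.2 from hb] at this
      rw [this, diagGL_mul b]; group

theorem SuffPos.one_le (hs : SuffPos ϖ c Kn Kn1 t' s) : 1 ≤ s := by
  obtain ⟨⟨c', h1, h2, _⟩, _⟩ := hs
  omega

theorem SuffPos.dom (hϖ : IsUniformizer ϖ) (hs : SuffPos ϖ c Kn Kn1 t' s) :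
    (∀ i j, i < j → ‖((t'.1.1 * iotaT t'.2.1) i : F)‖ ≤
      wt ϖ s i j * ‖((t'.1.1 * iotaT t'.2.1) j : F)‖) ∧
    ∀ i j, i < j → ‖((t'.1.2 * iotaT t'.2.2) i : F)‖ ≤
      wt ϖ s i j * ‖((t'.1.2 * iotaT t'.2.2) j : F)‖ :=
  ⟨fun _ _ h => IsDom.mul_iota_norm_le hϖ hs.2.1.1 hs.2.2.1 h,
    fun _ _ h => IsDom.mul_iota_norm_le hϖ hs.2.1.2 hs.2.2.2 h⟩

theorem Dplus_ne_zero_of_orbitSet (hϖ : IsUniformizer ϖ) (hKn : IsCSDIComponent ϖ c Kn)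
    (hKn1 : IsCSDIComponent ϖ c Kn1) (hs : SuffPos ϖ c Kn Kn1 t' s) {x : G0 n F}
    (hx : x ∈ orbitSet ϖ Kn Kn1 t' s) : Dplus (gstar x) ≠ 0 := by
  obtain ⟨h1, h2⟩ := orbitSet_inCell hϖ hKn hKn1 hs hx
  obtain ⟨d1, d2⟩ := hs.dom hϖ
  exact Dplus_ne_zero_of_cell hϖ hs.one_le
    (fun i j h => (d1 i j h).trans (mul_le_of_le_one_left (norm_nonneg _) (wt_le_one hϖ _ _ _)))
    (fun i j h => (d2 i j h).trans (mul_le_of_le_one_left (norm_nonneg _) (wt_le_one hϖ _ _ _)))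
    h1 h2

theorem phi_translate (h h' : GL (Fin n) F) (x : G0 n F) :
    (m0 n F)⁻¹ * ((j0 h)⁻¹ * x * j0 h') * m0 n F =
      (phi n F h)⁻¹ * ((m0 n F)⁻¹ * x * m0 n F) * phi n F h' := by
  rw [phi_apply, phi_apply]; group

theorem pair_conj_mem_K0 (hϖ : IsUniformizer ϖ) {c' : ℕ} (hc' : c' ≤ s)
    (hKn : Kangle ϖ n c' ⊆ Kn) (hKn1 : Kangle ϖ (n + 1) c' ⊆ Kn1) {g : G0 n F}
    (h1 : g.1 ∈ Kround ϖ n (-(s : ℤ))) (h2 : g.2 ∈ Kround ϖ (n + 1) (-(s : ℤ)))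
    (d1 : ∀ i, ‖g.1.1 i i - 1‖ ≤ ‖(ϖ : F)‖ ^ (c' - 1))
    (d2 : ∀ i, ‖g.2.1 i i - 1‖ ≤ ‖(ϖ : F)‖ ^ (c' - 1)) :
    (t0 ϖ n ^ s)⁻¹ * g * t0 ϖ n ^ s ∈ K0 Kn Kn1 :=
  ⟨hKn (conj_mem_Kangle hϖ hc' h1 d1), hKn1 (conj_mem_Kangle hϖ hc' h2 d2)⟩

theorem phi_conj_mem (hϖ : IsUniformizer ϖ) (hs : SuffPos ϖ c Kn Kn1 t' s) {h : GL (Fin n) F}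
    (hh : h ∈ KHs n ϖ s) : (t0 ϖ n ^ s)⁻¹ * phi n F h * t0 ϖ n ^ s ∈ K0 Kn Kn1 := by
  obtain ⟨⟨c', h1, h2, k1, _, k2, _⟩, _⟩ := hs
  have hp : ‖(ϖ : F)‖ ^ s ≤ ‖(ϖ : F)‖ ^ (c' - 1) :=
    pow_le_pow_of_le_one (norm_nonneg _) hϖ.1.le (by omega)
  have hm := mem_KHs_iff.1 hh
  refine pair_conj_mem_K0 hϖ (by omega) k1 k2 hm.1 hm.2 (fun i => ?_) fun i => ?_
  · have := KHs_sub_one hϖ hh i i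
    rw [Matrix.one_apply_eq] at this
    exact this.trans hp
  · have := Mhom_sub_one hϖ hh i i
    rw [Matrix.one_apply_eq] at this
    exact this.trans hp

theorem translate_mem_orbitSet (hϖ : IsUniformizer ϖ) (hs : SuffPos ϖ c Kn Kn1 t' s) {x : G0 n F}
    (hx : x ∈ orbitSet ϖ Kn Kn1 t' s) {h h' : GL (Fin n) F} (hh : h ∈ KHs n ϖ s)
    (hh' : h' ∈ KHs n ϖ s) : (j0 h)⁻¹ * x * j0 h' ∈ orbitSet ϖ Kn Kn1 t' s := by
  rw [mem_orbitSet_iff] at hx ⊢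
  obtain ⟨a, ha, b, hb, e⟩ := hx
  refine ⟨_, mul_mem (inv_mem (phi_conj_mem hϖ hs hh)) ha, _, mul_mem hb (phi_conj_mem hϖ hs hh'), ?_⟩
  rw [phi_translate, e]
  group

/-- Rigidity gives one direction; for the other, `K_{H,0}^{(s)}` is carried into `K₀` by conjugation
with `m_{0,s}`. -/
theorem translate_mem_orbitSet_iff (hϖ : IsUniformizer ϖ) (hKn : IsCSDIComponent ϖ c Kn)
    (hKn1 : IsCSDIComponent ϖ c Kn1) (hs : SuffPos ϖ c Kn Kn1 t' s) {x : G0 n F}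
    (hx : x ∈ orbitSet ϖ Kn Kn1 t' s) {h h' : GL (Fin n) F} :
    (j0 h)⁻¹ * x * j0 h' ∈ orbitSet ϖ Kn Kn1 t' s ↔ h ∈ KHs n ϖ s ∧ h' ∈ KHs n ϖ s := by
  refine ⟨fun hx' => ?_, fun h => translate_mem_orbitSet hϖ hs hx h.1 h.2⟩
  obtain ⟨c1, c2⟩ := orbitSet_inCell hϖ hKn hKn1 hs hx
  obtain ⟨c1', c2'⟩ := orbitSet_inCell hϖ hKn hKn1 hs hx'
  obtain ⟨d1, d2⟩ := hs.dom hϖ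
  refine rigidity hϖ hs.one_le d1 d2 c1' c1 c2' c2 ?_ ?_
  · change h * (h⁻¹ * x.1 * h') = x.1 * h'
    group
  · rw [Mhom_apply, Mhom_apply]
    change _ * ((mB n F)⁻¹ * ((embGL h)⁻¹ * x.2 * embGL h') * mB n F) = _
    group

/-- Elements of `H` found by `exists_lower` replace the two unipotent factors of level `s` by lower
triangular ones. Conjugation by `t₀^{-s'}` carries these into `K₀` for every `s' ≥ s`. -/
theorem exists_translate_mem_orbitSet (hϖ : IsUniformizer ϖ) (hKn : IsCSDIComponent ϖ c Kn)
    (hKn1 : IsCSDIComponent ϖ c Kn1) {s' : ℕ} (hs : SuffPos ϖ c Kn Kn1 t' s) (h : s ≤ s')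
    {x : G0 n F} (hx : x ∈ orbitSet ϖ Kn Kn1 t' s) :
    ∃ h h' : GL (Fin n) F, (j0 h)⁻¹ * x * j0 h' ∈ orbitSet ϖ Kn Kn1 t' s' := by
  rw [mem_orbitSet_iff_cell hϖ hKn hKn1 hs] at hx
  obtain ⟨u, hu, d, hd, hdK, v, hv, e⟩ := hx
  have hs1 := hs.one_le
  -- The matrix `u⁻¹ φ(h)` is integral and lower triangular, so it lies in `K^{(-s')}`; its diagonal
  -- is congruent to `1` modulo `ϖ^s`, hence modulo `ϖ^{c'-1}`.
  have key : ∀ u ∈ NU0 n ϖ s, ∃ h ∈ KHs n ϖ s,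
      (t0 ϖ n ^ s')⁻¹ * (u⁻¹ * phi n F h) * t0 ϖ n ^ s' ∈ K0 Kn Kn1 := by
    intro u hu
    obtain ⟨h, hh, l1, l2⟩ := exists_lower hϖ hs1 hu.1 hu.2
    refine ⟨h, hh, ?_⟩
    obtain ⟨⟨c', _, h2, k1, _, k2, _⟩, _⟩ := hs
    have hp : ‖(ϖ : F)‖ ^ s ≤ ‖(ϖ : F)‖ ^ (c' - 1) :=
      pow_le_pow_of_le_one (norm_nonneg _) hϖ.1.le (by omega)
    have hm := mem_KHs_iff.1 hh
    have hdiag : ∀ {ν : ℕ} {a g : GL (Fin ν) F} (_ : a ∈ NU ν ϖ s)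
        (_ : ∀ i j, ‖g.1 i j - (1 : Matrix (Fin ν) (Fin ν) F) i j‖ ≤ ‖(ϖ : F)‖ ^ s) (i : Fin ν),
        ‖(a⁻¹ * g).1 i i - 1‖ ≤ ‖(ϖ : F)‖ ^ (c' - 1) := by
      intro ν a g ha hg i
      refine le_trans ?_ hp
      have ha' := NU_sub_one hϖ ha
      have hai := (mem_NU hϖ).1 ha
      have e : (a⁻¹ * g).1 i i - 1 = ((a⁻¹).1 * (g.1 - a.1)) i i := by
        rw [Matrix.mul_sub, ← Units.val_mul, ← Units.val_mul, inv_mul_cancel, Matrix.sub_apply,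
          Units.val_one, Matrix.one_apply_eq]
      rw [e]
      have := norm_mul_apply_le_mul (A := (a⁻¹).1) (B := g.1 - a.1) (R := 1)
        (fun i j => (hai.2 i j).2.trans (wt_le_one hϖ _ _ _)) (R' := ‖(ϖ : F)‖ ^ s) (fun i j => by
          rw [Matrix.sub_apply, ← sub_sub_sub_cancel_right (g.1 i j) (a.1 i j)
            ((1 : Matrix (Fin ν) (Fin ν) F) i j)]
          exact (norm_sub_le_max _ _).trans (max_le (hg i j) (ha' i j))) zero_le_one
          (pow_nonneg (norm_nonneg _) _) i i
      rwa [one_mul] at this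
    refine pair_conj_mem_K0 hϖ (by omega) k1 k2 (lower_mem_Kround hϖ ?_ l1 s')
      (lower_mem_Kround hϖ ?_ l2 s')
      (hdiag hu.1 (KHs_sub_one hϖ hh)) (hdiag hu.2 (Mhom_sub_one hϖ hh))
    · exact ((mem_KroundS ϖ).1 (mul_mem (inv_mem hu.1.2) ((mem_KroundS ϖ).2 hm.1))).1
    · exact ((mem_KroundS ϖ).1 (mul_mem (inv_mem hu.2.2) ((mem_KroundS ϖ).2 hm.2))).1
  obtain ⟨h, hh, e1⟩ := key u hu
  -- The inverse is used because the right-hand factor to be made lower triangular is `v φ(h')`.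
  obtain ⟨h', hh', e2⟩ := key v⁻¹ (inv_mem hv)
  refine ⟨h, h', mem_orbitSet_iff.2 ⟨_, mul_mem (inv_mem e1) hdK, _, e2, ?_⟩⟩
  rw [phi_translate, e]
  nth_rewrite 1 [← t0_comm (ϖ := ϖ) (s := s') hd]
  group

/-- Dominance of `t'₁ t₀^{-(s+c)}` in `GL_{n+1}` forces its first two entries to differ by a factor
of norm at most `‖ϖ‖ ^ (s+c)`. Two entries exist because `n ≥ 1`. -/
theorem SuffPos.bounded (hϖ : IsUniformizer ϖ) (hn : 1 ≤ n) (c : ℕ)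
    (Kn : Subgroup (GL (Fin n) F)) (Kn1 : Subgroup (GL (Fin (n + 1)) F)) (t' : T0 n F × T0 n F) :
    ∃ M, ∀ s, SuffPos ϖ c Kn Kn1 t' s → s ≤ M := by
  set i : Fin (n + 1) := ⟨0, by omega⟩
  set j : Fin (n + 1) := ⟨1, by omega⟩
  have hij : i < j := Fin.lt_def.2 (by simp [i, j])
  have hi : 0 < ‖(t'.1.2 i : F)‖ := by simp
  have hj : 0 < ‖(t'.1.2 j : F)‖ := by simp
  obtain ⟨M, hM⟩ := exists_pow_lt_of_lt_one (div_pos hi hj) hϖ.1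
  refine ⟨M, fun s hs => ?_⟩
  by_contra hsM
  have h1 := IsDom.norm_le (ν := n + 1) (r := s + c) ϖ hs.2.1.2 hij
  rw [lt_div_iff₀ hj] at hM
  have h2 : wt ϖ (s + c) i j ≤ ‖(ϖ : F)‖ ^ M :=
    (wt_le_pow hϖ hij).trans (pow_le_pow_of_le_one (norm_nonneg _) hϖ.1.le (by omega))
  exact absurd (h1.trans (mul_le_mul_of_nonneg_right h2 hj.le)) (not_le.2 hM)

theorem image_invB_orbitSet (hϖ : IsUniformizer ϖ) (hKn : IsCSDIComponent ϖ c Kn)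
    (hKn1 : IsCSDIComponent ϖ c Kn1) {s' : ℕ} (hs : SuffPos ϖ c Kn Kn1 t' s)
    (hs' : SuffPos ϖ c Kn Kn1 t' s') (h : s ≤ s') :
    (fun x => invB (x, 1)) '' orbitSet ϖ Kn Kn1 t' s' =
      (fun x => invB (x, 1)) '' orbitSet ϖ Kn Kn1 t' s := by
  refine Set.Subset.antisymm (Set.image_mono (orbitSet_anti hϖ hKn hKn1 hs hs' h)) ?_
  rintro _ ⟨x, hx, rfl⟩
  obtain ⟨h, h', hm⟩ := exists_translate_mem_orbitSet hϖ hKn hKn1 hs h hx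
  exact ⟨_, hm, invB_translate h h' x⟩

end OrbitSet

/-! ### Counting in filtered unipotent groups -/

section Counting

theorem card_image_congr {α β γ : Type*} {f : α → β} {g : α → γ} {K : Set α}
    (h : ∀ a ∈ K, ∀ b ∈ K, f a = f b ↔ g a = g b) : Nat.card (f '' K) = Nat.card (g '' K) := by
  choose r hr using fun y : f '' K => y.2
  refine Nat.card_congr (Equiv.ofBijective (fun y => (⟨g (r y), r y, (hr y).1, rfl⟩ : g '' K))
    ⟨fun y z hyz => ?_, ?_⟩)
  · have h1 : g (r y) = g (r z) := congrArg Subtype.val hyz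
    rw [← h _ (hr y).1 _ (hr z).1, (hr y).2, (hr z).2] at h1
    exact Subtype.ext h1
  · rintro ⟨_, a, ha, rfl⟩
    refine ⟨⟨f a, a, ha, rfl⟩, Subtype.ext ?_⟩
    exact (h _ (hr _).1 _ ha).1 (hr ⟨f a, a, ha, rfl⟩).2

theorem card_image_eq_relIndex {G β : Type*} [Group G] {f : G → β} {H K : Subgroup G}
    (h : ∀ a ∈ K, ∀ b ∈ K, f a = f b ↔ a⁻¹ * b ∈ H) :
    Nat.card (f '' (K : Set G)) = H.relIndex K := by
  rw [← card_image_mk]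
  exact card_image_congr fun a ha b hb => (h a ha b hb).trans QuotientGroup.eq.symm

theorem card_image_add_mk {A : Type*} [AddGroup A] (H K : AddSubgroup A) :
    Nat.card ((QuotientAddGroup.mk : A → A ⧸ H) '' (K : Set A)) = H.relIndex K :=
  card_image_mk (AddSubgroup.toSubgroup H) (AddSubgroup.toSubgroup K)

end Counting

section Balls

variable {F : Type*} [NontriviallyNormedField F] [IsUltrametricDist F] {ϖ : Fˣ}

/-- The ideal `ϖ^k 𝒪₀`. -/
def ballPow (ϖ : Fˣ) (k : ℕ) : AddSubgroup F :=
  ballAdd (‖(ϖ : F)‖ ^ k) (pow_nonneg (norm_nonneg _) _)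

theorem mem_ballPow {k : ℕ} {x : F} : x ∈ ballPow ϖ k ↔ ‖x‖ ≤ ‖(ϖ : F)‖ ^ k := Iff.rfl

theorem ballPow_anti (hϖ : IsUniformizer ϖ) {k l : ℕ} (h : k ≤ l) :
    ballPow (F := F) ϖ l ≤ ballPow ϖ k := fun _ hx =>
  le_trans hx (pow_le_pow_of_le_one (norm_nonneg _) hϖ.1.le h)

theorem relIndex_ballPow_succ (ϖ : Fˣ) (k : ℕ) :
    (ballPow (F := F) ϖ (k + 1)).relIndex (ballPow ϖ k) = q0 ϖ := by
  have hinj : Function.Injective (AddMonoidHom.mulLeft ((ϖ : F) ^ k)) :=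
    mul_right_injective₀ (pow_ne_zero _ ϖ.ne_zero)
  have hp : 0 < ‖(ϖ : F)‖ ^ k := pow_pos (norm_pos_unif ϖ) _
  have hmap : ∀ (r : ℝ) (hr : 0 ≤ r) (l : ℕ) (_ : ‖(ϖ : F)‖ ^ l = ‖(ϖ : F)‖ ^ k * r),
      ballPow ϖ l = (ballAdd r hr).map (AddMonoidHom.mulLeft ((ϖ : F) ^ k)) := by
    intro r hr l hl
    ext x
    rw [mem_ballPow, hl]
    constructor
    · intro h
      refine ⟨((ϖ : F) ^ k)⁻¹ * x, ?_, ?_⟩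
      · change ‖_‖ ≤ r
        rw [norm_mul, norm_inv, norm_pow]
        rwa [inv_mul_le_iff₀ hp]
      · change (ϖ : F) ^ k * (((ϖ : F) ^ k)⁻¹ * x) = x
        rw [mul_inv_cancel_left₀ (pow_ne_zero _ ϖ.ne_zero)]
    · rintro ⟨y, hy, rfl⟩
      change ‖(ϖ : F) ^ k * y‖ ≤ _
      rw [norm_mul, norm_pow]
      exact mul_le_mul_of_nonneg_left hy hp.le
  rw [hmap ‖(ϖ : F)‖ (norm_nonneg _) (k + 1) (pow_succ _ _), hmap 1 zero_le_one k (mul_one _).symm,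
    AddSubgroup.relIndex_map_map_of_injective _ _ hinj]
  rfl

theorem relIndex_ballPow (hϖ : IsUniformizer ϖ) (k m : ℕ) :
    (ballPow (F := F) ϖ (k + m)).relIndex (ballPow ϖ k) = q0 ϖ ^ m := by
  induction m with
  | zero => simp
  | succ m ih =>
    rw [← add_assoc, ← AddSubgroup.relIndex_mul_relIndex _ _ _
      (ballPow_anti hϖ (Nat.le_add_right (k + m) 1)) (ballPow_anti hϖ (Nat.le_add_right k m)), ih,
      relIndex_ballPow_succ, pow_succ, mul_comm]

theorem q0_ne_zero [LocallyCompactSpace F] (ϖ : Fˣ) : q0 ϖ ≠ 0 := by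
  have : ProperSpace F := ProperSpace.of_nontriviallyNormedField_of_weaklyLocallyCompactSpace F
  set U := ballAdd (F := F) 1 zero_le_one
  set V := ballAdd (F := F) ‖(ϖ : F)‖ (norm_nonneg _)
  have hU : (U : Set F) = Metric.closedBall 0 1 := by
    ext x; rw [mem_closedBall_zero_iff]; rfl
  have hV : (V : Set F) = Metric.closedBall 0 ‖(ϖ : F)‖ := by
    ext x; rw [mem_closedBall_zero_iff]; rfl
  have : CompactSpace U := by
    refine isCompact_iff_compactSpace.1 ?_
    rw [hU]; exact isCompact_closedBall _ _
  have hVo : IsOpen (V : Set F) := by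
    rw [hV]; exact IsUltrametricDist.isOpen_closedBall _ (norm_pos_unif ϖ).ne'
  have ho : IsOpen ((V.addSubgroupOf U : AddSubgroup U) : Set U) :=
    hVo.preimage continuous_subtype_val
  have := AddSubgroup.quotient_finite_of_isOpen (V.addSubgroupOf U) ho
  exact AddSubgroup.index_ne_zero_of_finite

end Balls

section UnipotentIndex

variable {F : Type*} [NontriviallyNormedField F] [IsUltrametricDist F] {ν : ℕ} {ϖ : Fˣ} {s : ℕ}

theorem inv_mul_sub_one {a b : GL (Fin ν) F} : (a⁻¹ * b).1 - 1 = (a⁻¹).1 * (b.1 - a.1) := by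
  rw [Matrix.mul_sub, ← Units.val_mul, ← Units.val_mul, inv_mul_cancel, Units.val_one]

/-- The principal congruence subgroup of level `ϖ^M`. -/
def congrSub (ϖ : Fˣ) (ν M : ℕ) : Subgroup (GL (Fin ν) F) where
  carrier := {g | g ∈ GLO F ν ∧ ∀ i j, ‖(g.1 - 1) i j‖ ≤ ‖(ϖ : F)‖ ^ M}
  one_mem' := ⟨(GLOs F ν).one_mem, fun i j => by simp⟩
  mul_mem' := by
    rintro a b ⟨ha, ha'⟩ ⟨hb, hb'⟩
    refine ⟨(GLOs F ν).mul_mem ha hb, fun i j => ?_⟩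
    have e : (a * b).1 - 1 = (a.1 - 1) * b.1 + (b.1 - 1) := by
      rw [Matrix.sub_mul, Matrix.one_mul, Units.val_mul]; abel
    rw [e]
    refine (IsUltrametricDist.norm_add_le_max _ _).trans (max_le ?_ (hb' i j))
    have := norm_mul_apply_le_mul ha' hb.1 (pow_nonneg (norm_nonneg _) _) zero_le_one i j
    rwa [mul_one] at this
  inv_mem' := by
    rintro a ⟨ha, ha'⟩
    refine ⟨(GLOs F ν).inv_mem ha, fun i j => ?_⟩
    have e : (a⁻¹).1 - 1 = (a⁻¹).1 * (1 - a.1) := by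
      have := inv_mul_sub_one (a := a) (b := 1)
      rwa [mul_one, Units.val_one] at this
    rw [e]
    have := norm_mul_apply_le_mul ha.2 (fun i j => (norm_sub_rev _ _).trans_le (ha' i j))
      zero_le_one (pow_nonneg (norm_nonneg _) _) i j
    rwa [one_mul] at this

theorem mem_congrSub_iff {M : ℕ} {a b : GL (Fin ν) F} (ha : a ∈ GLO F ν)
    (hb : b ∈ GLO F ν) :
    a⁻¹ * b ∈ congrSub ϖ ν M ↔ ∀ i j, ‖b.1 i j - a.1 i j‖ ≤ ‖(ϖ : F)‖ ^ M := by
  have h0 : 0 ≤ ‖(ϖ : F)‖ ^ M := pow_nonneg (norm_nonneg _) _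
  constructor
  · rintro ⟨_, h⟩ i j
    have e : b.1 - a.1 = a.1 * ((a⁻¹ * b).1 - 1) := by
      rw [inv_mul_sub_one, ← Matrix.mul_assoc, ← Units.val_mul, mul_inv_cancel, Units.val_one,
        Matrix.one_mul]
    rw [← Matrix.sub_apply, e]
    have := norm_mul_apply_le_mul ha.1 h zero_le_one h0 i j
    rwa [one_mul] at this
  · intro h
    refine ⟨(GLOs F ν).mul_mem ((GLOs F ν).inv_mem ha) hb, fun i j => ?_⟩
    rw [inv_mul_sub_one]
    have := norm_mul_apply_le_mul ha.2 h zero_le_one h0 i j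
    rwa [one_mul] at this

theorem NU_le_GLOs (ν : ℕ) (ϖ : Fˣ) (s : ℕ) : NU ν ϖ s ≤ GLOs F ν := fun _ h => h.2.1

/-- An upper-triangular unipotent matrix with prescribed small entries. -/
theorem exists_mem_NU (hϖ : IsUniformizer ϖ) {x : Fin ν → Fin ν → F}
    (hx : ∀ i j, i < j → ‖x i j‖ ≤ wt ϖ s i j) :
    ∃ u ∈ NU ν ϖ s, ∀ i j, i < j → u.1 i j = x i j := by
  set U : Matrix (Fin ν) (Fin ν) F :=
    Matrix.of fun i j => if i < j then x i j else if i = j then 1 else 0 with hU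
  have hdet : U.det = 1 := by
    rw [Matrix.det_of_isUpperTriangular]
    · exact Finset.prod_eq_one fun i _ => by simp [hU]
    · intro i j hij
      have : j < i := hij
      simp [hU, not_lt.2 this.le, this.ne']
  let u := Matrix.GeneralLinearGroup.mkOfDetNeZero U (by rw [hdet]; exact one_ne_zero)
  have hu : u.1 = U := rfl
  have huU : UpperUnip u := ⟨fun i => by rw [hu]; simp [hU], fun i j hij => by
    rw [hu]; simp [hU, not_lt.2 hij.le, hij.ne']⟩
  refine ⟨u, ⟨huU, ?_⟩, fun i j hij => by rw [hu]; simp [hU, hij]⟩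
  refine (mem_KroundS ϖ).2 (mem_Kround_neg_of_det hϖ (fun i j => ?_) (by rw [hu, hdet, norm_one]))
  rcases lt_trichotomy i j with h | h | h
  · rw [hu]; simpa [hU, h] using hx i j h
  · subst h; rw [huU.1, norm_one, wt_of_le le_rfl]
  · rw [huU.2 i j h, norm_zero]; exact (wt_pos _ _ _).le

/-- Modulo `ϖ^M` the entries above the diagonal are independent, entry `(i, j)` running through
`ϖ^{r(j-i)} 𝒪₀ / ϖ^M 𝒪₀`. The bound on `M` keeps the natural subtraction in the exponent exact. -/
theorem relIndex_congrSub_NU (hϖ : IsUniformizer ϖ) {M r : ℕ} (hM : r * ν ≤ M) :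
    (upperN F ν ⊓ congrSub ϖ ν M).relIndex (NU ν ϖ r) =
      ∏ p : Fin ν × Fin ν, if p.1 < p.2 then q0 ϖ ^ (M - r * ((p.2 : ℕ) - p.1)) else 1 := by
  let f : GL (Fin ν) F → (Fin ν × Fin ν → F ⧸ ballPow (F := F) ϖ M) := fun g p =>
    QuotientAddGroup.mk (g.1 p.1 p.2)
  let t : Fin ν × Fin ν → Set (F ⧸ ballPow (F := F) ϖ M) := fun p =>
    if p.1 < p.2 then QuotientAddGroup.mk '' (ballPow (F := F) ϖ (r * ((p.2 : ℕ) - p.1)) : Set F)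
    else {QuotientAddGroup.mk ((1 : Matrix (Fin ν) (Fin ν) F) p.1 p.2)}
  have h1 : ∀ a ∈ NU ν ϖ r, ∀ b ∈ NU ν ϖ r,
      f a = f b ↔ a⁻¹ * b ∈ upperN F ν ⊓ congrSub ϖ ν M := by
    intro a ha b hb
    rw [Subgroup.mem_inf, and_iff_right ((upperN F ν).mul_mem ((upperN F ν).inv_mem ha.1) hb.1),
      mem_congrSub_iff (NU_le_GLOs ν ϖ r ha) (NU_le_GLOs ν ϖ r hb), funext_iff, Prod.forall]
    refine forall_congr' fun i => forall_congr' fun j => ?_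
    rw [QuotientAddGroup.eq, mem_ballPow, neg_add_eq_sub]
  have h2 : f '' (NU ν ϖ r : Set (GL (Fin ν) F)) = Set.univ.pi t := by
    ext y
    rw [Set.mem_univ_pi]
    constructor
    · rintro ⟨g, hg, rfl⟩ ⟨i, j⟩
      have hg' := (mem_NU hϖ).1 hg
      simp only [t, f]
      split_ifs with hij
      · exact ⟨_, (hg'.2 i j).1, rfl⟩
      · rw [Set.mem_singleton_iff]
        rcases (not_lt.1 hij).lt_or_eq with h | h
        · rw [hg'.1.2 i j h, Matrix.one_apply_ne h.ne']
        · subst h; rw [hg'.1.1, Matrix.one_apply_eq]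
    · intro hy
      have hy' : ∀ i j, ∃ x : F, QuotientAddGroup.mk x = y (i, j) ∧
          (i < j → ‖x‖ ≤ wt ϖ r i j) := by
        intro i j
        have := hy (i, j)
        by_cases hij : i < j
        · simp only [t, if_pos hij] at this
          obtain ⟨x, hx, e⟩ := this
          exact ⟨x, e, fun _ => hx⟩
        · obtain ⟨x, hx⟩ := QuotientAddGroup.mk_surjective (y (i, j))
          exact ⟨x, hx, fun h => absurd h hij⟩
      choose x hx hx' using hy'
      obtain ⟨u, hu, hux⟩ := exists_mem_NU hϖ hx'
      refine ⟨u, hu, ?_⟩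
      funext ⟨i, j⟩
      simp only [f]
      by_cases hij : i < j
      · rw [hux i j hij, hx]
      · have := hy (i, j)
        simp only [t, if_neg hij, Set.mem_singleton_iff] at this
        rw [this]
        congr 1
        have hu' := (mem_NU hϖ).1 hu
        rcases (not_lt.1 hij).lt_or_eq with h | h
        · rw [hu'.1.2 i j h, Matrix.one_apply_ne h.ne']
        · subst h; rw [hu'.1.1, Matrix.one_apply_eq]
  rw [← card_image_eq_relIndex h1, h2, Nat.card_congr (Equiv.Set.univPi t), Nat.card_pi]
  refine Finset.prod_congr rfl fun p _ => ?_
  simp only [t]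
  split_ifs with hp
  · rw [card_image_add_mk]
    have hle : r * ((p.2 : ℕ) - p.1) ≤ M :=
      (Nat.mul_le_mul_left r (by have := p.2.2; omega)).trans hM
    have := relIndex_ballPow hϖ (r * ((p.2 : ℕ) - p.1)) (M - r * ((p.2 : ℕ) - p.1))
    rwa [Nat.add_sub_cancel' hle] at this
  · simp

/-- `∑_{i < j} (j - i)`. -/
def heightSum (ν : ℕ) : ℕ := ∑ p : Fin ν × Fin ν, ((p.2 : ℕ) - p.1)

theorem relIndex_NU [LocallyCompactSpace F] (hϖ : IsUniformizer ϖ) (ν a m : ℕ) :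
    (NU (F := F) ν ϖ (a + m)).relIndex (NU ν ϖ a) = q0 ϖ ^ (m * heightSum ν) := by
  -- This depth is large enough for the congruence subgroup to lie in both groups; the index is the
  -- quotient of two counts modulo it.
  set M := (a + m) * ν with hM
  have hle : ∀ r, r ≤ a + m → upperN F ν ⊓ congrSub ϖ ν M ≤ NU ν ϖ r := by
    rintro r hr g ⟨hg, hgO, hg'⟩
    have key : ∀ g : GL (Fin ν) F, UpperUnip g → g ∈ congrSub ϖ ν M →
        ∀ i j, ‖g.1 i j‖ ≤ wt ϖ r i j := by
      intro g hg hg' i j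
      rcases lt_or_ge i j with h | h
      · have := hg'.2 i j
        rw [Matrix.sub_apply, Matrix.one_apply_ne h.ne, sub_zero] at this
        refine this.trans (pow_le_pow_of_le_one (norm_nonneg _) hϖ.1.le ?_)
        exact Nat.mul_le_mul hr (by have := j.2; omega)
      · rw [wt_of_le (show (j : ℕ) ≤ i from h)]; exact hg'.1.1 i j
    rw [mem_NU hϖ]
    exact ⟨hg, fun i j => ⟨key g hg ⟨hgO, hg'⟩ i j,
      key g⁻¹ ((upperN F ν).inv_mem hg) (inv_mem (show g ∈ congrSub ϖ ν M from ⟨hgO, hg'⟩)) i j⟩⟩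
  have h1 := Subgroup.relIndex_mul_relIndex _ _ _ (hle (a + m) le_rfl)
    (NU_anti hϖ (ν := ν) (Nat.le_add_right a m))
  rw [relIndex_congrSub_NU hϖ le_rfl,
    relIndex_congrSub_NU hϖ (Nat.mul_le_mul_right ν (Nat.le_add_right a m))] at h1
  have hq := q0_ne_zero (F := F) ϖ
  have hne : (∏ p : Fin ν × Fin ν,
      if p.1 < p.2 then q0 ϖ ^ (M - (a + m) * ((p.2 : ℕ) - p.1)) else 1) ≠ 0 :=
    Finset.prod_ne_zero_iff.2 fun p _ => by split_ifs <;> simp [hq]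
  refine Nat.eq_of_mul_eq_mul_left (Nat.pos_of_ne_zero hne) (h1.trans ?_)
  rw [heightSum, Finset.mul_sum, ← Finset.prod_pow_eq_pow_sum, ← Finset.prod_mul_distrib]
  refine Finset.prod_congr rfl fun p _ => ?_
  split_ifs with hp
  · rw [← pow_add]
    congr 1
    have hle : (a + m) * ((p.2 : ℕ) - p.1) ≤ M :=
      Nat.mul_le_mul_left _ (by have := p.2.2; omega)
    have e : (a + m) * ((p.2 : ℕ) - p.1) = a * ((p.2 : ℕ) - p.1) + m * ((p.2 : ℕ) - p.1) :=
      Nat.add_mul _ _ _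
    omega
  · rw [one_mul, Nat.sub_eq_zero_of_le (show (p.2 : ℕ) ≤ p.1 from not_lt.1 hp), mul_zero, pow_zero]

theorem heightSum_succ (ν : ℕ) : heightSum (ν + 1) = heightSum ν + ν * (ν + 1) / 2 := by
  rw [heightSum, heightSum, Fintype.sum_prod_type, Fintype.sum_prod_type, Fin.sum_univ_castSucc]
  simp only [Fin.sum_univ_castSucc, Fin.val_castSucc, Fin.val_last, Finset.sum_add_distrib]
  have h1 : ∑ x : Fin ν, ((x : ℕ) - ν) = 0 :=
    Finset.sum_eq_zero fun x _ => Nat.sub_eq_zero_of_le x.2.le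
  have h2 : ∑ x : Fin ν, (ν - (x : ℕ)) = ν * (ν + 1) / 2 := by
    rw [Fin.sum_univ_eq_sum_range (fun x => ν - x), ← Finset.sum_range_reflect]
    rw [Finset.sum_congr rfl (g := fun x => x + 1)]
    · have := Finset.sum_range_succ' (fun x => x) ν
      rw [Finset.sum_range_id, Nat.add_sub_cancel, add_zero] at this
      rw [← this, mul_comm]
    · intro x hx
      have := Finset.mem_range.1 hx
      omega
  rw [h1, h2, Nat.sub_self, add_zero, add_zero]

/-- Consecutive differences of `heightSum` are triangular numbers, and two consecutive triangular
numbers add up to a square. -/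
theorem heightSum_add (n : ℕ) : heightSum n + heightSum (n + 1) = dn n := by
  induction n with
  | zero => simp [heightSum, dn]
  | succ n ih =>
    have h1 := heightSum_succ n
    have h2 := heightSum_succ (n + 1)
    have e : dn (n + 1) = dn n + (n + 1) ^ 2 := Finset.sum_range_succ _ _
    have e1 : n * (n + 1) / 2 + (n + 1) * (n + 1 + 1) / 2 = (n + 1) ^ 2 := by
      obtain ⟨k, hk⟩ := Nat.even_mul_succ_self n
      obtain ⟨l, hl⟩ := Nat.even_mul_succ_self (n + 1)
      rw [hk, hl, ← two_mul, ← two_mul, Nat.mul_div_cancel_left _ two_pos,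
        Nat.mul_div_cancel_left _ two_pos]
      have : 2 * (k + l) = 2 * (n + 1) ^ 2 := by
        rw [mul_add, two_mul k, two_mul l, ← hk, ← hl]; ring
      omega
    omega

theorem relIndex_NU0 [LocallyCompactSpace F] (hϖ : IsUniformizer ϖ) (n a m : ℕ) :
    (NU0 (F := F) n ϖ (a + m)).relIndex (NU0 n ϖ a) = q0 ϖ ^ (m * dn n) := by
  rw [NU0, NU0, relIndex_prod, relIndex_NU hϖ, relIndex_NU hϖ, ← pow_add, ← mul_add, heightSum_add]

end UnipotentIndex

/-! ### The Weyl index and the index of `N(𝒪₀)` in `N ∩ Q` -/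

section WeylIndex

variable {G : Type*} [Group G] {N T L Z N0 K Kc : Subgroup G} {w τ : G}

/-- In the decomposition `K = N₀ (T ∩ K)(L ∩ K)` the last two factors already lie in `w K w⁻¹`. -/
theorem Tri.relIndex_weyl (D : Tri N T L Z N0 K Kc w τ) :
    (conjSub K w⁻¹).relIndex K = (conjSub K w⁻¹).relIndex N0 := by
  refine relIndex_eq_of_cover (fun a ha => ?_) fun b hb => ⟨b, D.N0K hb, by simp⟩
  obtain ⟨x, hx, d, hd, l, hl, hdK, hlK, rfl⟩ := D.dec a ha
  refine ⟨x, hx, ?_⟩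
  rw [mem_conjSub]
  have e : w⁻¹ * (x⁻¹ * (x * d * l)) * w⁻¹⁻¹ = (w * d * w⁻¹) * (w * l * w⁻¹) := by
    rw [show (w * d * w⁻¹) * (w * l * w⁻¹) = w * (d * l) * w⁻¹ by group, inv_inv]
    simp only [D.ww]
    group
  rw [e]
  exact K.mul_mem (D.wKT d hd hdK) (D.N0K (D.wKL l hl hlK))

/-- Conjugation by `τ` turns `N ∩ Q` into `N₀ ∩ w K w⁻¹` and `N₀` into `τ N₀ τ⁻¹`. -/
theorem Tri.relIndex_iota (D : Tri N T L Z N0 K Kc w τ) :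
    N0.relIndex (N ⊓ conjSub K (w * τ)) =
      (conjSub N0 τ⁻¹).relIndex (N0 ⊓ conjSub K w⁻¹) := by
  have h1 : N ⊓ conjSub K (w * τ) = conjSub (N0 ⊓ conjSub K w⁻¹) τ := by
    ext x
    rw [Subgroup.mem_inf, mem_conjSub, mem_conjSub, Subgroup.mem_inf, mem_conjSub, inv_inv]
    have e : w * τ * x * (w * τ)⁻¹ = w⁻¹ * (τ * x * τ⁻¹) * w := by rw [D.ww, mul_inv_rev, D.ww]; group
    rw [e]
    constructor
    · rintro ⟨hx, hK⟩
      refine ⟨?_, hK⟩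
      have h2 : w⁻¹ * (τ * x * τ⁻¹) * w ∈ L := by
        have := D.wN _ (D.conjN τ D.memτ x hx)
        rwa [D.ww] at this ⊢
      have h3 := D.wKL _ h2 hK
      rwa [show w * (w⁻¹ * (τ * x * τ⁻¹) * w) * w⁻¹ = τ * x * τ⁻¹ by group] at h3
    · rintro ⟨hx, hK⟩
      refine ⟨?_, hK⟩
      have := D.conjN τ⁻¹ (T.inv_mem D.memτ) _ (D.N0N hx)
      rwa [show τ⁻¹ * (τ * x * τ⁻¹) * τ⁻¹⁻¹ = x by group] at this
  have h2 : N0 = conjSub (conjSub N0 τ⁻¹) τ := by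
    ext x
    rw [mem_conjSub, mem_conjSub]
    congr! 1
    group
  rw [h1]
  nth_rewrite 1 [h2]
  rw [relIndex_conjSub]

/-- This is multiplicativity along `τ N₀ τ⁻¹ ≤ N₀ ∩ w K w⁻¹ ≤ N₀`. It explains both the factor
`q₀^{-ℓ(w₀)}` of `k'` and the `-c` in the normalizing exponent. -/
theorem Tri.iota_mul_weyl (D : Tri N T L Z N0 K Kc w τ) :
    N0.relIndex (N ⊓ conjSub K (w * τ)) * (conjSub K w⁻¹).relIndex K =
      (conjSub N0 τ⁻¹).relIndex N0 := by
  rw [D.relIndex_iota, D.relIndex_weyl, ← Subgroup.inf_relIndex_left N0 (conjSub K w⁻¹)]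
  refine Subgroup.relIndex_mul_relIndex _ _ _ (fun x hx => ?_) inf_le_left
  rw [mem_conjSub, inv_inv] at hx
  have h1 : x = τ * (τ⁻¹ * x * τ) * τ⁻¹ := by group
  refine ⟨?_, mem_conjSub.2 ?_⟩
  · rw [h1]; exact (D.domτ _ hx).1
  · have := D.KcK (D.N0τ _ hx)
    rw [inv_inv, D.ww]
    convert this using 1
    rw [mul_inv_rev, D.ww]; group

end WeylIndex

section

variable {F : Type*} [NontriviallyNormedField F] [IsUltrametricDist F] [LocallyCompactSpace F]
  {ϖ : Fˣ} {n c : ℕ} {Kn : Subgroup (GL (Fin n) F)} {Kn1 : Subgroup (GL (Fin (n + 1)) F)}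

theorem conjSub_prod {G G' : Type*} [Group G] [Group G'] (K : Subgroup G) (K' : Subgroup G')
    (g : G × G') : conjSub (K.prod K') g = (conjSub K g.1).prod (conjSub K' g.2) := by
  ext x
  simp only [mem_conjSub, Subgroup.mem_prod]
  rfl

theorem NU0_zero (hϖ : IsUniformizer ϖ) : NU0 n ϖ 0 = NO0 F n := by
  ext x
  rw [← conj_mem_NU0_iff hϖ (s := 0)]
  simp

theorem NU0_eq_conjSub (hϖ : IsUniformizer ϖ) (s : ℕ) :
    NU0 n ϖ s = conjSub (NO0 F n) (t0 ϖ n ^ s)⁻¹ := by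
  ext x
  rw [mem_conjSub, ← conj_mem_NU0_iff hϖ (s := s)]
  congr! 1
  group

theorem iotaIdx_mul_qEllW (hϖ : IsUniformizer ϖ) (hKn : IsCSDIComponent ϖ c Kn)
    (hKn1 : IsCSDIComponent ϖ c Kn1) :
    iotaIdx ϖ c Kn Kn1 * (qEllW Kn * qEllW Kn1) = q0 ϖ ^ (c * dn n) := by
  have D := triG0 hϖ hKn hKn1
  have h := D.iota_mul_weyl
  rw [← NU0_eq_conjSub hϖ, ← NU0_zero hϖ] at h
  have h2 := relIndex_NU0 (F := F) hϖ n 0 c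
  rw [zero_add] at h2
  rw [h2, NU0_zero hϖ, K0, conjSub_prod, conjSub_prod, relIndex_prod] at h
  rw [← h, iotaIdx, Qs, K0, conjSub_prod]
  rfl

end

/-! ### Indices between the groups `K_{H,0}^{(r)}` -/

section LevelIndex

variable {F : Type*} [NontriviallyNormedField F] [IsUltrametricDist F] {ν n : ℕ} {ϖ : Fˣ}

/-- `Z ↦ Z⁺ g` on strictly upper triangular matrices `Z⁺`, completed by the identity. -/
def upperMul (g : Matrix (Fin ν) (Fin ν) F) :
    Matrix (Fin ν) (Fin ν) F →ₗ[F] Matrix (Fin ν) (Fin ν) F where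
  toFun Z := Matrix.of fun i j => if i < j then
    ((Matrix.of fun i j => if i < j then Z i j else 0) * g) i j else Z i j
  map_add' A B := by
    ext i j
    simp only [Matrix.of_apply, Matrix.add_apply]
    split_ifs
    · rw [← Matrix.add_apply, ← Matrix.add_mul]
      refine congrArg (fun M : Matrix (Fin ν) (Fin ν) F => (M * g) i j) (Matrix.ext fun i j => ?_)
      simp only [Matrix.of_apply, Matrix.add_apply]
      split_ifs <;> simp
    · rfl
  map_smul' a A := by
    ext i j
    simp only [Matrix.of_apply, Matrix.smul_apply, RingHom.id_apply]
    split_ifs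
    · rw [← Matrix.smul_apply, ← Matrix.smul_mul]
      refine congrArg (fun M : Matrix (Fin ν) (Fin ν) F => (M * g) i j) (Matrix.ext fun i j => ?_)
      simp only [Matrix.of_apply, Matrix.smul_apply]
      split_ifs <;> simp
    · rfl

theorem upperMul_spec {g Z Y : Matrix (Fin ν) (Fin ν) F} (hY : ∀ i j, ¬ i < j → Y i j = 0)
    (h : upperMul g Z = Y) :
    (∀ i j, ¬ i < j → Z i j = 0) ∧ ∀ i j, i < j → (Z * g) i j = Y i j := by
  have h' := fun i j => congrFun (congrFun h i) j
  simp only [upperMul, LinearMap.coe_mk, AddHom.coe_mk, Matrix.of_apply] at h'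
  have h1 : ∀ i j, ¬ i < j → Z i j = 0 := fun i j hij => by
    have := h' i j
    rwa [if_neg hij, hY i j hij] at this
  have h2 : (Matrix.of fun i j => if i < j then Z i j else 0) = Z := by
    ext i j
    simp only [Matrix.of_apply]
    split_ifs with hij
    · rfl
    · exact (h1 i j hij).symm
  refine ⟨h1, fun i j hij => ?_⟩
  have := h' i j
  rwa [if_pos hij, h2] at this

/-- Matrices congruent to `1` factor as upper unipotent times lower triangular. -/
theorem exists_upper_lower (hϖ : IsUniformizer ϖ) {ε : ℝ} (hε0 : 0 ≤ ε) (hε : ε < 1)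
    {g : GL (Fin ν) F}
    (hg : ∀ i j, ‖g.1 i j - (1 : Matrix (Fin ν) (Fin ν) F) i j‖ ≤ ε) :
    ∃ u : GL (Fin ν) F, UpperUnip u ∧ u ∈ GLO F ν ∧ ∀ i j, i < j → (u * g).1 i j = 0 := by
  have hg1 : ∀ i j, ‖g.1 i j‖ ≤ 1 := fun i j => norm_apply_le_of_sub_one hε.le (hg i j)
  have sub : ∀ Z : Matrix (Fin ν) (Fin ν) F, ∀ i j, Z i j = (Z * g.1) i j - (Z * (g.1 - 1)) i j :=
    fun Z i j => by
      rw [Matrix.mul_sub, Matrix.mul_one, Matrix.sub_apply]; ring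
  have bd : ∀ {Z : Matrix (Fin ν) (Fin ν) F} {R : ℝ}, 0 ≤ R → (∀ i j, ‖Z i j‖ ≤ R) →
      ∀ i j, ‖(Z * (g.1 - 1)) i j‖ ≤ ε * R := fun hR hZ i j => by
    rw [mul_comm ε]
    exact norm_mul_apply_le_mul hZ hg hR hε0 i j
  -- The factor is sought as `u = 1 + Z` with `Z` strictly upper triangular. As `g - 1` is small, `Z
  -- ↦ (Zg)⁺` is a small perturbation of the identity.
  have hinj : Function.Injective (upperMul g.1) := by
    rw [injective_iff_map_eq_zero]
    intro Z hZ
    obtain ⟨h1, h2⟩ := upperMul_spec (Y := 0) (fun _ _ _ => rfl) hZ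
    have key : ∀ p : Fin ν × Fin ν, ‖Z p.1 p.2‖ ≤ 0 := by
      refine le_zero_of_contract hε fun R hR hx => ?_
      rintro ⟨i, j⟩
      by_cases hij : i < j
      · have e := sub Z i j
        rw [h2 i j hij, Matrix.zero_apply, zero_sub] at e
        simp only
        rw [e, norm_neg]
        exact bd hR (fun i j => hx (i, j)) i j
      · simp only
        rw [h1 i j hij, norm_zero]; exact mul_nonneg hε0 hR
    ext i j
    exact norm_le_zero_iff.1 (key (i, j))
  obtain ⟨Z, hZ⟩ := LinearMap.injective_iff_surjective.1 hinj
    (Matrix.of fun i j => if i < j then -g.1 i j else 0)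
  obtain ⟨h1, h2⟩ := upperMul_spec (fun i j hij => by simp [hij]) hZ
  have key : ∀ p : Fin ν × Fin ν, ‖Z p.1 p.2‖ ≤ 1 := by
    refine le_one_of_contract hε fun R hR hx => ?_
    rintro ⟨i, j⟩
    by_cases hij : i < j
    · have e := sub Z i j
      rw [h2 i j hij, Matrix.of_apply, if_pos hij] at e
      simp only
      rw [e]
      refine (norm_sub_le_max _ _).trans (max_le_max ?_
        (bd (zero_le_one.trans hR) (fun i j => hx (i, j)) i j))
      rw [norm_neg]; exact hg1 i j
    · simp only
      rw [h1 i j hij, norm_zero]; exact le_max_of_le_left zero_le_one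
  obtain ⟨u, hu, hux⟩ := exists_mem_NU (s := 0) hϖ (x := Z) fun i j _ => by
    have := key (i, j)
    simpa [wt] using this
  have hu1 := ((mem_NU hϖ).1 hu).1
  have huZ : u.1 = 1 + Z := by
    ext i j
    rw [Matrix.add_apply]
    rcases lt_trichotomy i j with h | h | h
    · rw [hux i j h, Matrix.one_apply_ne h.ne, zero_add]
    · subst h; rw [hu1.1, Matrix.one_apply_eq, h1 i i (lt_irrefl i), add_zero]
    · rw [hu1.2 i j h, Matrix.one_apply_ne h.ne', h1 i j (not_lt.2 h.le), add_zero]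
  refine ⟨u, hu1, NU_le_GLOs ν ϖ 0 hu, fun i j hij => ?_⟩
  rw [Units.val_mul, huZ, Matrix.add_mul, Matrix.one_mul, Matrix.add_apply, h2 i j hij,
    Matrix.of_apply, if_pos hij, add_neg_cancel]

theorem exists_NU_lower (hϖ : IsUniformizer ϖ) {r : ℕ} {ε : ℝ} (hε0 : 0 ≤ ε) (hε : ε < 1)
    {g : GL (Fin ν) F} (hr : g ∈ Kround ϖ ν (-(r : ℤ)))
    (hg : ∀ i j, ‖g.1 i j - (1 : Matrix (Fin ν) (Fin ν) F) i j‖ ≤ ε) (s : ℕ) :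
    ∃ u ∈ NU ν ϖ r, u⁻¹ * g ∈ KroundS ν ϖ (-(s : ℤ)) := by
  obtain ⟨u, hu, huO, hl⟩ := exists_upper_lower hϖ hε0 hε hg
  have hlO : u * g ∈ GLO F ν := (GLOs F ν).mul_mem huO hr.1
  have hl' := lower_mem_Kround hϖ hlO hl
  refine ⟨u⁻¹, ⟨(upperN F ν).inv_mem hu, ?_⟩, ?_⟩
  · have : u⁻¹ = g * (u * g)⁻¹ := by group
    rw [this]
    exact (KroundS ν ϖ _).mul_mem ((mem_KroundS ϖ).2 hr)
      ((KroundS ν ϖ _).inv_mem ((mem_KroundS ϖ).2 (hl' r)))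
  · rw [inv_inv]; exact (mem_KroundS ϖ).2 (hl' s)

/-- Inside the ambient group, `K_{H,0}^{(1)}` and the unipotent group of level `1` meet the same
cosets of `K₀^{(-(1+m))}`. In one direction an element congruent to `1` is factored as unipotent
times lower triangular; in the other `exists_lower` supplies the element of `H`. The index is thus
the one counted in `relIndex_NU0`. -/
theorem relIndex_KHs [LocallyCompactSpace F] (hϖ : IsUniformizer ϖ) (n m : ℕ) :
    (KHs (F := F) n ϖ (1 + m)).relIndex (KHs n ϖ 1) = q0 ϖ ^ (m * dn n) := by
  rw [← relIndex_NU0 hϖ n 1 m]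
  set Γ : Subgroup (G0 n F) :=
    (KroundS n ϖ (-((1 + m : ℕ) : ℤ))).prod (KroundS (n + 1) ϖ (-((1 + m : ℕ) : ℤ))) with hΓ
  have h1 : Γ.relIndex (NU0 n ϖ 1) = (NU0 n ϖ (1 + m)).relIndex (NU0 n ϖ 1) := by
    refine relIndex_congr_left fun x hx => ?_
    exact ⟨fun h => ⟨⟨hx.1.1, h.1⟩, ⟨hx.2.1, h.2⟩⟩, fun h => ⟨h.1.2, h.2.2⟩⟩
  have h2 : (KHs (F := F) n ϖ (1 + m)).relIndex (KHs n ϖ 1) =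
      Γ.relIndex ((KHs n ϖ 1).map (phi n F)) := by
    rw [KHs, Subgroup.relIndex_comap]
  rw [h2, ← h1]
  have hε := pow_unif_lt_one (s := 1) hϖ le_rfl
  have hε0 : 0 ≤ ‖(ϖ : F)‖ ^ 1 := pow_nonneg (norm_nonneg _) _
  refine relIndex_eq_of_cover ?_ ?_
  · rintro _ ⟨h, hh, rfl⟩
    have hm := mem_KHs_iff.1 hh
    obtain ⟨u, hu, e1⟩ := exists_NU_lower hϖ hε0 hε hm.1 (KHs_sub_one hϖ hh) (1 + m)
    obtain ⟨v, hv, e2⟩ := exists_NU_lower hϖ hε0 hε hm.2 (Mhom_sub_one hϖ hh) (1 + m)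
    exact ⟨(u, v), ⟨hu, hv⟩, ⟨e1, e2⟩⟩
  · rintro ⟨u, v⟩ ⟨hu, hv⟩
    obtain ⟨h, hh, l1, l2⟩ := exists_lower hϖ le_rfl hu hv
    have hm := mem_KHs_iff.1 hh
    refine ⟨phi n F h, ⟨h, hh, rfl⟩, ?_⟩
    have k1 : (u⁻¹ * h)⁻¹ ∈ KroundS n ϖ (-((1 + m : ℕ) : ℤ)) := inv_mem ((mem_KroundS ϖ).2
      (lower_mem_Kround hϖ ((GLOs F n).mul_mem (inv_mem (NU_le_GLOs n ϖ 1 hu)) hm.1.1) l1 _))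
    have k2 : (v⁻¹ * Mhom n F h)⁻¹ ∈ KroundS (n + 1) ϖ (-((1 + m : ℕ) : ℤ)) :=
      inv_mem ((mem_KroundS ϖ).2 (lower_mem_Kround hϖ
        ((GLOs F (n + 1)).mul_mem (inv_mem (NU_le_GLOs (n + 1) ϖ 1 hv)) hm.2.1) l2 _))
    rw [mul_inv_rev, inv_inv] at k1 k2
    exact ⟨k1, k2⟩

end LevelIndex

/-! ### Supports of the orbital integrals -/

section OrbitalSupport

variable {F : Type*} [NontriviallyNormedField F] [IsUltrametricDist F] [LocallyCompactSpace F]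
  {ϖ : Fˣ} {n c s : ℕ} {Kn : Subgroup (GL (Fin n) F)} {Kn1 : Subgroup (GL (Fin (n + 1)) F)}
  {t' : T0 n F × T0 n F}

theorem isOpen_KroundS (ν : ℕ) (r : ℤ) : IsOpen (KroundS (F := F) ν ϖ r : Set (GL (Fin ν) F)) := by
  have e : (KroundS (F := F) ν ϖ r : Set (GL (Fin ν) F)) =
      GLO F ν ∩ (fun g => tGL ϖ ν ^ r * g * tGL ϖ ν ^ (-r)) ⁻¹' GLO F ν := by
    ext g; exact mem_KroundS ϖ
  rw [e]
  exact isOpen_GLO.inter (isOpen_GLO.preimage (by fun_prop))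

theorem isOpen_KHs (s : ℕ) : IsOpen (KHs (F := F) n ϖ s : Set (GL (Fin n) F)) := by
  have hc : Continuous (phi n F) := by
    have : ⇑(phi n F) = fun h => (m0 n F)⁻¹ * j0 h * m0 n F := funext fun h => phi_apply h
    rw [this]
    exact (continuous_const.mul continuous_j0).mul continuous_const
  exact ((isOpen_KroundS n (-(s : ℤ))).prod (isOpen_KroundS (n + 1) (-(s : ℤ)))).preimage hc

theorem Kround_neg_anti (hϖ : IsUniformizer ϖ) {ν r s : ℕ} (h : r ≤ s) :
    Kround ϖ ν (-(s : ℤ)) ⊆ Kround (F := F) ϖ ν (-(r : ℤ)) := fun g hg => by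
  rw [mem_Kround_neg_iff hϖ] at hg ⊢
  exact fun i j => ⟨(hg i j).1.trans (wt_le_wt hϖ h), (hg i j).2.trans (wt_le_wt hϖ h)⟩

theorem KHs_anti (hϖ : IsUniformizer ϖ) {r s : ℕ} (h : r ≤ s) :
    KHs (F := F) n ϖ s ≤ KHs n ϖ r := fun _ hg =>
  mem_KHs_iff.2 ⟨Kround_neg_anti hϖ h (mem_KHs_iff.1 hg).1,
    Kround_neg_anti hϖ h (mem_KHs_iff.1 hg).2⟩

theorem KHs_le_GLOs (s : ℕ) : KHs (F := F) n ϖ s ≤ GLOs F n := fun _ hh => (mem_KHs_iff.1 hh).1.1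

theorem measure_KH_one (hϖ : IsUniformizer ϖ) (μ : Measure (GL (Fin n) F)) [μ.IsHaarMeasure]
    (hs : 1 ≤ s) :
    μ.real (KH ϖ n 1) = (q0 ϖ : ℝ) ^ ((s - 1) * dn n) * μ.real (KHs n ϖ s : Set (GL (Fin n) F)) := by
  obtain ⟨m, rfl⟩ := Nat.exists_eq_add_of_le hs
  have hi := relIndex_KHs hϖ n m
  rw [← coe_KHs, Measure.real, measure_subgroup_eq (isOpen_KHs (1 + m)).measurableSet
    (KHs_anti hϖ (Nat.le_add_right 1 m))
    (by rw [hi]; exact pow_ne_zero _ (q0_ne_zero ϖ)), hi, ENNReal.toReal_mul, Nat.add_sub_cancel_left]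
  simp [Measure.real]

/-- The elements of `H × H` that move `δ` into the set of orbit representatives. -/
def orbitTransporter (ϖ : Fˣ) (Kn : Subgroup (GL (Fin n) F)) (Kn1 : Subgroup (GL (Fin (n + 1)) F))
    (t' : T0 n F × T0 n F) (s : ℕ) (δ : G0 n F) : Set (GL (Fin n) F × GL (Fin n) F) :=
  {p | (j0 p.1)⁻¹ * δ * j0 p.2 ∈ orbitSet ϖ Kn Kn1 t' s}

theorem mem_orbitSet_iff_conj {x : G0 n F} : x ∈ orbitSet ϖ Kn Kn1 t' s ↔
    ∃ a ∈ K0 Kn Kn1, ∃ b ∈ K0 Kn Kn1, (m0s ϖ n s)⁻¹ * x * m0s ϖ n s =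
      a * (yel ϖ s t'.1 * w0 n F * (yel ϖ s t'.2)⁻¹) * b := by
  rw [orbitSet, Set.mem_ofPred_eq, yel_w_yel]
  refine exists_congr fun a => and_congr_right fun _ => exists_congr fun b => and_congr_right fun _ =>
    ⟨fun h => ?_, fun h => ?_⟩
  · rw [h]; group
  · rw [show x = m0s ϖ n s * ((m0s ϖ n s)⁻¹ * x * m0s ϖ n s) * (m0s ϖ n s)⁻¹ by group, h]; group

theorem isClopen_orbitSet (hKn : IsCSDIComponent ϖ c Kn) (hKn1 : IsCSDIComponent ϖ c Kn1) :
    IsClopen (orbitSet ϖ Kn Kn1 t' s) := by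
  have := (isClopen_double_coset (A := K0 Kn Kn1) (isOpen_K0 hKn hKn1)
    (yel ϖ s t'.1 * w0 n F * (yel ϖ s t'.2)⁻¹)).preimage (f := fun x =>
    (m0s ϖ n s)⁻¹ * x * m0s ϖ n s) (by fun_prop)
  convert this using 1
  ext x
  exact mem_orbitSet_iff_conj

theorem isCompact_orbitSet (hKn : IsCSDIComponent ϖ c Kn) (hKn1 : IsCSDIComponent ϖ c Kn1) :
    IsCompact (orbitSet ϖ Kn Kn1 t' s) := by
  have hK := isCompact_K0 hKn hKn1
  have := (hK.prod hK).image (f := fun p : G0 n F × G0 n F => m0s ϖ n s * p.1 *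
      (diag0 ((t'.1 / tVec0 ϖ n ^ s) * iota0 (t'.2 / tVec0 ϖ n ^ s)) * w0 n F) * p.2 *
        (m0s ϖ n s)⁻¹) (by fun_prop)
  convert this using 1
  ext x
  constructor
  · rintro ⟨a, ha, b, hb, rfl⟩
    exact ⟨(a, b), ⟨ha, hb⟩, rfl⟩
  · rintro ⟨⟨a, b⟩, ⟨ha, hb⟩, rfl⟩
    exact ⟨a, ha, b, hb, rfl⟩

theorem isClopen_orbitTransporter (hKn : IsCSDIComponent ϖ c Kn) (hKn1 : IsCSDIComponent ϖ c Kn1)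
    (δ : G0 n F) : IsClopen (orbitTransporter ϖ Kn Kn1 t' s δ) :=
  (isClopen_orbitSet hKn hKn1).preimage (((continuous_j0.comp continuous_fst).inv.mul
    continuous_const).mul (continuous_j0.comp continuous_snd))

theorem mul_inv_mem_of_mem_suppSet (hϖ : IsUniformizer ϖ) (hKn : IsCSDIComponent ϖ c Kn)
    (hKn1 : IsCSDIComponent ϖ c Kn1) (hs : SuffPos ϖ c Kn Kn1 t' s) {g1 g2 : G0 n F}
    (h : mkGp (g1, g2) ∈ suppSet ϖ c Kn Kn1 hϖ t' s) : g1 * g2⁻¹ ∈ orbitSet ϖ Kn Kn1 t' s := by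
  rw [mem_suppSet_iff hϖ hKn hKn1, InSupp, Qs, ← w0_mul_t0] at h
  obtain ⟨a, ha, b, hb, e⟩ := (triG0 hϖ hKn hKn1).quot_mem_of_support (yel_mem s t'.1)
    hs.tDom.1 hs.tDom.2 h
  refine mem_orbitSet_iff_conj.2 ⟨a, ha, b, hb, ?_⟩
  rw [← e]; group

theorem exists_suppSet_fibre (hϖ : IsUniformizer ϖ) (hKn : IsCSDIComponent ϖ c Kn)
    (hKn1 : IsCSDIComponent ϖ c Kn1) (hs : SuffPos ϖ c Kn Kn1 t' s) {g1 g2 : G0 n F}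
    (h : g1 * g2⁻¹ ∈ orbitSet ϖ Kn Kn1 t' s) :
    ∃ z0 : H2 n F, ∀ z, mkGp (g1, g2) * j2 z ∈ suppSet ϖ c Kn Kn1 hϖ t' s ↔
      z0⁻¹ * z ∈ (Qs ϖ c Kn Kn1).map mkH2 := by
  obtain ⟨a, ha, b, hb, e⟩ := mem_orbitSet_iff_conj.1 h
  obtain ⟨x0, hx0⟩ := (triG0 hϖ hKn hKn1).quot_fibre (yel_mem s t'.1) (yel_mem s t'.2)
    hs.tDom.1 hs.tDom.2 mkH2_eq_one ha hb (g1 := (m0s ϖ n s)⁻¹ * g1) (g2 := (m0s ϖ n s)⁻¹ * g2)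
    (by rw [← e]; group)
  refine ⟨mkH2 x0, fun z => ?_⟩
  obtain ⟨x, rfl⟩ := mkH2_surjective z
  rw [j2_mk, ← map_mul, Prod.mk_mul_mk, mem_suppSet_iff hϖ hKn hKn1, InSupp, Qs, ← w0_mul_t0,
    ← hx0 x]
  simp only [mul_assoc]

/-- The support of the integrand of the orbital integral of the test measure. -/
def orbSupport (c : ℕ) (Kn : Subgroup (GL (Fin n) F)) (Kn1 : Subgroup (GL (Fin (n + 1)) F))
    (hϖ : IsUniformizer ϖ) (t' : T0 n F × T0 n F) (s : ℕ) (g : G0 n F × G0 n F) :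
    Set ((GL (Fin n) F × GL (Fin n) F) × H2 n F) :=
  {p | (j1 p.1)⁻¹ * mkGp g * j2 p.2 ∈ suppSet ϖ c Kn Kn1 hϖ t' s}

theorem isClopen_orbSupport (hϖ : IsUniformizer ϖ) (hKn : IsCSDIComponent ϖ c Kn)
    (hKn1 : IsCSDIComponent ϖ c Kn1) (g : G0 n F × G0 n F) :
    IsClopen (orbSupport c Kn Kn1 hϖ t' s g) :=
  (isClopen_suppSet hϖ hKn hKn1 t' s).preimage (((continuous_j1.comp continuous_fst).inv.mul
    continuous_const).mul (continuous_j2.comp continuous_snd))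

theorem j1_inv_mul_mkGp (p : GL (Fin n) F × GL (Fin n) F) (g1 g2 : G0 n F) :
    (j1 p)⁻¹ * mkGp (g1, g2) = mkGp ((j0 p.1)⁻¹ * g1, (j0 p.2)⁻¹ * g2) := by
  rw [j1, ← map_inv, ← map_mul]; rfl

theorem translate_mul_inv (x y : GL (Fin n) F) (g1 g2 : G0 n F) :
    ((j0 x)⁻¹ * g1) * ((j0 y)⁻¹ * g2)⁻¹ = (j0 x)⁻¹ * (g1 * g2⁻¹) * j0 y := by group

theorem mem_transporter_of_mem_orbSupport (hϖ : IsUniformizer ϖ) (hKn : IsCSDIComponent ϖ c Kn)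
    (hKn1 : IsCSDIComponent ϖ c Kn1) (hs : SuffPos ϖ c Kn Kn1 t' s) {g1 g2 : G0 n F}
    {p : (GL (Fin n) F × GL (Fin n) F) × H2 n F}
    (h : p ∈ orbSupport c Kn Kn1 hϖ t' s (g1, g2)) :
    p.1 ∈ orbitTransporter ϖ Kn Kn1 t' s (g1 * g2⁻¹) := by
  obtain ⟨x, hx⟩ := mkH2_surjective p.2
  rw [orbSupport, Set.mem_ofPred_eq, j1_inv_mul_mkGp, ← hx, j2_mk, ← map_mul, Prod.mk_mul_mk] at h
  have := mul_inv_mem_of_mem_suppSet hϖ hKn hKn1 hs h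
  rw [orbitTransporter, Set.mem_ofPred_eq, ← translate_mul_inv]
  convert this using 1
  group

/-- By Fubini over `H₁'`: above each point of the transporter the fibre in `H₂'` is one left coset
of the image of `Q`, and elsewhere it is empty. -/
theorem measure_orbSupport (hϖ : IsUniformizer ϖ) (hKn : IsCSDIComponent ϖ c Kn)
    (hKn1 : IsCSDIComponent ϖ c Kn1) (hs : SuffPos ϖ c Kn Kn1 t' s)
    (μn : Measure (GL (Fin n) F)) [μn.IsHaarMeasure] (μH : Measure (H2 n F)) [μH.IsHaarMeasure]
    (g1 g2 : G0 n F) :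
    orbMeasure μn μH (orbSupport c Kn Kn1 hϖ t' s (g1, g2)) =
      μH ((Qs ϖ c Kn Kn1).map mkH2 : Set (H2 n F)) *
        (μn.prod μn) (orbitTransporter ϖ Kn Kn1 t' s (g1 * g2⁻¹)) := by
  have : SecondCountableTopology (GL (Fin n) F) := secondCountable_GL
  have : WeaklyLocallyCompactSpace (GL (Fin n) F) := weaklyLocallyCompact_GL
  have : SecondCountableTopology (H2 n F) := secondCountable_H2
  have : WeaklyLocallyCompactSpace (H2 n F) := weaklyLocallyCompact_H2
  rw [orbMeasure, Measure.prod_apply (isClopen_orbSupport hϖ hKn hKn1 _).2.measurableSet,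
    ← setLIntegral_const, ← lintegral_indicator (isClopen_orbitTransporter hKn hKn1 _).2.measurableSet]
  refine lintegral_congr fun p => ?_
  by_cases hp : p ∈ orbitTransporter ϖ Kn Kn1 t' s (g1 * g2⁻¹)
  · rw [Set.indicator_of_mem hp]
    rw [orbitTransporter, Set.mem_ofPred_eq, ← translate_mul_inv] at hp
    obtain ⟨z0, hz0⟩ := exists_suppSet_fibre hϖ hKn hKn1 hs hp
    rw [← measure_leftCoset ((Qs ϖ c Kn Kn1).map mkH2 : Set (H2 n F)) z0]
    congr 1
    ext z
    rw [Set.mem_preimage, orbSupport, Set.mem_ofPred_eq, j1_inv_mul_mkGp, hz0]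
    rfl
  · rw [Set.indicator_of_notMem hp]
    convert measure_empty (μ := μH)
    refine Set.eq_empty_of_forall_notMem fun z hz => hp ?_
    exact mem_transporter_of_mem_orbSupport hϖ hKn hKn1 hs (p := (p, z)) hz

theorem orbitTransporter_eq (hϖ : IsUniformizer ϖ) (hKn : IsCSDIComponent ϖ c Kn)
    (hKn1 : IsCSDIComponent ϖ c Kn1) (hs : SuffPos ϖ c Kn Kn1 t' s) {δ : G0 n F}
    (hδ : δ ∈ orbitSet ϖ Kn Kn1 t' s) :
    orbitTransporter ϖ Kn Kn1 t' s δ =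
      (KHs n ϖ s : Set (GL (Fin n) F)) ×ˢ (KHs n ϖ s : Set (GL (Fin n) F)) := by
  ext p
  exact translate_mem_orbitSet_iff hϖ hKn hKn1 hs hδ

theorem orbitTransporter_translate (x y : GL (Fin n) F) (δ : G0 n F) :
    orbitTransporter ϖ Kn Kn1 t' s ((j0 x)⁻¹ * δ * j0 y) =
      (fun p => (x, y) * p) ⁻¹' orbitTransporter ϖ Kn Kn1 t' s δ := by
  ext p
  simp only [orbitTransporter, Set.mem_ofPred_eq, Set.mem_preimage, Prod.fst_mul, Prod.snd_mul,
    j0_mul, mul_inv_rev, mul_assoc]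

theorem measure_transporter_translate
    (μn : Measure (GL (Fin n) F)) [μn.IsHaarMeasure] (x y : GL (Fin n) F) (δ : G0 n F) :
    (μn.prod μn) (orbitTransporter ϖ Kn Kn1 t' s ((j0 x)⁻¹ * δ * j0 y)) =
      (μn.prod μn) (orbitTransporter ϖ Kn Kn1 t' s δ) := by
  have : SecondCountableTopology (GL (Fin n) F) := secondCountable_GL
  have : WeaklyLocallyCompactSpace (GL (Fin n) F) := weaklyLocallyCompact_GL
  rw [orbitTransporter_translate, measure_preimage_mul]

/-- A nonempty transporter is a translate of the transporter of a point of the orbit set, which is a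
product of two compact groups by rigidity. -/
theorem measure_transporter_lt_top (hϖ : IsUniformizer ϖ) (hKn : IsCSDIComponent ϖ c Kn)
    (hKn1 : IsCSDIComponent ϖ c Kn1) (hs : SuffPos ϖ c Kn Kn1 t' s)
    (μn : Measure (GL (Fin n) F)) [μn.IsHaarMeasure] (δ : G0 n F) :
    (μn.prod μn) (orbitTransporter ϖ Kn Kn1 t' s δ) < ⊤ := by
  have : SecondCountableTopology (GL (Fin n) F) := secondCountable_GL
  have : WeaklyLocallyCompactSpace (GL (Fin n) F) := weaklyLocallyCompact_GL
  rcases (orbitTransporter ϖ Kn Kn1 t' s δ).eq_empty_or_nonempty with h | ⟨p, hp⟩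
  · simp [h]
  · rw [← measure_transporter_translate μn p.1 p.2 δ,
      orbitTransporter_eq hϖ hKn hKn1 hs hp, Measure.prod_prod]
    have hlt : μn (KHs n ϖ s : Set (GL (Fin n) F)) < ⊤ :=
      (measure_mono (KHs_le_GLOs s)).trans_lt isCompact_GLOs.measure_lt_top
    exact ENNReal.mul_lt_top hlt hlt

end OrbitalSupport

/-! ### The explicit constants -/

section Constants

variable {F : Type*} [NontriviallyNormedField F] [IsUltrametricDist F] [LocallyCompactSpace F]
  {ϖ : Fˣ} {n c s : ℕ} {Kn : Subgroup (GL (Fin n) F)} {Kn1 : Subgroup (GL (Fin (n + 1)) F)}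
  {t' : T0 n F × T0 n F}

theorem iotaIdx_ne_zero (hϖ : IsUniformizer ϖ) (hKn : IsCSDIComponent ϖ c Kn)
    (hKn1 : IsCSDIComponent ϖ c Kn1) : iotaIdx ϖ c Kn Kn1 ≠ 0 := fun h => by
  have := iotaIdx_mul_qEllW hϖ hKn hKn1
  rw [h, zero_mul] at this
  exact pow_ne_zero _ (q0_ne_zero ϖ) this.symm

/-- The mass of the fibres of the support of the test measure over the transporter. -/
noncomputable def fibreMass (ϖ : Fˣ) (c : ℕ) (Kn : Subgroup (GL (Fin n) F))
    (Kn1 : Subgroup (GL (Fin (n + 1)) F)) (s : ℕ) : ℚ :=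
  (q0 ϖ : ℚ) ^ ((dn n : ℤ) * (2 * s - c)) * iotaIdx ϖ c Kn Kn1 *
    (K0 Kn Kn1).relIndex (GO0 F n)

/-- The volume of `K` in `G'` cancels against that of `Q` in `H₂'`. What remains is rational, so
that the matching function can take rational values. -/
theorem suppVal_mul_measure (hϖ : IsUniformizer ϖ) (hKn : IsCSDIComponent ϖ c Kn)
    (hKn1 : IsCSDIComponent ϖ c Kn1) (μG : Measure (Gp n F)) [μG.IsHaarMeasure]
    (hμG : μG (mkGp '' (G0O n F ×ˢ G0O n F)) = 1)
    (μH : Measure (H2 n F)) [μH.IsHaarMeasure] (hμH : μH (mkH2 '' G0O n F) = 1) (s : ℕ) :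
    suppVal ϖ c Kn Kn1 μG s * (μH.real ((Qs ϖ c Kn Kn1).map mkH2 : Set (H2 n F)) : ℂ) =
      (fibreMass ϖ c Kn Kn1 s : ℂ) := by
  have hK : (μG.real (KCS ϖ c Kn Kn1 : Set (Gp n F)) : ℂ) ≠ 0 := by
    rw [Ne, Complex.ofReal_eq_zero, Measure.real, ENNReal.toReal_eq_zero_iff, not_or]
    exact ⟨((isOpen_KCS hKn hKn1).measure_pos μG ⟨1, Subgroup.one_mem _⟩).ne',
      (isCompact_KCS hKn hKn1).measure_lt_top.ne⟩
  have h : μH.real ((Qs ϖ c Kn Kn1).map mkH2 : Set (H2 n F)) =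
      (K0 Kn Kn1).relIndex (GO0 F n) * μG.real (KCS ϖ c Kn Kn1 : Set (Gp n F)) := by
    rw [Measure.real, measure_KCS hϖ hKn hKn1 μG hμG μH hμH, ENNReal.toReal_mul,
      ENNReal.toReal_natCast, ← Measure.real]
  rw [h, suppVal, fibreMass]
  push_cast
  field_simp

/-- Here `[N ∩ Q : N(𝒪₀)]` is traded for `q₀^{c d(n) - ℓ(w₀)}`, the index of `K₀` for `vol(K₀)⁻¹`,
and the volume at level `s` for the one at level `1`. -/
theorem fibreMass_mul_measure (hϖ : IsUniformizer ϖ) (hKn : IsCSDIComponent ϖ c Kn)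
    (hKn1 : IsCSDIComponent ϖ c Kn1) (hs : 1 ≤ s)
    (μn : Measure (GL (Fin n) F)) [μn.IsHaarMeasure] (hμn : μn (GLO F n) = 1)
    (μn1 : Measure (GL (Fin (n + 1)) F)) [μn1.IsHaarMeasure] (hμn1 : μn1 (GLO F (n + 1)) = 1) :
    (fibreMass ϖ c Kn Kn1 s : ℝ) * μn.real (KHs n ϖ s : Set (GL (Fin n) F)) ^ 2 =
      kPrime ϖ Kn Kn1 μn μn1 := by
  have : SecondCountableTopology (GL (Fin n) F) := secondCountable_GL
  have : WeaklyLocallyCompactSpace (GL (Fin n) F) := weaklyLocallyCompact_GL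
  have hq : (q0 ϖ : ℝ) ≠ 0 := by exact_mod_cast q0_ne_zero ϖ
  have hi : (iotaIdx ϖ c Kn Kn1 : ℝ) * (qEllW Kn * qEllW Kn1) = (q0 ϖ : ℝ) ^ (c * dn n) := by
    exact_mod_cast iotaIdx_mul_qEllW hϖ hKn hKn1
  have hw : (qEllW Kn * qEllW Kn1 : ℝ) ≠ 0 := fun h => by
    rw [h, mul_zero] at hi; exact pow_ne_zero _ hq hi.symm
  rw [kPrime, volCirc, measureReal_prod_prod, measure_KH_one hϖ μn hs,
    measure_K0 hKn hKn1 μn hμn μn1 hμn1, eq_div_iff hw, div_inv_eq_mul, fibreMass]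
  set v := μn.real (KHs n ϖ s : Set (GL (Fin n) F))
  set R : ℝ := ((K0 Kn Kn1).relIndex (GO0 F n) : ℝ)
  push_cast
  -- Both exponents equal `2 s d(n)`: on the left `d(n)(2s - c) + c d(n)`, on the right `2 d(n) +
  -- 2(s - 1) d(n)`.
  have hz : (q0 ϖ : ℝ) ^ ((dn n : ℤ) * (2 * s - c)) * (q0 ϖ : ℝ) ^ (c * dn n) =
      ((q0 ϖ : ℝ) ^ 2) ^ dn n * ((q0 ϖ : ℝ) ^ ((s - 1) * dn n)) ^ 2 := by
    rw [← pow_mul, ← pow_mul, ← pow_add, ← zpow_natCast, ← zpow_natCast, ← zpow_add₀ hq]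
    congr 1
    push_cast [Nat.cast_sub hs]
    ring
  calc _ = ((q0 ϖ : ℝ) ^ ((dn n : ℤ) * (2 * s - c)) * ((iotaIdx ϖ c Kn Kn1 : ℝ) *
        (qEllW Kn * qEllW Kn1))) * (R * v ^ 2) := by ring
    _ = _ := by rw [hi, hz]; ring

end Constants

/-! ### Evaluation of the orbital integrals -/

section OrbitalIntegral

variable {F : Type*} [NontriviallyNormedField F] [IsUltrametricDist F] [LocallyCompactSpace F]
  {ϖ : Fˣ} {n c s : ℕ} {Kn : Subgroup (GL (Fin n) F)} {Kn1 : Subgroup (GL (Fin (n + 1)) F)}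
  {t' : T0 n F × T0 n F}

theorem orbIntegrand_testMeasure (hϖ : IsUniformizer ϖ) (hKn : IsCSDIComponent ϖ c Kn)
    (hKn1 : IsCSDIComponent ϖ c Kn1) (hs : SuffPos ϖ c Kn Kn1 t' s)
    (μG : Measure (Gp n F)) [μG.IsHaarMeasure] {χ : Fˣ →* ℂˣ} {g : G0 n F × G0 n F}
    (hχ : ∀ p ∈ orbSupport c Kn Kn1 hϖ t' s g,
      χ (Matrix.GeneralLinearGroup.det p.1.1 * Matrix.GeneralLinearGroup.det p.1.2) = 1) :
    orbIntegrand (testMeasure ϖ c Kn Kn1 t' μG s) χ (mkGp g) =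
      (orbSupport c Kn Kn1 hϖ t' s g).indicator fun _ => suppVal ϖ c Kn Kn1 μG s := by
  funext p
  rw [orbIntegrand, testMeasure_eq hϖ hKn hKn1 hs μG (iotaIdx_ne_zero hϖ hKn hKn1)]
  by_cases hp : p ∈ orbSupport c Kn Kn1 hϖ t' s g
  · rw [Set.indicator_of_mem hp, Set.indicator_of_mem (by exact hp), hχ p hp, Units.val_one, mul_one]
  · rw [Set.indicator_of_notMem hp, Set.indicator_of_notMem (by exact hp), zero_mul]

/-- The orbital integral of the test measure is the volume of a transporter, when the character
is trivial on the support. -/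
theorem integral_orbIntegrand (hϖ : IsUniformizer ϖ) (hKn : IsCSDIComponent ϖ c Kn)
    (hKn1 : IsCSDIComponent ϖ c Kn1) (hs : SuffPos ϖ c Kn Kn1 t' s)
    (μn : Measure (GL (Fin n) F)) [μn.IsHaarMeasure]
    (μG : Measure (Gp n F)) [μG.IsHaarMeasure]
    (hμG : μG (mkGp '' (G0O n F ×ˢ G0O n F)) = 1)
    (μH : Measure (H2 n F)) [μH.IsHaarMeasure] (hμH : μH (mkH2 '' G0O n F) = 1)
    {χ : Fˣ →* ℂˣ} {g1 g2 : G0 n F}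
    (hχ : ∀ p ∈ orbSupport c Kn Kn1 hϖ t' s (g1, g2),
      χ (Matrix.GeneralLinearGroup.det p.1.1 * Matrix.GeneralLinearGroup.det p.1.2) = 1) :
    Integrable (orbIntegrand (testMeasure ϖ c Kn Kn1 t' μG s) χ (mkGp (g1, g2)))
      (orbMeasure μn μH) ∧
    ∫ p, orbIntegrand (testMeasure ϖ c Kn Kn1 t' μG s) χ (mkGp (g1, g2)) p ∂(orbMeasure μn μH) =
      (fibreMass ϖ c Kn Kn1 s : ℂ) *
        ((μn.prod μn).real (orbitTransporter ϖ Kn Kn1 t' s (g1 * g2⁻¹)) : ℂ) := by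
  have : SecondCountableTopology (GL (Fin n) F) := secondCountable_GL
  have : SecondCountableTopology (H2 n F) := secondCountable_H2
  have hm := (isClopen_orbSupport (t' := t') (s := s) hϖ hKn hKn1 (g1, g2)).2.measurableSet
  have hv := measure_orbSupport hϖ hKn hKn1 hs μn μH g1 g2
  have hQ : IsCompact ((Qs ϖ c Kn Kn1).map mkH2 : Set (H2 n F)) :=
    isCompact_map_mkH2 (isCompact_conjSub (isCompact_K0 hKn hKn1) _)
  have hfin : orbMeasure μn μH (orbSupport c Kn Kn1 hϖ t' s (g1, g2)) ≠ ⊤ := by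
    rw [hv]
    exact (ENNReal.mul_lt_top hQ.measure_lt_top
      (measure_transporter_lt_top hϖ hKn hKn1 hs μn _)).ne
  rw [orbIntegrand_testMeasure hϖ hKn hKn1 hs μG hχ]
  refine ⟨(integrable_indicator_iff hm).2 (integrableOn_const hfin), ?_⟩
  rw [integral_indicator hm, setIntegral_const, Measure.real, hv, ENNReal.toReal_mul,
    ← Measure.real, ← Measure.real, ← suppVal_mul_measure hϖ hKn hKn1 μG hμG μH hμH s,
    Complex.real_smul]
  push_cast
  ring

theorem integral_unitaryIntegrand (hϖ : IsUniformizer ϖ) (hKn : IsCSDIComponent ϖ c Kn)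
    (hKn1 : IsCSDIComponent ϖ c Kn1) (hs : SuffPos ϖ c Kn Kn1 t' s)
    (μn : Measure (GL (Fin n) F)) [μn.IsHaarMeasure] (a : ℂ) (δ : G0 n F) :
    Integrable (unitaryIntegrand ((orbitSet ϖ Kn Kn1 t' s).indicator fun _ => a) δ) (μn.prod μn) ∧
    ∫ p, unitaryIntegrand ((orbitSet ϖ Kn Kn1 t' s).indicator fun _ => a) δ p ∂(μn.prod μn) =
      a * ((μn.prod μn).real (orbitTransporter ϖ Kn Kn1 t' s δ) : ℂ) := by
  have : SecondCountableTopology (GL (Fin n) F) := secondCountable_GL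
  have hm := (isClopen_orbitTransporter (t' := t') (s := s) hKn hKn1 δ).2.measurableSet
  have e : unitaryIntegrand ((orbitSet ϖ Kn Kn1 t' s).indicator fun _ => a) δ =
      (orbitTransporter ϖ Kn Kn1 t' s δ).indicator fun _ => a := rfl
  rw [e]
  refine ⟨(integrable_indicator_iff hm).2
    (integrableOn_const (measure_transporter_lt_top hϖ hKn hKn1 hs μn δ).ne), ?_⟩
  rw [integral_indicator hm, setIntegral_const, Complex.real_smul, mul_comm]

theorem SuffPosChar.det_eq_one (hϖ : IsUniformizer ϖ) {χ : Fˣ →* ℂˣ} (hχ : SuffPosChar ϖ χ s)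
    {h : GL (Fin n) F} (hh : h ∈ KHs n ϖ s) : χ (Matrix.GeneralLinearGroup.det h) = 1 :=
  hχ.2 _ (norm_det_sub_one_le (pow_nonneg (norm_nonneg _) _)
    (pow_unif_lt_one hϖ hχ.1).le (KHs_sub_one hϖ hh))

end OrbitalIntegral

/-! ### Matching of orbits -/

section Matching

variable {F : Type*} [NontriviallyNormedField F] {n : ℕ}

theorem eq_j0_mul_of_gstar_eq {a b : G0 n F} (h : gstar a = gstar b) :
    a = j0 (a.1 * b.1⁻¹) * b := by
  have h2 : a.2 = embGL a.1 * gstar a := by rw [gstar, mul_inv_cancel_left]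
  refine Prod.ext (by simp [j0]) ?_
  rw [h2, h, gstar]
  simp [j0, embGL_mul, embGL_inv, mul_assoc]

/-- The element `δ` is determined by `δ_⋆` up to left multiplication by `j(GL_n)`, while conjugation
of `δ_⋆` comes from right multiplication. Matching orbits therefore differ by `H × H`, and their
transporters have equal volume. -/
theorem OrbitsMatch.exists_translate {g1 g2 δ : G0 n F} (h : OrbitsMatch (g1, g2) δ) :
    ∃ x y : GL (Fin n) F, δ = (j0 x)⁻¹ * (g1 * g2⁻¹) * j0 y := by
  obtain ⟨y, hy⟩ := h
  have h1 : gstar δ = gstar ((j0 1)⁻¹ * (g1 * g2⁻¹) * j0 (g2.1 * y)) := by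
    rw [sMat_fst] at hy
    rw [gstar_translate, mul_inv_rev, embGL_mul]
    calc gstar δ = (embGL y)⁻¹ * (embGL y * gstar δ * (embGL y)⁻¹) * embGL y := by group
      _ = _ := by rw [hy, embGL_inv y]; group
  refine ⟨(δ.1 * ((j0 1)⁻¹ * (g1 * g2⁻¹) * j0 (g2.1 * y)).1⁻¹)⁻¹, g2.1 * y, ?_⟩
  conv_lhs => rw [eq_j0_mul_of_gstar_eq h1]
  rw [j0_inv, inv_inv, j0_one]
  group

theorem isLocallyConstant_indicator {X M : Type*} [TopologicalSpace X] [Zero M] {U : Set X}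
    (hU : IsClopen U) (a : M) : IsLocallyConstant (U.indicator fun _ => a) := by
  rw [IsLocallyConstant.iff_exists_open]
  intro x
  by_cases hx : x ∈ U
  · refine ⟨U, hU.2, hx, fun y hy => ?_⟩
    rw [Set.indicator_of_mem hx, Set.indicator_of_mem hy]
  · refine ⟨Uᶜ, hU.1.isOpen_compl, hx, fun y hy => ?_⟩
    rw [Set.indicator_of_notMem hx, Set.indicator_of_notMem hy]

/-- As `θ(-1)² = 1`, the transfer factor is a sign, hence rational. -/
theorem exists_sign (θ : Fˣ →* ℂˣ) (k : ℕ) : ∃ ε : ℚ, (ε : ℂ) = (θ (-1) : ℂ) ^ k := by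
  have h : (θ (-1) : ℂ) ^ 2 = 1 := by
    rw [← Units.val_pow_eq_pow_val, ← map_pow, neg_one_sq, map_one, Units.val_one]
  rcases eq_or_eq_neg_of_sq_eq_sq _ 1 (h.trans (one_pow 2).symm) with h | h
  · exact ⟨1, by rw [h]; simp⟩
  · exact ⟨(-1) ^ k, by rw [h]; simp⟩

end Matching

/-! ### Assembly of the theorem -/

section Main

variable {F : Type*} [NontriviallyNormedField F] [IsUltrametricDist F] [LocallyCompactSpace F]
  {ϖ : Fˣ} {n c s : ℕ} {Kn : Subgroup (GL (Fin n) F)} {Kn1 : Subgroup (GL (Fin (n + 1)) F)}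
  {t' : T0 n F × T0 n F}

theorem tsupport_testMeasure_subset (hϖ : IsUniformizer ϖ) (hKn : IsCSDIComponent ϖ c Kn)
    (hKn1 : IsCSDIComponent ϖ c Kn1) (hs : SuffPos ϖ c Kn Kn1 t' s)
    (μG : Measure (Gp n F)) [μG.IsHaarMeasure] :
    tsupport (testMeasure ϖ c Kn Kn1 t' μG s) ⊆ mkGp '' RegPlus n F := by
  rw [testMeasure_eq hϖ hKn hKn1 hs μG (iotaIdx_ne_zero hϖ hKn hKn1)]
  refine (closure_minimal Set.support_indicator_subset
    (isClopen_suppSet hϖ hKn hKn1 t' s).1).trans fun x hx => ?_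
  obtain ⟨⟨g1, g2⟩, rfl⟩ := mkGp_surjective x
  exact ⟨(g1, g2), (mem_RegPlus_iff' g1 g2).2 (Dplus_ne_zero_of_orbitSet hϖ hKn hKn1 hs
    (mul_inv_mem_of_mem_suppSet hϖ hKn hKn1 hs hx)), rfl⟩

theorem matches_orbitSet_indicator (hϖ : IsUniformizer ϖ) (hKn : IsCSDIComponent ϖ c Kn)
    (hKn1 : IsCSDIComponent ϖ c Kn1) (hs : SuffPos ϖ c Kn Kn1 t' s) (θ : Fˣ →* ℂˣ)
    (μn : Measure (GL (Fin n) F)) [μn.IsHaarMeasure]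
    (μG : Measure (Gp n F)) [μG.IsHaarMeasure]
    (hμG : μG (mkGp '' (G0O n F ×ˢ G0O n F)) = 1)
    (μH : Measure (H2 n F)) [μH.IsHaarMeasure] (hμH : μH (mkH2 '' G0O n F) = 1) :
    Matches θ μn μH (testMeasure ϖ c Kn Kn1 t' μG s) ((orbitSet ϖ Kn Kn1 t' s).indicator
      fun _ => (θ (-1) : ℂ) ^ (n * (n + 1) / 2) * (fibreMass ϖ c Kn Kn1 s : ℂ)) := by
  rintro ⟨g1, g2⟩ hg δ hδ
  obtain ⟨h1, h2⟩ := integral_orbIntegrand hϖ hKn hKn1 hs μn μG hμG μH hμH (χ := 1)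
    (g1 := g1) (g2 := g2) fun _ _ => rfl
  obtain ⟨h3, h4⟩ := integral_unitaryIntegrand hϖ hKn hKn1 hs μn
    ((θ (-1) : ℂ) ^ (n * (n + 1) / 2) * (fibreMass ϖ c Kn Kn1 s : ℂ)) δ
  refine ⟨h1, h3, ?_⟩
  obtain ⟨x, y, rfl⟩ := hδ.exists_translate
  rw [orbI, h2, h4, kappa_eq θ hg.1, mul_assoc, Measure.real, Measure.real,
    measure_transporter_translate μn]

/-- The invariants are constant on `H × H` orbits, so a nonempty transporter would put `invB g` in
the image of the orbit set. -/
theorem orbI_eq_zero (hϖ : IsUniformizer ϖ) (hKn : IsCSDIComponent ϖ c Kn)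
    (hKn1 : IsCSDIComponent ϖ c Kn1) (hs : SuffPos ϖ c Kn Kn1 t' s) (θ χ : Fˣ →* ℂˣ)
    (μn : Measure (GL (Fin n) F)) [μn.IsHaarMeasure]
    (μG : Measure (Gp n F)) [μG.IsHaarMeasure]
    (hμG : μG (mkGp '' (G0O n F ×ˢ G0O n F)) = 1)
    (μH : Measure (H2 n F)) [μH.IsHaarMeasure] (hμH : μH (mkH2 '' G0O n F) = 1)
    {g : G0 n F × G0 n F} (hg : invB g ∉ (fun x => invB (x, 1)) '' orbitSet ϖ Kn Kn1 t' s) :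
    Integrable (orbIntegrand (testMeasure ϖ c Kn Kn1 t' μG s) χ (mkGp g)) (orbMeasure μn μH) ∧
      orbI θ μn μH (testMeasure ϖ c Kn Kn1 t' μG s) χ g = 0 := by
  obtain ⟨g1, g2⟩ := g
  have hE : ∀ p, p ∉ orbitTransporter ϖ Kn Kn1 t' s (g1 * g2⁻¹) := fun p hp =>
    hg ⟨_, hp, (invB_translate _ _ _).trans (invB_mul_inv g1 g2)⟩
  obtain ⟨h1, h2⟩ := integral_orbIntegrand hϖ hKn hKn1 hs μn μG hμG μH hμH (χ := χ)
    (g1 := g1) (g2 := g2) fun p hp =>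
      absurd (mem_transporter_of_mem_orbSupport hϖ hKn hKn1 hs hp) (hE _)
  refine ⟨h1, ?_⟩
  rw [orbI, h2, Set.eq_empty_of_forall_notMem hE]
  simp

/-- On the support both components of `H₁'` lie in `K_{H,0}^{(s)}`, where determinants are congruent
to `1` modulo `ϖ^s` and the character is trivial. -/
theorem orbI_eq_kPrime (hϖ : IsUniformizer ϖ) (hKn : IsCSDIComponent ϖ c Kn)
    (hKn1 : IsCSDIComponent ϖ c Kn1) (hs : SuffPos ϖ c Kn Kn1 t' s) (θ : Fˣ →* ℂˣ)
    {χ : Fˣ →* ℂˣ} (hχ : SuffPosChar ϖ χ s)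
    (μn : Measure (GL (Fin n) F)) [μn.IsHaarMeasure] (hμn : μn (GLO F n) = 1)
    (μn1 : Measure (GL (Fin (n + 1)) F)) [μn1.IsHaarMeasure] (hμn1 : μn1 (GLO F (n + 1)) = 1)
    (μG : Measure (Gp n F)) [μG.IsHaarMeasure]
    (hμG : μG (mkGp '' (G0O n F ×ˢ G0O n F)) = 1)
    (μH : Measure (H2 n F)) [μH.IsHaarMeasure] (hμH : μH (mkH2 '' G0O n F) = 1)
    {δ : G0 n F} (hδ : δ ∈ orbitSet ϖ Kn Kn1 t' s) :
    Integrable (orbIntegrand (testMeasure ϖ c Kn Kn1 t' μG s) χ (mkGp (δ, 1)))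
        (orbMeasure μn μH) ∧
      orbI θ μn μH (testMeasure ϖ c Kn Kn1 t' μG s) χ (δ, 1) =
        (θ (-1) : ℂ) ^ (n * (n + 1) / 2) * (kPrime ϖ Kn Kn1 μn μn1 : ℂ) := by
  have : SecondCountableTopology (GL (Fin n) F) := secondCountable_GL
  have : WeaklyLocallyCompactSpace (GL (Fin n) F) := weaklyLocallyCompact_GL
  have hE := orbitTransporter_eq hϖ hKn hKn1 hs hδ
  obtain ⟨h1, h2⟩ := integral_orbIntegrand hϖ hKn hKn1 hs μn μG hμG μH hμH (χ := χ)
    (g1 := δ) (g2 := 1) fun p hp => by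
      have h := mem_transporter_of_mem_orbSupport hϖ hKn hKn1 hs hp
      rw [inv_one, mul_one, hE] at h
      rw [map_mul, hχ.det_eq_one hϖ h.1, hχ.det_eq_one hϖ h.2, mul_one]
  refine ⟨h1, ?_⟩
  rw [orbI, h2, inv_one, mul_one, hE, measureReal_prod_prod,
    ← fibreMass_mul_measure hϖ hKn hKn1 hs.one_le μn hμn μn1 hμn1, kappa_eq]
  · push_cast; ring
  · rw [mem_RegPlus_iff', inv_one, mul_one]
    exact Dplus_ne_zero_of_orbitSet hϖ hKn hKn1 hs hδ

theorem mul_mem_orbitSet_iff {k x : G0 n F} (hk : k ∈ K0 Kn Kn1) :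
    (m0s ϖ n s * k * (m0s ϖ n s)⁻¹ * x ∈ orbitSet ϖ Kn Kn1 t' s ↔
      x ∈ orbitSet ϖ Kn Kn1 t' s) ∧
    (x * (m0s ϖ n s * k * (m0s ϖ n s)⁻¹) ∈ orbitSet ϖ Kn Kn1 t' s ↔
      x ∈ orbitSet ϖ Kn Kn1 t' s) := by
  have hl : ∀ {k x : G0 n F}, k ∈ K0 Kn Kn1 → x ∈ orbitSet ϖ Kn Kn1 t' s →
      m0s ϖ n s * k * (m0s ϖ n s)⁻¹ * x ∈ orbitSet ϖ Kn Kn1 t' s := by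
    rintro k _ hk ⟨a, ha, b, hb, rfl⟩
    exact ⟨k * a, Subgroup.mul_mem _ hk ha, b, hb, by group⟩
  have hr : ∀ {k x : G0 n F}, k ∈ K0 Kn Kn1 → x ∈ orbitSet ϖ Kn Kn1 t' s →
      x * (m0s ϖ n s * k * (m0s ϖ n s)⁻¹) ∈ orbitSet ϖ Kn Kn1 t' s := by
    rintro k _ hk ⟨a, ha, b, hb, rfl⟩
    exact ⟨a, ha, b * k, Subgroup.mul_mem _ hb hk, by group⟩
  refine ⟨⟨fun h => ?_, hl hk⟩, ⟨fun h => ?_, hr hk⟩⟩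
  · convert hl (Subgroup.inv_mem _ hk) h using 1
    group
  · convert hr (Subgroup.inv_mem _ hk) h using 1
    group

theorem exists_matching (hϖ : IsUniformizer ϖ) (hKn : IsCSDIComponent ϖ c Kn)
    (hKn1 : IsCSDIComponent ϖ c Kn1) (hs : SuffPos ϖ c Kn Kn1 t' s) (θ : Fˣ →* ℂˣ)
    (μn : Measure (GL (Fin n) F)) [μn.IsHaarMeasure]
    (μG : Measure (Gp n F)) [μG.IsHaarMeasure]
    (hμG : μG (mkGp '' (G0O n F ×ˢ G0O n F)) = 1)
    (μH : Measure (H2 n F)) [μH.IsHaarMeasure] (hμH : μH (mkH2 '' G0O n F) = 1) :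
    ∃ f : G0 n F → ℚ, IsLocallyConstant f ∧ HasCompactSupport f ∧
      Matches θ μn μH (testMeasure ϖ c Kn Kn1 t' μG s) (fun x => (f x : ℂ)) ∧
      (∀ δ, f δ ≠ 0 → IsRegularG δ) ∧
      ∃ g : G0 n F, ∀ k ∈ K0 Kn Kn1, ∀ x,
        f (g * k * g⁻¹ * x) = f x ∧ f (x * (g * k * g⁻¹)) = f x := by
  obtain ⟨ε, hε⟩ := exists_sign θ (n * (n + 1) / 2)
  refine ⟨(orbitSet ϖ Kn Kn1 t' s).indicator fun _ => ε * fibreMass ϖ c Kn Kn1 s,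
    isLocallyConstant_indicator (isClopen_orbitSet hKn hKn1) _,
    HasCompactSupport.intro (isCompact_orbitSet hKn hKn1) fun x hx =>
      Set.indicator_of_notMem hx _, ?_, fun δ hδ => ?_, m0s ϖ n s, fun k hk x => ?_⟩
  · convert matches_orbitSet_indicator hϖ hKn hKn1 hs θ μn μG hμG μH hμH using 1
    funext x
    by_cases hx : x ∈ orbitSet ϖ Kn Kn1 t' s
    · rw [Set.indicator_of_mem hx, Set.indicator_of_mem hx, Rat.cast_mul, hε]
    · rw [Set.indicator_of_notMem hx, Set.indicator_of_notMem hx, Rat.cast_zero]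
  · exact isRegularG_of_Dplus (Dplus_ne_zero_of_orbitSet hϖ hKn hKn1 hs
      (Set.mem_of_indicator_ne_zero hδ))
  · obtain ⟨h1, h2⟩ := mul_mem_orbitSet_iff (ϖ := ϖ) (s := s) (t' := t') (x := x) hk
    classical
    simp only [Set.indicator_apply, h1, h2, and_self]

/-- Representatives must serve every admissible `s` at once. The orbit sets decrease with `s` and
have the same invariants, so the set at the largest admissible `s`, which exists by
`SuffPos.bounded`, is suitable. -/
theorem exists_orbit_image (hϖ : IsUniformizer ϖ) (hn : 1 ≤ n) (hKn : IsCSDIComponent ϖ c Kn)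
    (hKn1 : IsCSDIComponent ϖ c Kn1) (t' : T0 n F × T0 n F) :
    ∃ O : Set (G0 n F), IsCompact O ∧ (∀ x ∈ O, Dplus (gstar x) ≠ 0) ∧
      ∀ s, SuffPos ϖ c Kn Kn1 t' s →
      O ⊆ orbitSet ϖ Kn Kn1 t' s ∧
      (fun x => invB (x, 1)) '' O = (fun x => invB (x, 1)) '' orbitSet ϖ Kn Kn1 t' s := by
  obtain ⟨M, hM⟩ := SuffPos.bounded hϖ hn c Kn Kn1 t'
  by_cases h : ∃ s, SuffPos ϖ c Kn Kn1 t' s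
  · obtain ⟨s₀, hs₀, hmax⟩ : ∃ s₀, SuffPos ϖ c Kn Kn1 t' s₀ ∧
        ∀ s, SuffPos ϖ c Kn Kn1 t' s → s ≤ s₀ := by
      classical
      obtain ⟨s, hs⟩ := h
      exact ⟨_, Nat.findGreatest_spec (hM s hs) hs, fun s' hs' => Nat.le_findGreatest (hM s' hs') hs'⟩
    refine ⟨orbitSet ϖ Kn Kn1 t' s₀, isCompact_orbitSet hKn hKn1,
      fun x hx => Dplus_ne_zero_of_orbitSet hϖ hKn hKn1 hs₀ hx, fun s hs =>
      ⟨orbitSet_anti hϖ hKn hKn1 hs hs₀ (hmax s hs),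
        image_invB_orbitSet hϖ hKn hKn1 hs hs₀ (hmax s hs)⟩⟩
  -- Without any admissible `s` the conditions are vacuous and the empty set serves.
  · exact ⟨∅, isCompact_empty, fun x hx => absurd hx (Set.notMem_empty x),
      fun s hs => absurd ⟨s, hs⟩ h⟩

end Main

end SplitOrb

theorem mainTheorem9 {F : Type*} [NontriviallyNormedField F] [IsUltrametricDist F]
    [LocallyCompactSpace F] [CharZero F]
    (ϖ : Fˣ) (hϖ : IsUniformizer ϖ)
    (n : ℕ) (hn : 1 ≤ n)
    -- the conjugate-symmetric deeper Iwahori `K` of depth `c`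
    (c : ℕ) (hc : 1 ≤ c)
    (Kn : Subgroup (GL (Fin n) F)) (Kn1 : Subgroup (GL (Fin (n + 1)) F))
    (hKn : IsCSDIComponent ϖ c Kn) (hKn1 : IsCSDIComponent ϖ c Kn1)
    -- the element `t' = [t'₁; t'₂]` of `T^{++}`
    (t' : T0 n F × T0 n F)
    (ht'₁ : IsStrictDom t'.1.1 ∧ IsStrictDom t'.1.2)
    (ht'₂ : IsStrictDom t'.2.1 ∧ IsStrictDom t'.2.2)
    -- the component at the place of the character that defines the transfer factor
    (θ : Fˣ →* ℂˣ)
    -- the normalized Haar measures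
    (μn : Measure (GL (Fin n) F)) [μn.IsHaarMeasure] (hμn : μn (GLO F n) = 1)
    (μn1 : Measure (GL (Fin (n + 1)) F)) [μn1.IsHaarMeasure] (hμn1 : μn1 (GLO F (n + 1)) = 1)
    (μG : Measure (Gp n F)) [μG.IsHaarMeasure] (hμG : μG (mkGp '' (G0O n F ×ˢ G0O n F)) = 1)
    (μH : Measure (H2 n F)) [μH.IsHaarMeasure] (hμH : μH (mkH2 '' G0O n F) = 1) :
    -- plus-regular support and matching
    (∀ s : ℕ, SuffPos ϖ c Kn Kn1 t' s →
      tsupport (testMeasure ϖ c Kn Kn1 t' μG s) ⊆ mkGp '' RegPlus n F ∧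
      ∃ f : G0 n F → ℚ, IsLocallyConstant f ∧ HasCompactSupport f ∧
        Matches θ μn μH (testMeasure ϖ c Kn Kn1 t' μG s) (fun x => (f x : ℂ)) ∧
        (∀ δ, f δ ≠ 0 → IsRegularG δ) ∧
        ∃ g : G0 n F, ∀ k ∈ K0 Kn Kn1, ∀ x,
          f (g * k * g⁻¹ * x) = f x ∧ f (x * (g * k * g⁻¹)) = f x) ∧
    -- the values of the orbital integrals
    ∃ B : Set (Aff n F × Aff n F), IsCompact B ∧ B ⊆ Bp n F ∧
      (∀ s : ℕ, SuffPos ϖ c Kn Kn1 t' s →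
        B = (fun x => invB (x, 1)) '' orbitSet ϖ Kn Kn1 t' s) ∧
      (∀ g ∈ RegPlus n F, invB g ∉ B →
        ∀ (χ : Fˣ →* ℂˣ) (s : ℕ), SuffPosChar ϖ χ s → SuffPos ϖ c Kn Kn1 t' s →
          Integrable (orbIntegrand (testMeasure ϖ c Kn Kn1 t' μG s) χ (mkGp g))
            (orbMeasure μn μH) ∧
          orbI θ μn μH (testMeasure ϖ c Kn Kn1 t' μG s) χ g = 0) ∧
      (∀ γ ∈ B, ∃ g ∈ RegPlus n F, invB g = γ ∧
        ∀ (χ : Fˣ →* ℂˣ) (s : ℕ), SuffPosChar ϖ χ s → SuffPos ϖ c Kn Kn1 t' s →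
          Integrable (orbIntegrand (testMeasure ϖ c Kn Kn1 t' μG s) χ (mkGp g))
            (orbMeasure μn μH) ∧
          orbI θ μn μH (testMeasure ϖ c Kn Kn1 t' μG s) χ g =
            (θ (-1) : ℂ) ^ (n * (n + 1) / 2) * (kPrime ϖ Kn Kn1 μn μn1 : ℂ)) := by
  refine ⟨fun s hs => ⟨tsupport_testMeasure_subset hϖ hKn hKn1 hs μG,
    exists_matching hϖ hKn hKn1 hs θ μn μG hμG μH hμH⟩, ?_⟩
  obtain ⟨O, hO, hOD, hOs⟩ := exists_orbit_image hϖ hn hKn hKn1 t'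
  refine ⟨(fun x => invB (x, 1)) '' O, hO.image continuous_invB, ?_,
    fun s hs => (hOs s hs).2, fun g _ hg χ s _ hs => ?_, ?_⟩
  · rintro _ ⟨x, -, rfl⟩
    exact ⟨_, rfl⟩
  · rw [(hOs s hs).2] at hg
    exact orbI_eq_zero hϖ hKn hKn1 hs θ χ μn μG hμG μH hμH hg
  · rintro _ ⟨δ, hδ, rfl⟩
    -- The representative `(δ, 1)` is chosen before `χ` and `s`; this is legitimate because `δ` lies
    -- in the orbit set of every admissible `s`.
    refine ⟨(δ, 1), ?_, rfl, fun χ s hχ hs => orbI_eq_kPrime hϖ hKn hKn1 hs θ hχ μn hμn μn1 hμn1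
      μG hμG μH hμH ((hOs s hs).1 hδ)⟩
    rw [mem_RegPlus_iff', inv_one, mul_one]
    exact hOD δ hδ
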